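/- Let $S\subset\mathbb{P}^6_{\mathbb{Q}}$ be the singular del Pezzo surface of degree $6$ given by \begin{align*} x_3^2+x_0x_5+x_1x_6 &= x_2x_3-x_0x_6 = x_1x_2+x_0x_3+x_0x_4=0,\\ x_3x_5+x_4x_5+x_6^2 &= x_2x_5-x_4x_6 = x_1x_5-x_3x_6=0,\\ x_4^2+x_0x_5+x_2x_6 &= x_3x_4-x_0x_5 = x_1x_4-x_0x_6=0, \end{align*} and let $U=S\setminus(L_1\cup L_2)$, where $L_1:\ x_1=x_3=x_4=x_5=x_6=0$ and $L_2:\ x_2=x_3=x_4=x_5=x_6=0$ are lines of $S$. For a rational point $x$ put $H(x)=\max_{0\le i\le 6}|x_i|$, where $(x_0,\dots,x_6)$ is a primitive integer vector representing $x$, and let $$Z_{U,H}(s)=\sum_{x\in U(\mathbb{Q})}\frac{1}{H(x)^s}.$$ Define meromorphic functions $E_1,E_2$ by $$E_1(s+1)=\zeta(4s+1)\,\zeta(3s+1)^2\,\zeta(2s+1),\qquad E_2(s+1)=\frac{\zeta(7s+3)^4\,\zeta(8s+3)^2}{\zeta(4s+2)^3\,\zeta(5s+2)^2\,\zeta(6s+2)\,\zeta(10s+4)}.$$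 Then the series $Z_{U,H}(s)$ converges absolutely for $\operatorname{Re}(s)>1$, and there exist a constant $\lambda\in\mathbb{R}$ and complex functions $G_1,G_2$ such that 1. $G_1$ is holomorphic and bounded on $\operatorname{Re}(s)>5/6$; 2. for every $\varepsilon>0$, $G_2$ is holomorphic on $\operatorname{Re}(s)\ge 3/4+\varepsilon$ and satisfies $G_2(s)\ll_\varepsilon 1+|\operatorname{Im}(s)|$ there; 3. for $\operatorname{Re}(s)>1$, $$Z_{U,H}(s)=E_1(s)E_2(s)G_1(s)+\frac{12/\pi^2+2\lambda}{s-1}+G_2(s).$$ In particular, $(s-1)^4Z_{U,H}(s)$ has a holomorphic continuation to the half-plane $\operatorname{Re}(s)>5/6$, and the formula in 3, read as an identity for the continued function, holds for all $s\ne1$ in this half-plane. -/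

import Mathlib

/-- The nine quadratic forms cutting out the sextic del Pezzo surface in `ℙ⁶`, evaluated on a
vector of homogeneous coordinates. -/
def SurfaceEquations (x : Fin 7 → ℚ) : Prop :=
  x 3 ^ 2 + x 0 * x 5 + x 1 * x 6 = 0 ∧
  x 2 * x 3 - x 0 * x 6 = 0 ∧
  x 1 * x 2 + x 0 * x 3 + x 0 * x 4 = 0 ∧
  x 3 * x 5 + x 4 * x 5 + x 6 ^ 2 = 0 ∧
  x 2 * x 5 - x 4 * x 6 = 0 ∧
  x 1 * x 5 - x 3 * x 6 = 0 ∧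
  x 4 ^ 2 + x 0 * x 5 + x 2 * x 6 = 0 ∧
  x 3 * x 4 - x 0 * x 5 = 0 ∧
  x 1 * x 4 - x 0 * x 6 = 0

/-- The equations of the line `L₁`. -/
def LineOneEquations (x : Fin 7 → ℚ) : Prop :=
  x 1 = 0 ∧ x 3 = 0 ∧ x 4 = 0 ∧ x 5 = 0 ∧ x 6 = 0

/-- The equations of the line `L₂`. -/
def LineTwoEquations (x : Fin 7 → ℚ) : Prop :=
  x 2 = 0 ∧ x 3 = 0 ∧ x 4 = 0 ∧ x 5 = 0 ∧ x 6 = 0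

/-- The rational points of the surface `S`. All equations are homogeneous, so the choice of
representative of the projective point is irrelevant. -/
def surfacePoints : Set (Projectivization ℚ (Fin 7 → ℚ)) :=
  {x | SurfaceEquations x.rep}

/-- The rational points of the line `L₁`. -/
def lineOnePoints : Set (Projectivization ℚ (Fin 7 → ℚ)) :=
  {x | LineOneEquations x.rep}

/-- The rational points of the line `L₂`. -/
def lineTwoPoints : Set (Projectivization ℚ (Fin 7 → ℚ)) :=
  {x | LineTwoEquations x.rep}

/-- The rational points of the open subset `U = S \ (L₁ ∪ L₂)`. -/
def openPoints : Set (Projectivization ℚ (Fin 7 → ℚ)) :=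
  surfacePoints \ (lineOnePoints ∪ lineTwoPoints)

/-- `v` is a primitive integer vector in the affine cone above the projective point `x`. -/
def IsPrimitiveRep (x : Projectivization ℚ (Fin 7 → ℚ)) (v : Fin 7 → ℤ) : Prop :=
  Finset.univ.gcd v = 1 ∧
    ∃ hv : (fun i => (v i : ℚ)) ≠ 0, Projectivization.mk ℚ (fun i => (v i : ℚ)) hv = x

/-- Every rational point has a primitive integer representative. -/
theorem exists_isPrimitiveRep (x : Projectivization ℚ (Fin 7 → ℚ)) :
    ∃ v : Fin 7 → ℤ, IsPrimitiveRep x v := by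
  obtain ⟨b, hb⟩ := IsLocalization.exist_integer_multiples_of_finite (nonZeroDivisors ℤ) x.rep
  choose w hw using hb
  have hb0 : ((b : ℤ) : ℚ) ≠ 0 := by
    exact_mod_cast nonZeroDivisors.ne_zero b.2
  have hw' : ∀ i, (w i : ℚ) = (b : ℤ) * x.rep i := by
    intro i
    have h := hw i
    simpa [Algebra.smul_def] using h
  obtain ⟨j, hj⟩ : ∃ j, x.rep j ≠ 0 := by
    by_contra! h
    exact x.rep_nonzero (funext h)
  have hwj : w j ≠ 0 := by
    intro h
    have := hw' j
    rw [h] at this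
    simp only [Int.cast_zero] at this
    exact mul_ne_zero hb0 hj this.symm
  obtain ⟨v, hv, hg⟩ := Finset.extract_gcd w (s := Finset.univ) ⟨j, Finset.mem_univ j⟩
  set g : ℤ := Finset.univ.gcd w with hgdef
  have hg0 : (g : ℚ) ≠ 0 := by
    intro h
    have h0 : g = 0 := by exact_mod_cast h
    exact hwj (by rw [hv j (Finset.mem_univ j), h0, zero_mul])
  have hvx : ∀ i, (v i : ℚ) = ((b : ℤ) / g : ℚ) * x.rep i := by
    intro i
    have h1 := hw' i
    rw [hv i (Finset.mem_univ i)] at h1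
    push_cast at h1
    field_simp
    linarith
  have hc : ((b : ℤ) / g : ℚ) ≠ 0 := div_ne_zero hb0 hg0
  have hv0 : (fun i => (v i : ℚ)) ≠ 0 := by
    intro h
    have := congrFun h j
    simp only [Pi.zero_apply, hvx j] at this
    exact mul_ne_zero hc hj this
  refine ⟨v, hg, hv0, ?_⟩
  conv_rhs => rw [← x.mk_rep]
  rw [Projectivization.mk_eq_mk_iff']
  exact ⟨(b : ℤ) / g, by ext i; simp [hvx i]⟩

/-- The height `H(x) = max |xᵢ|`, where `(x₀, …, x₆)` is a primitive integer vector in the affine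
cone above `x` (which is unique up to sign). -/
noncomputable def pointHeight (x : Projectivization ℚ (Fin 7 → ℚ)) : ℕ :=
  Finset.univ.sup fun i => ((exists_isPrimitiveRep x).choose i).natAbs

/-- The height may be computed from any primitive integer representative. -/
theorem pointHeight_eq {x : Projectivization ℚ (Fin 7 → ℚ)} {v : Fin 7 → ℤ}
    (hv : IsPrimitiveRep x v) :
    pointHeight x = Finset.univ.sup fun i => (v i).natAbs := by
  have key : ∀ w : Fin 7 → ℤ, IsPrimitiveRep x w →
      ((Finset.univ.sup fun i => (w i).natAbs : ℕ) : ℝ) = x.mulHeight := by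
    rintro w ⟨hg, hw, rfl⟩
    rw [Projectivization.mulHeight_mk]
    have h1 := Rat.mulHeight_eq_max_abs_of_gcd_eq_one hg
    have h2 : ((Finset.univ.sup fun i => (w i).natAbs : ℕ) : ℤ) = ⨆ i, |w i| := by
      apply le_antisymm
      · obtain ⟨i, -, hi⟩ := Finset.exists_mem_eq_sup (Finset.univ : Finset (Fin 7))
          Finset.univ_nonempty fun i => (w i).natAbs
        rw [hi, Int.natCast_natAbs]
        exact le_ciSup (f := fun i => |w i|) (Set.finite_range _).bddAbove i
      · refine ciSup_le fun i => ?_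
        rw [← Int.natCast_natAbs]
        exact_mod_cast Finset.le_sup (f := fun i => (w i).natAbs) (Finset.mem_univ i)
    have h3 : (fun i => (w i : ℚ)) = ((↑) : ℤ → ℚ) ∘ w := rfl
    rw [h3, h1, ← h2]
    norm_cast
  have h := (key _ (exists_isPrimitiveRep x).choose_spec).trans (key v hv).symm
  exact_mod_cast h

/-- The height zeta function `Z_{U,H}(s) = ∑_{x ∈ U(ℚ)} H(x)^{-s}`. -/
noncomputable def heightZeta (s : ℂ) : ℂ :=
  ∑' x : openPoints, 1 / (pointHeight x.1 : ℂ) ^ s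

/-- `E₁(s + 1) = ζ(4s+1) ζ(3s+1)² ζ(2s+1)`. -/
noncomputable def zetaE₁ (s : ℂ) : ℂ :=
  riemannZeta (4 * (s - 1) + 1) * riemannZeta (3 * (s - 1) + 1) ^ 2 *
    riemannZeta (2 * (s - 1) + 1)

/-- `E₂(s + 1) = ζ(7s+3)⁴ ζ(8s+3)² / (ζ(4s+2)³ ζ(5s+2)² ζ(6s+2) ζ(10s+4))`. -/
noncomputable def zetaE₂ (s : ℂ) : ℂ :=
  riemannZeta (7 * (s - 1) + 3) ^ 4 * riemannZeta (8 * (s - 1) + 3) ^ 2 /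
    (riemannZeta (4 * (s - 1) + 2) ^ 3 * riemannZeta (5 * (s - 1) + 2) ^ 2 *
      riemannZeta (6 * (s - 1) + 2) * riemannZeta (10 * (s - 1) + 4))

/-! The open set `U` is an affine plane: `x₅` does not vanish on it, and all coordinates are
monomials in `y = x₆/x₅`, `z = x₃/x₅` and `w = -y² - z`. Put `y = a/q` and `z = u/(n q²)` with `a/q`
and `u/n` reduced. Then the height is `q⁴ n² h(y, z) / (gcd(u, q) gcd(n a² + u, q))`, where `h` is
the largest absolute value of the real coordinates (`pointHeight_fibrePoint`). The height zeta
function becomes a sum over `y`, `n` and `u`.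

For fixed `y` and `n`, Möbius inversion turns the gcd's and the condition `(u, n) = 1` into
congruences on `u`, and a sum over a progression differs from its integral by at most the total
variation. The variation of `h(y, ·)⁻ˢ` is `O(|s| / (1 + y²))`, so the errors add up to a function
`fibreError`, holomorphic for `Re s > 3/4` and `O(1 + |Im s|)` on each smaller closed half-plane
(`tsum_fibreTerm`).

In the main term the sum over `n` yields `ζ(2s-1)/ζ(2s)`. The sum over `a` prime to `q` of the fibre
integrals yields `φ(q)` times the archimedean density plus a discrepancy, so that `Z = ζ(2s-1)/ζ(2s)
· (archDensity · totientSeries + discrepancySeries) + fibreError` (`heightZeta_eq`). The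
coefficients of `totientSeries` are multiplicative, and its Euler product is `ζ(4s-3) ζ(3s-2)² ζ(2s)
/ ζ(6s-4)` times a product that converges absolutely for `Re s > 5/6` (`totientSeries_eq`). This
gives `E₁ E₂ G₁`.

The delicate part is `ζ(2s-1)` times the discrepancy series. Here `ζ(2s-1)` contributes the simple
pole and a factor `O(√(1 + |Im s|))`, so the discrepancies themselves must be `O(√(1 + |s|))`
uniformly in the denominator, while differentiation in `y` would only give `O(|s|)`. The saving has
two sources (`exists_norm_latticeError_le_sqrt`). When the height itself is the variable of
integration, `s` enters only through `u⁻ˢ`, which does not depend on `y`, so the variation in `y` is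
bounded independently of `s` away from the stationary point of the height. A short window around
that point balances `δ|s|` against `1/δ`. What is left is a plateau where the height equals `y`; it
leads to the sums `∑ k^(-it)`, which are treated by a regularised form of the Kuzmin–Landau and van
der Corput estimates (`norm_partialSum_sub_integral_le`).

The residue of the secondary term is half the value at `1` of the discrepancy series divided by
`ζ(2s)`. It is real by conjugation symmetry, and `λ` is read off from it. -/

open MeasureTheory Set Filter Topology

/-! ### Bounded variation, and comparison of sums over progressions with integrals -/

/-- `f` has total variation at most `V` on `s`, witnessed by a monotone control function. -/
def VariationLE (f : ℝ → ℂ) (s : Set ℝ) (V : ℝ) : Prop :=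
  ∃ Ψ : ℝ → ℝ, ∀ a ∈ s, ∀ b ∈ s, a ≤ b → ‖f b - f a‖ ≤ Ψ b - Ψ a ∧ Ψ b - Ψ a ≤ V

namespace VariationLE

variable {f g : ℝ → ℂ} {s t : Set ℝ} {V W : ℝ}

theorem mono (h : VariationLE f s V) (hts : t ⊆ s) : VariationLE f t V := by
  obtain ⟨Ψ, hΨ⟩ := h
  exact ⟨Ψ, fun a ha b hb hab => hΨ a (hts ha) b (hts hb) hab⟩

theorem weaken (h : VariationLE f s V) (hVW : V ≤ W) : VariationLE f s W := by
  obtain ⟨Ψ, hΨ⟩ := h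
  exact ⟨Ψ, fun a ha b hb hab => ⟨(hΨ a ha b hb hab).1, (hΨ a ha b hb hab).2.trans hVW⟩⟩

theorem congr (h : VariationLE f s V) (hfg : EqOn f g s) : VariationLE g s V := by
  obtain ⟨Ψ, hΨ⟩ := h
  refine ⟨Ψ, fun a ha b hb hab => ?_⟩
  rw [← hfg ha, ← hfg hb]
  exact hΨ a ha b hb hab

theorem add (hf : VariationLE f s V) (hg : VariationLE g s W) :
    VariationLE (fun x => f x + g x) s (V + W) := by
  obtain ⟨Ψ, hΨ⟩ := hf
  obtain ⟨Θ, hΘ⟩ := hg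
  refine ⟨fun x => Ψ x + Θ x, fun a ha b hb hab => ?_⟩
  obtain ⟨h1, h2⟩ := hΨ a ha b hb hab
  obtain ⟨h3, h4⟩ := hΘ a ha b hb hab
  constructor
  · calc ‖f b + g b - (f a + g a)‖ = ‖(f b - f a) + (g b - g a)‖ := by ring_nf
      _ ≤ _ := norm_add_le _ _
      _ ≤ _ := by linarith
  · linarith

theorem const_mul (c : ℂ) (hf : VariationLE f s V) :
    VariationLE (fun x => c * f x) s (‖c‖ * V) := by
  obtain ⟨Ψ, hΨ⟩ := hf
  refine ⟨fun x => ‖c‖ * Ψ x, fun a ha b hb hab => ?_⟩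
  obtain ⟨h1, h2⟩ := hΨ a ha b hb hab
  rw [← mul_sub, ← mul_sub, norm_mul]
  exact ⟨by gcongr, by gcongr⟩

theorem union {c : ℝ} (h1 : VariationLE f (s ∩ Iic c) V) (h2 : VariationLE f (s ∩ Ici c) W)
    (hc : c ∈ s) : VariationLE f s (V + W) := by
  obtain ⟨Ψ, hΨ⟩ := h1
  obtain ⟨Θ, hΘ⟩ := h2
  -- Both control functions are shifted to vanish at `c`, so that they glue.
  refine ⟨fun x => if x ≤ c then Ψ x - Ψ c else Θ x - Θ c, fun a ha b hb hab => ?_⟩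
  have hcl : c ∈ s ∩ Iic c := ⟨hc, le_refl c⟩
  have hcr : c ∈ s ∩ Ici c := ⟨hc, le_refl c⟩
  have hV : 0 ≤ V := by have := (hΨ c hcl c hcl le_rfl).2; linarith
  have hW : 0 ≤ W := by have := (hΘ c hcr c hcr le_rfl).2; linarith
  rcases le_or_gt b c with hbc | hbc
  · have hac := hab.trans hbc
    obtain ⟨h3, h4⟩ := hΨ a ⟨ha, hac⟩ b ⟨hb, hbc⟩ hab
    simp only [hac, hbc, if_true]
    constructor <;> linarith
  · rcases le_or_gt a c with hac | hac
    · obtain ⟨h3, h4⟩ := hΨ a ⟨ha, hac⟩ c hcl hac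
      obtain ⟨h5, h6⟩ := hΘ c hcr b ⟨hb, hbc.le⟩ hbc.le
      simp only [hac, not_le.2 hbc, if_true, if_false]
      constructor
      · calc ‖f b - f a‖ = ‖(f b - f c) + (f c - f a)‖ := by ring_nf
          _ ≤ _ := norm_add_le _ _
          _ ≤ _ := by linarith
      · linarith
    · obtain ⟨h3, h4⟩ := hΘ a ⟨ha, hac.le⟩ b ⟨hb, hbc.le⟩ hab
      simp only [not_le.2 hac, not_le.2 hbc, if_false]
      constructor <;> linarith

theorem comp_neg (h : VariationLE f s V) : VariationLE (fun x => f (-x)) (-s) V := by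
  obtain ⟨Ψ, hΨ⟩ := h
  refine ⟨fun x => -Ψ (-x), fun a ha b hb hab => ?_⟩
  obtain ⟨h1, h2⟩ := hΨ (-b) hb (-a) ha (neg_le_neg hab)
  rw [norm_sub_rev]
  constructor <;> linarith

theorem of_even (h : VariationLE f (Ici 0) V) (hf : ∀ x, f (-x) = f x) :
    VariationLE f univ (V + V) := by
  refine union (c := 0) ?_ (by simpa using h) (mem_univ _)
  have := h.comp_neg
  simp only [hf] at this
  exact this.mono (by intro x hx; simpa using hx)

theorem comp_affine (h : VariationLE f univ V) {l : ℝ} (hl : 0 < l) (c : ℝ) :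
    VariationLE (fun x => f (c + l * x)) univ V := by
  obtain ⟨Ψ, hΨ⟩ := h
  refine ⟨fun x => Ψ (c + l * x), fun a _ b _ hab => hΨ _ (mem_univ _) _ (mem_univ _) ?_⟩
  gcongr

theorem of_monotoneOn {φ : ℝ → ℝ} (hφ : MonotoneOn φ s) (h0 : ∀ x ∈ s, 0 ≤ φ x)
    (hV : ∀ x ∈ s, φ x ≤ V) : VariationLE (fun x => (φ x : ℂ)) s V := by
  refine ⟨φ, fun a ha b hb hab => ?_⟩
  have h1 := hφ ha hb hab
  have h2 := h0 a ha
  have h3 := hV b hb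
  rw [← Complex.ofReal_sub, Complex.norm_real, Real.norm_eq_abs, abs_of_nonneg (by linarith)]
  constructor <;> linarith

theorem of_antitoneOn {φ : ℝ → ℝ} (hφ : AntitoneOn φ s) (h0 : ∀ x ∈ s, 0 ≤ φ x)
    (hV : ∀ x ∈ s, φ x ≤ V) : VariationLE (fun x => (φ x : ℂ)) s V := by
  refine ⟨fun x => -φ x, fun a ha b hb hab => ?_⟩
  have h1 := hφ ha hb hab
  have h2 := h0 b hb
  have h3 := hV a ha
  rw [← Complex.ofReal_sub, Complex.norm_real, Real.norm_eq_abs, abs_of_nonpos (by linarith)]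
  constructor <;> linarith

end VariationLE

/-- Mean value inequality with a variable majorant. It replaces integration of `‖f'‖`, so no
integrability of `f'` is needed. -/
theorem norm_sub_le_of_hasDerivAt_le {f f' : ℝ → ℂ} {B B' : ℝ → ℝ} {a b : ℝ} (hab : a ≤ b)
    (hf : ∀ x ∈ Icc a b, HasDerivAt f (f' x) x) (hB : ∀ x ∈ Icc a b, HasDerivAt B (B' x) x)
    (h : ∀ x ∈ Icc a b, ‖f' x‖ ≤ B' x) : ‖f b - f a‖ ≤ B b - B a := by
  have := image_norm_le_of_norm_deriv_right_le_deriv_boundary' (f := fun x => f x - f a)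
    (f' := f') (B := fun x => B x - B a) (B' := B') (a := a) (b := b)
    (fun x hx => ((hf x hx).continuousAt.sub continuousAt_const).continuousWithinAt)
    (fun x hx => ((hf x (Ico_subset_Icc_self hx)).sub_const _).hasDerivWithinAt)
    (by simp)
    (fun x hx => ((hB x hx).continuousAt.sub continuousAt_const).continuousWithinAt)
    (fun x hx => ((hB x (Ico_subset_Icc_self hx)).sub_const _).hasDerivWithinAt)
    (fun x hx => h x (Ico_subset_Icc_self hx))
  exact this (right_mem_Icc.2 hab)

theorem hasDerivAt_ofReal_cpow {x : ℝ} (hx : 0 < x) (s : ℂ) :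
    HasDerivAt (fun t : ℝ => (t : ℂ) ^ s) (s * (x : ℂ) ^ (s - 1)) x := by
  have h := (hasDerivAt_id (x : ℂ)).cpow_const (c := s) (Or.inl (by simpa using hx))
  simpa using h.comp_ofReal

/-- The derivative of `x⁻ˢ` has norm `‖s‖ x^(-σ-1)`, which is `‖s‖/σ` times the derivative of
`-x^(-σ)`. Variation bounds for real powers thus pass to complex powers at the cost of the factor
`‖s‖/σ`. -/
theorem norm_cpow_sub_cpow_le {a b : ℝ} (ha : 0 < a) (hb : 0 < b) {s : ℂ} (hs : 0 < s.re) :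
    ‖(a : ℂ) ^ (-s) - (b : ℂ) ^ (-s)‖ ≤ ‖s‖ / s.re * |a ^ (-s.re) - b ^ (-s.re)| := by
  wlog hab : a ≤ b generalizing a b
  · rw [norm_sub_rev, abs_sub_comm]
    exact this hb ha (le_of_not_ge hab)
  have key := norm_sub_le_of_hasDerivAt_le (f := fun t : ℝ => (t : ℂ) ^ (-s))
    (f' := fun x => -s * (x : ℂ) ^ (-s - 1)) (B := fun x => -(‖s‖ / s.re) * x ^ (-s.re))
    (B' := fun x => -(‖s‖ / s.re) * (-s.re * x ^ (-s.re - 1))) hab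
    (fun x hx => hasDerivAt_ofReal_cpow (ha.trans_le hx.1) _)
    (fun x hx => (Real.hasDerivAt_rpow_const (Or.inl (ha.trans_le hx.1).ne')).const_mul _)
    (fun x hx => by
      rw [norm_mul, norm_neg, Complex.norm_cpow_eq_rpow_re_of_pos (ha.trans_le hx.1)]
      simp only [Complex.sub_re, Complex.neg_re, Complex.one_re]
      apply le_of_eq
      field_simp)
  rw [norm_sub_rev, abs_of_nonneg]
  · linarith
  · exact sub_nonneg.2 (Real.rpow_le_rpow_of_nonpos ha hab (by linarith))

theorem VariationLE.cpow {h : ℝ → ℝ} {t : Set ℝ} {V : ℝ} {s : ℂ} (hs : 0 < s.re)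
    (h0 : ∀ x ∈ t, 0 < h x)
    (hv : VariationLE (fun x => ((h x ^ (-s.re) : ℝ) : ℂ)) t V) :
    VariationLE (fun x => (h x : ℂ) ^ (-s)) t (‖s‖ / s.re * V) := by
  obtain ⟨Ψ, hΨ⟩ := hv
  refine ⟨fun x => ‖s‖ / s.re * Ψ x, fun a ha b hb hab => ?_⟩
  obtain ⟨h1, h2⟩ := hΨ a ha b hb hab
  have h3 : 0 ≤ ‖s‖ / s.re := by positivity
  rw [← mul_sub]
  refine ⟨(norm_cpow_sub_cpow_le (h0 b hb) (h0 a ha) hs).trans ?_, by gcongr⟩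
  rw [← Complex.ofReal_sub, Complex.norm_real, Real.norm_eq_abs] at h1
  gcongr

/-- On each cell of the progression the sample differs from the mean by at most the increment of the
control function, and the increments telescope. The bound does not depend on the offset or on the
step, which gives the uniformity in all congruence conditions. -/
theorem VariationLE.summable_and_norm_tsum_sub_integral_le {f : ℝ → ℂ} {V : ℝ} (hv : VariationLE f univ V)
    (hf : Integrable f) (c : ℝ) {l : ℝ} (hl : 0 < l) :
    Summable (fun k : ℤ => f (c + l * k)) ∧
      ‖∑' k : ℤ, f (c + l * k) - (1 / l : ℝ) * ∫ x, f x‖ ≤ V := by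
  obtain ⟨Ψ, hΨ⟩ := hv.comp_affine hl c
  set g : ℝ → ℂ := fun x => f (c + l * x) with hg
  have hgi : Integrable g := (hf.comp_add_left c).comp_mul_left' hl.ne'
  have hint : ∫ x, g x = (1 / l : ℝ) * ∫ x, f x := by
    have h1 := Measure.integral_comp_mul_left (fun x => f (c + x)) l
    rw [integral_add_left_eq_self f c] at h1
    rw [hg, h1, abs_of_pos (by positivity), one_div, Complex.real_smul]
  have hsum := hgi.hasSum_intervalIntegral_comp_add_int
  have hd : ∀ n : ℤ, ‖g n - ∫ x in (0 : ℝ)..1, g (x + n)‖ ≤ Ψ (n + 1) - Ψ n := by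
    intro n
    have h1 : g n - ∫ x in (0 : ℝ)..1, g (x + n) = ∫ x in (0 : ℝ)..1, (g n - g (x + n)) := by
      rw [intervalIntegral.integral_sub (by simp)]
      · simp
      · exact (hgi.comp_add_right (n : ℝ)).intervalIntegrable
    rw [h1]
    have h2 := intervalIntegral.norm_integral_le_of_norm_le_const (a := (0 : ℝ)) (b := 1)
      (f := fun x => g n - g (x + n)) (C := Ψ (n + 1) - Ψ n) ?_
    · simpa using h2
    · intro x hx
      rw [uIoc_of_le zero_le_one] at hx
      have h3 := (hΨ n (mem_univ _) (x + n) (mem_univ _) (by linarith [hx.1])).1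
      have h4 := (hΨ (x + n) (mem_univ _) (n + 1) (mem_univ _) (by linarith [hx.2])).1
      have h5 := norm_nonneg (f (c + l * (n + 1)) - f (c + l * (x + n)))
      rw [norm_sub_rev]
      simp only [hg] at h3 ⊢
      linarith
  have hnn : ∀ n : ℤ, 0 ≤ Ψ (n + 1) - Ψ n := fun n => (norm_nonneg _).trans (hd n)
  have hbd : ∀ u : Finset ℤ, ∑ n ∈ u, (Ψ (n + 1) - Ψ n) ≤ V := by
    intro u
    obtain ⟨N, hN⟩ : ∃ N : ℕ, ∀ n ∈ u, n.natAbs < N :=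
      ⟨u.sup Int.natAbs + 1, fun n hn => Nat.lt_succ_of_le (Finset.le_sup hn)⟩
    -- A finite set of cells is enlarged to the run `[-N, N)`, over which the increments telescope.
    have hsub : u ⊆ (Finset.range (2 * N)).image (fun i : ℕ => (i : ℤ) - N) := by
      intro n hn
      have := hN n hn
      refine Finset.mem_image.2 ⟨(n + N).toNat, ?_, ?_⟩
      · rw [Finset.mem_range]; omega
      · omega
    refine (Finset.sum_le_sum_of_subset_of_nonneg hsub fun n _ _ => hnn n).trans ?_
    rw [Finset.sum_image (fun i _ j _ hij => by simpa using hij)]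
    have h6 := Finset.sum_range_sub (fun i : ℕ => Ψ ((i : ℝ) - N)) (2 * N)
    have h7 : ∑ i ∈ Finset.range (2 * N), (Ψ ((((i : ℤ) - N : ℤ) : ℝ) + 1) - Ψ (((i : ℤ) - N : ℤ) : ℝ))
        = Ψ (((2 * N : ℕ) : ℝ) - N) - Ψ (((0 : ℕ) : ℝ) - N) := by
      rw [← h6]
      refine Finset.sum_congr rfl fun i _ => ?_
      push_cast
      congr 2
      ring
    rw [h7]
    exact (hΨ _ (mem_univ _) _ (mem_univ _) (by push_cast; linarith [Nat.cast_nonneg (α := ℝ) N])).2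
  have hs1 : Summable fun n : ℤ => Ψ (n + 1) - Ψ n := summable_of_sum_le hnn hbd
  have hs2 : Summable fun n : ℤ => g n - ∫ x in (0 : ℝ)..1, g (x + n) := .of_norm_bounded hs1 hd
  have hs3 : Summable fun n : ℤ => g n := by
    simpa using hs2.add hsum.summable
  refine ⟨hs3, ?_⟩
  have h8 : ∑' k : ℤ, g k - ∫ x, g x = ∑' n : ℤ, (g n - ∫ x in (0 : ℝ)..1, g (x + n)) := by
    rw [hs3.tsum_sub hsum.summable, hsum.tsum_eq]
  rw [← hint]
  change ‖∑' k : ℤ, g k - ∫ x, g x‖ ≤ V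
  rw [h8]
  exact (tsum_of_norm_bounded hs1.hasSum hd).trans (Summable.tsum_le_of_sum_le hs1 hbd)

/-- Differentiation under the integral brings down `log h`, which costs only an arbitrarily small
power of `h`; the open half-plane leaves room for it. -/
theorem differentiableOn_integral_cpow {α : Type*} [MeasurableSpace α] (μ : Measure α) {h : α → ℝ}
    (hm : Measurable h) (h1 : ∀ x, 1 ≤ h x) {σ₀ : ℝ}
    (hi : ∀ σ : ℝ, σ₀ < σ → Integrable (fun x => h x ^ (-σ)) μ) :
    DifferentiableOn ℂ (fun s : ℂ => ∫ x, (h x : ℂ) ^ (-s) ∂μ) {s | σ₀ < s.re} := by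
  intro s hs
  refine DifferentiableAt.differentiableWithinAt ?_
  simp only [mem_ofPred_eq] at hs
  set δ := (s.re - σ₀) / 4 with hδ
  have hδ0 : 0 < δ := by rw [hδ]; linarith
  have hmeas : ∀ z : ℂ, Measurable fun x => (h x : ℂ) ^ (-z) := fun z =>
    (Complex.measurable_ofReal.comp hm).pow_const _
  have hnorm : ∀ (z : ℂ) (x : α), ‖(h x : ℂ) ^ (-z)‖ = h x ^ (-z.re) := fun z x => by
    rw [Complex.norm_cpow_eq_rpow_re_of_pos (by linarith [h1 x])]; simp
  have := hasDerivAt_integral_of_dominated_loc_of_deriv_le (μ := μ) (𝕜 := ℂ)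
    (F := fun z x => (h x : ℂ) ^ (-z)) (x₀ := s) (s := Metric.ball s δ)
    (F' := fun z x => (h x : ℂ) ^ (-z) * Complex.log (h x) * (-1))
    (bound := fun x => (1 / δ) * h x ^ (-(s.re - 2 * δ)))
    (Metric.ball_mem_nhds s hδ0)
    (Eventually.of_forall fun z => (hmeas z).aestronglyMeasurable)
    ((hi s.re hs).mono' (hmeas s).aestronglyMeasurable
      (ae_of_all _ fun x => (hnorm s x).le))
    (((hmeas s).mul (Complex.measurable_log.comp (Complex.measurable_ofReal.comp hm))).mul_const
      _).aestronglyMeasurable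
    (ae_of_all _ fun x z hz => by
      have hz1 : |z.re - s.re| < δ := by
        rw [Metric.mem_ball, Complex.dist_eq] at hz
        exact (by simpa using Complex.abs_re_le_norm (z - s) : |z.re - s.re| ≤ _).trans_lt hz
      have hpos : 0 < h x := by linarith [h1 x]
      rw [norm_mul, norm_mul, hnorm, ← Complex.ofReal_log hpos.le, Complex.norm_real, norm_neg,
        norm_one, mul_one, Real.norm_eq_abs, abs_of_nonneg (Real.log_nonneg (h1 x))]
      have h2 : Real.log (h x) ≤ h x ^ δ / δ := Real.log_le_rpow_div hpos.le hδ0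
      calc h x ^ (-z.re) * Real.log (h x) ≤ h x ^ (-(s.re - δ)) * (h x ^ δ / δ) := by
            refine mul_le_mul ?_ h2 (Real.log_nonneg (h1 x)) (by positivity)
            exact Real.rpow_le_rpow_of_exponent_le (h1 x) (by linarith [(abs_lt.1 hz1).1])
        _ = (1 / δ) * h x ^ (-(s.re - 2 * δ)) := by
            rw [mul_div_assoc', ← Real.rpow_add hpos]
            ring_nf)
    ((hi _ (by linarith)).const_mul _)
    (ae_of_all _ fun x z _ => by
      have hpos : (h x : ℂ) ≠ 0 := by
        have := h1 x
        exact_mod_cast (by linarith : h x ≠ 0)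
      exact ((hasDerivAt_id z).neg.const_cpow (Or.inl hpos)))
  exact this.2.differentiableAt

/-! ### The divisor bound -/

section DivisorBound

/-- Prime by prime: `k + 1 ≤ 2^k ≤ p^(kε)` as soon as `p^ε ≥ 2`, and each of the finitely many
smaller primes costs at most a constant factor, by Bernoulli's inequality. -/
theorem exists_card_divisors_le_rpow {ε : ℝ} (hε : 0 < ε) :
    ∃ C : ℝ, 1 ≤ C ∧ ∀ n : ℕ, (n.divisors.card : ℝ) ≤ C * (n : ℝ) ^ ε := by
  set K : ℝ := max 1 (1 / (ε * Real.log 2)) with hK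
  have hK1 : 1 ≤ K := le_max_left _ _
  have hlog : 0 < Real.log 2 := Real.log_pos (by norm_num)
  obtain ⟨N, hN⟩ := exists_nat_ge ((2 : ℝ) ^ (1 / ε))
  have hlarge : ∀ p : ℕ, N ≤ p → (2 : ℝ) ≤ (p : ℝ) ^ ε := by
    intro p hp
    have h1 : (2 : ℝ) ^ (1 / ε) ≤ p := hN.trans (by exact_mod_cast hp)
    calc (2 : ℝ) = ((2 : ℝ) ^ (1 / ε)) ^ ε := by
          rw [← Real.rpow_mul (by norm_num), one_div_mul_cancel hε.ne', Real.rpow_one]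
      _ ≤ _ := by gcongr
  refine ⟨K ^ N, one_le_pow₀ hK1, fun n => ?_⟩
  rcases eq_or_ne n 0 with rfl | hn
  · simp [Real.zero_rpow hε.ne']
  have hterm : ∀ p ∈ n.primeFactors, ((n.factorization p + 1 : ℕ) : ℝ) ≤
      (if p < N then K else 1) * (((p : ℝ) ^ n.factorization p) ^ ε) := by
    intro p hp
    have hp2 := (Nat.prime_of_mem_primeFactors hp).two_le
    set k := n.factorization p
    have e1 : ((p : ℝ) ^ k) ^ ε = ((p : ℝ) ^ ε) ^ k := by
      rw [← Real.rpow_natCast, ← Real.rpow_natCast, ← Real.rpow_mul (by positivity),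
        ← Real.rpow_mul (by positivity), mul_comm]
    rw [e1]
    split_ifs with h
    · have h1 : 1 + ε * Real.log 2 ≤ (2 : ℝ) ^ ε := by
        rw [Real.rpow_def_of_pos (by norm_num)]
        linarith [Real.add_one_le_exp (Real.log 2 * ε)]
      have h2 : (1 + ε * Real.log 2) ^ k ≤ ((p : ℝ) ^ ε) ^ k := by
        gcongr
        refine h1.trans ?_
        gcongr
        exact_mod_cast hp2
      have h3 := one_add_mul_le_pow (a := ε * Real.log 2)
        (by have := mul_pos hε hlog; linarith) k
      have h4 : 1 ≤ K * (ε * Real.log 2) := by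
        have h5 : 1 / (ε * Real.log 2) ≤ K := le_max_right _ _
        rwa [div_le_iff₀ (by positivity)] at h5
      calc ((k + 1 : ℕ) : ℝ) = k * 1 + 1 := by push_cast; ring
        _ ≤ k * (K * (ε * Real.log 2)) + K := by gcongr
        _ = K * (1 + k * (ε * Real.log 2)) := by ring
        _ ≤ _ := by gcongr; exact h3.trans h2
    · rw [one_mul]
      have h1 := hlarge p (not_lt.1 h)
      calc ((k + 1 : ℕ) : ℝ) ≤ (2 : ℝ) ^ k := by exact_mod_cast Nat.lt_two_pow_self
        _ ≤ _ := by gcongr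
  rw [Nat.card_divisors hn]
  push_cast
  have hterm' : ∀ p ∈ n.primeFactors, ((n.factorization p : ℝ) + 1) ≤
      (if p < N then K else 1) * (((p : ℝ) ^ n.factorization p) ^ ε) := by
    intro p hp
    have := hterm p hp
    push_cast at this
    exact this
  refine (Finset.prod_le_prod (fun p _ => by positivity) hterm').trans ?_
  rw [Finset.prod_mul_distrib, Real.finsetProd_rpow _ _ (fun p _ => by positivity)]
  have h1 : ∏ p ∈ n.primeFactors, ((p : ℝ) ^ n.factorization p) = n := by
    have := Nat.prod_factorization_pow_eq_self hn
    rw [Finsupp.prod, Nat.support_factorization] at this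
    exact_mod_cast this
  rw [h1]
  gcongr
  rw [← Finset.prod_filter, Finset.prod_const]
  refine pow_le_pow_right₀ hK1 ?_
  calc _ ≤ (Finset.range N).card := Finset.card_le_card (by
        intro p hp
        simpa using (Finset.mem_filter.1 hp).2)
    _ = N := Finset.card_range N

end DivisorBound

/-! ### A regularised kernel for exponential sums -/

section VanDerCorput

/-- Abel summation: differences of a bounded sequence against weights of bounded variation. -/
theorem norm_sum_sub_mul_le {z : ℕ → ℂ} (hz : ∀ k, ‖z k‖ ≤ 1) (g : ℕ → ℂ) {m n : ℕ} (hmn : m ≤ n) :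
    ‖∑ k ∈ Finset.Ico m n, (z k - z (k + 1)) * g k‖ ≤
      ‖g m‖ + ‖g n‖ + ∑ k ∈ Finset.Ico m n, ‖g (k + 1) - g k‖ := by
  have key : ∑ k ∈ Finset.Ico m n, (z k - z (k + 1)) * g k =
      z m * g m - z n * g n + ∑ k ∈ Finset.Ico m n, z (k + 1) * (g (k + 1) - g k) := by
    induction n, hmn using Nat.le_induction with
    | base => simp
    | succ n hmn ih =>
      rw [Finset.sum_Ico_succ_top hmn, Finset.sum_Ico_succ_top hmn, ih]
      ring
  rw [key]
  refine (norm_add_le _ _).trans (add_le_add ((norm_sub_le _ _).trans (add_le_add ?_ ?_)) ?_)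
  · rw [norm_mul]
    exact mul_le_of_le_one_left (norm_nonneg _) (hz m)
  · rw [norm_mul]
    exact mul_le_of_le_one_left (norm_nonneg _) (hz n)
  · refine (norm_sum_le _ _).trans (Finset.sum_le_sum fun k _ => ?_)
    rw [norm_mul]
    exact mul_le_of_le_one_left (norm_nonneg _) (hz _)

theorem normSq_one_sub_exp (θ : ℝ) :
    ‖1 - Complex.exp (θ * Complex.I)‖ ^ 2 = 2 - 2 * Real.cos θ := by
  rw [Complex.sq_norm, Complex.normSq_apply]
  simp only [Complex.sub_re, Complex.one_re, Complex.sub_im, Complex.one_im,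
    Complex.exp_ofReal_mul_I_re, Complex.exp_ofReal_mul_I_im]
  nlinarith [Real.sin_sq_add_cos_sq θ]

theorem two_sub_two_cos_ge {θ : ℝ} (hθ : |θ| ≤ Real.pi) :
    4 / Real.pi ^ 2 * θ ^ 2 ≤ 2 - 2 * Real.cos θ := by
  have := Real.cos_le_one_sub_mul_cos_sq hθ
  have h2 : 4 / Real.pi ^ 2 * θ ^ 2 = 2 * (2 / Real.pi ^ 2 * θ ^ 2) := by ring
  linarith

/-- The regularised denominator `|1 - exp (iθ)|² + Δ²`. -/
noncomputable def regDenom (Δ θ : ℝ) : ℝ := 2 - 2 * Real.cos θ + Δ ^ 2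

/-- The primitive of the inverse of the regularised denominator. -/
noncomputable def regPrim (Δ θ : ℝ) : ℝ := ∫ x in (0 : ℝ)..θ, (regDenom Δ x)⁻¹

variable {Δ : ℝ}

theorem regDenom_pos (hΔ : 0 < Δ) (θ : ℝ) : 0 < regDenom Δ θ := by
  unfold regDenom
  have := Real.cos_le_one θ
  have := pow_pos hΔ 2
  linarith

theorem continuous_regDenom_inv (hΔ : 0 < Δ) : Continuous fun θ => (regDenom Δ θ)⁻¹ := by
  refine Continuous.inv₀ ?_ fun θ => (regDenom_pos hΔ θ).ne'
  unfold regDenom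
  fun_prop

theorem hasDerivAt_regPrim (hΔ : 0 < Δ) (θ : ℝ) :
    HasDerivAt (regPrim Δ) (regDenom Δ θ)⁻¹ θ :=
  intervalIntegral.integral_hasDerivAt_right
    ((continuous_regDenom_inv hΔ).intervalIntegrable _ _)
    ((continuous_regDenom_inv hΔ).stronglyMeasurableAtFilter _ _)
    (continuous_regDenom_inv hΔ).continuousAt

theorem monotone_regPrim (hΔ : 0 < Δ) : Monotone (regPrim Δ) :=
  monotone_of_hasDerivAt_nonneg (hasDerivAt_regPrim hΔ) fun θ =>
    (inv_pos.2 (regDenom_pos hΔ θ)).le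

/-- Over one period the integrand is dominated by a multiple of `1 / ((πΔ/2)² + x²)`, whose integral
over the line is explicit; `[0, θ]` is covered by at most `θ/2π + 1` periods. -/
theorem regPrim_le (hΔ : 0 < Δ) {θ : ℝ} (hθ : 0 ≤ θ) :
    regPrim Δ θ ≤ (θ / (2 * Real.pi) + 1) * (Real.pi ^ 2 / (2 * Δ)) := by
  have hpi := Real.pi_pos
  have hper : Function.Periodic (fun θ => (regDenom Δ θ)⁻¹) (2 * Real.pi) := by
    intro x
    simp [regDenom]
  have hone : ∫ x in (0 : ℝ)..2 * Real.pi, (regDenom Δ x)⁻¹ ≤ Real.pi ^ 2 / (2 * Δ) := by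
    -- The period is moved to `[-π, π]`, where the quadratic lower bound for `2 - 2 cos` is valid.
    have h1 := hper.intervalIntegral_add_eq 0 (-Real.pi)
    rw [zero_add] at h1
    rw [h1, show -Real.pi + 2 * Real.pi = Real.pi by ring]
    have hc : Real.pi * Δ / 2 ≠ 0 := by positivity
    have h2 := integral_inv_sq_add_sq (a := -Real.pi) (b := Real.pi) hc
    have h3 : ∫ x in (-Real.pi)..Real.pi, (regDenom Δ x)⁻¹ ≤
        ∫ x in (-Real.pi)..Real.pi, Real.pi ^ 2 / 4 * ((Real.pi * Δ / 2) ^ 2 + x ^ 2)⁻¹ := by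
      refine intervalIntegral.integral_mono_on (by linarith)
        ((continuous_regDenom_inv hΔ).intervalIntegrable _ _)
        (Continuous.intervalIntegrable ?_ _ _) ?_
      · refine continuous_const.mul (Continuous.inv₀ (by fun_prop) fun x => ?_)
        positivity
      · intro x hx
        have h4 := two_sub_two_cos_ge (abs_le.2 hx)
        rw [← div_eq_mul_inv, inv_eq_one_div, div_le_div_iff₀ (regDenom_pos hΔ x) (by positivity)]
        unfold regDenom
        have h5 : Real.pi ^ 2 / 4 * (4 / Real.pi ^ 2 * x ^ 2) ≤
            Real.pi ^ 2 / 4 * (2 - 2 * Real.cos x) := by gcongr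
        have h6 : Real.pi ^ 2 / 4 * (4 / Real.pi ^ 2 * x ^ 2) = x ^ 2 := by field_simp
        nlinarith
    refine h3.trans ?_
    rw [intervalIntegral.integral_const_mul, h2]
    have h7 := Real.arctan_lt_pi_div_two (Real.pi / (Real.pi * Δ / 2))
    have h8 := Real.neg_pi_div_two_lt_arctan (-Real.pi / (Real.pi * Δ / 2))
    calc Real.pi ^ 2 / 4 * ((Real.pi * Δ / 2)⁻¹ * (Real.arctan (Real.pi / (Real.pi * Δ / 2)) -
          Real.arctan (-Real.pi / (Real.pi * Δ / 2))))
        ≤ Real.pi ^ 2 / 4 * ((Real.pi * Δ / 2)⁻¹ * Real.pi) := by gcongr; linarith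
      _ = Real.pi ^ 2 / (2 * Δ) := by field_simp; norm_num
  obtain ⟨N, hN⟩ : ∃ N : ℕ, N = ⌈θ / (2 * Real.pi)⌉₊ := ⟨_, rfl⟩
  have h1 : θ ≤ N * (2 * Real.pi) := by
    have := Nat.le_ceil (θ / (2 * Real.pi))
    rw [← hN, div_le_iff₀ (by positivity)] at this
    exact this
  have h2 : (N : ℝ) ≤ θ / (2 * Real.pi) + 1 := by
    rw [hN]; exact (Nat.ceil_lt_add_one (by positivity)).le
  have h3 : regPrim Δ (N * (2 * Real.pi)) = N * ∫ x in (0 : ℝ)..2 * Real.pi, (regDenom Δ x)⁻¹ := by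
    have := hper.intervalIntegral_add_zsmul_eq N 0
      (fun _ _ => (continuous_regDenom_inv hΔ).intervalIntegrable _ _)
    simpa [regPrim] using this
  calc regPrim Δ θ ≤ regPrim Δ (N * (2 * Real.pi)) := monotone_regPrim hΔ h1
    _ = N * ∫ x in (0 : ℝ)..2 * Real.pi, (regDenom Δ x)⁻¹ := h3
    _ ≤ _ := by
        have h4 := monotone_regPrim hΔ (by positivity : (0 : ℝ) ≤ 2 * Real.pi)
        have h5 : regPrim Δ 0 = 0 := by simp [regPrim]
        rw [h5, regPrim] at h4
        gcongr

theorem hasDerivAt_regDenom_inv (hΔ : 0 < Δ) (θ : ℝ) :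
    HasDerivAt (fun x => (regDenom Δ x)⁻¹) (-(2 * Real.sin θ) / regDenom Δ θ ^ 2) θ := by
  have h : HasDerivAt (regDenom Δ) (2 * Real.sin θ) θ := by
    have := (((Real.hasDerivAt_cos θ).const_mul 2).const_sub 2).add_const (Δ ^ 2)
    convert! this using 1
    ring
  exact h.inv (regDenom_pos hΔ θ).ne'

theorem sin_sq_le_two_sub (θ : ℝ) : Real.sin θ ^ 2 ≤ 2 - 2 * Real.cos θ := by
  nlinarith [Real.sin_sq_add_cos_sq θ, Real.cos_le_one θ, Real.neg_one_le_cos θ]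

/-- By the arithmetic-geometric mean inequality, `2 |sin θ| Δ ≤ sin² θ + Δ²`, which is at most the
denominator. The logarithmic derivative of the inverse denominator is thus at most `1/Δ`. -/
theorem abs_two_sin_div_le (hΔ : 0 < Δ) (θ : ℝ) :
    |-(2 * Real.sin θ) / regDenom Δ θ ^ 2| ≤ 1 / Δ * (regDenom Δ θ)⁻¹ := by
  have hD := regDenom_pos hΔ θ
  rw [abs_div, abs_neg, abs_of_pos (pow_pos hD 2), abs_mul, abs_two, ← one_div,
    one_div_mul_one_div, div_le_div_iff₀ (by positivity) (by positivity)]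
  have h1 : 2 * |Real.sin θ| * Δ ≤ regDenom Δ θ := by
    unfold regDenom
    have := sin_sq_le_two_sub θ
    rw [← sq_abs] at this
    nlinarith [sq_nonneg (|Real.sin θ| - Δ)]
  nlinarith

/-- A point value is replaced by an integral over the window of length `Δ²` to its left. Within the
window the inverse denominator lies below its value at `θ` by at most `L/Δ`, so the error
contributes `ΔL ≤ L`. When the phases are `Δ²`-spaced the windows do not overlap, and sums of point
values telescope. -/
theorem mul_regDenom_inv_le (hΔ : 0 < Δ) (hΔ1 : Δ ≤ 1) (θ : ℝ) :
    Δ ^ 2 * (regDenom Δ θ)⁻¹ ≤ 2 * (regPrim Δ θ - regPrim Δ (θ - Δ ^ 2)) := by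
  have hΔ2 : 0 < Δ ^ 2 := by positivity
  set L := regPrim Δ θ - regPrim Δ (θ - Δ ^ 2) with hL
  have hL' : L = ∫ x in (θ - Δ ^ 2)..θ, (regDenom Δ x)⁻¹ := by
    rw [hL, regPrim, regPrim, intervalIntegral.integral_interval_sub_left] <;>
    exact (continuous_regDenom_inv hΔ).intervalIntegrable _ _
  have hL0 : 0 ≤ L := sub_nonneg.2 (monotone_regPrim hΔ (by linarith))
  have h1 : ∀ x ∈ Icc (θ - Δ ^ 2) θ, (regDenom Δ θ)⁻¹ - 1 / Δ * L ≤ (regDenom Δ x)⁻¹ := by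
    intro x hx
    have h2 := norm_sub_le_of_hasDerivAt_le hx.2
      (fun y _ => (hasDerivAt_regDenom_inv hΔ y).ofReal_comp)
      (fun y _ => (hasDerivAt_regPrim hΔ y).const_mul (1 / Δ))
      (fun y _ => by
        rw [Complex.norm_real, Real.norm_eq_abs]
        exact abs_two_sin_div_le hΔ y)
    rw [← Complex.ofReal_sub, Complex.norm_real, Real.norm_eq_abs] at h2
    have h3 := le_of_abs_le h2
    have h4 : regPrim Δ (θ - Δ ^ 2) ≤ regPrim Δ x := monotone_regPrim hΔ hx.1
    have h5 : 1 / Δ * regPrim Δ (θ - Δ ^ 2) ≤ 1 / Δ * regPrim Δ x := by gcongr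
    rw [hL]
    linarith
  have h2 : ∫ x in (θ - Δ ^ 2)..θ, ((regDenom Δ θ)⁻¹ - 1 / Δ * L) ≤ L := by
    rw [hL']
    exact intervalIntegral.integral_mono_on (by linarith) (by simp)
      ((continuous_regDenom_inv hΔ).intervalIntegrable _ _) (by rw [← hL']; exact h1)
  rw [intervalIntegral.integral_const, smul_eq_mul] at h2
  have h3 : Δ ^ 2 * (1 / Δ * L) = Δ * L := by field_simp
  nlinarith

/-- The regularised kernel `conj (1 - w) / (|1 - w|² + Δ²)` for `w = exp (-iθ)`. -/
noncomputable def regKernel (Δ θ : ℝ) : ℂ :=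
  (1 - Complex.exp (θ * Complex.I)) * ((regDenom Δ θ)⁻¹ : ℝ)

theorem norm_one_sub_exp_le (hΔ : 0 < Δ) (θ : ℝ) :
    ‖1 - Complex.exp (θ * Complex.I)‖ ^ 2 ≤ regDenom Δ θ := by
  rw [normSq_one_sub_exp, regDenom]
  have := pow_pos hΔ 2
  linarith

theorem norm_regKernel_le (hΔ : 0 < Δ) (θ : ℝ) : ‖regKernel Δ θ‖ ≤ 1 / (2 * Δ) := by
  have hD := regDenom_pos hΔ θ
  rw [regKernel, norm_mul, Complex.norm_real, Real.norm_eq_abs, abs_of_pos (inv_pos.2 hD),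
    ← div_eq_mul_inv, div_le_div_iff₀ hD (by positivity)]
  have h1 : regDenom Δ θ = ‖1 - Complex.exp (θ * Complex.I)‖ ^ 2 + Δ ^ 2 := by
    rw [normSq_one_sub_exp, regDenom]
  nlinarith [sq_nonneg (‖1 - Complex.exp (θ * Complex.I)‖ - Δ)]

/-- The derivative of the kernel is at most three times the inverse denominator: once from the
exponential and twice from differentiating the inverse denominator. -/
theorem norm_regKernel_sub_le (hΔ : 0 < Δ) {θ θ' : ℝ} (h : θ ≤ θ') :
    ‖regKernel Δ θ' - regKernel Δ θ‖ ≤ 3 * (regPrim Δ θ' - regPrim Δ θ) := by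
  rw [mul_sub]
  refine norm_sub_le_of_hasDerivAt_le (f := regKernel Δ) (B := fun x => 3 * regPrim Δ x) h
    (f' := fun y => -(Complex.exp (y * Complex.I) * (1 * Complex.I)) * ((regDenom Δ y)⁻¹ : ℝ) +
      (1 - Complex.exp (y * Complex.I)) * ((-(2 * Real.sin y) / regDenom Δ y ^ 2 : ℝ) : ℂ))
    (fun y _ => ?_) (fun y _ => (hasDerivAt_regPrim hΔ y).const_mul 3) (fun y _ => ?_)
  · have h1 : HasDerivAt (fun t : ℝ => (1 : ℂ) - Complex.exp (t * Complex.I))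
        (-(Complex.exp (y * Complex.I) * (1 * Complex.I))) y :=
      (((hasDerivAt_id (y : ℂ)).comp_ofReal.mul_const Complex.I).cexp).const_sub 1
    exact h1.mul (hasDerivAt_regDenom_inv hΔ y).ofReal_comp
  · have hD := regDenom_pos hΔ y
    refine (norm_add_le _ _).trans ?_
    rw [norm_mul, norm_mul, norm_neg, norm_mul, one_mul, Complex.norm_I, mul_one,
      Complex.norm_exp_ofReal_mul_I, one_mul, Complex.norm_real, Complex.norm_real,
      Real.norm_eq_abs, Real.norm_eq_abs, abs_of_pos (inv_pos.2 hD), abs_div, abs_neg,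
      abs_of_pos (pow_pos hD 2), abs_mul, abs_two]
    have h1 := norm_one_sub_exp_le hΔ y
    set ρ := ‖1 - Complex.exp (y * Complex.I)‖ with hρ
    have hρ0 : 0 ≤ ρ := norm_nonneg _
    have h2 : |Real.sin y| ≤ ρ := by
      refine abs_le_of_sq_le_sq ?_ hρ0
      rw [hρ, normSq_one_sub_exp]
      exact sin_sq_le_two_sub y
    have h3 : ρ * (2 * |Real.sin y| / regDenom Δ y ^ 2) ≤ 2 * (regDenom Δ y)⁻¹ := by
      rw [mul_div_assoc', ← div_eq_mul_inv, div_le_div_iff₀ (by positivity) hD]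
      have h4 : ρ * (2 * |Real.sin y|) ≤ 2 * regDenom Δ y := by nlinarith
      nlinarith
    linarith

end VanDerCorput

/-! ### Bounds for the sums of `k^(-it)` -/

section PartialSums

theorem norm_natCast_cpow_mul_I (k : ℕ) (hk : 0 < k) (t : ℝ) :
    ‖(k : ℂ) ^ (-(t * Complex.I))‖ = 1 := by
  have := Complex.norm_cpow_eq_rpow_re_of_pos (x := (k : ℝ)) (by exact_mod_cast hk)
    (-(t * Complex.I))
  simpa using this

theorem natCast_succ_cpow_mul_I {k : ℕ} (hk : 0 < k) (t : ℝ) :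
    ((k + 1 : ℕ) : ℂ) ^ (-(t * Complex.I)) = (k : ℂ) ^ (-(t * Complex.I)) *
      Complex.exp (-((t * Real.log ((k + 1) / k) : ℝ) : ℂ) * Complex.I) := by
  have hk0 : (0 : ℝ) < k := by exact_mod_cast hk
  have hk1 : (k : ℂ) ≠ 0 := by exact_mod_cast hk.ne'
  have hk2 : ((k + 1 : ℕ) : ℂ) ≠ 0 := by exact_mod_cast (Nat.succ_ne_zero k)
  rw [Complex.cpow_def_of_ne_zero hk1, Complex.cpow_def_of_ne_zero hk2, ← Complex.exp_add,
    Real.log_div (by positivity) hk0.ne']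
  congr 1
  have e1 : Complex.log (k : ℂ) = (Real.log k : ℝ) := by
    rw [Complex.ofReal_log hk0.le]; simp
  have e2 : Complex.log ((k + 1 : ℕ) : ℂ) = (Real.log (k + 1) : ℝ) := by
    rw [Complex.ofReal_log (by positivity)]; push_cast; rfl
  rw [e1, e2]
  push_cast
  ring

theorem log_succ_div_le {k : ℕ} (hk : 0 < k) : Real.log (((k : ℝ) + 1) / k) ≤ 1 / k := by
  have hk0 : (0 : ℝ) < k := by exact_mod_cast hk
  have := Real.log_le_sub_one_of_pos (x := ((k : ℝ) + 1) / k) (by positivity)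
  calc _ ≤ ((k : ℝ) + 1) / k - 1 := this
    _ = _ := by field_simp; ring

theorem le_log_succ_div {k : ℕ} (hk : 0 < k) : 1 / ((k : ℝ) + 1) ≤ Real.log (((k : ℝ) + 1) / k) := by
  have hk0 : (0 : ℝ) < k := by exact_mod_cast hk
  have := Real.one_sub_inv_le_log_of_pos (x := ((k : ℝ) + 1) / k) (by positivity)
  calc _ = 1 - (((k : ℝ) + 1) / k)⁻¹ := by field_simp; ring
    _ ≤ _ := this

/-- The spacing of consecutive phases, divided by `t`: it equals `log ((k+1)² / (k(k+2)))`. -/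
theorem le_log_succ_div_sub {k : ℕ} (hk : 0 < k) :
    1 / ((k : ℝ) + 1) ^ 2 ≤
      Real.log (((k : ℝ) + 1) / k) - Real.log (((k + 1 : ℕ) + 1 : ℝ) / (k + 1 : ℕ)) := by
  have hk0 : (0 : ℝ) < k := by exact_mod_cast hk
  rw [← Real.log_div (by positivity) (by positivity)]
  have := Real.one_sub_inv_le_log_of_pos
    (x := (((k : ℝ) + 1) / k) / (((k + 1 : ℕ) + 1 : ℝ) / (k + 1 : ℕ))) (by positivity)
  refine le_trans (le_of_eq ?_) this
  push_cast
  field_simp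
  ring

/-- With `z k = k^(-it)` and phases `θ k = t log ((k+1)/k)`, multiplying the kernel by `1 - z (k+1)
/ z k` gives `1 - Δ²/D`, where `D` is the regularised denominator. So each term is a difference of
consecutive `z` weighted by the kernel, plus a remainder of size `Δ²/D`. The variation of the kernel
and the sum of the remainders are bounded by three and two times the total increase of `regPrim`
along the phases, whence the factor `5`. The range need not be split where the phases come close to
multiples of `2π`. -/
theorem norm_sum_cpow_le_of_le_sq {t : ℝ} {m n : ℕ} (hm : 0 < m) (hmn : m ≤ n) (ht : 0 < t)
    (htn : t ≤ (n : ℝ) ^ 2) :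
    ‖∑ k ∈ Finset.Ico m n, (k : ℂ) ^ (-(t * Complex.I))‖ ≤
      n / √t + 5 * ((t / m) / (2 * Real.pi) + 1) * (Real.pi ^ 2 / 2 * (n / √t)) := by
  have hn : 0 < n := hm.trans_le hmn
  have hn0 : (0 : ℝ) < n := by exact_mod_cast hn
  have hm0 : (0 : ℝ) < m := by exact_mod_cast hm
  have hst : 0 < √t := Real.sqrt_pos.2 ht
  -- Chosen so that `Δ² = t/n²` is a lower bound for the spacing of the phases at indices below `n`.
  set Δ : ℝ := √t / n with hΔ
  have hΔ0 : 0 < Δ := by positivity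
  have hΔ1 : Δ ≤ 1 := by
    rw [hΔ, div_le_one hn0]
    exact Real.sqrt_le_iff.2 ⟨hn0.le, htn⟩
  have hΔ2 : Δ ^ 2 = t / (n : ℝ) ^ 2 := by rw [hΔ, div_pow, Real.sq_sqrt ht.le]
  set θ : ℕ → ℝ := fun k => t * Real.log (((k : ℝ) + 1) / k) with hθ
  -- shifted phases so that only positive indices matter
  set z : ℕ → ℂ := fun k => if k = 0 then 0 else (k : ℂ) ^ (-(t * Complex.I)) with hz
  have hz1 : ∀ k, ‖z k‖ ≤ 1 := by
    intro k
    by_cases hk : k = 0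
    · simp [hz, hk]
    · simp only [hz, hk, if_false]
      exact (norm_natCast_cpow_mul_I k (Nat.pos_of_ne_zero hk) t).le
  have hgap : ∀ k, 0 < k → Δ ^ 2 ≤ θ k - θ (k + 1) ∨ n ≤ k := by
    intro k hk
    rcases lt_or_ge k n with h | h
    · left
      have h1 := le_log_succ_div_sub hk
      have h2 : ((k : ℝ) + 1) ≤ n := by exact_mod_cast h
      rw [hΔ2]
      calc t / (n : ℝ) ^ 2 ≤ t / ((k : ℝ) + 1) ^ 2 := by gcongr
        _ = t * (1 / ((k : ℝ) + 1) ^ 2) := by ring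
        _ ≤ t * (Real.log (((k : ℝ) + 1) / k) - Real.log (((k + 1 : ℕ) + 1 : ℝ) / (k + 1 : ℕ))) := by
            gcongr
        _ = _ := by rw [mul_sub]
    · right; exact h
  have hdecomp : ∀ k ∈ Finset.Ico m n, (k : ℂ) ^ (-(t * Complex.I)) =
      (z k - z (k + 1)) * regKernel Δ (θ k) + z k * ((Δ ^ 2 * (regDenom Δ (θ k))⁻¹ : ℝ) : ℂ) := by
    intro k hk
    have hk0 : 0 < k := hm.trans_le (Finset.mem_Ico.1 hk).1
    have e1 : z k = (k : ℂ) ^ (-(t * Complex.I)) := by simp [hz, hk0.ne']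
    have e2 : z (k + 1) = z k * Complex.exp (-((θ k : ℝ) : ℂ) * Complex.I) := by
      rw [e1]
      simpa [hz, hθ] using natCast_succ_cpow_mul_I hk0 t
    rw [← e1, e2, regKernel]
    have hD : ((regDenom Δ (θ k) : ℝ) : ℂ) ≠ 0 := by
      exact_mod_cast (regDenom_pos hΔ0 _).ne'
    have e3 : (1 - Complex.exp (-((θ k : ℝ) : ℂ) * Complex.I)) *
        (1 - Complex.exp ((θ k : ℝ) * Complex.I)) + (Δ ^ 2 : ℝ) = (regDenom Δ (θ k) : ℝ) := by
      have e4 : (1 - Complex.exp (-((θ k : ℝ) : ℂ) * Complex.I)) *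
          (1 - Complex.exp ((θ k : ℝ) * Complex.I)) =
          ((‖1 - Complex.exp ((θ k : ℝ) * Complex.I)‖ ^ 2 : ℝ) : ℂ) := by
        rw [Complex.sq_norm, Complex.normSq_eq_conj_mul_self]
        congr 1
        rw [map_sub, map_one, ← Complex.exp_conj, map_mul, Complex.conj_I, Complex.conj_ofReal]
        ring_nf
      rw [e4, normSq_one_sub_exp, regDenom]
      push_cast
      ring
    calc z k = z k * ((1 - Complex.exp (-((θ k : ℝ) : ℂ) * Complex.I)) *
        (1 - Complex.exp ((θ k : ℝ) * Complex.I)) + (Δ ^ 2 : ℝ)) * ((regDenom Δ (θ k) : ℝ) : ℂ)⁻¹ := by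
          rw [e3, mul_inv_cancel_right₀ hD]
      _ = _ := by
          push_cast
          ring
  rw [Finset.sum_congr rfl hdecomp, Finset.sum_add_distrib]
  have hθpos : ∀ k : ℕ, 0 < k → 0 ≤ θ k := fun k hk => by
    have := le_log_succ_div hk
    have h2 : (0 : ℝ) ≤ 1 / ((k : ℝ) + 1) := by positivity
    exact mul_nonneg ht.le (h2.trans this)
  have hΓ : ∑ k ∈ Finset.Ico m n, (regPrim Δ (θ k) - regPrim Δ (θ (k + 1))) ≤ regPrim Δ (θ m) := by
    have h1 : ∑ k ∈ Finset.Ico m n, (regPrim Δ (θ k) - regPrim Δ (θ (k + 1))) =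
        regPrim Δ (θ m) - regPrim Δ (θ n) := by
      rw [← neg_inj, ← Finset.sum_neg_distrib]
      simp only [neg_sub]
      exact Finset.sum_Ico_sub (fun k => regPrim Δ (θ k)) hmn
    have h2 : regPrim Δ 0 ≤ regPrim Δ (θ n) := monotone_regPrim hΔ0 (hθpos n hn)
    have h3 : regPrim Δ 0 = 0 := by simp [regPrim]
    linarith
  have hΓm : regPrim Δ (θ m) ≤ ((t / m) / (2 * Real.pi) + 1) * (Real.pi ^ 2 / 2 * (n / √t)) := by
    refine (regPrim_le hΔ0 (hθpos m hm)).trans ?_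
    have h1 : θ m ≤ t / m := by
      have := log_succ_div_le hm
      calc θ m ≤ t * (1 / m) := by simp only [hθ]; gcongr
        _ = _ := by ring
    have h2 : Real.pi ^ 2 / (2 * Δ) = Real.pi ^ 2 / 2 * (n / √t) := by
      rw [hΔ]; field_simp
    rw [h2]
    gcongr
  have hA := norm_sum_sub_mul_le hz1 (fun k => regKernel Δ (θ k)) hmn
  have hB : ∑ k ∈ Finset.Ico m n, ‖regKernel Δ (θ (k + 1)) - regKernel Δ (θ k)‖ ≤
      3 * ∑ k ∈ Finset.Ico m n, (regPrim Δ (θ k) - regPrim Δ (θ (k + 1))) := by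
    rw [Finset.mul_sum]
    refine Finset.sum_le_sum fun k hk => ?_
    obtain ⟨hk1, hk2⟩ := Finset.mem_Ico.1 hk
    rw [norm_sub_rev]
    refine norm_regKernel_sub_le hΔ0 ?_
    rcases hgap k (hm.trans_le hk1) with h | h
    · have := pow_pos hΔ0 2
      linarith
    · omega
  have hC : ‖∑ k ∈ Finset.Ico m n, z k * ((Δ ^ 2 * (regDenom Δ (θ k))⁻¹ : ℝ) : ℂ)‖ ≤
      2 * ∑ k ∈ Finset.Ico m n, (regPrim Δ (θ k) - regPrim Δ (θ (k + 1))) := by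
    rw [Finset.mul_sum]
    refine (norm_sum_le _ _).trans (Finset.sum_le_sum fun k hk => ?_)
    obtain ⟨hk1, hk2⟩ := Finset.mem_Ico.1 hk
    rw [norm_mul, Complex.norm_real, Real.norm_eq_abs, abs_of_nonneg (by
      have := regDenom_pos hΔ0 (θ k)
      positivity)]
    refine (mul_le_of_le_one_left (by
      have := regDenom_pos hΔ0 (θ k)
      positivity) (hz1 k)).trans ((mul_regDenom_inv_le hΔ0 hΔ1 _).trans ?_)
    rcases hgap k (hm.trans_le hk1) with h | h
    · have := monotone_regPrim hΔ0 (show θ (k + 1) ≤ θ k - Δ ^ 2 by linarith)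
      linarith
    · omega
  have hD1 := norm_regKernel_le hΔ0 (θ m)
  have hD2 := norm_regKernel_le hΔ0 (θ n)
  have hD3 : 1 / (2 * Δ) + 1 / (2 * Δ) = n / √t := by rw [hΔ]; field_simp; norm_num
  refine (norm_add_le _ _).trans ?_
  linarith

/-- The Kuzmin–Landau case: all phases lie in `(0, 1]`, away from the nonzero multiples of `2π`, so
no regularisation is needed. The weights `1/(1 - w k)` have variation controlled by that of `1/θ k`,
which grows up to about `n/t`. -/
theorem norm_sum_cpow_le_of_le {t : ℝ} {m n : ℕ} (hm : 0 < m) (hmn : m ≤ n) (ht : 0 < t)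
    (htm : t ≤ m) :
    ‖∑ k ∈ Finset.Ico m n, (k : ℂ) ^ (-(t * Complex.I))‖ ≤ 8 * ((n + 1) / t) := by
  have hn : 0 < n := hm.trans_le hmn
  set θ : ℕ → ℝ := fun k => t * Real.log (((k : ℝ) + 1) / k) with hθ
  set z : ℕ → ℂ := fun k => if k = 0 then 0 else (k : ℂ) ^ (-(t * Complex.I)) with hz
  have hz1 : ∀ k, ‖z k‖ ≤ 1 := by
    intro k
    by_cases hk : k = 0
    · simp [hz, hk]
    · simp only [hz, hk, if_false]
      exact (norm_natCast_cpow_mul_I k (Nat.pos_of_ne_zero hk) t).le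
  have hθpos : ∀ k : ℕ, 0 < k → 0 < θ k := fun k hk => by
    have := le_log_succ_div hk
    have h2 : (0 : ℝ) < 1 / ((k : ℝ) + 1) := by positivity
    exact mul_pos ht (h2.trans_le this)
  have hθ1 : ∀ k : ℕ, m ≤ k → θ k ≤ 1 := fun k hk => by
    have hk0 : 0 < k := hm.trans_le hk
    have hk0' : (0 : ℝ) < k := by exact_mod_cast hk0
    have h1 : (m : ℝ) ≤ k := by exact_mod_cast hk
    calc θ k ≤ t * (1 / k) := by simp only [hθ]; gcongr; exact log_succ_div_le hk0
      _ ≤ 1 := by rw [mul_one_div, div_le_one hk0']; linarith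
  have hθanti : ∀ k : ℕ, 0 < k → θ (k + 1) ≤ θ k := fun k hk => by
    have h1 := le_log_succ_div_sub hk
    have h2 : (0 : ℝ) ≤ 1 / ((k : ℝ) + 1) ^ 2 := by positivity
    exact mul_le_mul_of_nonneg_left (by linarith) ht.le
  set w : ℕ → ℂ := fun k => Complex.exp (-((θ k : ℝ) : ℂ) * Complex.I) with hw
  have hwn : ∀ k, m ≤ k → 2 / Real.pi * θ k ≤ ‖1 - w k‖ := by
    intro k hk
    have h0 := hθpos k (hm.trans_le hk)
    have h1 := hθ1 k hk
    have h2 := normSq_one_sub_exp (-θ k)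
    have h3 := two_sub_two_cos_ge (θ := -θ k) (by
      rw [abs_neg, abs_of_pos h0]; linarith [Real.pi_gt_three])
    have h4 : ‖1 - w k‖ ^ 2 = 2 - 2 * Real.cos (-θ k) := by
      rw [← h2]; simp [hw]
    refine abs_le_of_sq_le_sq' ?_ (norm_nonneg _) |>.2
    rw [h4]
    refine le_trans (le_of_eq ?_) h3
    rw [mul_pow, div_pow, neg_sq]
    norm_num
  have hw0 : ∀ k, m ≤ k → 0 < ‖1 - w k‖ := fun k hk =>
    lt_of_lt_of_le (by have := hθpos k (hm.trans_le hk); have := Real.pi_pos; positivity) (hwn k hk)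
  have hdecomp : ∀ k ∈ Finset.Ico m n, (k : ℂ) ^ (-(t * Complex.I)) =
      (z k - z (k + 1)) * (1 - w k)⁻¹ := by
    intro k hk
    have hkm := (Finset.mem_Ico.1 hk).1
    have hk0 : 0 < k := hm.trans_le hkm
    have e1 : z k = (k : ℂ) ^ (-(t * Complex.I)) := by simp [hz, hk0.ne']
    have e2 : z (k + 1) = z k * w k := by
      rw [e1]
      simpa [hz, hθ, hw] using natCast_succ_cpow_mul_I hk0 t
    have e3 : (1 - w k) ≠ 0 := norm_pos_iff.1 (hw0 k hkm)
    rw [← e1, e2]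
    field_simp
  rw [Finset.sum_congr rfl hdecomp]
  have hinv : ∀ k, m ≤ k → ‖(1 - w k)⁻¹‖ ≤ Real.pi / 2 * (θ k)⁻¹ := by
    intro k hk
    have h0 := hθpos k (hm.trans_le hk)
    rw [norm_inv]
    calc (‖1 - w k‖)⁻¹ ≤ (2 / Real.pi * θ k)⁻¹ := by
          have := Real.pi_pos
          gcongr
          exact hwn k hk
      _ = _ := by rw [mul_inv, inv_div]
  have hdiff : ∀ k ∈ Finset.Ico m n, ‖(1 - w (k + 1))⁻¹ - (1 - w k)⁻¹‖ ≤
      Real.pi ^ 2 / 4 * ((θ (k + 1))⁻¹ - (θ k)⁻¹) := by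
    intro k hk
    have hkm := (Finset.mem_Ico.1 hk).1
    have h0 := hθpos k (hm.trans_le hkm)
    have h1 := hθpos (k + 1) (Nat.succ_pos k)
    have h2 := hw0 k hkm
    have h3 := hw0 (k + 1) (by omega)
    have e1 : (1 - w (k + 1))⁻¹ - (1 - w k)⁻¹ =
        (w (k + 1) - w k) * ((1 - w (k + 1))⁻¹ * (1 - w k)⁻¹) := by
      have := norm_pos_iff.1 h2
      have := norm_pos_iff.1 h3
      field_simp
      ring
    have e2 : ‖w (k + 1) - w k‖ ≤ θ k - θ (k + 1) := by
      have h5 := Real.norm_exp_I_mul_ofReal_sub_one_le (x := θ k - θ (k + 1))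
      have h6 : w (k + 1) - w k = w k * (Complex.exp (Complex.I * ((θ k - θ (k + 1) : ℝ) : ℂ)) - 1) := by
        simp only [hw]
        rw [mul_sub, ← Complex.exp_add, mul_one]
        congr 2
        push_cast
        ring
      have h7 : ‖w k‖ = 1 := by
        have := Complex.norm_exp_ofReal_mul_I (-θ k)
        simpa [hw] using this
      rw [h6, norm_mul, h7, one_mul]
      refine h5.trans (le_of_eq ?_)
      rw [Real.norm_eq_abs, abs_of_nonneg (sub_nonneg.2 (hθanti k (hm.trans_le hkm)))]
    rw [e1, norm_mul, norm_mul]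
    calc _ ≤ (θ k - θ (k + 1)) * ((Real.pi / 2 * (θ (k + 1))⁻¹) * (Real.pi / 2 * (θ k)⁻¹)) := by
          have h8 := hinv k hkm
          have h9 := hinv (k + 1) (by omega)
          have h10 : 0 ≤ θ k - θ (k + 1) := (norm_nonneg _).trans e2
          have h11 : 0 ≤ Real.pi / 2 * (θ (k + 1))⁻¹ := (norm_nonneg _).trans h9
          gcongr
      _ = _ := by field_simp; ring
  have hsum : ∑ k ∈ Finset.Ico m n, ‖(1 - w (k + 1))⁻¹ - (1 - w k)⁻¹‖ ≤
      Real.pi ^ 2 / 4 * ((θ n)⁻¹ - (θ m)⁻¹) := by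
    refine (Finset.sum_le_sum hdiff).trans (le_of_eq ?_)
    rw [← Finset.mul_sum]
    congr 1
    exact Finset.sum_Ico_sub (fun k => (θ k)⁻¹) hmn
  have hA := norm_sum_sub_mul_le hz1 (fun k => (1 - w k)⁻¹) hmn
  have h1 := hinv m le_rfl
  have h2 := hinv n hmn
  have h3 : (θ m)⁻¹ ≤ (θ n)⁻¹ := by
    have h4 : 0 ≤ Real.pi ^ 2 / 4 * ((θ n)⁻¹ - (θ m)⁻¹) :=
      (Finset.sum_nonneg fun _ _ => norm_nonneg _).trans hsum
    have h5 : 0 < Real.pi ^ 2 / 4 := by have := Real.pi_pos; positivity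
    nlinarith
  have h4 : (θ n)⁻¹ ≤ (n + 1) / t := by
    have h5 := le_log_succ_div hn
    have h6 : t * (1 / ((n : ℝ) + 1)) ≤ θ n := by simp only [hθ]; gcongr
    calc (θ n)⁻¹ ≤ (t * (1 / ((n : ℝ) + 1)))⁻¹ := by gcongr
      _ = _ := by field_simp
  have h5 : 0 < (θ m)⁻¹ := inv_pos.2 (hθpos m hm)
  have hpi := Real.pi_lt_d2
  have hpi0 := Real.pi_pos
  have hpi2 : Real.pi ^ 2 / 4 ≤ 4 := by nlinarith
  have h6 : Real.pi ^ 2 / 4 * ((θ n)⁻¹ - (θ m)⁻¹) ≤ 4 * ((θ n)⁻¹ - (θ m)⁻¹) := by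
    gcongr
  have h7 : Real.pi / 2 * (θ m)⁻¹ ≤ 2 * (θ m)⁻¹ := by gcongr; linarith
  have h8 : Real.pi / 2 * (θ n)⁻¹ ≤ 2 * (θ n)⁻¹ := by
    have := h5.trans_le h3
    gcongr; linarith
  linarith

end PartialSums

/-! ### The sums of `k^(-it)` compared with integrals -/

section PartialSums

/-- As a function of its right endpoint, the trapezoidal error has derivative `-1/2` times `F x - F
a - (x - a) F' x`. The latter vanishes at `a` and has derivative `-(x - a) F'' x`, so it is at most
`M` on a cell of length one. -/
theorem norm_trapezoid_sub_integral_le {F F' F'' : ℝ → ℂ} {a M : ℝ}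
    (h1 : ∀ x ∈ Icc a (a + 1), HasDerivAt F (F' x) x)
    (h2 : ∀ x ∈ Icc a (a + 1), HasDerivAt F' (F'' x) x)
    (hc : ContinuousOn F (Icc a (a + 1)))
    (hM : ∀ x ∈ Icc a (a + 1), ‖F'' x‖ ≤ M) :
    ‖(F a + F (a + 1)) / 2 - ∫ x in a..(a + 1), F x‖ ≤ M := by
  have hM0 : 0 ≤ M := (norm_nonneg _).trans (hM a ⟨le_rfl, by linarith⟩)
  have hψ : ∀ x ∈ Icc a (a + 1), ‖F x - F a - (x - a) * F' x‖ ≤ M := by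
    intro x hx
    have hsub : Icc a x ⊆ Icc a (a + 1) := Icc_subset_Icc_right hx.2
    have := norm_sub_le_of_hasDerivAt_le (f := fun y => F y - F a - (y - a) * F' y)
      (f' := fun y => F' y - (1 * F' y + (y - a) * F'' y)) (B := fun y => M * y)
      (B' := fun _ => M * 1) hx.1
      (fun y hy => ((h1 y (hsub hy)).sub_const _).sub
        ((((hasDerivAt_id (y : ℂ)).comp_ofReal).sub_const _).mul (h2 y (hsub hy))))
      (fun y _ => (hasDerivAt_id y).const_mul M)
      (fun y hy => by
        have e : F' y - (1 * F' y + (y - a) * F'' y) = -(((y - a : ℝ) : ℂ) * F'' y) := by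
          push_cast; ring
        rw [e, norm_neg, norm_mul, Complex.norm_real, Real.norm_eq_abs,
          abs_of_nonneg (sub_nonneg.2 hy.1), mul_one]
        have h3 := hM y (hsub hy)
        have h4 : y - a ≤ 1 := by linarith [(hsub hy).2]
        calc (y - a) * ‖F'' y‖ ≤ 1 * M := by
              have := sub_nonneg.2 hy.1
              gcongr
          _ = M := one_mul M)
    simp only [sub_self, zero_mul, sub_zero] at this
    have h5 : M * x - M * a ≤ M := by nlinarith [hx.2]
    exact this.trans h5
  set G : ℝ → ℂ := fun x => (x - a) * (F a + F x) / 2 - ∫ u in a..x, F u with hG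
  have hGc : ContinuousOn G (Icc a (a + 1)) := by
    have hi : ContinuousOn (fun x => ∫ u in a..x, F u) (Icc a (a + 1)) := by
      have := intervalIntegral.continuousOn_primitive_interval (μ := volume) (f := F) (a := a)
        (b := a + 1)
      rw [uIcc_of_le (by linarith)] at this
      exact this hc.integrableOn_Icc
    refine ContinuousOn.sub ?_ hi
    exact (((Complex.continuous_ofReal.continuousOn).sub continuousOn_const).mul
      (continuousOn_const.add hc)).div_const 2
  have := image_norm_le_of_norm_deriv_right_le_deriv_boundary' (f := G)
    (f' := fun x => (1 * (F a + F x) + (x - a) * F' x) / 2 - F x)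
    (B := fun x => M * (x - a)) (B' := fun x => M * 1) hGc
    (fun x hx => by
      have hx' : x ∈ Icc a (a + 1) := Ico_subset_Icc_self hx
      have hd1 : HasDerivAt (fun x : ℝ => ((x : ℂ) - a) * (F a + F x) / 2)
          ((1 * (F a + F x) + (x - a) * F' x) / 2) x :=
        (((((hasDerivAt_id (x : ℂ)).comp_ofReal).sub_const _).mul
          ((h1 x hx').const_add (F a)))).div_const 2
      have hd2 : HasDerivWithinAt (fun x => ∫ u in a..x, F u) (F x) (Ici x) x := by
        refine intervalIntegral.integral_hasDerivWithinAt_right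
          ((hc.mono (Icc_subset_Icc_right hx'.2)).intervalIntegrable_of_Icc hx'.1) ?_
          (h1 x hx').continuousAt.continuousWithinAt
        exact ⟨Icc a (a+1), mem_nhdsWithin.2 ⟨Iio (a + 1), isOpen_Iio, hx.2, fun y hy =>
          ⟨hx.1.trans (le_of_lt hy.2), le_of_lt hy.1⟩⟩, hc.aestronglyMeasurable measurableSet_Icc⟩
      exact hd1.hasDerivWithinAt.sub hd2)
    (by simp [hG])
    (fun x _ => by fun_prop)
    (fun x _ => (((hasDerivAt_id x).sub_const a).const_mul M).hasDerivWithinAt)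
    (fun x hx => by
      have hx' : x ∈ Icc a (a + 1) := Ico_subset_Icc_self hx
      have e : (1 * (F a + F x) + (x - a) * F' x) / 2 - F x =
          (-1 / 2 : ℂ) * (F x - F a - (x - a) * F' x) := by ring
      rw [e, norm_mul]
      have h3 := hψ x hx'
      have h4 : ‖(-1 / 2 : ℂ)‖ = 1 / 2 := by norm_num
      rw [h4]
      linarith)
    (right_mem_Icc.2 (by linarith : a ≤ a + 1))
  simp only [hG] at this
  simpa [add_sub_cancel_left] using this

theorem norm_integral_cpow_le {t a b : ℝ} (ht : 0 < t) (ha : 0 < a) (hab : a ≤ b) :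
    ‖∫ u in a..b, (u : ℂ) ^ (-(t * Complex.I))‖ ≤ 2 * b / t := by
  have hb := ha.trans_le hab
  rw [integral_cpow (Or.inl (by simp)), norm_div]
  have h1 : ∀ x : ℝ, 0 < x → ‖(x : ℂ) ^ (-(t * Complex.I) + 1)‖ = x := by
    intro x hx
    rw [Complex.norm_cpow_eq_rpow_re_of_pos hx]
    simp
  have h2 : t ≤ ‖-(t * Complex.I) + 1‖ := by
    have := Complex.abs_im_le_norm (-(t * Complex.I) + 1)
    simpa [abs_of_pos ht] using this
  calc _ ≤ (b + a) / t := by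
        gcongr
        exact (norm_sub_le _ _).trans (by rw [h1 b hb, h1 a ha])
    _ ≤ _ := by gcongr; linarith

/-- The trapezoidal rule on unit cells: the second derivative of `x^(-it)` is at most `t(t+1)/m²`,
and passing from the sum to the trapezoidal sum leaves only half of two endpoint terms. -/
theorem norm_sum_sub_integral_cpow_le {t : ℝ} {m n : ℕ} (hm : 0 < m) (hmn : m ≤ n) (ht : 0 < t) :
    ‖∑ k ∈ Finset.Ico m n, (k : ℂ) ^ (-(t * Complex.I)) -
        ∫ u in (m : ℝ)..n, (u : ℂ) ^ (-(t * Complex.I))‖ ≤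
      1 + ((n : ℝ) - m) * (t * (t + 1) / (m : ℝ) ^ 2) := by
  set F : ℝ → ℂ := fun x => (x : ℂ) ^ (-(t * Complex.I)) with hF
  have hm0 : (0 : ℝ) < m := by exact_mod_cast hm
  have hderiv : ∀ x : ℝ, 0 < x → HasDerivAt F (-(t * Complex.I) * (x : ℂ) ^ (-(t * Complex.I) - 1)) x :=
    fun x hx => hasDerivAt_ofReal_cpow hx _
  have hcont : ∀ a b : ℝ, 0 < a → ContinuousOn F (Icc a b) := fun a b ha x hx =>
    (hderiv x (ha.trans_le hx.1)).continuousAt.continuousWithinAt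
  have hint : ∫ u in (m : ℝ)..n, F u = ∑ k ∈ Finset.Ico m n, ∫ u in (k : ℝ)..((k + 1 : ℕ) : ℝ), F u := by
    rw [intervalIntegral.sum_integral_adjacent_intervals_Ico (a := fun k : ℕ => (k : ℝ)) hmn]
    intro k hk
    refine (hcont _ _ ?_).intervalIntegrable_of_Icc (by push_cast; linarith)
    exact_mod_cast hm.trans_le hk.1
  have htrap : ∑ k ∈ Finset.Ico m n, F k =
      ∑ k ∈ Finset.Ico m n, (F k + F (k + 1)) / 2 + (F m - F n) / 2 := by
    clear hint
    induction n, hmn using Nat.le_induction with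
    | base => simp
    | succ n hmn ih =>
      rw [Finset.sum_Ico_succ_top hmn, Finset.sum_Ico_succ_top hmn, ih]
      push_cast
      ring
  have hF1 : ∀ k : ℕ, 0 < k → ‖F k‖ = 1 := fun k hk => by
    simpa [hF] using norm_natCast_cpow_mul_I k hk t
  have hcell : ∀ k ∈ Finset.Ico m n,
      ‖(F k + F (k + 1)) / 2 - ∫ u in (k : ℝ)..((k + 1 : ℕ) : ℝ), F u‖ ≤ t * (t + 1) / (m : ℝ) ^ 2 := by
    intro k hk
    have hk1 : (m : ℝ) ≤ k := by exact_mod_cast (Finset.mem_Ico.1 hk).1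
    have hk0 : (0 : ℝ) < k := hm0.trans_le hk1
    push_cast
    refine norm_trapezoid_sub_integral_le (fun x hx => hderiv x (hk0.trans_le hx.1))
      (fun x hx => (hasDerivAt_ofReal_cpow (hk0.trans_le hx.1) _).const_mul _)
      (hcont _ _ hk0) fun x hx => ?_
    have hx0 := hk0.trans_le hx.1
    rw [norm_mul, norm_mul, Complex.norm_cpow_eq_rpow_re_of_pos hx0]
    have e1 : ‖-(t * Complex.I)‖ = t := by simp [abs_of_pos ht]
    have e2 : ‖-(t * Complex.I) - 1‖ ≤ t + 1 := (norm_sub_le _ _).trans (by simp [e1])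
    have e3 : (-(t * Complex.I) - 1 - 1).re = -2 := by simp; norm_num
    have e4 : x ^ (-2 : ℝ) ≤ 1 / (m : ℝ) ^ 2 := by
      rw [Real.rpow_neg hx0.le, ← one_div]
      have : (m : ℝ) ≤ x := hk1.trans hx.1
      norm_cast
      push_cast
      gcongr
    rw [e1, e3]
    calc t * (‖-(t * Complex.I) - 1‖ * x ^ (-2 : ℝ)) ≤ t * ((t + 1) * (1 / (m : ℝ) ^ 2)) := by
          gcongr
      _ = _ := by ring
  have htrap' : ∑ k ∈ Finset.Ico m n, (k : ℂ) ^ (-(t * Complex.I)) -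
        ∫ u in (m : ℝ)..n, (u : ℂ) ^ (-(t * Complex.I)) =
      ∑ k ∈ Finset.Ico m n, ((F k + F (k + 1)) / 2 - ∫ u in (k : ℝ)..((k + 1 : ℕ) : ℝ), F u) +
        (F m - F n) / 2 := by
    rw [Finset.sum_sub_distrib, ← hint]
    have : ∑ k ∈ Finset.Ico m n, (k : ℂ) ^ (-(t * Complex.I)) = ∑ k ∈ Finset.Ico m n, F k := by
      simp [hF]
    rw [this, htrap]
    ring
  rw [htrap']
  refine (norm_add_le _ _).trans ?_
  have h1 : ‖(F m - F n) / 2‖ ≤ 1 := by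
    rw [norm_div, Complex.norm_ofNat]
    have := norm_sub_le (F m) (F n)
    rw [hF1 m hm, hF1 n (hm.trans_le hmn)] at this
    linarith
  have h2 := (norm_sum_le _ _).trans (Finset.sum_le_sum hcell)
  rw [Finset.sum_const, Nat.card_Ico, nsmul_eq_mul, Nat.cast_sub hmn] at h2
  linarith

theorem conj_ofReal_cpow {x : ℝ} (hx : 0 ≤ x) (s : ℂ) :
    (starRingEnd ℂ) ((x : ℂ) ^ s) = (x : ℂ) ^ (starRingEnd ℂ) s := by
  rw [Complex.cpow_conj _ _ (by
    rw [Complex.arg_ofReal_of_nonneg hx]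
    exact Real.pi_ne_zero.symm), Complex.conj_ofReal]

/-- After reduction to `t > 0` there are four ranges. For `m ≤ √t` both sides are trivially at most
`m`. For `√t < m ≤ t` the regularised estimate bounds the sum by `O(√t)`, and the integral is
bounded. For `t < m ≤ t^(3/2)` the Kuzmin–Landau bound `O(m/t)` suffices for the sum and the
integral separately. For `m > t^(3/2)` the trapezoidal error `O(t²/m)` is small, and the two cancel.
-/
theorem norm_partialSum_sub_integral_le {t : ℝ} (ht : 1 ≤ |t|) {m : ℕ} (hm : 0 < m) {x : ℝ}
    (hmx : (m : ℝ) ≤ x) (hx : x ≤ 2 * m) :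
    ‖∑ k ∈ Finset.Ioc m ⌊x⌋₊, (k : ℂ) ^ (-(t * Complex.I)) -
        ∫ u in (m : ℝ)..x, (u : ℂ) ^ (-(t * Complex.I))‖ ≤ 200 * √|t| := by
  have hm0 : (0 : ℝ) < m := by exact_mod_cast hm
  wlog htp : 0 < t generalizing t
  · have htn : t < 0 := lt_of_le_of_ne (not_lt.1 htp) (by rintro rfl; norm_num at ht)
    have h1 := this (t := -t) (by simpa using ht) (by linarith)
    rw [abs_neg] at h1
    -- Negative `t` reduces to positive `t` by complex conjugation.
    rw [← Complex.norm_conj]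
    refine le_trans (le_of_eq ?_) h1
    congr 1
    rw [map_sub, map_sum, ← intervalIntegral.intervalIntegral_conj]
    have e : (starRingEnd ℂ) (-(t * Complex.I)) = -(((-t : ℝ) : ℂ) * Complex.I) := by simp
    congr 1
    · refine Finset.sum_congr rfl fun k _ => ?_
      have := conj_ofReal_cpow (Nat.cast_nonneg (α := ℝ) k) (-(t * Complex.I))
      rw [e] at this
      simpa using this
    · refine intervalIntegral.integral_congr fun u hu => ?_
      rw [uIcc_of_le hmx] at hu
      rw [conj_ofReal_cpow (hm0.le.trans hu.1), e]
  rw [abs_of_pos htp] at ht ⊢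
  set n := ⌊x⌋₊ with hn
  have hnx : (n : ℝ) ≤ x := Nat.floor_le (hm0.le.trans hmx)
  have hxn : x < n + 1 := Nat.lt_floor_add_one x
  have hmn : m ≤ n := Nat.le_floor hmx
  have hmn' : (m : ℝ) ≤ n := by exact_mod_cast hmn
  have hn2 : (n : ℝ) ≤ 2 * m := hnx.trans hx
  have hIoc : Finset.Ioc m n = Finset.Ico (m + 1) (n + 1) := by
    ext k; simp only [Finset.mem_Ioc, Finset.mem_Ico]; omega
  have hst1 : 1 ≤ √t := Real.one_le_sqrt.2 ht
  have hst0 : 0 < √t := by linarith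
  have hsq : √t * √t = t := Real.mul_self_sqrt htp.le
  have hint := norm_integral_cpow_le htp hm0 hmx
  have hm1 : (1 : ℝ) ≤ m := by exact_mod_cast hm
  rcases le_or_gt ((m : ℝ) ^ 2) t with h1 | h1
  -- Trivial range: at most `m ≤ √t` terms of modulus one.
  · have hms : (m : ℝ) ≤ √t := Real.le_sqrt_of_sq_le h1
    refine (norm_sub_le _ _).trans ?_
    have h2 : ‖∑ k ∈ Finset.Ioc m n, (k : ℂ) ^ (-(t * Complex.I))‖ ≤ n - m := by
      refine (norm_sum_le _ _).trans ?_
      rw [Finset.sum_congr rfl fun k hk =>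
        norm_natCast_cpow_mul_I k (hm.trans (Finset.mem_Ioc.1 hk).1) t]
      simp [Nat.cast_sub hmn]
    have h3 : ‖∫ u in (m : ℝ)..x, (u : ℂ) ^ (-(t * Complex.I))‖ ≤ 1 * |x - m| := by
      refine intervalIntegral.norm_integral_le_of_norm_le_const fun u hu => ?_
      rw [uIoc_of_le hmx] at hu
      rw [Complex.norm_cpow_eq_rpow_re_of_pos (hm0.trans hu.1)]
      simp
    rw [abs_of_nonneg (by linarith)] at h3
    linarith
  · have hstm : √t ≤ m := Real.sqrt_le_iff.2 ⟨hm0.le, h1.le⟩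
    rcases le_or_gt (m : ℝ) t with h2 | h2
    · refine (norm_sub_le _ _).trans ?_
      rw [hIoc]
      have h3 := norm_sum_cpow_le_of_le_sq (m := m + 1) (n := n + 1) (Nat.succ_pos m) (by omega) htp
        (by push_cast; nlinarith)
      push_cast at h3
      have h4 : ((n : ℝ) + 1) / √t ≤ 2 * ((m + 1) / √t) := by
        rw [mul_div_assoc']; gcongr; linarith
      have h5 : ((m : ℝ) + 1) / √t ≤ 2 * √t := by
        rw [div_le_iff₀ hst0]; nlinarith
      have h6 : t / ((m : ℝ) + 1) * (((m : ℝ) + 1) / √t) = √t := by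
        field_simp
        nlinarith
      have hA : 0 ≤ ((m : ℝ) + 1) / √t := by positivity
      have hB : 0 ≤ t / ((m : ℝ) + 1) := by positivity
      have hpi := Real.pi_gt_three
      have hpi' := Real.pi_lt_d2
      have h7 : 5 * (t / ((m : ℝ) + 1) / (2 * Real.pi) + 1) *
          (Real.pi ^ 2 / 2 * (((n : ℝ) + 1) / √t)) ≤
          5 * (t / ((m : ℝ) + 1) / 6 + 1) * (5 * (2 * (((m : ℝ) + 1) / √t))) := by
        gcongr
        · linarith
        · nlinarith
      have h8 : 5 * (t / ((m : ℝ) + 1) / 6 + 1) * (5 * (2 * (((m : ℝ) + 1) / √t))) =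
          50 / 6 * (t / ((m : ℝ) + 1) * (((m : ℝ) + 1) / √t)) + 50 * (((m : ℝ) + 1) / √t) := by
        ring
      have h9 : 2 * x / t ≤ 4 := by
        rw [div_le_iff₀ htp]; linarith
      rw [h8, h6] at h7
      linarith
    · rcases le_or_gt (m : ℝ) (t * √t) with h3 | h3
      · refine (norm_sub_le _ _).trans ?_
        rw [hIoc]
        have h4 := norm_sum_cpow_le_of_le (m := m + 1) (n := n + 1) (Nat.succ_pos m) (by omega) htp
          (by push_cast; linarith)
        push_cast at h4
        have h5 : ((n : ℝ) + 1 + 1) / t ≤ 4 * √t := by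
          rw [div_le_iff₀ htp]; nlinarith
        have h6 : 2 * x / t ≤ 4 * √t := by
          rw [div_le_iff₀ htp]; nlinarith
        linarith
      · have h4 := norm_sum_sub_integral_cpow_le hm hmn htp
        have h5 : ((n : ℝ) - m) * (t * (t + 1) / (m : ℝ) ^ 2) ≤ 2 * √t := by
          calc ((n : ℝ) - m) * (t * (t + 1) / (m : ℝ) ^ 2) ≤ m * (t * (t + 1) / (m : ℝ) ^ 2) := by
                gcongr; linarith
            _ = t * (t + 1) / m := by field_simp
            _ ≤ 2 * √t := by
                rw [div_le_iff₀ hm0]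
                nlinarith
        have h6 : ∑ k ∈ Finset.Ioc m n, (k : ℂ) ^ (-(t * Complex.I)) =
            ∑ k ∈ Finset.Ico m n, (k : ℂ) ^ (-(t * Complex.I)) +
              ((n : ℂ) ^ (-(t * Complex.I)) - (m : ℂ) ^ (-(t * Complex.I))) := by
          have e1 := Finset.sum_Ico_succ_top hmn (fun k : ℕ => (k : ℂ) ^ (-(t * Complex.I)))
          have e2 := Finset.sum_eq_sum_Ico_succ_bot (show m < n + 1 by omega)
            (fun k : ℕ => (k : ℂ) ^ (-(t * Complex.I)))
          rw [hIoc]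
          rw [e1] at e2
          linear_combination -e2
        have hcont : ∀ a b : ℝ, 0 < a → a ≤ b →
            IntervalIntegrable (fun u : ℝ => (u : ℂ) ^ (-(t * Complex.I))) volume a b :=
          fun a b ha hab => ContinuousOn.intervalIntegrable_of_Icc hab fun u hu =>
            (hasDerivAt_ofReal_cpow (ha.trans_le hu.1) _).continuousAt.continuousWithinAt
        have h7 : ∫ u in (m : ℝ)..x, (u : ℂ) ^ (-(t * Complex.I)) =
            (∫ u in (m : ℝ)..n, (u : ℂ) ^ (-(t * Complex.I))) +
              ∫ u in (n : ℝ)..x, (u : ℂ) ^ (-(t * Complex.I)) :=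
          (intervalIntegral.integral_add_adjacent_intervals (hcont _ _ hm0 hmn')
            (hcont _ _ (hm0.trans_le hmn') hnx)).symm
        have h8 : ‖∫ u in (n : ℝ)..x, (u : ℂ) ^ (-(t * Complex.I))‖ ≤ 1 * |x - n| := by
          refine intervalIntegral.norm_integral_le_of_norm_le_const fun u hu => ?_
          rw [uIoc_of_le hnx] at hu
          rw [Complex.norm_cpow_eq_rpow_re_of_pos ((hm0.trans_le hmn').trans hu.1)]
          simp
        rw [abs_of_nonneg (by linarith)] at h8
        have h9 := norm_natCast_cpow_mul_I m hm t
        have h10 := norm_natCast_cpow_mul_I n (hm.trans_le hmn) t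
        have h11 := norm_sub_le ((n : ℂ) ^ (-(t * Complex.I))) ((m : ℂ) ^ (-(t * Complex.I)))
        rw [h6, h7]
        calc _ = ‖(∑ k ∈ Finset.Ico m n, (k : ℂ) ^ (-(t * Complex.I)) -
                ∫ u in (m : ℝ)..n, (u : ℂ) ^ (-(t * Complex.I))) +
              (((n : ℂ) ^ (-(t * Complex.I)) - (m : ℂ) ^ (-(t * Complex.I))) -
                ∫ u in (n : ℝ)..x, (u : ℂ) ^ (-(t * Complex.I)))‖ := by ring_nf
          _ ≤ _ := norm_add_le _ _
          _ ≤ _ := by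
              have := norm_sub_le ((n : ℂ) ^ (-(t * Complex.I)) - (m : ℂ) ^ (-(t * Complex.I)))
                (∫ u in (n : ℝ)..x, (u : ℂ) ^ (-(t * Complex.I)))
              linarith

end PartialSums

/-! ### Decay of the archimedean height -/

section ArchimedeanHeight

/-- The archimedean height of the point with affine coordinates `y = x₆ / x₅`, `z = x₃ / x₅`. -/
noncomputable def archHeight (y z : ℝ) : ℝ :=
  max (max |z| |y ^ 2 + z|) 1 * max (min |z| |y ^ 2 + z|) (max |y| 1)

/-- The archimedean height in the symmetric fibre coordinate `v = z + y² / 2`. -/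
theorem archHeight_sub (y v : ℝ) : archHeight y (v - y ^ 2 / 2) =
    max (|v| + y ^ 2 / 2) 1 * max |(|v| - y ^ 2 / 2)| (max |y| 1) := by
  have hr : 0 ≤ y ^ 2 / 2 := by positivity
  set r := y ^ 2 / 2 with hrdef
  have e : y ^ 2 + (v - r) = v + r := by rw [hrdef]; ring
  unfold archHeight
  rw [e]
  have h1 : max |v - r| |v + r| = |v| + r := by
    rcases le_total 0 v with hv | hv
    · rw [abs_of_nonneg hv, abs_of_nonneg (add_nonneg hv hr)]
      exact max_eq_right (abs_le.2 ⟨by linarith, by linarith⟩)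
    · rw [abs_of_nonpos hv, abs_of_nonpos (by linarith : v - r ≤ 0)]
      rw [max_eq_left (abs_le.2 ⟨by linarith, by linarith⟩)]
      ring
  have h2 : min |v - r| |v + r| = |(|v| - r)| := by
    rcases le_total 0 v with hv | hv
    · rw [abs_of_nonneg hv, abs_of_nonneg (add_nonneg hv hr)]
      exact min_eq_left (abs_le.2 ⟨by linarith, by linarith⟩)
    · rw [abs_of_nonpos hv, abs_of_nonpos (by linarith : v - r ≤ 0)]
      rw [min_eq_right (abs_le.2 ⟨by linarith, by linarith⟩), ← abs_neg]
      congr 1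
      ring
  rw [h1, h2]

theorem one_le_archHeight (y z : ℝ) : 1 ≤ archHeight y z :=
  one_le_mul_of_one_le_of_one_le (le_max_right _ _) ((le_max_right _ _).trans (le_max_right _ _))

theorem archHeight_pos (y z : ℝ) : 0 < archHeight y z := by linarith [one_le_archHeight y z]

theorem continuous_archHeight : Continuous fun p : ℝ × ℝ => archHeight p.1 p.2 := by
  unfold archHeight
  fun_prop

theorem continuous_archHeight_right (y : ℝ) : Continuous fun z => archHeight y z :=
  continuous_archHeight.comp (by fun_prop : Continuous fun z : ℝ => (y, z))

theorem archHeight_neg (y z : ℝ) : archHeight (-y) z = archHeight y z := by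
  simp [archHeight]

/-- The larger factor of the height dominates both `1 + y²` and `1 + ||v| - y²/2|`. Lending the
exponent `1/4` of it to the second quantity leaves `σ₀ - 1/4 > 1/2` for the integral over `y` and
gives `σ₀ + 1/4 > 1` for the integral over the fibre. Both inequalities amount to `σ₀ > 3/4`. -/
theorem archHeight_rpow_le {σ₀ : ℝ} (h0 : 3 / 4 < σ₀) (h1 : σ₀ ≤ 1) {σ : ℝ} (hσ : σ₀ ≤ σ) (y v : ℝ) :
    archHeight y (v - y ^ 2 / 2) ^ (-σ) ≤ 16 * (1 + y ^ 2) ^ (-(σ₀ - 1 / 4)) *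
      (1 + |(|v| - y ^ 2 / 2)|) ^ (-(σ₀ + 1 / 4)) := by
  have hle : archHeight y (v - y ^ 2 / 2) ^ (-σ) ≤ archHeight y (v - y ^ 2 / 2) ^ (-σ₀) :=
    Real.rpow_le_rpow_of_exponent_le (one_le_archHeight _ _) (by linarith)
  refine hle.trans ?_
  rw [archHeight_sub]
  have hr : 0 ≤ y ^ 2 / 2 := by positivity
  set r := y ^ 2 / 2 with hrdef
  set d := |(|v| - r)| with hd
  have hd0 : 0 ≤ d := abs_nonneg _
  set A := max (|v| + r) 1 with hA
  set B := max d (max |y| 1) with hB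
  have hv := abs_nonneg v
  have hA1 : 1 ≤ A := le_max_right _ _
  have hA2 : |v| + r ≤ A := le_max_left _ _
  have hdv : d ≤ |v| + r := abs_le.2 ⟨by linarith, by linarith⟩
  have hB1 : 1 ≤ B := (le_max_right _ _).trans (le_max_right _ _)
  have hB2 : d ≤ B := le_max_left _ _
  have hAr : (1 + y ^ 2) / 4 ≤ A := by
    have : y ^ 2 = 2 * r := by rw [hrdef]; ring
    rw [this]; linarith
  have hAd : (1 + d) / 2 ≤ A := by linarith
  have hBd : (1 + d) / 2 ≤ B := by linarith
  have hy1 : 0 < 1 + y ^ 2 := by positivity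
  have hA0 : 0 < A := by linarith
  have hB0 : 0 < B := by linarith
  rw [Real.mul_rpow hA0.le hB0.le]
  have e1 : A ^ (-σ₀) = A ^ (-(σ₀ - 1 / 4)) * A ^ (-(1 / 4 : ℝ)) := by
    rw [← Real.rpow_add hA0]; ring_nf
  have i1 : A ^ (-(σ₀ - 1 / 4)) ≤ 4 * (1 + y ^ 2) ^ (-(σ₀ - 1 / 4)) := by
    calc A ^ (-(σ₀ - 1 / 4)) ≤ ((1 + y ^ 2) / 4) ^ (-(σ₀ - 1 / 4)) :=
          Real.rpow_le_rpow_of_nonpos (by positivity) hAr (by linarith)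
      _ = (1 + y ^ 2) ^ (-(σ₀ - 1 / 4)) * 4 ^ (σ₀ - 1 / 4) := by
          rw [Real.div_rpow hy1.le (by norm_num), Real.rpow_neg (by norm_num : (0 : ℝ) ≤ 4),
            div_inv_eq_mul]
      _ ≤ (1 + y ^ 2) ^ (-(σ₀ - 1 / 4)) * 4 ^ (1 : ℝ) := by
          gcongr
          · norm_num
          · linarith
      _ = _ := by rw [Real.rpow_one]; ring
  have i2 : A ^ (-(1 / 4 : ℝ)) ≤ ((1 + d) / 2) ^ (-(1 / 4 : ℝ)) :=
    Real.rpow_le_rpow_of_nonpos (by positivity) hAd (by norm_num)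
  have i3 : B ^ (-σ₀) ≤ ((1 + d) / 2) ^ (-σ₀) :=
    Real.rpow_le_rpow_of_nonpos (by positivity) hBd (by linarith)
  have e2 : ((1 + d) / 2) ^ (-(1 / 4 : ℝ)) * ((1 + d) / 2) ^ (-σ₀) ≤
      4 * (1 + d) ^ (-(σ₀ + 1 / 4)) := by
    rw [← Real.rpow_add (by positivity), show -(1 / 4 : ℝ) + -σ₀ = -(σ₀ + 1 / 4) by ring,
      Real.div_rpow (by positivity) (by norm_num), Real.rpow_neg (by norm_num : (0 : ℝ) ≤ 2),
      div_inv_eq_mul, mul_comm]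
    gcongr
    calc (2 : ℝ) ^ (σ₀ + 1 / 4) ≤ 2 ^ (2 : ℝ) := by
          gcongr
          · norm_num
          · linarith
      _ = 4 := by norm_num
  calc A ^ (-σ₀) * B ^ (-σ₀) = A ^ (-(σ₀ - 1 / 4)) * (A ^ (-(1 / 4 : ℝ)) * B ^ (-σ₀)) := by
        rw [e1]; ring
    _ ≤ (4 * (1 + y ^ 2) ^ (-(σ₀ - 1 / 4))) *
        (((1 + d) / 2) ^ (-(1 / 4 : ℝ)) * ((1 + d) / 2) ^ (-σ₀)) := by gcongr
    _ ≤ (4 * (1 + y ^ 2) ^ (-(σ₀ - 1 / 4))) * (4 * (1 + d) ^ (-(σ₀ + 1 / 4))) := by gcongr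
    _ = _ := by ring

theorem integrable_one_add_abs_rpow {p : ℝ} (hp : 1 < p) :
    Integrable fun x : ℝ => (1 + |x|) ^ (-p) := by
  have := integrable_one_add_norm (E := ℝ) (μ := volume) (r := p) (by simpa using hp)
  simpa using this

theorem fold_weight_le {p : ℝ} (r v : ℝ) :
    (1 + |(|v| - r)|) ^ (-p) ≤ (1 + |v - r|) ^ (-p) + (1 + |v + r|) ^ (-p) := by
  rcases le_total 0 v with hv | hv
  · rw [abs_of_nonneg hv]
    have : 0 ≤ (1 + |v + r|) ^ (-p) := by positivity
    linarith
  · rw [abs_of_nonpos hv, show -v - r = -(v + r) by ring, abs_neg]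
    have : 0 ≤ (1 + |v - r|) ^ (-p) := by positivity
    linarith

theorem measurable_archHeight_rpow (y σ : ℝ) : Measurable fun z => archHeight y z ^ (-σ) :=
  (continuous_archHeight_right y).measurable.pow_const _

theorem exists_fibre_bound {σ₀ : ℝ} (h0 : 3 / 4 < σ₀) (h1 : σ₀ ≤ 1) :
    ∃ C : ℝ, 0 < C ∧ ∀ σ : ℝ, σ₀ ≤ σ → ∀ y : ℝ,
      Integrable (fun z => archHeight y z ^ (-σ)) ∧
      ∫ z, archHeight y z ^ (-σ) ≤ C * (1 + y ^ 2) ^ (-(σ₀ - 1 / 4)) := by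
  set p := σ₀ + 1 / 4 with hp
  have hp1 : 1 < p := by rw [hp]; linarith
  have hI := integrable_one_add_abs_rpow hp1
  set I := ∫ x : ℝ, (1 + |x|) ^ (-p) with hIdef
  have hI0 : 0 ≤ I := integral_nonneg fun x => by positivity
  refine ⟨32 * I + 1, by positivity, fun σ hσ y => ?_⟩
  set r := y ^ 2 / 2 with hr
  have hw : Integrable fun v => 16 * (1 + y ^ 2) ^ (-(σ₀ - 1 / 4)) *
      ((1 + |v - r|) ^ (-p) + (1 + |v + r|) ^ (-p)) :=
    ((hI.comp_sub_right r).add (hI.comp_add_right r)).const_mul _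
  have hle : ∀ v, archHeight y (v - r) ^ (-σ) ≤ 16 * (1 + y ^ 2) ^ (-(σ₀ - 1 / 4)) *
      ((1 + |v - r|) ^ (-p) + (1 + |v + r|) ^ (-p)) := fun v => by
    refine (archHeight_rpow_le h0 h1 hσ y v).trans ?_
    gcongr
    exact fold_weight_le r v
  have hint : Integrable fun v => archHeight y (v - r) ^ (-σ) := by
    refine hw.mono' ((measurable_archHeight_rpow y σ).comp
      (measurable_id.sub_const r)).aestronglyMeasurable (ae_of_all _ fun v => ?_)
    rw [Real.norm_of_nonneg (Real.rpow_nonneg (archHeight_pos _ _).le _)]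
    exact hle v
  constructor
  · have := hint.comp_add_right r
    simpa using this
  · rw [← integral_sub_right_eq_self (fun z => archHeight y z ^ (-σ)) r]
    refine (integral_mono hint hw hle).trans ?_
    rw [integral_const_mul, integral_add (hI.comp_sub_right r) (hI.comp_add_right r),
      integral_sub_right_eq_self (fun x => (1 + |x|) ^ (-p)) r,
      integral_add_right_eq_self (fun x => (1 + |x|) ^ (-p)) r, ← hIdef]
    have : 0 ≤ (1 + y ^ 2) ^ (-(σ₀ - 1 / 4)) := by positivity
    nlinarith

theorem integrable_one_add_sq_rpow {p : ℝ} (hp : 1 / 2 < p) :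
    Integrable fun x : ℝ => (1 + x ^ 2) ^ (-p) := by
  have := integrable_rpow_neg_one_add_norm_sq (E := ℝ) (μ := volume) (r := 2 * p)
    (by simp; linarith)
  have e : -(2 * p) / 2 = -p := by ring
  simpa [e] using this

theorem variationLE_one_add_sq_rpow {p : ℝ} (hp : 0 ≤ p) :
    VariationLE (fun x => (((1 + x ^ 2) ^ (-p) : ℝ) : ℂ)) univ (1 + 1) := by
  refine VariationLE.of_even (VariationLE.of_antitoneOn (fun a ha b hb hab => ?_)
    (fun x _ => by positivity) fun x _ => ?_) (fun x => by simp)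
  · have ha0 : (0 : ℝ) ≤ a := ha
    refine Real.rpow_le_rpow_of_nonpos (by positivity) (by gcongr) (by linarith)
  · exact Real.rpow_le_one_of_one_le_of_nonpos (by nlinarith [sq_nonneg x]) (by linarith)

/-- The variation comparison with step `1/e`: the sum is `e` times the integral up to a bounded
error, and `e ≥ 1` absorbs the error. -/
theorem exists_lattice_bound {p : ℝ} (hp : 1 / 2 < p) :
    ∃ C : ℝ, 0 < C ∧ ∀ e : ℕ, 0 < e →
      Summable (fun k : ℤ => (1 + ((k : ℝ) / e) ^ 2) ^ (-p)) ∧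
      ∑' k : ℤ, (1 + ((k : ℝ) / e) ^ 2) ^ (-p) ≤ C * e := by
  have hI := integrable_one_add_sq_rpow hp
  set I := ∫ x : ℝ, (1 + x ^ 2) ^ (-p) with hIdef
  have hI0 : 0 ≤ I := integral_nonneg fun x => by positivity
  refine ⟨I + 2, by positivity, fun e he => ?_⟩
  have he0 : (0 : ℝ) < e := by exact_mod_cast he
  obtain ⟨h1, h2⟩ := (variationLE_one_add_sq_rpow (p := p)
    (by linarith)).summable_and_norm_tsum_sub_integral_le hI.ofReal 0 (inv_pos.2 he0)
  have e1 : (fun k : ℤ => (((1 + (0 + (e : ℝ)⁻¹ * k) ^ 2) ^ (-p) : ℝ) : ℂ)) =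
      fun k : ℤ => (((1 + ((k : ℝ) / e) ^ 2) ^ (-p) : ℝ) : ℂ) := by
    ext k; congr 4; ring
  rw [e1] at h1 h2
  have hs := Complex.summable_ofReal.1 h1
  refine ⟨hs, ?_⟩
  rw [← Complex.ofReal_tsum, integral_complex_ofReal, ← Complex.ofReal_mul, ← Complex.ofReal_sub,
    Complex.norm_real, Real.norm_eq_abs, one_div, inv_inv, ← hIdef] at h2
  have h3 := le_of_abs_le h2
  have h4 : (1 : ℝ) ≤ e := by exact_mod_cast he
  nlinarith

end ArchimedeanHeight

/-! ### Variation of the height along a fibre -/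

section FibreVariation

theorem antitoneOn_rpow_neg {h : ℝ → ℝ} {t : Set ℝ} {σ : ℝ} (hσ : 0 ≤ σ) (hpos : ∀ x ∈ t, 0 < h x)
    (hm : MonotoneOn h t) : AntitoneOn (fun x => h x ^ (-σ)) t := fun _ ha _ hb hab =>
  Real.rpow_le_rpow_of_nonpos (hpos _ ha) (hm ha hb hab) (by linarith)

theorem monotoneOn_rpow_neg {h : ℝ → ℝ} {t : Set ℝ} {σ : ℝ} (hσ : 0 ≤ σ) (hpos : ∀ x ∈ t, 0 < h x)
    (hm : AntitoneOn h t) : MonotoneOn (fun x => h x ^ (-σ)) t := fun _ ha _ hb hab =>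
  Real.rpow_le_rpow_of_nonpos (hpos _ hb) (hm ha hb hab) (by linarith)

/-- With `u = (1 + y²)/4` the first factor of the height is at least `u` and the second at least
`u^(1/3)`. At the exponent `3/4` they contribute `3/4 + 1/4 = 1`. -/
theorem archHeight_rpow_le_div {σ : ℝ} (hσ : 3 / 4 ≤ σ) (y z : ℝ) :
    archHeight y z ^ (-σ) ≤ 4 / (1 + y ^ 2) := by
  have hle : archHeight y z ^ (-σ) ≤ archHeight y z ^ (-(3 / 4 : ℝ)) :=
    Real.rpow_le_rpow_of_exponent_le (one_le_archHeight _ _) (by linarith)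
  refine hle.trans ?_
  have hz : archHeight y z = archHeight y ((z + y ^ 2 / 2) - y ^ 2 / 2) := by ring_nf
  rw [hz, archHeight_sub]
  set v := z + y ^ 2 / 2
  set m := max |y| 1 with hm
  have hm1 : 1 ≤ m := le_max_right _ _
  have hmy : y ^ 2 ≤ m ^ 2 := by
    rw [← sq_abs y]
    exact pow_le_pow_left₀ (abs_nonneg _) (le_max_left _ _) 2
  set A := max (|v| + y ^ 2 / 2) 1 with hA
  have hA1 : 1 ≤ A := le_max_right _ _
  have hA2 : |v| + y ^ 2 / 2 ≤ A := le_max_left _ _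
  have hv := abs_nonneg v
  set B := max |(|v| - y ^ 2 / 2)| m with hB
  have hB2 : m ≤ B := le_max_right _ _
  set u := (1 + y ^ 2) / 4 with hu
  have hu0 : 0 < u := by positivity
  have hAu : u ≤ A := by rw [hu]; linarith
  have hum : u ≤ m ^ (3 : ℕ) := by
    have : m ^ 2 ≤ m ^ 3 := pow_le_pow_right₀ hm1 (by norm_num)
    rw [hu]; nlinarith
  have h1 : u ^ (3 / 4 : ℝ) ≤ A ^ (3 / 4 : ℝ) := by gcongr
  have h2 : u ^ (1 / 4 : ℝ) ≤ B ^ (3 / 4 : ℝ) := by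
    calc u ^ (1 / 4 : ℝ) ≤ (m ^ (3 : ℕ)) ^ (1 / 4 : ℝ) := by gcongr
      _ = m ^ (3 / 4 : ℝ) := by
        rw [← Real.rpow_natCast, ← Real.rpow_mul (by linarith)]; norm_num
      _ ≤ _ := by gcongr
  have h3 : u ≤ (A * B) ^ (3 / 4 : ℝ) := by
    rw [Real.mul_rpow (by linarith) (by linarith)]
    calc u = u ^ (3 / 4 : ℝ) * u ^ (1 / 4 : ℝ) := by rw [← Real.rpow_add hu0]; norm_num
      _ ≤ _ := by gcongr
  rw [Real.rpow_neg (by positivity)]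
  calc ((A * B) ^ (3 / 4 : ℝ))⁻¹ ≤ u⁻¹ := by gcongr
    _ = 4 / (1 + y ^ 2) := by rw [hu, inv_div]

/-- In the symmetric coordinate the height is even and, on the positive half-line, first decreasing
and then increasing. The line thus splits into four intervals of monotonicity, each contributing at
most the supremum of the power. -/
theorem variationLE_archHeight_rpow {σ : ℝ} (hσ : 3 / 4 ≤ σ) (y : ℝ) :
    VariationLE (fun z => ((archHeight y z ^ (-σ) : ℝ) : ℂ)) univ (16 / (1 + y ^ 2)) := by
  set r := y ^ 2 / 2 with hr
  have hr0 : 0 ≤ r := by positivity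
  set m := max |y| 1 with hm
  have hm1 : 1 ≤ m := le_max_right _ _
  -- The turning point on `v ≥ 0`: below it the height is `r² - v²`, above it both factors are
  -- nondecreasing.
  set c := max (r - m) 0 with hc
  have hpos : ∀ v ∈ (Set.univ : Set ℝ), 0 < archHeight y (v - r) := fun v _ => archHeight_pos _ _
  have hb : ∀ v, archHeight y (v - r) ^ (-σ) ≤ 4 / (1 + y ^ 2) := fun v =>
    archHeight_rpow_le_div hσ y _
  have h0 : ∀ v, 0 ≤ archHeight y (v - r) ^ (-σ) := fun v =>
    Real.rpow_nonneg (archHeight_pos _ _).le _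
  have key : VariationLE (fun v => ((archHeight y (v - r) ^ (-σ) : ℝ) : ℂ)) univ
      (4 / (1 + y ^ 2) + 4 / (1 + y ^ 2) + (4 / (1 + y ^ 2) + 4 / (1 + y ^ 2))) := by
    refine VariationLE.of_even (VariationLE.union (c := c) ?_ ?_ (mem_Ici.2 (le_max_right _ _))) fun v => ?_
    · refine VariationLE.of_monotoneOn ?_ (fun v _ => h0 v) (fun v _ => hb v)
      refine monotoneOn_rpow_neg (by linarith) (fun v _ => archHeight_pos _ _) ?_
      rintro a ⟨ha, hac⟩ b ⟨hb, hbc⟩ hab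
      simp only [mem_Ici, mem_Iic] at ha hac hb hbc
      rcases le_or_gt (r - m) 0 with h | h
      · rw [hc, max_eq_right h] at hac hbc
        rw [le_antisymm hac ha, le_antisymm hbc hb]
      · rw [hc, max_eq_left h.le] at hac hbc
        dsimp only
        rw [hr, archHeight_sub, archHeight_sub, ← hr, abs_of_nonneg ha, abs_of_nonneg hb, ← hm,
          abs_of_nonpos (by linarith : a - r ≤ 0), abs_of_nonpos (by linarith : b - r ≤ 0),
          max_eq_left (by linarith : (1 : ℝ) ≤ a + r), max_eq_left (by linarith : (1 : ℝ) ≤ b + r),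
          max_eq_left (by linarith : m ≤ -(a - r)), max_eq_left (by linarith : m ≤ -(b - r))]
        nlinarith
    · refine VariationLE.of_antitoneOn ?_ (fun v _ => h0 v) (fun v _ => hb v)
      refine antitoneOn_rpow_neg (by linarith) (fun v _ => archHeight_pos _ _) ?_
      rintro a ⟨ha, hac⟩ b ⟨hb, hbc⟩ hab
      simp only [mem_Ici] at ha hac hb hbc
      have hcr : r - m ≤ c := le_max_left _ _
      have hx : ∀ x, c ≤ x → max |x - r| m = max (x - r) m := fun x hx => by
        rcases le_total 0 (x - r) with h | h
        · rw [abs_of_nonneg h]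
        · rw [abs_of_nonpos h, max_eq_right (by linarith), max_eq_right (by linarith)]
      dsimp only
      rw [hr, archHeight_sub, archHeight_sub, ← hr, abs_of_nonneg ha, abs_of_nonneg hb, ← hm,
        hx a hac, hx b hbc]
      gcongr
    · rw [hr, archHeight_sub, archHeight_sub, abs_neg]
  have := key.comp_affine one_pos r
  refine (this.weaken (le_of_eq ?_)).congr fun z _ => ?_
  · ring
  · simp

theorem variationLE_archHeight_cpow {s : ℂ} (hs : 3 / 4 ≤ s.re) (y : ℝ) :
    VariationLE (fun z => (archHeight y z : ℂ) ^ (-s)) univ (‖s‖ / s.re * (16 / (1 + y ^ 2))) :=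
  VariationLE.cpow (by linarith) (fun _ _ => archHeight_pos _ _) (variationLE_archHeight_rpow hs y)

end FibreVariation

/-! ### Fibre integrals, their mean value and the lattice discrepancy -/

section FibreIntegral

theorem norm_archHeight_cpow (y z : ℝ) (s : ℂ) :
    ‖(archHeight y z : ℂ) ^ (-s)‖ = archHeight y z ^ (-s.re) := by
  rw [Complex.norm_cpow_eq_rpow_re_of_pos (archHeight_pos _ _), Complex.neg_re]

theorem measurable_archHeight_prod_cpow (s : ℂ) :
    Measurable fun p : ℝ × ℝ => (archHeight p.1 p.2 : ℂ) ^ (-s) :=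
  (Complex.measurable_ofReal.comp continuous_archHeight.measurable).pow_const _

theorem measurable_archHeight_cpow (y : ℝ) (s : ℂ) :
    Measurable fun z : ℝ => (archHeight y z : ℂ) ^ (-s) :=
  (Complex.measurable_ofReal.comp (continuous_archHeight_right y).measurable).pow_const _

theorem integrable_archHeight_rpow {σ : ℝ} (hσ : 3 / 4 < σ) (y : ℝ) :
    Integrable fun z => archHeight y z ^ (-σ) := by
  obtain ⟨C, -, h⟩ := exists_fibre_bound (σ₀ := min σ 1) (lt_min hσ (by norm_num)) (min_le_right _ _)
  exact (h σ (min_le_left _ _) y).1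

theorem integrable_archHeight_cpow {s : ℂ} (hs : 3 / 4 < s.re) (y : ℝ) :
    Integrable fun z => (archHeight y z : ℂ) ^ (-s) :=
  (integrable_archHeight_rpow hs y).mono' (measurable_archHeight_cpow y s).aestronglyMeasurable
    (ae_of_all _ fun z => (norm_archHeight_cpow y z s).le)

/-- The integral of the archimedean height over the fibre above `y`. -/
noncomputable def fibreIntegral (s : ℂ) (y : ℝ) : ℂ := ∫ z, (archHeight y z : ℂ) ^ (-s)

theorem fibreIntegral_neg (s : ℂ) (y : ℝ) : fibreIntegral s (-y) = fibreIntegral s y := by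
  simp [fibreIntegral, archHeight_neg]

theorem exists_norm_fibreIntegral_le {σ₀ : ℝ} (h0 : 3 / 4 < σ₀) (h1 : σ₀ ≤ 1) :
    ∃ C : ℝ, 0 < C ∧ ∀ s : ℂ, σ₀ ≤ s.re → ∀ y : ℝ,
      ‖fibreIntegral s y‖ ≤ C * (1 + y ^ 2) ^ (-(σ₀ - 1 / 4)) := by
  obtain ⟨C, hC, h⟩ := exists_fibre_bound h0 h1
  refine ⟨C, hC, fun s hs y => ?_⟩
  refine (norm_integral_le_integral_norm _).trans ?_
  simp_rw [norm_archHeight_cpow]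
  exact (h s.re hs y).2

theorem differentiableOn_fibreIntegral (y : ℝ) :
    DifferentiableOn ℂ (fun s => fibreIntegral s y) {s | 3 / 4 < s.re} :=
  differentiableOn_integral_cpow volume (continuous_archHeight_right y).measurable
    (one_le_archHeight y) fun _ hσ => integrable_archHeight_rpow hσ y

theorem stronglyMeasurable_fibreIntegral (s : ℂ) : StronglyMeasurable (fibreIntegral s) :=
  (measurable_archHeight_prod_cpow s).stronglyMeasurable.integral_prod_right'

theorem integrable_fibreIntegral {s : ℂ} (hs : 3 / 4 < s.re) : Integrable (fibreIntegral s) := by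
  have h0 : 3 / 4 < min s.re 1 := lt_min hs (by norm_num)
  obtain ⟨C, -, h⟩ := exists_norm_fibreIntegral_le h0 (min_le_right _ _)
  exact ((integrable_one_add_sq_rpow (by linarith)).const_mul C).mono'
    (stronglyMeasurable_fibreIntegral s).aestronglyMeasurable
    (ae_of_all _ fun y => h s (min_le_left _ _) y)

theorem integrable_archHeight_prod_rpow {σ : ℝ} (hσ : 3 / 4 < σ) :
    Integrable (fun p : ℝ × ℝ => archHeight p.1 p.2 ^ (-σ)) (volume.prod volume) := by
  have hm : Measurable fun p : ℝ × ℝ => archHeight p.1 p.2 ^ (-σ) :=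
    continuous_archHeight.measurable.pow_const _
  rw [integrable_prod_iff hm.aestronglyMeasurable]
  refine ⟨ae_of_all _ fun y => integrable_archHeight_rpow hσ y, ?_⟩
  have h0 : 3 / 4 < min σ 1 := lt_min hσ (by norm_num)
  obtain ⟨C, -, h⟩ := exists_fibre_bound h0 (min_le_right _ _)
  refine ((integrable_one_add_sq_rpow (p := min σ 1 - 1 / 4) (by linarith)).const_mul C).mono'
    hm.stronglyMeasurable.norm.integral_prod_right'.aestronglyMeasurable (ae_of_all _ fun y => ?_)
  rw [Real.norm_of_nonneg (integral_nonneg fun _ => norm_nonneg _)]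
  simp_rw [Real.norm_of_nonneg (Real.rpow_nonneg (archHeight_pos _ _).le _)]
  exact (h σ (min_le_left _ _) y).2

/-- The archimedean density `∬ h(y, z)⁻ˢ dz dy`. -/
noncomputable def archDensity (s : ℂ) : ℂ := ∫ y, fibreIntegral s y

theorem differentiableOn_archDensity : DifferentiableOn ℂ archDensity {s | 3 / 4 < s.re} := by
  refine (differentiableOn_integral_cpow (volume.prod volume) continuous_archHeight.measurable
    (fun p => one_le_archHeight p.1 p.2) fun _ hσ => integrable_archHeight_prod_rpow hσ).congr ?_
  intro s hs
  rw [integral_prod]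
  · rfl
  · refine (integrable_archHeight_prod_rpow hs).mono'
      (measurable_archHeight_prod_cpow s).aestronglyMeasurable
      (ae_of_all _ fun p => (norm_archHeight_cpow _ _ s).le)

theorem exists_norm_archDensity_le {σ₀ : ℝ} (h0 : 3 / 4 < σ₀) :
    ∃ C : ℝ, 0 < C ∧ ∀ s : ℂ, σ₀ ≤ s.re → ‖archDensity s‖ ≤ C := by
  have h1 : 3 / 4 < min σ₀ 1 := lt_min h0 (by norm_num)
  obtain ⟨C, hC, h⟩ := exists_norm_fibreIntegral_le h1 (min_le_right _ _)
  have hI := integrable_one_add_sq_rpow (p := min σ₀ 1 - 1 / 4) (by linarith)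
  refine ⟨C * (∫ y : ℝ, (1 + y ^ 2) ^ (-(min σ₀ 1 - 1 / 4))) + 1, ?_, fun s hs => ?_⟩
  · have : 0 ≤ ∫ y : ℝ, (1 + y ^ 2) ^ (-(min σ₀ 1 - 1 / 4)) :=
      integral_nonneg fun y => by positivity
    positivity
  · refine (norm_integral_le_of_norm_le (hI.const_mul C)
      (ae_of_all _ fun y => h s ((min_le_left _ _).trans hs) y)).trans ?_
    rw [integral_const_mul]
    linarith

/-- The discrepancy between the sum of the fibre integrals over `e⁻¹ ℤ` and its mean value. -/
noncomputable def latticeError (e : ℕ) (s : ℂ) : ℂ :=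
  ∑' k : ℤ, fibreIntegral s ((k : ℝ) / e) - e * archDensity s

theorem summable_fibreIntegral {e : ℕ} (he : 0 < e) {s : ℂ} (hs : 3 / 4 < s.re) :
    Summable fun k : ℤ => fibreIntegral s ((k : ℝ) / e) := by
  have h1 : 3 / 4 < min s.re 1 := lt_min hs (by norm_num)
  obtain ⟨C, hC, h⟩ := exists_norm_fibreIntegral_le h1 (min_le_right _ _)
  obtain ⟨D, hD, h2⟩ := exists_lattice_bound (p := min s.re 1 - 1 / 4) (by linarith)
  exact .of_norm_bounded ((h2 e he).1.mul_left C) fun k => h s (min_le_left _ _) _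

theorem differentiableOn_latticeError {e : ℕ} (he : 0 < e) :
    DifferentiableOn ℂ (latticeError e) {s | 3 / 4 < s.re} := by
  refine DifferentiableOn.sub ?_ (differentiableOn_archDensity.const_mul _)
  intro s hs
  simp only [mem_ofPred_eq] at hs
  -- An exponent strictly between `3/4` and `Re s`, capped at `1`, serves as the majorant on a
  -- neighbourhood.
  have h1 : 3 / 4 < min ((s.re + 3 / 4) / 2) 1 := lt_min (by linarith) (by norm_num)
  set σ₀ := min ((s.re + 3 / 4) / 2) 1
  have h1' : σ₀ < s.re := (min_le_left _ _).trans_lt (by linarith)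
  obtain ⟨C, hC, h⟩ := exists_norm_fibreIntegral_le h1 (min_le_right _ _)
  obtain ⟨D, hD, h2⟩ := exists_lattice_bound (p := σ₀ - 1 / 4) (by linarith)
  have hopen : IsOpen {s : ℂ | σ₀ < s.re} := isOpen_lt continuous_const Complex.continuous_re
  have := Complex.differentiableOn_tsum_of_summable_norm (u := fun k : ℤ =>
      C * (1 + ((k : ℝ) / e) ^ 2) ^ (-(σ₀ - 1 / 4))) (F := fun (k : ℤ) s => fibreIntegral s ((k : ℝ) / e))
    ((h2 e he).1.mul_left C) (U := {s : ℂ | σ₀ < s.re})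
    (fun k => (differentiableOn_fibreIntegral _).mono fun z (hz : σ₀ < z.re) => h1.trans hz)
    hopen (fun k z hz => h z (le_of_lt hz) _)
  exact (this.differentiableAt (hopen.mem_nhds h1')).differentiableWithinAt

/-- The trivial bound, without cancellation. It needs no upper bound on `Re s` and is used only far
to the right, where the loss of a factor `e` is affordable. -/
theorem exists_norm_latticeError_le {σ₀ : ℝ} (h0 : 3 / 4 < σ₀) :
    ∃ C : ℝ, 0 < C ∧ ∀ e : ℕ, 0 < e → ∀ s : ℂ, σ₀ ≤ s.re → ‖latticeError e s‖ ≤ C * e := by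
  have h1 : 3 / 4 < min σ₀ 1 := lt_min h0 (by norm_num)
  obtain ⟨C, hC, h⟩ := exists_norm_fibreIntegral_le h1 (min_le_right _ _)
  obtain ⟨D, hD, h2⟩ := exists_lattice_bound (p := min σ₀ 1 - 1 / 4) (by linarith)
  obtain ⟨K, hK, h3⟩ := exists_norm_archDensity_le h0
  refine ⟨C * D + K, by positivity, fun e he s hs => ?_⟩
  obtain ⟨h4, h5⟩ := h2 e he
  have h6 := tsum_of_norm_bounded (h4.mul_left C).hasSum fun k : ℤ =>
    h s ((min_le_left _ _).trans hs) ((k : ℝ) / e)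
  rw [tsum_mul_left] at h6
  refine (norm_sub_le _ _).trans ?_
  rw [norm_mul, Complex.norm_natCast]
  have := h3 s hs
  calc _ ≤ C * (D * e) + e * K := by gcongr; exact h6.trans (by gcongr)
    _ = _ := by ring

end FibreIntegral

/-! ### Variation of integrals against `u⁻ˢ` -/

section MellinVariation

theorem VariationLE.mul {f g : ℝ → ℂ} {s : Set ℝ} {V W A B : ℝ} (hf : VariationLE f s V)
    (hg : VariationLE g s W) (hA : ∀ x ∈ s, ‖f x‖ ≤ A) (hB : ∀ x ∈ s, ‖g x‖ ≤ B) (hA0 : 0 ≤ A)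
    (hB0 : 0 ≤ B) : VariationLE (fun x => f x * g x) s (A * W + B * V) := by
  obtain ⟨Ψ, hΨ⟩ := hf
  obtain ⟨Θ, hΘ⟩ := hg
  refine ⟨fun x => A * Θ x + B * Ψ x, fun a ha b hb hab => ?_⟩
  obtain ⟨h1, h2⟩ := hΨ a ha b hb hab
  obtain ⟨h3, h4⟩ := hΘ a ha b hb hab
  have e : A * Θ b + B * Ψ b - (A * Θ a + B * Ψ a) = A * (Θ b - Θ a) + B * (Ψ b - Ψ a) := by ring
  rw [e]
  constructor
  · calc ‖f b * g b - f a * g a‖ = ‖f b * (g b - g a) + g a * (f b - f a)‖ := by ring_nf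
      _ ≤ ‖f b‖ * ‖g b - g a‖ + ‖g a‖ * ‖f b - f a‖ := by
        rw [← norm_mul, ← norm_mul]; exact norm_add_le _ _
      _ ≤ _ := by
        gcongr
        · exact hA b hb
        · exact hB a ha
  · gcongr

theorem VariationLE.comp_monotoneOn {f : ℝ → ℂ} {s t : Set ℝ} {V : ℝ} (hf : VariationLE f s V)
    {φ : ℝ → ℝ} (hφ : MonotoneOn φ t) (hm : MapsTo φ t s) : VariationLE (fun x => f (φ x)) t V := by
  obtain ⟨Ψ, hΨ⟩ := hf
  exact ⟨fun x => Ψ (φ x), fun a ha b hb hab => hΨ _ (hm ha) _ (hm hb) (hφ ha hb hab)⟩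

/-- Since `u⁻ˢ` does not depend on `y`, the variation in `y` is at most the integral of `u^(-3/4)`
against the variation of `K u`, with no dependence on `Im s`. For each `u` the kernel vanishes until
`P u` holds and decreases from then on, so its variation is at most twice its bound. The constant is
`2D ∫ u^(-13/12) du = 24D`. -/
theorem VariationLE.integral_of_unimodal {t : Set ℝ} {s : ℂ} (hs : 3 / 4 ≤ s.re) {K : ℝ → ℝ → ℝ}
    {P : ℝ → ℝ → Prop} {D : ℝ}
    (hP : ∀ u, ∀ a ∈ t, ∀ b ∈ t, a ≤ b → P u a → P u b)
    (hPm : ∀ y ∈ t, MeasurableSet {u | P u y}) (hKm : ∀ y ∈ t, Measurable fun u => K u y)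
    (hK0 : ∀ u ∈ Ioi (1 : ℝ), ∀ y ∈ t, 0 ≤ K u y)
    (hK : ∀ u ∈ Ioi (1 : ℝ), ∀ y ∈ t, K u y ≤ D * u ^ (-(1 / 3 : ℝ)))
    (hKP : ∀ u ∈ Ioi (1 : ℝ), ∀ y ∈ t, ¬ P u y → K u y = 0)
    (hanti : ∀ u ∈ Ioi (1 : ℝ), ∀ a ∈ t, ∀ b ∈ t, a ≤ b → P u a → K u b ≤ K u a) :
    VariationLE (fun y => ∫ u in Ioi (1 : ℝ), (u : ℂ) ^ (-s) * (K u y : ℂ)) t (24 * D) := by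
  classical
  have hnorm : ∀ u ∈ Ioi (1 : ℝ), ‖(u : ℂ) ^ (-s)‖ ≤ u ^ (-(3 / 4 : ℝ)) := fun u hu => by
    have hu1 : (1 : ℝ) < u := hu
    rw [Complex.norm_cpow_eq_rpow_re_of_pos (by linarith)]
    exact Real.rpow_le_rpow_of_exponent_le hu1.le (by simp; linarith)
  have hmul : ∀ u ∈ Ioi (1 : ℝ), u ^ (-(3 / 4 : ℝ)) * (D * u ^ (-(1 / 3 : ℝ))) =
      D * u ^ (-(13 / 12 : ℝ)) := fun u hu => by
    have hu1 : (1 : ℝ) < u := hu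
    rw [mul_left_comm, ← Real.rpow_add (by linarith)]
    norm_num
  have hMi : IntegrableOn (fun u : ℝ => D * u ^ (-(13 / 12 : ℝ))) (Ioi 1) :=
    (integrableOn_Ioi_rpow_of_lt (by norm_num) one_pos).const_mul _
  have hMv : ∫ u in Ioi (1 : ℝ), D * u ^ (-(13 / 12 : ℝ)) = 12 * D := by
    rw [integral_const_mul, integral_Ioi_rpow_of_lt (by norm_num) one_pos]
    norm_num
    ring
  have hcm : Measurable fun u : ℝ => (u : ℂ) ^ (-s) := Complex.measurable_ofReal.pow_const _
  have hle : ∀ u ∈ Ioi (1 : ℝ), ∀ y ∈ t, ‖(u : ℂ) ^ (-s)‖ * K u y ≤ D * u ^ (-(13 / 12 : ℝ)) :=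
    fun u hu y hy => by
      rw [← hmul u hu]
      exact mul_le_mul (hnorm u hu) (hK u hu y hy) (hK0 u hu y hy)
        (Real.rpow_nonneg (by linarith [mem_Ioi.1 hu]) _)
  have hKi : ∀ y ∈ t, IntegrableOn (fun u : ℝ => ‖(u : ℂ) ^ (-s)‖ * K u y) (Ioi 1) := fun y hy => by
    refine Integrable.mono' hMi (hcm.norm.mul (hKm y hy)).aestronglyMeasurable
      ((ae_restrict_iff' measurableSet_Ioi).2 (ae_of_all _ fun u hu => ?_))
    rw [Real.norm_of_nonneg (mul_nonneg (norm_nonneg _) (hK0 u hu y hy))]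
    exact hle u hu y hy
  have hFi : ∀ y ∈ t, IntegrableOn (fun u : ℝ => (u : ℂ) ^ (-s) * (K u y : ℂ)) (Ioi 1) :=
    fun y hy => by
      refine Integrable.mono' hMi (hcm.mul
        (Complex.measurable_ofReal.comp (hKm y hy))).aestronglyMeasurable
        ((ae_restrict_iff' measurableSet_Ioi).2 (ae_of_all _ fun u hu => ?_))
      rw [norm_mul, Complex.norm_real, Real.norm_of_nonneg (hK0 u hu y hy)]
      exact hle u hu y hy
  -- Zero before `P u` holds and twice the majorant minus the kernel term afterwards: at the onset
  -- it rises by at least the kernel term, and later it increases as the kernel decreases.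
  set Ψ : ℝ → ℝ → ℝ := fun u y => {u | P u y}.indicator
    (fun u => 2 * (D * u ^ (-(13 / 12 : ℝ))) - ‖(u : ℂ) ^ (-s)‖ * K u y) u with hΨ
  have hΨi : ∀ y ∈ t, IntegrableOn (fun u => Ψ u y) (Ioi 1) := fun y hy =>
    ((hMi.const_mul 2).sub (hKi y hy)).indicator (hPm y hy)
  have key : ∀ u ∈ Ioi (1 : ℝ), ∀ a ∈ t, ∀ b ∈ t, a ≤ b →
      ‖(u : ℂ) ^ (-s) * (K u b : ℂ) - (u : ℂ) ^ (-s) * (K u a : ℂ)‖ ≤ Ψ u b - Ψ u a ∧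
      Ψ u b - Ψ u a ≤ 2 * (D * u ^ (-(13 / 12 : ℝ))) := by
    intro u hu a ha b hb hab
    rw [← mul_sub, norm_mul, ← Complex.ofReal_sub, Complex.norm_real, Real.norm_eq_abs]
    have hla := hle u hu a ha
    have hlb := hle u hu b hb
    have hu1 : (1 : ℝ) < u := hu
    have hpa := mul_nonneg (norm_nonneg ((u : ℂ) ^ (-s))) (hK0 u hu a ha)
    have hpb := mul_nonneg (norm_nonneg ((u : ℂ) ^ (-s))) (hK0 u hu b hb)
    simp only [hΨ, indicator_apply, mem_ofPred_eq]
    by_cases h1 : P u a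
    · have h2 := hP u a ha b hb hab h1
      have h3 := hanti u hu a ha b hb hab h1
      rw [if_pos h1, if_pos h2, abs_of_nonpos (by linarith)]
      constructor <;> nlinarith
    · rw [if_neg h1, hKP u hu a ha h1, sub_zero, abs_of_nonneg (hK0 u hu b hb)]
      by_cases h2 : P u b
      · rw [if_pos h2]
        constructor <;> linarith
      · rw [if_neg h2, hKP u hu b hb h2]
        constructor
        · simp
        · linarith
  refine ⟨fun y => ∫ u in Ioi (1 : ℝ), Ψ u y, fun a ha b hb hab => ?_⟩
  rw [← integral_sub (hFi b hb) (hFi a ha), ← integral_sub (hΨi b hb) (hΨi a ha)]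
  constructor
  · exact norm_integral_le_of_norm_le ((hΨi b hb).sub (hΨi a ha))
      ((ae_restrict_iff' measurableSet_Ioi).2 (ae_of_all _ fun u hu => (key u hu a ha b hb hab).1))
  · refine (setIntegral_mono_on ((hΨi b hb).sub (hΨi a ha)) (hMi.const_mul 2) measurableSet_Ioi
      fun u hu => (key u hu a ha b hb hab).2).trans (le_of_eq ?_)
    rw [integral_const_mul, hMv]
    ring

theorem setIntegral_Ioi_mul_indicator {c : ℝ → ℂ} {w : ℝ → ℝ} {S : Set ℝ} (hS : MeasurableSet S)
    (h1 : S ⊆ Ioi 1) :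
    ∫ u in Ioi (1 : ℝ), c u * ((S.indicator w u : ℝ) : ℂ) = ∫ u in S, c u * (w u : ℂ) := by
  have : (fun u => c u * ((S.indicator w u : ℝ) : ℂ)) = S.indicator fun u => c u * (w u : ℂ) := by
    ext u
    by_cases hu : u ∈ S <;> simp [hu]
  rw [this, setIntegral_indicator hS, inter_eq_right.2 h1]

end MellinVariation

/-! ### The fibre integral in terms of the height as variable -/

section HalfFibre

/-- The archimedean height in the one-sided fibre coordinate `x = |z + y² / 2| + y² / 2`. -/
noncomputable def halfHeight (y x : ℝ) : ℝ := max x 1 * max |x - y ^ 2| (max |y| 1)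

theorem archHeight_sub_eq_halfHeight (y v : ℝ) :
    archHeight y (v - y ^ 2 / 2) = halfHeight y (|v| + y ^ 2 / 2) := by
  rw [archHeight_sub, halfHeight]
  congr 3
  ring

theorem integral_comp_abs_complex {f : ℝ → ℂ} (hf : Integrable fun x => f |x|) :
    ∫ x, f |x| = 2 * ∫ x in Ioi (0 : ℝ), f x := by
  have h1 : ∫ x in Ioi (0 : ℝ), f |x| = ∫ x in Ioi (0 : ℝ), f x :=
    setIntegral_congr_fun measurableSet_Ioi fun x hx => by rw [abs_of_pos hx]
  have h2 : ∫ x in Iic (0 : ℝ), f |x| = ∫ x in Ioi (0 : ℝ), f x := by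
    have := integral_comp_neg_Iic (0 : ℝ) fun x => f |x|
    simp only [abs_neg, neg_zero] at this
    rw [this, h1]
  rw [← intervalIntegral.integral_Iic_add_Ioi hf.integrableOn hf.integrableOn (b := 0), h1, h2]
  ring

theorem integral_Ioi_comp_add_right (f : ℝ → ℂ) (a r : ℝ) :
    ∫ x in Ioi a, f (x + r) = ∫ x in Ioi (a + r), f x := by
  have := integral_image_eq_integral_abs_deriv_smul (s := Ioi a) (f := fun x => x + r)
    (f' := fun _ => 1) measurableSet_Ioi
    (fun x _ => ((hasDerivAt_id x).add_const r).hasDerivWithinAt)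
    (fun x _ y _ h => by simpa using h) f
  simpa using this.symm

theorem integrableOn_halfHeight {s : ℂ} (hs : 3 / 4 < s.re) (y : ℝ) :
    IntegrableOn (fun x => (halfHeight y x : ℂ) ^ (-s)) (Ioi (y ^ 2 / 2)) := by
  have h := (integrable_archHeight_cpow hs y).comp_sub_right (y ^ 2 / 2)
  have h2 : IntegrableOn (fun x => (archHeight y (x - y ^ 2 / 2 - y ^ 2 / 2) : ℂ) ^ (-s))
      (Ioi (y ^ 2 / 2)) := (h.comp_sub_right (y ^ 2 / 2)).integrableOn
  refine h2.congr_fun (fun x hx => ?_) measurableSet_Ioi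
  have hx' : y ^ 2 / 2 < x := hx
  dsimp only
  rw [archHeight_sub_eq_halfHeight, abs_of_nonneg (by linarith), sub_add_cancel]

theorem fibreIntegral_eq {s : ℂ} (hs : 3 / 4 < s.re) (y : ℝ) :
    fibreIntegral s y = 2 * ∫ x in Ioi (y ^ 2 / 2), (halfHeight y x : ℂ) ^ (-s) := by
  have h := (integrable_archHeight_cpow hs y).comp_sub_right (y ^ 2 / 2)
  simp only [archHeight_sub_eq_halfHeight] at h
  rw [fibreIntegral, ← integral_sub_right_eq_self _ (y ^ 2 / 2)]
  simp only [archHeight_sub_eq_halfHeight]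
  rw [integral_comp_abs_complex (f := fun x => (halfHeight y (x + y ^ 2 / 2) : ℂ) ^ (-s)) h,
    integral_Ioi_comp_add_right fun x => (halfHeight y x : ℂ) ^ (-s), zero_add]

variable {s : ℂ} {y x : ℝ}

theorem halfHeight_of_gt (hy : 0 ≤ y) (hx : y ^ 2 + max y 1 < x) :
    halfHeight y x = x * (x - y ^ 2) := by
  have h1 : (1 : ℝ) ≤ max y 1 := le_max_right _ _
  have h2 := sq_nonneg y
  rw [halfHeight, abs_of_nonneg hy, max_eq_left (by linarith : (1 : ℝ) ≤ x),
    abs_of_nonneg (by linarith), max_eq_left (by linarith)]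

theorem halfHeight_of_le (hy : 0 ≤ y) (hx : x ≤ y ^ 2 + max y 1) (hx2 : y ^ 2 - max y 1 ≤ x) :
    halfHeight y x = max x 1 * max y 1 := by
  rw [halfHeight, abs_of_nonneg hy, max_eq_right (abs_le.2 ⟨by linarith, by linarith⟩)]

theorem halfHeight_of_lt (hy : 2 ≤ y) (hx : y ^ 2 / 2 < x) (hx2 : x ≤ y ^ 2 - y) :
    halfHeight y x = x * (y ^ 2 - x) := by
  rw [halfHeight, abs_of_nonneg (by linarith : (0 : ℝ) ≤ y), max_eq_left (by linarith : (1 : ℝ) ≤ y),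
    max_eq_left (by nlinarith : (1 : ℝ) ≤ x), abs_of_nonpos (by linarith),
    max_eq_left (by linarith)]
  ring

/-- The substitution `u = x (x - y²)`, whose inverse is a root of a quadratic polynomial; the
density is the inverse square root of its discriminant. -/
theorem integral_Ioi_halfHeight_tail (hy : 0 ≤ y) :
    ∫ x in Ioi (y ^ 2 + max y 1), (halfHeight y x : ℂ) ^ (-s) =
      ∫ u in Ioi ((y ^ 2 + max y 1) * max y 1), (u : ℂ) ^ (-s) *
        (((√((y ^ 2) ^ 2 + 4 * u))⁻¹ : ℝ) : ℂ) := by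
  have hm : (1 : ℝ) ≤ max y 1 := le_max_right _ _
  set m := max y 1
  set q := y ^ 2
  have hq : 0 ≤ q := sq_nonneg y
  have himg : (fun x => x * (x - q)) '' Ioi (q + m) = Ioi ((q + m) * m) := by
    ext u
    simp only [mem_image, mem_Ioi]
    constructor
    · rintro ⟨x, hx, rfl⟩
      nlinarith
    · intro hu
      have h0 : 0 ≤ q ^ 2 + 4 * u := by nlinarith
      refine ⟨(q + √(q ^ 2 + 4 * u)) / 2, ?_, ?_⟩
      · have : q + 2 * m < √(q ^ 2 + 4 * u) := Real.lt_sqrt_of_sq_lt (by nlinarith)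
        linarith
      · have := Real.sq_sqrt h0
        nlinarith
  rw [← himg, integral_image_eq_integral_abs_deriv_smul (f' := fun x => 2 * x - q)
    measurableSet_Ioi]
  · refine setIntegral_congr_fun measurableSet_Ioi fun x hx => ?_
    have hx' : q + m < x := hx
    have h1 : 0 < 2 * x - q := by linarith
    rw [halfHeight_of_gt hy hx', show q ^ 2 + 4 * (x * (x - q)) = (2 * x - q) ^ 2 by ring,
      Real.sqrt_sq h1.le, abs_of_pos h1, Complex.real_smul, mul_left_comm, ← Complex.ofReal_mul,
      mul_inv_cancel₀ h1.ne', Complex.ofReal_one, mul_one]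
  · intro x _
    have := (hasDerivAt_id x).mul ((hasDerivAt_id x).sub_const q)
    simp only [id] at this
    convert! this.hasDerivWithinAt using 1
    ring
  · intro a ha b hb hab
    simp only [mem_Ioi] at ha hb hab
    have : (a - b) * (a + b - q) = 0 := by linarith
    rcases mul_eq_zero.1 this with h | h
    · linarith
    · linarith

/-- The substitution `u = x (y² - x)`. It reverses orientation to the right of the stationary point
`y²/2`, so the half-open interval changes sides, and the density becomes singular as `c` approaches
`y²/2`. -/
theorem integral_Ioc_halfHeight_inner (hy : 2 ≤ y) {c : ℝ} (hc : y ^ 2 / 2 ≤ c) :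
    ∫ x in Ioc c (y ^ 2 - y), (halfHeight y x : ℂ) ^ (-s) =
      ∫ u in Ico ((y ^ 2 - y) * y) (c * (y ^ 2 - c)), (u : ℂ) ^ (-s) *
        (((√((y ^ 2) ^ 2 - 4 * u))⁻¹ : ℝ) : ℂ) := by
  set q := y ^ 2 with hq
  have ha : q / 2 ≤ q - y := by nlinarith
  have himg : (fun x => x * (q - x)) '' Ioc c (q - y) = Ico ((q - y) * y) (c * (q - c)) := by
    ext u
    simp only [mem_image, mem_Ioc, mem_Ico]
    constructor
    · rintro ⟨x, ⟨hx, hx2⟩, rfl⟩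
      constructor <;> nlinarith
    · rintro ⟨hu, hu2⟩
      have h0 : 0 ≤ q ^ 2 - 4 * u := by nlinarith [sq_nonneg (q - 2 * c)]
      have h1 := Real.sq_sqrt h0
      have h2 := Real.sqrt_nonneg (q ^ 2 - 4 * u)
      refine ⟨(q + √(q ^ 2 - 4 * u)) / 2, ⟨?_, ?_⟩, ?_⟩
      · have : 2 * c - q < √(q ^ 2 - 4 * u) := Real.lt_sqrt_of_sq_lt (by nlinarith)
        linarith
      · have : √(q ^ 2 - 4 * u) ≤ q - 2 * y :=
          (Real.sqrt_le_left (by linarith)).2 (by nlinarith)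
        linarith
      · nlinarith
  rw [← himg, integral_image_eq_integral_abs_deriv_smul (f' := fun x => q - 2 * x)
    measurableSet_Ioc]
  · refine setIntegral_congr_fun measurableSet_Ioc fun x hx => ?_
    have h1 : 0 < 2 * x - q := by linarith [hx.1]
    rw [halfHeight_of_lt hy (by linarith [hx.1]) hx.2,
      show q ^ 2 - 4 * (x * (q - x)) = (2 * x - q) ^ 2 by ring,
      Real.sqrt_sq h1.le, abs_of_neg (by linarith), neg_sub, Complex.real_smul, mul_left_comm,
      ← Complex.ofReal_mul, mul_inv_cancel₀ h1.ne', Complex.ofReal_one, mul_one]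
  · intro x _
    have := (hasDerivAt_id x).mul ((hasDerivAt_id x).const_sub q)
    simp only [id] at this
    convert! this.hasDerivWithinAt using 1
    ring
  · intro a ha b hb hab
    simp only [mem_Ioc] at ha hb hab
    have : (a - b) * (a + b - q) = 0 := by linarith
    rcases mul_eq_zero.1 this with h | h
    · linarith
    · linarith

/-- Near the stationary point the height is homogeneous under `x = y² w`, so all dependence on `y`
is in a power of `y` and in the upper limit. -/
theorem intervalIntegral_halfHeight_central (hy : 2 ≤ y) {τ : ℝ} (h1 : 1 / 2 ≤ τ) (h2 : y ^ 2 * τ ≤ y ^ 2 - y) :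
    ∫ x in (y ^ 2 / 2)..(y ^ 2 * τ), (halfHeight y x : ℂ) ^ (-s) =
      (y : ℂ) ^ (2 - 4 * s) * ∫ w in (1 / 2 : ℝ)..τ, ((w * (1 - w) : ℝ) : ℂ) ^ (-s) := by
  have hy0 : 0 < y := by linarith
  have hyc : (y : ℂ) ≠ 0 := by exact_mod_cast hy0.ne'
  rw [show y ^ 2 / 2 = y ^ 2 * (1 / 2) by ring]
  rw [← intervalIntegral.smul_integral_comp_mul_left, ← intervalIntegral.integral_const_mul,
    ← intervalIntegral.integral_smul]
  rw [intervalIntegral.integral_of_le h1, intervalIntegral.integral_of_le h1]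
  refine setIntegral_congr_fun measurableSet_Ioc fun w hw => ?_
  have hw1 : 1 / 2 < w := hw.1
  have hy2 : (0 : ℝ) < y ^ 2 := by positivity
  have hw2 : y ^ 2 * w ≤ y ^ 2 - y := (mul_le_mul_of_nonneg_left hw.2 hy2.le).trans h2
  have hw3 : 0 ≤ 1 - w := by
    by_contra! h
    nlinarith
  rw [halfHeight_of_lt hy (by nlinarith) hw2,
    show y ^ 2 * w * (y ^ 2 - y ^ 2 * w) = y ^ 4 * (w * (1 - w)) by ring,
    Complex.real_smul, Complex.ofReal_mul (y ^ 4), Complex.mul_cpow_ofReal_nonneg (by positivity)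
    (by nlinarith), ← mul_assoc]
  congr 1
  have e2 : ((y ^ 4 : ℝ) : ℂ) ^ (-s) = ((y : ℂ) ^ (-s)) ^ 4 := by
    rw [show (y ^ 4 : ℝ) = y * (y * (y * y)) by ring, Complex.ofReal_mul,
      Complex.mul_cpow_ofReal_nonneg hy0.le (by positivity), Complex.ofReal_mul,
      Complex.mul_cpow_ofReal_nonneg hy0.le (by positivity), Complex.ofReal_mul,
      Complex.mul_cpow_ofReal_nonneg hy0.le hy0.le]
    ring
  rw [e2, show 2 - 4 * s = ((2 : ℕ) : ℂ) + -s * ((4 : ℕ) : ℂ) by push_cast; ring,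
    Complex.cpow_add _ _ hyc, Complex.cpow_natCast, Complex.cpow_mul_nat]
  push_cast
  rfl

theorem intervalIntegral_halfHeight_linear (hy : 0 ≤ y) :
    ∫ x in (max (max (y ^ 2 / 2) (y ^ 2 - max y 1)) 1)..(y ^ 2 + max y 1),
        (halfHeight y x : ℂ) ^ (-s) =
      ∫ u in Ioc ((max (max (y ^ 2 / 2) (y ^ 2 - max y 1)) 1) * max y 1)
        ((y ^ 2 + max y 1) * max y 1), (u : ℂ) ^ (-s) * (((max y 1)⁻¹ : ℝ) : ℂ) := by
  have hm : (1 : ℝ) ≤ max y 1 := le_max_right _ _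
  set m := max y 1 with hmdef
  have hq : 0 ≤ y ^ 2 := sq_nonneg y
  set b := max (max (y ^ 2 / 2) (y ^ 2 - m)) 1 with hb
  have hbd : b ≤ y ^ 2 + m := max_le (max_le (by linarith) (by linarith)) (by linarith)
  rw [← intervalIntegral.integral_of_le (by gcongr),
    intervalIntegral.integral_mul_const, ← intervalIntegral.smul_integral_comp_mul_right,
    ← intervalIntegral.integral_smul, ← intervalIntegral.integral_mul_const]
  rw [intervalIntegral.integral_of_le hbd, intervalIntegral.integral_of_le hbd]
  refine setIntegral_congr_fun measurableSet_Ioc fun x hx => ?_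
  have hx1 : b < x := hx.1
  have h1 : (1 : ℝ) ≤ b := le_max_right _ _
  have h2 : y ^ 2 - m ≤ b := (le_max_right _ _).trans (le_max_left _ _)
  have hm0 : (m : ℂ) ≠ 0 := by
    have : m ≠ 0 := by linarith
    exact_mod_cast this
  rw [halfHeight_of_le hy hx.2 (by linarith), max_eq_left (by linarith : (1 : ℝ) ≤ x), ← hmdef,
    Complex.real_smul, Complex.ofReal_inv]
  field_simp

theorem intervalIntegral_halfHeight_const (hy : 0 ≤ y) :
    ∫ x in (max (y ^ 2 / 2) (y ^ 2 - max y 1))..(max (max (y ^ 2 / 2) (y ^ 2 - max y 1)) 1),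
        (halfHeight y x : ℂ) ^ (-s) =
      ((max (1 - y ^ 2 / 2) 0 : ℝ) : ℂ) * (max y 1 : ℝ) ^ (-s) := by
  have hm : (1 : ℝ) ≤ max y 1 := le_max_right _ _
  set m := max y 1 with hmdef
  have hq : 0 ≤ y ^ 2 := sq_nonneg y
  set a := max (y ^ 2 / 2) (y ^ 2 - m) with ha
  have e : ∫ x in a..(max a 1), (halfHeight y x : ℂ) ^ (-s) =
      ∫ x in a..(max a 1), (m : ℂ) ^ (-s) := by
    rw [intervalIntegral.integral_of_le (le_max_left _ _),
      intervalIntegral.integral_of_le (le_max_left _ _)]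
    refine setIntegral_congr_fun measurableSet_Ioc fun x hx => ?_
    have hx1 : a < x := hx.1
    have h2 : y ^ 2 - m ≤ a := le_max_right _ _
    have hx2 : x ≤ 1 := by
      rcases le_max_iff.1 hx.2 with h | h
      · linarith
      · exact h
    rw [halfHeight_of_le hy (by linarith) (by linarith), max_eq_right hx2, ← hmdef, one_mul]
  rw [e, intervalIntegral.integral_const, Complex.real_smul]
  congr 2
  rcases le_total y 1 with h | h
  · have : m = 1 := max_eq_right h
    have h3 : a = y ^ 2 / 2 := max_eq_left (by nlinarith)
    rw [h3, max_eq_right (by nlinarith), max_eq_left (by nlinarith)]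
  · have : m = y := max_eq_left h
    rcases le_total y 2 with h4 | h4
    · have h3 : a = y ^ 2 / 2 := max_eq_left (by nlinarith)
      rw [h3]
      rcases le_total (y ^ 2 / 2) 1 with h5 | h5
      · rw [max_eq_right h5, max_eq_left (by linarith)]
      · rw [max_eq_left h5, max_eq_right (by linarith), sub_self]
    · have h3 : 1 ≤ a := le_trans (by nlinarith) (le_max_left (y ^ 2 / 2) (y ^ 2 - m))
      rw [max_eq_left h3, max_eq_right (by nlinarith), sub_self]

end HalfFibre

/-! ### Variation of the fibre integral away from the plateau -/

section RegularPart

/-- Each piece of the fibre integral is a density over a window moving with `y`. A given `u` may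
enter the window once and leave it once, and the density decreases while `u` is inside, so the
unimodal estimate applies. -/
theorem VariationLE.integral_window {t : Set ℝ} {s : ℂ} (hs : 3 / 4 ≤ s.re) {S : ℝ → Set ℝ}
    {w : ℝ → ℝ → ℝ} {P : ℝ → ℝ → Prop} {D : ℝ} (hD : 0 ≤ D)
    (hP : ∀ u, ∀ a ∈ t, ∀ b ∈ t, a ≤ b → P u a → P u b)
    (hPm : ∀ y ∈ t, MeasurableSet {u | P u y}) (hSm : ∀ y ∈ t, MeasurableSet (S y))
    (hwm : ∀ y ∈ t, Measurable fun u => w u y) (hS1 : ∀ y ∈ t, S y ⊆ Ioi 1)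
    (hSP : ∀ y ∈ t, ∀ u ∈ S y, P u y)
    (hSS : ∀ a ∈ t, ∀ b ∈ t, a ≤ b → ∀ u ∈ S b, P u a → u ∈ S a)
    (hw0 : ∀ y ∈ t, ∀ u ∈ S y, 0 ≤ w u y)
    (hwD : ∀ y ∈ t, ∀ u ∈ S y, w u y ≤ D * u ^ (-(1 / 3 : ℝ)))
    (hanti : ∀ a ∈ t, ∀ b ∈ t, a ≤ b → ∀ u ∈ S a, u ∈ S b → w u b ≤ w u a) :
    VariationLE (fun y => ∫ u in S y, (u : ℂ) ^ (-s) * (w u y : ℂ)) t (24 * D) := by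
  classical
  have h := VariationLE.integral_of_unimodal (t := t) hs
    (K := fun u y => (S y).indicator (fun u => w u y) u) (P := P) (D := D) hP hPm
    (fun y hy => (hwm y hy).indicator (hSm y hy))
    (fun u _ y hy => by
      by_cases h : u ∈ S y
      · simpa [h] using hw0 y hy u h
      · simp [h])
    (fun u hu y hy => by
      have hu0 : (0 : ℝ) ≤ u := by linarith [mem_Ioi.1 hu]
      by_cases h : u ∈ S y
      · simpa only [indicator_of_mem h] using hwD y hy u h
      · simp only [indicator_of_notMem h]
        positivity)
    (fun u _ y hy hPu => indicator_of_notMem (fun h => hPu (hSP y hy u h)) _)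
    (fun u _ a ha b hb hab hPu => by
      by_cases h : u ∈ S b
      · have h' := hSS a ha b hb hab u h hPu
        simpa only [indicator_of_mem h, indicator_of_mem h'] using hanti a ha b hb hab u h' h
      · simp only [indicator_of_notMem h]
        by_cases h' : u ∈ S a
        · simpa [h'] using hw0 a ha u h'
        · simp [h'])
  exact h.congr fun y hy => setIntegral_Ioi_mul_indicator (hSm y hy) (hS1 y hy)

/-- The square-root densities would allow the exponent `1/2`. The weaker `1/3` is shared with the
linear piece, whose density `1 / max y 1` is only of order `u^(-1/3)` at the far end of its window.
-/
theorem inv_sqrt_le_rpow {u v : ℝ} (hu : 1 ≤ u) {k : ℝ} (hk : 0 < k) (h : k ^ 2 * u ≤ v) :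
    (√v)⁻¹ ≤ 1 / k * u ^ (-(1 / 3 : ℝ)) := by
  have hu0 : 0 < u := by linarith
  have h1 : k * √u ≤ √v := by
    rw [← Real.sqrt_sq hk.le, ← Real.sqrt_mul (by positivity)]
    exact Real.sqrt_le_sqrt h
  have h2 : u ^ (1 / 3 : ℝ) ≤ √u := by
    rw [Real.sqrt_eq_rpow]
    exact Real.rpow_le_rpow_of_exponent_le hu (by norm_num)
  rw [Real.rpow_neg hu0.le, one_div, ← mul_inv]
  exact inv_anti₀ (by positivity) ((mul_le_mul_of_nonneg_left h2 hk.le).trans h1)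

variable {s : ℂ}

theorem variationLE_tail (hs : 3 / 4 ≤ s.re) :
    VariationLE (fun y => ∫ u in Ioi ((y ^ 2 + max y 1) * max y 1), (u : ℂ) ^ (-s) *
        (((√((y ^ 2) ^ 2 + 4 * u))⁻¹ : ℝ) : ℂ)) (Ici 0) (24 * 1) := by
  have h1 : ∀ y : ℝ, 1 ≤ (y ^ 2 + max y 1) * max y 1 := fun y =>
    one_le_mul_of_one_le_of_one_le (by nlinarith [le_max_right y 1, sq_nonneg y]) (le_max_right _ _)
  have hmono : ∀ a ∈ Ici (0 : ℝ), ∀ b ∈ Ici (0 : ℝ), a ≤ b →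
      (a ^ 2 + max a 1) * max a 1 ≤ (b ^ 2 + max b 1) * max b 1 := fun a ha b hb hab => by
    have : (0 : ℝ) ≤ a := ha
    gcongr
  refine VariationLE.integral_window hs (S := fun y => Ioi ((y ^ 2 + max y 1) * max y 1))
    (w := fun u y => (√((y ^ 2) ^ 2 + 4 * u))⁻¹) (P := fun _ _ => True) (by norm_num)
    (fun _ _ _ _ _ _ _ => trivial) (by simp) (fun _ _ => measurableSet_Ioi)
    (fun y _ => by fun_prop) (fun y _ => Ioi_subset_Ioi (h1 y)) (fun _ _ _ _ => trivial)
    (fun a ha b hb hab u hu _ => (hmono a ha b hb hab).trans_lt hu)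
    (fun y _ u _ => by positivity) (fun y _ u hu => ?_) (fun a ha b hb hab u hu _ => ?_)
  · have hu1 : 1 ≤ u := (h1 y).trans (le_of_lt hu)
    have := inv_sqrt_le_rpow hu1 one_pos (v := (y ^ 2) ^ 2 + 4 * u) (by nlinarith [sq_nonneg (y ^ 2)])
    simpa using this
  · have ha0 : (0 : ℝ) ≤ a := ha
    have hu1 : 1 < u := (h1 a).trans_lt hu
    have : 0 < (a ^ 2) ^ 2 + 4 * u := by positivity
    gcongr

theorem variationLE_linear (hs : 3 / 4 ≤ s.re) :
    VariationLE (fun y => ∫ u in Ioc ((max (max (y ^ 2 / 2) (y ^ 2 - max y 1)) 1) * max y 1)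
        ((y ^ 2 + max y 1) * max y 1), (u : ℂ) ^ (-s) * (((max y 1)⁻¹ : ℝ) : ℂ))
      (Ici 0) (24 * 2) := by
  have hm : ∀ y : ℝ, (1 : ℝ) ≤ max y 1 := fun y => le_max_right _ _
  have h1 : ∀ y : ℝ, 1 ≤ (max (max (y ^ 2 / 2) (y ^ 2 - max y 1)) 1) * max y 1 := fun y =>
    one_le_mul_of_one_le_of_one_le (le_max_right _ _) (le_max_right _ _)
  have hsub : ∀ a ∈ Ici (0 : ℝ), ∀ b ∈ Ici (0 : ℝ), a ≤ b →
      a ^ 2 - max a 1 ≤ b ^ 2 - max b 1 := fun a ha b hb hab => by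
    have ha0 : (0 : ℝ) ≤ a := ha
    rcases le_total b 1 with h | h
    · rw [max_eq_right h, max_eq_right (hab.trans h)]
      gcongr
    · rw [max_eq_left h]
      rcases le_total a 1 with h' | h'
      · rw [max_eq_right h']; nlinarith
      · rw [max_eq_left h']; nlinarith
  refine VariationLE.integral_window hs (S := fun y =>
      Ioc ((max (max (y ^ 2 / 2) (y ^ 2 - max y 1)) 1) * max y 1) ((y ^ 2 + max y 1) * max y 1))
    (w := fun u y => (max y 1)⁻¹) (P := fun u y => u ≤ (y ^ 2 + max y 1) * max y 1) (by norm_num)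
    (fun u a ha b hb hab h => ?_) (fun _ _ => measurableSet_Iic) (fun _ _ => measurableSet_Ioc)
    (fun y _ => by fun_prop) (fun y _ u hu => (h1 y).trans_lt hu.1) (fun _ _ _ h => h.2)
    (fun a ha b hb hab u hu hPu => ⟨lt_of_le_of_lt ?_ hu.1, hPu⟩)
    (fun y _ u _ => by positivity) (fun y hy u hu => ?_) (fun a ha b hb hab u hu _ => ?_)
  · have ha0 : (0 : ℝ) ≤ a := ha
    exact h.trans (by gcongr)
  · have ha0 : (0 : ℝ) ≤ a := ha
    have := hsub a ha b hb hab
    gcongr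
  · have hu1 : 1 < u := (h1 y).trans_lt hu.1
    have hm1 := hm y
    have hy0 : (0 : ℝ) ≤ y := hy
    have hy2 : y ^ 2 ≤ (max y 1) ^ 2 := by gcongr; exact le_max_left _ _
    have h3 : u ≤ (2 * max y 1) ^ (3 : ℕ) := hu.2.trans (by nlinarith [pow_pos (by linarith : 0 < max y 1) 3, pow_pos (by linarith : 0 < max y 1) 2])
    have h4 : u ^ (1 / 3 : ℝ) ≤ 2 * max y 1 := by
      calc u ^ (1 / 3 : ℝ) ≤ ((2 * max y 1) ^ (3 : ℕ)) ^ (1 / 3 : ℝ) := by gcongr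
        _ = 2 * max y 1 := by
          rw [← Real.rpow_natCast, ← Real.rpow_mul (by linarith)]; norm_num
    have h5 : 0 < u ^ (1 / 3 : ℝ) := by positivity
    rw [Real.rpow_neg (by linarith), inv_eq_one_div, ← div_eq_mul_inv, div_le_div_iff₀ (by linarith) h5]
    linarith
  · have := hm a
    gcongr

/-- The density is singular where `u = y⁴/4`. Stopping at `(1/4 - δ²) y⁴` keeps the discriminant at
least `16 δ² u`, which gives the factor `1/(4δ)`. -/
theorem variationLE_inner (hs : 3 / 4 ≤ s.re) {δ : ℝ} (hδ : 0 < δ) (hδ1 : δ ≤ 1 / 4) :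
    VariationLE (fun y => ∫ u in {_u | 2 ≤ y} ∩ Ico ((y ^ 2 - y) * y)
        (y ^ 2 * (1 / 2 + δ) * (y ^ 2 - y ^ 2 * (1 / 2 + δ))), (u : ℂ) ^ (-s) *
        (((√((y ^ 2) ^ 2 - 4 * u))⁻¹ : ℝ) : ℂ)) (Ici 0) (24 * (1 / (4 * δ))) := by
  have hκ : ∀ y : ℝ, y ^ 2 * (1 / 2 + δ) * (y ^ 2 - y ^ 2 * (1 / 2 + δ)) =
      (1 / 4 - δ ^ 2) * y ^ 4 := fun y => by ring
  have hκ0 : 0 ≤ 1 / 4 - δ ^ 2 := by nlinarith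
  simp only [hκ]
  have h1 : ∀ y u : ℝ, 2 ≤ y → (y ^ 2 - y) * y ≤ u → 1 < u := fun y u hy hu => by nlinarith
  refine VariationLE.integral_window hs (S := fun y => {_u | 2 ≤ y} ∩ Ico ((y ^ 2 - y) * y)
      ((1 / 4 - δ ^ 2) * y ^ 4))
    (w := fun u y => (√((y ^ 2) ^ 2 - 4 * u))⁻¹)
    (P := fun u y => 2 ≤ y ∧ u < (1 / 4 - δ ^ 2) * y ^ 4) (by positivity)
    (fun u a ha b hb hab h => ⟨h.1.trans hab, h.2.trans_le ?_⟩)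
    (fun y _ => (MeasurableSet.const _).inter measurableSet_Iio)
    (fun y _ => (MeasurableSet.const _).inter measurableSet_Ico)
    (fun y _ => by fun_prop) (fun y _ u hu => h1 y u hu.1 hu.2.1) (fun _ _ _ h => ⟨h.1, h.2.2⟩)
    (fun a ha b hb hab u hu hPu => ⟨hPu.1, ?_, hPu.2⟩)
    (fun y _ u _ => by positivity) (fun y hy u hu => ?_) (fun a ha b hb hab u hu _ => ?_)
  · have ha0 : (0 : ℝ) ≤ a := ha
    gcongr
  · refine le_trans ?_ hu.2.1
    have h2 : 2 ≤ a := hPu.1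
    have : a ^ 2 - a ≤ b ^ 2 - b := by nlinarith
    have : 0 ≤ b ^ 2 - b := by nlinarith
    gcongr
  · have hu1 := h1 y u hu.1 hu.2.1
    refine inv_sqrt_le_rpow hu1.le (by positivity) ?_
    have h2 := hu.2.2
    have h3 : 0 ≤ y ^ 4 := by positivity
    have e : (y ^ 2) ^ 2 = y ^ 4 := by ring
    rw [e]
    nlinarith [sq_nonneg δ, mul_nonneg h3 (sq_nonneg δ), mul_nonneg hκ0 h3,
      mul_nonneg h3 (sq_nonneg (δ ^ 2)), mul_lt_mul_of_pos_left h2 (by positivity : 0 < 16 * δ ^ 2)]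
  · have ha0 : (0 : ℝ) ≤ a := ha
    have h2 := hu.2.2
    have h3 : 0 ≤ a ^ 4 := by positivity
    have : 0 < (a ^ 2) ^ 2 - 4 * u := by nlinarith [mul_nonneg h3 (sq_nonneg δ)]
    gcongr

theorem norm_centralKernel_le (hs0 : 0 ≤ s.re) (hs : s.re ≤ 5 / 4) {w : ℝ} (hw : w ∈ Icc (1 / 2 : ℝ) (3 / 4)) :
    ‖((w * (1 - w) : ℝ) : ℂ) ^ (-s)‖ ≤ 32 := by
  obtain ⟨h1, h2⟩ := hw
  have h3 : 1 / 16 ≤ w * (1 - w) := by nlinarith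
  rw [Complex.norm_cpow_eq_rpow_re_of_pos (by linarith), Complex.neg_re]
  calc (w * (1 - w)) ^ (-s.re) ≤ (1 / 16) ^ (-s.re) :=
        Real.rpow_le_rpow_of_nonpos (by norm_num) h3 (by linarith)
    _ ≤ (1 / 16) ^ (-(5 / 4) : ℝ) :=
        Real.rpow_le_rpow_of_exponent_ge (by norm_num) (by norm_num) (by linarith)
    _ = 32 := by
        rw [show (1 / 16 : ℝ) = 2 ^ (-4 : ℝ) by norm_num, ← Real.rpow_mul (by norm_num)]
        norm_num

theorem norm_intervalIntegral_centralKernel_le (hs0 : 0 ≤ s.re) (hs : s.re ≤ 5 / 4) {a b : ℝ}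
    (ha : a ∈ Icc (1 / 2 : ℝ) (3 / 4)) (hb : b ∈ Icc (1 / 2 : ℝ) (3 / 4)) (hab : a ≤ b) :
    ‖∫ w in a..b, ((w * (1 - w) : ℝ) : ℂ) ^ (-s)‖ ≤ 32 * (b - a) := by
  have := intervalIntegral.norm_integral_le_of_norm_le_const (a := a) (b := b) (C := 32)
    (f := fun w : ℝ => ((w * (1 - w) : ℝ) : ℂ) ^ (-s)) fun w hw => by
      rw [uIoc_of_le hab] at hw
      exact norm_centralKernel_le hs0 hs ⟨ha.1.trans hw.1.le, hw.2.trans hb.2⟩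
  rwa [abs_of_nonneg (by linarith)] at this

theorem variationLE_centralIntegral (hs0 : 0 ≤ s.re) (hs : s.re ≤ 5 / 4) {δ : ℝ} (hδ1 : δ ≤ 1 / 4) :
    VariationLE (fun c => ∫ w in (1 / 2 : ℝ)..c, ((w * (1 - w) : ℝ) : ℂ) ^ (-s))
      (Icc (1 / 2) (1 / 2 + δ)) (32 * δ) := by
  refine ⟨fun c => 32 * c, fun a ha b hb hab => ⟨?_, ?_⟩⟩
  · have hint : ∀ c, 1 / 2 ≤ c → c ≤ 1 / 2 + δ →
        IntervalIntegrable (fun w : ℝ => ((w * (1 - w) : ℝ) : ℂ) ^ (-s)) volume (1 / 2) c := by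
      intro c hc hc2
      refine ContinuousOn.intervalIntegrable fun w hw => ?_
      rw [uIcc_of_le hc] at hw
      have : 0 < w * (1 - w) := by nlinarith [hw.1, hw.2]
      refine ContinuousWithinAt.cpow (by fun_prop) continuousWithinAt_const ?_
      exact Complex.ofReal_mem_slitPlane.2 this
    rw [intervalIntegral.integral_interval_sub_left (hint b hb.1 hb.2) (hint a ha.1 ha.2), ← mul_sub]
    exact norm_intervalIntegral_centralKernel_le hs0 hs ⟨ha.1, by linarith [ha.2]⟩
      ⟨hb.1, by linarith [hb.2]⟩ hab
  · linarith [ha.1, hb.2]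

/-- The power of `y` has variation `O(‖s‖)`, but it multiplies an integral over an interval of
length at most `δ`, so the product costs only `O(δ (1 + ‖s‖))`. Writing `max y 2` makes the interval
empty for `y ≤ 2`, where this piece is absent. -/
theorem variationLE_central (hs0 : 3 / 4 ≤ s.re) (hs : s.re ≤ 5 / 4) {δ : ℝ} (hδ : 0 < δ)
    (hδ1 : δ ≤ 1 / 4) :
    VariationLE (fun y => ((max y 2 : ℝ) : ℂ) ^ (2 - 4 * s) *
      ∫ w in (1 / 2 : ℝ)..(min (1 - 1 / max y 2) (1 / 2 + δ)), ((w * (1 - w) : ℝ) : ℂ) ^ (-s))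
      (Ici 0) (1 * (32 * δ) + 32 * δ * (‖4 * s - 2‖ * 1)) := by
  have h2 : ∀ y : ℝ, (2 : ℝ) ≤ max y 2 := fun y => le_max_right _ _
  have hre : (4 * s - 2).re = 4 * s.re - 2 := by simp
  have hmap : MapsTo (fun y : ℝ => min (1 - 1 / max y 2) (1 / 2 + δ)) (Ici 0)
      (Icc (1 / 2) (1 / 2 + δ)) := fun y _ => by
    refine ⟨le_min ?_ (by linarith), min_le_right _ _⟩
    have : 1 / max y 2 ≤ 1 / 2 := one_div_le_one_div_of_le (by norm_num) (h2 y)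
    linarith
  have e : ∀ y : ℝ, ((max y 2 : ℝ) : ℂ) ^ (2 - 4 * s) = ((max y 2 : ℝ) : ℂ) ^ (-(4 * s - 2)) :=
    fun y => by rw [neg_sub]
  have hle : ∀ y : ℝ, (max y 2) ^ (-(4 * s - 2).re) ≤ 1 := fun y =>
    Real.rpow_le_one_of_one_le_of_nonpos (by linarith [h2 y]) (by rw [hre]; linarith)
  refine VariationLE.mul ?_ ?_ (fun y _ => ?_) (fun y hy => ?_) zero_le_one (by positivity)
  · simp only [e]
    refine (VariationLE.cpow (h := fun y => max y 2) (V := 1) (by rw [hre]; linarith)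
      (fun y _ => by linarith [h2 y])
      (VariationLE.of_antitoneOn (fun a _ b _ hab => ?_)
        (fun y _ => Real.rpow_nonneg (by linarith [h2 y]) _) fun y _ => hle y)).weaken ?_
    · exact Real.rpow_le_rpow_of_nonpos (by linarith [h2 a]) (by gcongr) (by rw [hre]; linarith)
    · gcongr
      exact div_le_self (norm_nonneg _) (by rw [hre]; linarith)
  · refine (variationLE_centralIntegral (by linarith) hs hδ1).comp_monotoneOn (fun a _ b _ hab => ?_) hmap
    have := h2 a
    gcongr
  · rw [e, Complex.norm_cpow_eq_rpow_re_of_pos (by linarith [h2 y]), Complex.neg_re]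
    exact hle y
  · have h3 := hmap hy
    simp only [mem_Icc] at h3
    refine (norm_intervalIntegral_centralKernel_le (by linarith) hs ⟨le_rfl, by norm_num⟩
      ⟨h3.1, by linarith⟩ h3.1).trans ?_
    linarith

/-- The half-line is cut where the formula for the height changes, and once more, artificially, at
`(1/2 + δ) y²`. The pieces are the window at the stationary point, the inner part, the plateau where
the height is constant, the part where it is linear, and the tail. -/
theorem intervalIntegral_halfHeight_split {y : ℝ} (hs : 3 / 4 < s.re) (hy : 0 ≤ y) {δ : ℝ}
    (hδ : 0 < δ) :
    ∫ x in Ioi (y ^ 2 / 2), (halfHeight y x : ℂ) ^ (-s) =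
      ((max y 2 : ℝ) : ℂ) ^ (2 - 4 * s) *
      (∫ w in (1 / 2 : ℝ)..(min (1 - 1 / max y 2) (1 / 2 + δ)), ((w * (1 - w) : ℝ) : ℂ) ^ (-s)) +
      (∫ u in {_u | 2 ≤ y} ∩ Ico ((y ^ 2 - y) * y)
        (y ^ 2 * (1 / 2 + δ) * (y ^ 2 - y ^ 2 * (1 / 2 + δ))), (u : ℂ) ^ (-s) *
        (((√((y ^ 2) ^ 2 - 4 * u))⁻¹ : ℝ) : ℂ)) +
      ((max (1 - y ^ 2 / 2) 0 : ℝ) : ℂ) * (max y 1 : ℝ) ^ (-s) +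
      (∫ u in Ioc ((max (max (y ^ 2 / 2) (y ^ 2 - max y 1)) 1) * max y 1)
        ((y ^ 2 + max y 1) * max y 1), (u : ℂ) ^ (-s) * (((max y 1)⁻¹ : ℝ) : ℂ)) +
      ∫ u in Ioi ((y ^ 2 + max y 1) * max y 1), (u : ℂ) ^ (-s) *
        (((√((y ^ 2) ^ 2 + 4 * u))⁻¹ : ℝ) : ℂ) := by
  have hm : (1 : ℝ) ≤ max y 1 := le_max_right _ _
  have hq : 0 ≤ y ^ 2 := sq_nonneg y
  rw [← integral_Ioi_halfHeight_tail hy, ← intervalIntegral_halfHeight_linear hy,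
    ← intervalIntegral_halfHeight_const hy]
  set a := max (y ^ 2 / 2) (y ^ 2 - max y 1) with ha
  set b := max a 1 with hb
  have hra : y ^ 2 / 2 ≤ a := le_max_left _ _
  have hab : a ≤ b := le_max_left _ _
  have hbd : b ≤ y ^ 2 + max y 1 := max_le (max_le (by linarith) (by linarith)) (by linarith)
  have hI := integrableOn_halfHeight hs y
  have hIi : ∀ u v, y ^ 2 / 2 ≤ u → y ^ 2 / 2 ≤ v →
      IntervalIntegrable (fun x => (halfHeight y x : ℂ) ^ (-s)) volume u v := fun u v hu hv =>
    (intervalIntegrable_iff.2 (hI.mono_set fun x hx => (le_min hu hv).trans_lt hx.1))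
  have hIo : ∀ u, y ^ 2 / 2 ≤ u → IntegrableOn (fun x => (halfHeight y x : ℂ) ^ (-s)) (Ioi u) :=
    fun u hu => hI.mono_set (Ioi_subset_Ioi hu)
  rw [← intervalIntegral.integral_interval_add_Ioi (hIo _ le_rfl) (hIo a hra),
    ← intervalIntegral.integral_interval_add_Ioi (hIo a hra) (hIo b (hra.trans hab)),
    ← intervalIntegral.integral_interval_add_Ioi (hIo b (hra.trans hab))
      (hIo _ ((hra.trans hab).trans hbd))]
  have main : ∫ x in (y ^ 2 / 2)..a, (halfHeight y x : ℂ) ^ (-s) =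
      ((max y 2 : ℝ) : ℂ) ^ (2 - 4 * s) *
      (∫ w in (1 / 2 : ℝ)..(min (1 - 1 / max y 2) (1 / 2 + δ)), ((w * (1 - w) : ℝ) : ℂ) ^ (-s)) +
      (∫ u in {_u | 2 ≤ y} ∩ Ico ((y ^ 2 - y) * y)
        (y ^ 2 * (1 / 2 + δ) * (y ^ 2 - y ^ 2 * (1 / 2 + δ))), (u : ℂ) ^ (-s) *
        (((√((y ^ 2) ^ 2 - 4 * u))⁻¹ : ℝ) : ℂ)) := by
    rcases le_total 2 y with h | h
    · have hmy : max y 1 = y := max_eq_left (by linarith)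
      have ha' : a = y ^ 2 - y := by rw [ha, hmy]; exact max_eq_right (by nlinarith)
      have hset : {u : ℝ | 2 ≤ y} = univ := eq_univ_of_forall fun _ => h
      set τ := min (1 - 1 / y) (1 / 2 + δ) with hτ
      have hy0 : 0 < y := by linarith
      have h1y : 1 / y ≤ 1 / 2 := one_div_le_one_div_of_le (by norm_num) h
      have hτ1 : 1 / 2 ≤ τ := le_min (by linarith) (by linarith)
      have e1 : y ^ 2 * (1 - 1 / y) = y ^ 2 - y := by field_simp
      have hτ2 : y ^ 2 * τ ≤ y ^ 2 - y := by
        rw [← e1]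
        gcongr
        exact min_le_left _ _
      -- If the artificial cut lies beyond `y² - y`, the inner part is empty and the central part
      -- reaches all the way.
      have e2 : Ioc (y ^ 2 * (1 / 2 + δ)) (y ^ 2 - y) = Ioc (y ^ 2 * τ) (y ^ 2 - y) := by
        rcases le_total (1 - 1 / y) (1 / 2 + δ) with h' | h'
        · have : τ = 1 - 1 / y := min_eq_left h'
          rw [this, e1, Ioc_self, Ioc_eq_empty]
          rw [not_lt, ← e1]
          gcongr
        · rw [hτ, min_eq_right h']
      rw [max_eq_left h, hset, univ_inter, ← hτ, ← intervalIntegral_halfHeight_central h hτ1 hτ2,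
        ← integral_Ioc_halfHeight_inner h (by nlinarith), e2,
        ← intervalIntegral.integral_of_le hτ2, ha',
        intervalIntegral.integral_add_adjacent_intervals (hIi _ _ le_rfl (by nlinarith))
          (hIi _ _ (by nlinarith) (by nlinarith))]
    · have ha' : a = y ^ 2 / 2 := by
        refine max_eq_left ?_
        rcases le_total y 1 with h1 | h1
        · rw [max_eq_right h1]; nlinarith
        · rw [max_eq_left h1]; nlinarith
      have e1 : min (1 - 1 / (2 : ℝ)) (1 / 2 + δ) = 1 / 2 := by
        rw [min_eq_left (by linarith)]; norm_num
      rw [ha', intervalIntegral.integral_same, max_eq_right h, e1, intervalIntegral.integral_same,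
        mul_zero, zero_add]
      rcases h.lt_or_eq with h2 | h2
      · have hset : {u : ℝ | 2 ≤ y} = ∅ := eq_empty_of_forall_notMem fun _ => not_le.2 h2
        rw [hset, empty_inter, setIntegral_empty]
      · rw [Ico_eq_empty, inter_empty, setIntegral_empty]
        rw [h2]
        nlinarith [sq_nonneg δ]
  rw [main]
  ring

/-- The contribution of the part of the fibre on which the height is constant, for `1 < y < √2`. -/
noncomputable def flatPart (s : ℂ) (y : ℝ) : ℂ :=
  (Ioi (1 : ℝ)).indicator (fun y => ((max (1 - y ^ 2 / 2) 0 : ℝ) : ℂ) * (y : ℂ) ^ (-s)) y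

/-- For `y ≤ 1` the plateau has height `1` and its contribution is independent of `s`. Only `1 < y <
√2` oscillates with `s`, and that part is treated separately. -/
theorem flat_eq (s : ℂ) {y : ℝ} (hy : 0 ≤ y) :
    ((max (1 - y ^ 2 / 2) 0 : ℝ) : ℂ) * (max y 1 : ℝ) ^ (-s) =
      (((Iic (1 : ℝ)).indicator (fun y => 1 - y ^ 2 / 2) y : ℝ) : ℂ) + flatPart s y := by
  rcases le_or_gt y 1 with h | h
  · rw [flatPart, indicator_of_mem (mem_Iic.2 h), indicator_of_notMem (notMem_Ioi.2 h),
      max_eq_right h, max_eq_left (by nlinarith)]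
    simp
  · rw [flatPart, indicator_of_notMem (notMem_Iic.2 h), indicator_of_mem (mem_Ioi.2 h),
      max_eq_left h.le]
    simp

/-- The width `δ = 1/(4 √(1 + ‖s‖))` balances the central piece `δ ‖s‖` against the inner piece
`1/δ`. The other pieces have variation bounded independently of `s`. -/
theorem exists_variationLE_fibreIntegral_sub_flatPart :
    ∃ K : ℝ, 0 < K ∧ ∀ s : ℂ, 3 / 4 < s.re → s.re ≤ 5 / 4 →
      VariationLE (fun y => fibreIntegral s y - 2 * flatPart s |y|) univ (K * √(1 + ‖s‖)) := by
  refine ⟨4 * 400, by norm_num, fun s hs hs1 => ?_⟩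
  set R := √(1 + ‖s‖) with hR
  have hR1 : 1 ≤ R := Real.one_le_sqrt.2 (by linarith [norm_nonneg s])
  have hR2 : R ^ 2 = 1 + ‖s‖ := Real.sq_sqrt (by positivity)
  set δ := 1 / (4 * R) with hδ
  have hδ0 : 0 < δ := by positivity
  have hδ1 : δ ≤ 1 / 4 := by
    rw [hδ]
    exact one_div_le_one_div_of_le (by norm_num) (by linarith)
  have hδR : δ * R = 1 / 4 := by rw [hδ]; field_simp
  have hv0 : VariationLE (fun y => (((Iic (1 : ℝ)).indicator (fun y => 1 - y ^ 2 / 2) y : ℝ) : ℂ))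
      (Ici 0) 1 := by
    have h0 : ∀ x : ℝ, 0 ≤ x → 0 ≤ (Iic (1 : ℝ)).indicator (fun y => 1 - y ^ 2 / 2) x :=
      fun x hx => by
        by_cases h : x ≤ 1
        · rw [indicator_of_mem (mem_Iic.2 h)]
          nlinarith
        · rw [indicator_of_notMem (by simpa using h)]
    refine VariationLE.of_antitoneOn (fun a ha b hb hab => ?_) (fun x hx => h0 x hx) fun x hx => ?_
    · by_cases h : b ≤ 1
      · rw [indicator_of_mem (mem_Iic.2 h), indicator_of_mem (mem_Iic.2 (hab.trans h))]
        have ha0 : (0 : ℝ) ≤ a := ha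
        gcongr
      · rw [indicator_of_notMem (by simpa using h)]
        exact h0 a ha
    · refine indicator_le' (fun x _ => ?_) (fun _ _ => zero_le_one) x
      nlinarith [sq_nonneg x]
  have hv := (((((variationLE_central hs.le hs1 hδ0 hδ1).add
    (variationLE_inner hs.le hδ0 hδ1)).add hv0).add (variationLE_linear hs.le)).add
    (variationLE_tail hs.le)).const_mul 2
  refine (VariationLE.of_even (hv.congr (g := fun y => fibreIntegral s y - 2 * flatPart s |y|)
    fun y hy => ?_) fun y => by rw [fibreIntegral_neg, abs_neg]).weaken ?_
  · have hy0 : (0 : ℝ) ≤ y := hy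
    dsimp only
    rw [fibreIntegral_eq hs, intervalIntegral_halfHeight_split hs hy0 hδ0, flat_eq s hy0,
      abs_of_nonneg hy0]
    ring
  · have h4 : ‖4 * s - 2‖ ≤ 4 * ‖s‖ + 2 := by
      refine (norm_sub_le _ _).trans ?_
      simp
    have h5 : δ * ‖4 * s - 2‖ ≤ R := by
      calc δ * ‖4 * s - 2‖ ≤ δ * (4 * R ^ 2) := by
            gcongr
            rw [hR2]
            linarith
        _ = 4 * (δ * R) * R := by ring
        _ = R := by rw [hδR]; ring
    have h6 : 1 / (4 * δ) = R := by rw [hδ]; field_simp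
    rw [h6, Complex.norm_ofNat]
    nlinarith

end RegularPart

/-! ### The plateau and the square-root bound for the discrepancy -/

section FlatPart

/-- Abel summation and integration by parts, subtracted: since `f` vanishes at the right end there
are no boundary terms, and what remains is the integral of `f'` against the difference of the
partial sums and `G`. -/
theorem norm_sum_mul_sub_integral_mul_le {a : ℕ} {b B D : ℝ} (hab : (a : ℝ) ≤ b) {f f' g G : ℝ → ℂ}
    {c : ℕ → ℂ} (hf : ∀ x ∈ Icc (a : ℝ) b, HasDerivAt f (f' x) x)
    (hf' : ContinuousOn f' (Icc (a : ℝ) b)) (hD : ∀ x ∈ Icc (a : ℝ) b, ‖f' x‖ ≤ D) (hfb : f b = 0)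
    (hG : ∀ x ∈ Icc (a : ℝ) b, HasDerivAt G (g x) x) (hg : ContinuousOn g (Icc (a : ℝ) b))
    (hB : ∀ x ∈ Icc (a : ℝ) b, ‖∑ k ∈ Finset.Ioc a ⌊x⌋₊, c k - (G x - G a)‖ ≤ B) :
    ‖∑ k ∈ Finset.Ioc a ⌊b⌋₊, f k * c k - ∫ x in (a : ℝ)..b, f x * g x‖ ≤ D * B * (b - a) := by
  classical
  set c' : ℕ → ℂ := fun k => if a < k then c k else 0 with hc'
  have hA : ∀ n : ℕ, ∑ k ∈ Finset.Icc 0 n, c' k = ∑ k ∈ Finset.Ioc a n, c k := fun n => by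
    rw [hc', ← Finset.sum_filter]
    refine Finset.sum_congr (Finset.ext fun k => ?_) fun _ _ => rfl
    simp [and_comm]
  have hderiv : EqOn (deriv f) f' (Icc (a : ℝ) b) := fun x hx => (hf x hx).deriv
  have hint : IntegrableOn (deriv f) (Icc (a : ℝ) b) :=
    (hf'.integrableOn_compact isCompact_Icc).congr_fun (fun x hx => (hderiv hx).symm)
      measurableSet_Icc
  have h1 := sum_mul_eq_sub_sub_integral_mul c' (Nat.cast_nonneg a) hab
    (fun x hx => (hf x hx).differentiableAt) hint
  have hGc : ContinuousOn G (Icc (a : ℝ) b) := fun x hx => (hG x hx).continuousAt.continuousWithinAt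
  have hu : uIcc (a : ℝ) b = Icc (a : ℝ) b := uIcc_of_le hab
  have h2 := intervalIntegral.integral_mul_deriv_eq_deriv_mul (u := f) (v := fun x => G x - G a)
    (u' := f') (v' := g) (a := a) (b := b) (fun x hx => hf x (hu ▸ hx))
    (fun x hx => (hG x (hu ▸ hx)).sub_const _)
    (hf'.intervalIntegrable_of_Icc hab) (hg.intervalIntegrable_of_Icc hab)
  have h3 : ∑ k ∈ Finset.Ioc a ⌊b⌋₊, f k * c k = ∑ k ∈ Finset.Ioc ⌊(a : ℝ)⌋₊ ⌊b⌋₊, f k * c' k := by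
    rw [Nat.floor_natCast]
    refine Finset.sum_congr rfl fun k hk => ?_
    rw [hc']
    simp only [(Finset.mem_Ioc.1 hk).1, if_true]
  rw [h3, h1, h2, hfb]
  simp only [hA, Nat.floor_natCast, Finset.Ioc_self, Finset.sum_empty, sub_self]
  have hAi := integrableOn_mul_sum_Icc c' (Nat.cast_nonneg a) hint (m := 0)
  simp only [hA] at hAi
  have hAi' : IntervalIntegrable (fun x => f' x * ∑ k ∈ Finset.Ioc a ⌊x⌋₊, c k) volume a b := by
    rw [intervalIntegrable_iff_integrableOn_Ioc_of_le hab]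
    refine (hAi.mono_set Ioc_subset_Icc_self).congr_fun (fun x hx => ?_) measurableSet_Ioc
    dsimp only
    rw [hderiv (Ioc_subset_Icc_self hx)]
  have hGi' : IntervalIntegrable (fun x => f' x * (G x - G a)) volume a b :=
    (hf'.mul (hGc.sub continuousOn_const)).intervalIntegrable_of_Icc hab
  have h4 : ∫ x in Ioc (a : ℝ) b, deriv f x * ∑ k ∈ Finset.Ioc a ⌊x⌋₊, c k =
      ∫ x in (a : ℝ)..b, f' x * ∑ k ∈ Finset.Ioc a ⌊x⌋₊, c k := by
    rw [intervalIntegral.integral_of_le hab]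
    refine setIntegral_congr_fun measurableSet_Ioc fun x hx => ?_
    rw [hderiv (Ioc_subset_Icc_self hx)]
  rw [h4]
  have h5 : ∫ x in (a : ℝ)..b, f' x * (∑ k ∈ Finset.Ioc a ⌊x⌋₊, c k - (G x - G a)) =
      (∫ x in (a : ℝ)..b, f' x * ∑ k ∈ Finset.Ioc a ⌊x⌋₊, c k) -
        ∫ x in (a : ℝ)..b, f' x * (G x - G a) := by
    rw [← intervalIntegral.integral_sub hAi' hGi']
    congr 1
    ext x
    ring
  have h6 : ‖∫ x in (a : ℝ)..b, f' x * (∑ k ∈ Finset.Ioc a ⌊x⌋₊, c k - (G x - G a))‖ ≤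
      D * B * |b - a| := by
    refine intervalIntegral.norm_integral_le_of_norm_le_const fun x hx => ?_
    rw [uIoc_of_le hab] at hx
    have hx' := Ioc_subset_Icc_self hx
    rw [norm_mul]
    exact mul_le_mul (hD x hx') (hB x hx') (norm_nonneg _) ((norm_nonneg _).trans (hD x hx'))
  rw [abs_of_nonneg (by linarith)] at h6
  refine le_trans (le_of_eq ?_) h6
  rw [h5, ← norm_neg]
  congr 1
  ring

/-- The real weight in the flat part, on the scale `e`. -/
noncomputable def flatWeight (σ : ℝ) (e x : ℝ) : ℝ := (1 - (x / e) ^ 2 / 2) * (x / e) ^ (-σ)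

theorem hasDerivAt_flatWeight (σ : ℝ) {e x : ℝ} (he : 0 < e) (hx : 0 < x) :
    HasDerivAt (flatWeight σ e)
      (-(x / e) * (1 / e) * (x / e) ^ (-σ) +
        (1 - (x / e) ^ 2 / 2) * ((1 / e) * (-σ) * (x / e) ^ (-σ - 1))) x := by
  have h1 : HasDerivAt (fun x => x / e) (1 / e) x := (hasDerivAt_id x).div_const e
  have h2 := (((h1.pow 2).div_const 2).const_sub 1).mul
    (h1.rpow_const (p := -σ) (Or.inl (by positivity)))
  convert! h2 using 1
  simp only [Pi.pow_apply, Nat.cast_ofNat]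
  ring

theorem abs_deriv_flatWeight_le {σ e x : ℝ} (hσ0 : 0 ≤ σ) (hσ : σ ≤ 5 / 4) (he : 0 < e) (hx : e ≤ x)
    (hx2 : (x / e) ^ 2 ≤ 2) :
    |-(x / e) * (1 / e) * (x / e) ^ (-σ) +
        (1 - (x / e) ^ 2 / 2) * ((1 / e) * (-σ) * (x / e) ^ (-σ - 1))| ≤ 4 / e := by
  have h1 : 1 ≤ x / e := (one_le_div he).2 hx
  set w := x / e
  have h2 : w ≤ 2 := by nlinarith
  have h3 : w ^ (-σ) ≤ 1 := Real.rpow_le_one_of_one_le_of_nonpos h1 (by linarith)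
  have h4 : w ^ (-σ - 1) ≤ 1 := Real.rpow_le_one_of_one_le_of_nonpos h1 (by linarith)
  have h5 : 0 ≤ w ^ (-σ) := by positivity
  have h6 : 0 ≤ w ^ (-σ - 1) := by positivity
  have e1 : -w * (1 / e) * w ^ (-σ) + (1 - w ^ 2 / 2) * ((1 / e) * (-σ) * w ^ (-σ - 1)) =
      -((w * w ^ (-σ) + (1 - w ^ 2 / 2) * σ * w ^ (-σ - 1)) * (1 / e)) := by ring
  have h7 : w * w ^ (-σ) ≤ 2 * 1 := by gcongr
  have h8 : (1 - w ^ 2 / 2) * σ * w ^ (-σ - 1) ≤ 1 * (5 / 4) * 1 := by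
    gcongr
    nlinarith
  have h9 : 0 ≤ (1 - w ^ 2 / 2) * σ * w ^ (-σ - 1) := by
    have : 0 ≤ 1 - w ^ 2 / 2 := by linarith
    positivity
  have h10 : 0 ≤ w * w ^ (-σ) := by positivity
  rw [e1, abs_neg, abs_of_nonneg (by positivity), div_eq_mul_one_div 4 e]
  gcongr
  linarith

/-- Separates a smooth real weight from the oscillation `x^(-it)`; the factor `e^(it)` is constant
of modulus one. -/
theorem flatPart_div_eq (s : ℂ) {e x : ℝ} (he : 0 < e) (hx : e < x) (hx2 : (x / e) ^ 2 ≤ 2) :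
    flatPart s (x / e) = (flatWeight s.re e x : ℂ) * (x : ℂ) ^ (-(s.im * Complex.I)) *
      (e : ℂ) ^ (s.im * Complex.I) := by
  have hx0 : 0 < x := he.trans hx
  have hec : (e : ℂ) ≠ 0 := by exact_mod_cast he.ne'
  have hxc : ((x / e : ℝ) : ℂ) ≠ 0 := by
    have : 0 < x / e := by positivity
    exact_mod_cast this.ne'
  rw [flatPart, indicator_of_mem (mem_Ioi.2 ((one_lt_div he).2 hx)), flatWeight,
    max_eq_left (by linarith)]
  have h1 : ((x / e : ℝ) : ℂ) ^ (-s) = (((x / e) ^ (-s.re) : ℝ) : ℂ) *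
      ((x / e : ℝ) : ℂ) ^ (-(s.im * Complex.I)) := by
    rw [Complex.ofReal_cpow (by positivity), ← Complex.cpow_add _ _ hxc]
    congr 1
    conv_lhs => rw [← Complex.re_add_im s]
    push_cast
    ring
  have h2 : ((x / e : ℝ) : ℂ) ^ (-(s.im * Complex.I)) * (e : ℂ) ^ (-(s.im * Complex.I)) =
      (x : ℂ) ^ (-(s.im * Complex.I)) := by
    rw [← Complex.mul_cpow_ofReal_nonneg (by positivity) he.le, ← Complex.ofReal_mul,
      div_mul_cancel₀ _ he.ne']
  have h3 : (e : ℂ) ^ (-(s.im * Complex.I)) * (e : ℂ) ^ (s.im * Complex.I) = 1 := by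
    rw [← Complex.cpow_add _ _ hec]
    simp
  rw [h1, ← h2]
  push_cast
  linear_combination (-(1 - ((x : ℂ) / e) ^ 2 / 2) * (((x / e) ^ (-s.re) : ℝ) : ℂ) *
    (((x : ℂ) / e) ^ (-(s.im * Complex.I)))) * h3

theorem flatPart_of_le (s : ℂ) {y : ℝ} (hy : y ≤ 1) : flatPart s y = 0 :=
  indicator_of_notMem (notMem_Ioi.2 hy) _

theorem flatPart_of_sq_ge (s : ℂ) {y : ℝ} (hy : 2 ≤ y ^ 2) : flatPart s y = 0 := by
  unfold flatPart
  rw [indicator_apply]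
  split_ifs
  · rw [max_eq_right (by linarith)]; simp
  · rfl

/-- The weight has derivative `O(1/e)` on an interval of length `O(e)` and vanishes at `√2 e`, so
partial summation preserves the bound `O(√|t|)` uniformly in `e`. -/
theorem norm_sum_flatPart_sub_integral_le {s : ℂ} (hs0 : 0 ≤ s.re) (hs : s.re ≤ 5 / 4)
    (ht : 1 ≤ |s.im|) {e : ℕ} (he : 0 < e) :
    ‖∑ k ∈ Finset.Ioc e ⌊√2 * e⌋₊, flatPart s ((k : ℝ) / e) -
      ∫ x in (e : ℝ)..(√2 * e), flatPart s (x / e)‖ ≤ 800 * √|s.im| := by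
  have he0 : (0 : ℝ) < e := by exact_mod_cast he
  have h2a : 1 ≤ √2 := Real.one_le_sqrt.2 (by norm_num)
  have h2b : √2 ≤ 2 := Real.sqrt_le_left (by norm_num) |>.2 (by norm_num)
  have h2c : √2 ^ 2 = 2 := Real.sq_sqrt (by norm_num)
  have hab : (e : ℝ) ≤ √2 * e := by nlinarith
  have hsq : ∀ x ∈ Icc (e : ℝ) (√2 * e), (x / e) ^ 2 ≤ 2 := fun x hx => by
    rw [← h2c]
    have : x / e ≤ √2 := (div_le_iff₀ he0).2 hx.2
    have : 0 ≤ x / e := div_nonneg (he0.le.trans hx.1) he0.le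
    gcongr
  have hpos : ∀ x ∈ Icc (e : ℝ) (√2 * e), 0 < x := fun x hx => he0.trans_le hx.1
  set t := s.im
  have htI : (1 - t * Complex.I : ℂ) ≠ 0 := by
    intro h
    have := congrArg Complex.re h
    simp at this
  have hGd : ∀ x ∈ Icc (e : ℝ) (√2 * e), HasDerivAt
      (fun x : ℝ => (x : ℂ) ^ (1 - t * Complex.I) / (1 - t * Complex.I))
      ((x : ℂ) ^ (-(t * Complex.I))) x := fun x hx => by
    have := (hasDerivAt_ofReal_cpow (hpos x hx) (1 - t * Complex.I)).div_const (1 - t * Complex.I)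
    rw [mul_div_cancel_left₀ _ htI] at this
    convert! this using 2
    ring
  have hgc : ContinuousOn (fun x : ℝ => (x : ℂ) ^ (-(t * Complex.I))) (Icc (e : ℝ) (√2 * e)) :=
    fun x hx => (hasDerivAt_ofReal_cpow (hpos x hx) _).continuousAt.continuousWithinAt
  set f' : ℝ → ℝ := fun x => -(x / e) * (1 / e) * (x / e) ^ (-s.re) +
        (1 - (x / e) ^ 2 / 2) * ((1 / e) * (-s.re) * (x / e) ^ (-s.re - 1)) with hf'
  have hf'c : ContinuousOn f' (Icc (e : ℝ) (√2 * e)) := by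
    have h : ∀ p : ℝ, ContinuousOn (fun x : ℝ => (x / e) ^ p) (Icc (e : ℝ) (√2 * e)) := fun p x hx => by
      have : x / e ≠ 0 := (div_pos (hpos x hx) he0).ne'
      exact ((continuousAt_id.div_const (e : ℝ)).rpow_const (Or.inl this)).continuousWithinAt
    have h1 := h (-s.re)
    have h2 := h (-s.re - 1)
    rw [hf']
    fun_prop
  have key := norm_sum_mul_sub_integral_mul_le (a := e) (b := √2 * e) (B := 200 * √|t|) (D := 4 / e)
    (f := fun x => (flatWeight s.re e x : ℂ)) (f' := fun x => (f' x : ℂ))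
    (c := fun k => (k : ℂ) ^ (-(t * Complex.I))) hab
    (fun x hx => (hasDerivAt_flatWeight s.re he0 (hpos x hx)).ofReal_comp)
    (Complex.continuous_ofReal.comp_continuousOn hf'c)
    (fun x hx => by
      rw [Complex.norm_real]
      exact abs_deriv_flatWeight_le hs0 hs he0 hx.1 (hsq x hx))
    (by
      have : √2 * (e : ℝ) / e = √2 := by field_simp
      rw [flatWeight, this, h2c]
      norm_num) hGd hgc
    (fun x hx => by
      have h1 := norm_partialSum_sub_integral_le ht he hx.1 (hx.2.trans (by gcongr))
      have hu : uIcc (e : ℝ) x = Icc (e : ℝ) x := uIcc_of_le hx.1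
      rwa [intervalIntegral.integral_eq_sub_of_hasDerivAt
        (fun u hu' => hGd u ⟨(hu ▸ hu').1, (hu ▸ hu').2.trans hx.2⟩)
        ((hgc.mono (Icc_subset_Icc_right hx.2)).intervalIntegrable_of_Icc hx.1)] at h1)
  have e1 : ∑ k ∈ Finset.Ioc e ⌊√2 * e⌋₊, flatPart s ((k : ℝ) / e) =
      (e : ℂ) ^ (t * Complex.I) * ∑ k ∈ Finset.Ioc e ⌊√2 * e⌋₊,
        (flatWeight s.re e k : ℂ) * (k : ℂ) ^ (-(t * Complex.I)) := by
    rw [Finset.mul_sum]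
    refine Finset.sum_congr rfl fun k hk => ?_
    have hk := Finset.mem_Ioc.1 hk
    have h1 : (e : ℝ) < k := by exact_mod_cast hk.1
    have h2 : (k : ℝ) ≤ √2 * e := (Nat.le_floor_iff (by positivity)).1 hk.2
    rw [flatPart_div_eq s he0 h1 (hsq k ⟨h1.le, h2⟩), mul_comm]
    simp only [Complex.ofReal_natCast]
    rfl
  have e2 : ∫ x in (e : ℝ)..(√2 * e), flatPart s (x / e) = (e : ℂ) ^ (t * Complex.I) *
      ∫ x in (e : ℝ)..(√2 * e), (flatWeight s.re e x : ℂ) * (x : ℂ) ^ (-(t * Complex.I)) := by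
    rw [← intervalIntegral.integral_const_mul, intervalIntegral.integral_of_le hab,
      intervalIntegral.integral_of_le hab]
    refine setIntegral_congr_fun measurableSet_Ioc fun x hx => ?_
    rw [flatPart_div_eq s he0 hx.1 (hsq x (Ioc_subset_Icc_self hx)), mul_comm]
    simp only [Complex.ofReal_natCast]
    rfl
  rw [e1, e2, ← mul_sub, norm_mul]
  have e3 : ‖(e : ℂ) ^ (t * Complex.I)‖ = 1 := by
    rw [Complex.norm_natCast_cpow_of_pos he]
    simp
  rw [e3, one_mul]
  refine key.trans ?_
  have h7 : 0 ≤ √|t| := Real.sqrt_nonneg _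
  calc 4 / (e : ℝ) * (200 * √|t|) * (√2 * e - e) = 800 * √|t| * (√2 - 1) := by field_simp; ring
    _ ≤ 800 * √|t| * 1 := by gcongr; linarith
    _ = _ := by ring

theorem measurable_flatPart (s : ℂ) : Measurable (flatPart s) := by
  refine Measurable.indicator (Measurable.mul ?_ (Complex.measurable_ofReal.pow_const _))
    measurableSet_Ioi
  exact Complex.measurable_ofReal.comp (by fun_prop)

theorem norm_flatPart_le {s : ℂ} (hs : 0 ≤ s.re) (y : ℝ) : ‖flatPart s y‖ ≤ 1 := by
  unfold flatPart
  rw [indicator_apply]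
  split_ifs with h
  · have h1 : 1 < y := h
    rw [norm_mul, Complex.norm_real, Complex.norm_cpow_eq_rpow_re_of_pos (by linarith),
      Real.norm_of_nonneg (le_max_right _ _), Complex.neg_re]
    refine mul_le_one₀ (max_le (by nlinarith [sq_nonneg y]) zero_le_one) (by positivity) ?_
    exact Real.rpow_le_one_of_one_le_of_nonpos h1.le (by linarith)
  · simp

theorem integrable_flatPart_abs {s : ℂ} (hs : 0 ≤ s.re) : Integrable fun y => flatPart s |y| := by
  have h1 : Integrable ((Icc (-2 : ℝ) 2).indicator fun _ => (1 : ℝ)) :=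
    (integrableOn_const (by simp)).integrable_indicator measurableSet_Icc
  refine h1.mono' ((measurable_flatPart s).comp measurable_norm).aestronglyMeasurable
    (ae_of_all _ fun y => ?_)
  by_cases h : y ∈ Icc (-2 : ℝ) 2
  · rw [indicator_of_mem h]
    exact norm_flatPart_le hs _
  · rw [indicator_of_notMem h, flatPart_of_sq_ge, norm_zero]
    have : 2 ≤ |y| := by
      by_contra! h'
      exact h (abs_le.1 h'.le)
    nlinarith

/-- The crude bound of order `‖s‖`. It serves only when `|Im s| < 1`, where the estimate for `∑
k^(-it)` does not apply. -/
theorem variationLE_flatPart_abs {s : ℂ} (hs : 0 < s.re) :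
    VariationLE (fun y => flatPart s |y|) univ (2 * (1 + ‖s‖ / s.re)) := by
  set q : ℝ → ℝ := (Ioi (1 : ℝ)).indicator fun y => max (1 - y ^ 2 / 2) 0 with hq
  have hq0 : ∀ y, 0 ≤ q y := fun y => indicator_nonneg (fun _ _ => le_max_right _ _) y
  have hq1 : ∀ y, q y ≤ 1 / 2 := fun y => by
    by_cases h : 1 < y
    · rw [hq, indicator_of_mem (mem_Ioi.2 h)]
      exact max_le (by nlinarith) (by norm_num)
    · rw [hq, indicator_of_notMem (by simpa using h)]
      norm_num
  have hqv : VariationLE (fun y => (q y : ℂ)) (Ici 0) 1 := by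
    refine ⟨fun y => if y ≤ 1 then 0 else 1 - q y, fun a _ b _ hab => ?_⟩
    rw [← Complex.ofReal_sub, Complex.norm_real, Real.norm_eq_abs]
    by_cases hb : b ≤ 1
    · have ha := hab.trans hb
      simp [hq, ha, hb]
    · by_cases ha : a ≤ 1
      · have : q a = 0 := indicator_of_notMem (notMem_Ioi.2 ha) _
        simp only [if_neg hb, if_pos ha]
        rw [this, sub_zero, abs_of_nonneg (hq0 b)]
        constructor <;> linarith [hq1 b, hq0 b]
      · have hle : q b ≤ q a := by
          rw [hq, indicator_of_mem (mem_Ioi.2 (not_le.1 hb)),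
            indicator_of_mem (mem_Ioi.2 (not_le.1 ha))]
          have : 0 ≤ a := by linarith
          gcongr
        simp only [if_neg hb, if_neg ha]
        rw [abs_of_nonpos (by linarith)]
        constructor <;> linarith [hq1 a, hq0 b]
  have hpv : VariationLE (fun y => ((max y 1 : ℝ) : ℂ) ^ (-s)) (Ici 0) (‖s‖ / s.re * 1) := by
    have h1 : ∀ y : ℝ, (1 : ℝ) ≤ max y 1 := fun y => le_max_right _ _
    refine VariationLE.cpow (h := fun y => max y 1) hs (fun y _ => by linarith [h1 y])
      (VariationLE.of_antitoneOn (fun a _ b _ hab => ?_)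
        (fun y _ => Real.rpow_nonneg (by linarith [h1 y]) _)
        fun y _ => Real.rpow_le_one_of_one_le_of_nonpos (h1 y) (by linarith))
    exact Real.rpow_le_rpow_of_nonpos (by linarith [h1 a]) (by gcongr) (by linarith)
  have h := hqv.mul (A := 1) (B := 1) hpv (fun y _ => by
      rw [Complex.norm_real, Real.norm_of_nonneg (hq0 y)]
      linarith [hq1 y])
    (fun y _ => by
      have h1 : (1 : ℝ) ≤ max y 1 := le_max_right _ _
      rw [Complex.norm_cpow_eq_rpow_re_of_pos (by linarith)]
      exact Real.rpow_le_one_of_one_le_of_nonpos h1 (by simp; linarith)) zero_le_one zero_le_one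
  refine (VariationLE.of_even (h.congr fun y hy => ?_) fun y => by rw [abs_neg]).weaken
    (le_of_eq (by ring))
  have hy0 : (0 : ℝ) ≤ y := hy
  dsimp only
  rw [abs_of_nonneg hy0, flatPart, hq]
  by_cases h1 : 1 < y
  · rw [indicator_of_mem (mem_Ioi.2 h1), indicator_of_mem (mem_Ioi.2 h1), max_eq_left h1.le]
  · rw [indicator_of_notMem (by simpa using h1), indicator_of_notMem (by simpa using h1)]
    simp

theorem tsum_flatPart_abs (s : ℂ) {e : ℕ} (he : 0 < e) :
    Summable (fun k : ℤ => flatPart s |(k : ℝ) / e|) ∧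
    ∑' k : ℤ, flatPart s |(k : ℝ) / e| =
      2 * ∑ k ∈ Finset.Ioc e ⌊√2 * e⌋₊, flatPart s ((k : ℝ) / e) := by
  have he0 : (0 : ℝ) < e := by exact_mod_cast he
  have hz : ∀ k : ℕ, k ∉ Finset.Ioc e ⌊√2 * e⌋₊ → flatPart s ((k : ℝ) / e) = 0 := fun k hk => by
    rw [Finset.mem_Ioc, not_and_or, not_lt, not_le] at hk
    rcases hk with hk | hk
    · exact flatPart_of_le s ((div_le_one he0).2 (by exact_mod_cast hk))
    · refine flatPart_of_sq_ge s ?_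
      have h1 : √2 * e < k := (Nat.floor_lt (by positivity)).1 hk
      have h2 : √2 < k / e := (lt_div_iff₀ he0).2 h1
      have := Real.sq_sqrt (show (0 : ℝ) ≤ 2 by norm_num)
      nlinarith [Real.sqrt_nonneg 2]
  have habs : ∀ k : ℤ, |(k : ℝ) / e| = (k.natAbs : ℝ) / e := fun k => by
    rw [abs_div, abs_of_pos he0, Nat.cast_natAbs, Int.cast_abs]
  simp only [habs]
  have hsum : Summable fun k : ℤ => flatPart s ((k.natAbs : ℝ) / e) := by
    refine summable_of_ne_finset_zero (s := Finset.Icc (-(⌊√2 * e⌋₊ : ℤ)) ⌊√2 * e⌋₊) fun k hk => hz _ fun h => hk ?_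
    rw [Finset.mem_Ioc] at h
    rw [Finset.mem_Icc]
    omega
  refine ⟨hsum, ?_⟩
  rw [tsum_int_eq_zero_add_two_mul_tsum_pnat (fun k => by simp) hsum]
  have h0 : flatPart s (((0 : ℤ).natAbs : ℝ) / e) = 0 := flatPart_of_le s (by simp)
  have hsn : Summable fun n : ℕ => flatPart s ((n : ℝ) / e) :=
    summable_of_ne_finset_zero (s := Finset.Ioc e ⌊√2 * e⌋₊) hz
  have h1 := tsum_zero_pnat_eq_tsum_nat hsn
  rw [CharP.cast_eq_zero, zero_div, flatPart_of_le s zero_le_one, zero_add,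
    tsum_eq_sum (s := Finset.Ioc e ⌊√2 * e⌋₊) hz] at h1
  rw [h0, zero_add, nsmul_eq_mul, ← h1]
  simp

theorem integral_flatPart_abs {s : ℂ} (hs : 0 ≤ s.re) {e : ℕ} (he : 0 < e) :
    e * ∫ y, flatPart s |y| = 2 * ∫ x in (e : ℝ)..(√2 * e), flatPart s (x / e) := by
  have he0 : (0 : ℝ) < e := by exact_mod_cast he
  have h2a : 1 ≤ √2 := Real.one_le_sqrt.2 (by norm_num)
  have h2c : √2 ^ 2 = 2 := Real.sq_sqrt (by norm_num)
  rw [integral_comp_abs_complex (integrable_flatPart_abs hs), intervalIntegral.integral_comp_div _ he0.ne',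
    div_self he0.ne', mul_div_cancel_right₀ _ he0.ne', intervalIntegral.integral_of_le h2a,
    Complex.real_smul, Complex.ofReal_natCast]
  have : ∫ x in Ioi (0 : ℝ), flatPart s x = ∫ x in Ioc 1 √2, flatPart s x := by
    refine setIntegral_eq_of_subset_of_forall_sdiff_eq_zero measurableSet_Ioi
      (fun x hx => lt_trans one_pos hx.1) fun x hx => ?_
    by_cases h1 : x ≤ 1
    · exact flatPart_of_le s h1
    · refine flatPart_of_sq_ge s ?_
      have h3 : √2 < x := by
        by_contra! h
        exact hx.2 ⟨not_le.1 h1, h⟩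
      nlinarith
  rw [this]
  ring

/-- The analytic core. The regular part is handled by its variation and the plateau by the estimate
for `∑ k^(-it)`; both give `O(√(1 + ‖s‖))` uniformly in `e`. -/
theorem exists_norm_latticeError_le_sqrt :
    ∃ K : ℝ, 0 < K ∧ ∀ e : ℕ, 0 < e → ∀ s : ℂ, 3 / 4 < s.re → s.re ≤ 5 / 4 →
      ‖latticeError e s‖ ≤ K * √(1 + ‖s‖) := by
  obtain ⟨K, hK, hvar⟩ := exists_variationLE_fibreIntegral_sub_flatPart
  refine ⟨K + 3200, by positivity, fun e he s hs hs1 => ?_⟩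
  have he0 : (0 : ℝ) < e := by exact_mod_cast he
  have hR1 : 1 ≤ √(1 + ‖s‖) := Real.one_le_sqrt.2 (by linarith [norm_nonneg s])
  have hfi := integrable_fibreIntegral hs
  have hpi := integrable_flatPart_abs (s := s) (by linarith)
  obtain ⟨h1, h2⟩ := (hvar s hs hs1).summable_and_norm_tsum_sub_integral_le
    (hfi.sub (hpi.const_mul 2)) 0 (inv_pos.2 he0)
  obtain ⟨h3, h4⟩ := tsum_flatPart_abs s he
  have e1 : ∀ k : ℤ, 0 + (e : ℝ)⁻¹ * k = (k : ℝ) / e := fun k => by ring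
  simp only [e1] at h1 h2
  have hfs := summable_fibreIntegral he hs
  rw [hfs.tsum_sub (h3.mul_left 2), tsum_mul_left, integral_sub hfi (hpi.const_mul 2),
    integral_const_mul, one_div, inv_inv, Complex.ofReal_natCast] at h2
  have h5 : latticeError e s = (∑' k : ℤ, fibreIntegral s ((k : ℝ) / e) -
      2 * ∑' k : ℤ, flatPart s |(k : ℝ) / e| -
      e * ((∫ y, fibreIntegral s y) - 2 * ∫ y, flatPart s |y|)) +
      2 * (∑' k : ℤ, flatPart s |(k : ℝ) / e| - e * ∫ y, flatPart s |y|) := by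
    rw [latticeError, archDensity]
    ring
  have h6 : ‖∑' k : ℤ, flatPart s |(k : ℝ) / e| - e * ∫ y, flatPart s |y|‖ ≤
      1600 * √(1 + ‖s‖) := by
    rcases le_or_gt 1 |s.im| with ht | ht
    · rw [h4, integral_flatPart_abs (by linarith) he, ← mul_sub, norm_mul, Complex.norm_ofNat]
      have h7 := norm_sum_flatPart_sub_integral_le (s := s) (by linarith) hs1 ht he
      have h8 : √|s.im| ≤ √(1 + ‖s‖) :=
        Real.sqrt_le_sqrt (by linarith [Complex.abs_im_le_norm s])
      nlinarith
    · have h7 := ((variationLE_flatPart_abs (s := s)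
        (by linarith)).summable_and_norm_tsum_sub_integral_le hpi 0 (inv_pos.2 he0)).2
      simp only [e1] at h7
      rw [one_div, inv_inv, Complex.ofReal_natCast] at h7
      refine h7.trans ?_
      have h8 : ‖s‖ ≤ 9 / 4 := by
        refine (Complex.norm_le_abs_re_add_abs_im s).trans ?_
        rw [abs_of_nonneg (by linarith)]
        linarith
      have h9 : ‖s‖ / s.re ≤ 3 := (div_le_iff₀ (by linarith)).2 (by linarith)
      linarith
  rw [h5]
  refine (norm_add_le _ _).trans ?_
  rw [norm_mul, Complex.norm_ofNat]
  linarith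

end FlatPart

/-! ### The arithmetic of a single fibre -/

section FibreSum

/-- The Jordan-type function `J_s = μ * (·)ˢ`. -/
noncomputable def jordanCoeff (s : ℂ) (g : ℕ) : ℂ :=
  ∑ x ∈ g.divisorsAntidiagonal, (ArithmeticFunction.moebius x.1 : ℂ) * (x.2 : ℂ) ^ s

theorem sum_divisors_jordanCoeff (s : ℂ) {m : ℕ} (hm : 0 < m) :
    ∑ g ∈ m.divisors, jordanCoeff s g = (m : ℂ) ^ s :=
  (ArithmeticFunction.sum_eq_iff_sum_mul_moebius_eq (f := jordanCoeff s)
    (g := fun m : ℕ => (m : ℂ) ^ s)).2 (fun _ _ => rfl) m hm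

theorem norm_moebius_le_one (n : ℕ) : ‖(ArithmeticFunction.moebius n : ℂ)‖ ≤ 1 := by
  rw [← Complex.ofReal_intCast, Complex.norm_real, Real.norm_eq_abs, ← Int.cast_abs]
  exact_mod_cast ArithmeticFunction.abs_moebius_le_one

theorem norm_jordanCoeff_le {s : ℂ} (hs : 0 ≤ s.re) (g : ℕ) :
    ‖jordanCoeff s g‖ ≤ g.divisors.card * (g : ℝ) ^ s.re := by
  rcases Nat.eq_zero_or_pos g with rfl | hg
  · simp [jordanCoeff]
  unfold jordanCoeff
  refine (norm_sum_le_of_le (n := fun _ => (g : ℝ) ^ s.re) _ fun x hx => ?_).trans ?_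
  · have h1 := (Nat.mem_divisorsAntidiagonal.1 hx).1
    have h2 : x.2 ∣ g := Dvd.intro_left _ h1
    rw [norm_mul, Complex.norm_natCast_cpow_of_pos (Nat.pos_of_dvd_of_pos h2 hg)]
    calc _ ≤ 1 * (g : ℝ) ^ s.re := by
          gcongr
          · exact norm_moebius_le_one _
          · exact Nat.le_of_dvd hg h2
      _ = _ := one_mul _
  · rw [Nat.sum_divisorsAntidiagonal (f := fun _ _ => (g : ℝ) ^ s.re), Finset.sum_const,
      nsmul_eq_mul]

theorem differentiable_jordanCoeff {g : ℕ} : Differentiable ℂ fun s => jordanCoeff s g := by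
  unfold jordanCoeff
  refine Differentiable.fun_sum fun x hx => ?_
  have : (x.2 : ℂ) ≠ 0 := by
    have h := (Nat.mem_divisorsAntidiagonal.1 hx)
    intro h0
    have h0' : x.2 = 0 := by exact_mod_cast h0
    exact h.2 (by rw [← h.1, h0', mul_zero])
  exact (differentiable_id.const_cpow (Or.inl this)).const_mul _

/-- The pairs of coprime divisors of `q` which are both coprime to `n`. -/
def coprimePairs (q n : ℕ) : Finset (ℕ × ℕ) :=
  {g ∈ q.divisors ×ˢ q.divisors | g.1.Coprime g.2 ∧ (g.1 * g.2).Coprime n}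

theorem mem_coprimePairs {q n : ℕ} {g : ℕ × ℕ} : g ∈ coprimePairs q n ↔
    (g.1 ∣ q ∧ g.2 ∣ q ∧ q ≠ 0) ∧ g.1.Coprime g.2 ∧ g.1.Coprime n ∧ g.2.Coprime n := by
  simp only [coprimePairs, Finset.mem_filter, Finset.mem_product, Nat.mem_divisors,
    Nat.coprime_mul_iff_left]
  tauto

theorem card_coprimePairs_le (q n : ℕ) : (coprimePairs q n).card ≤ q.divisors.card ^ 2 := by
  refine (Finset.card_filter_le _ _).trans ?_
  rw [Finset.card_product, sq]

/-- The coefficient of the main term of the sum over a fibre. -/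
noncomputable def fibreCoeff (s : ℂ) (q n : ℕ) : ℂ :=
  ∑ g ∈ coprimePairs q n, jordanCoeff s g.1 * jordanCoeff s g.2 / (g.1 * g.2)

theorem norm_jordanCoeff_mul_le {s : ℂ} (hs : 0 ≤ s.re) {q n : ℕ} {g : ℕ × ℕ}
    (hg : g ∈ coprimePairs q n) :
    ‖jordanCoeff s g.1 * jordanCoeff s g.2‖ ≤ (q.divisors.card : ℝ) ^ 2 * (g.1 * g.2 : ℝ) ^ s.re := by
  obtain ⟨⟨h1, h2, h0⟩, -⟩ := mem_coprimePairs.1 hg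
  rw [norm_mul]
  calc _ ≤ ((q.divisors.card : ℝ) * (g.1 : ℝ) ^ s.re) * ((q.divisors.card : ℝ) * (g.2 : ℝ) ^ s.re) := by
        gcongr
        · refine (norm_jordanCoeff_le hs _).trans ?_
          gcongr
        · refine (norm_jordanCoeff_le hs _).trans ?_
          gcongr
    _ = _ := by
        rw [Real.mul_rpow (by positivity) (by positivity)]
        ring

/-- The `u`-th term of the sum over the fibre above `a / q` with denominator `n`. -/
noncomputable def fibreTerm (s : ℂ) (q : ℕ) (a : ℤ) (n : ℕ) (u : ℤ) : ℂ :=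
  if IsCoprime u n then
    ((Int.gcd u q * Int.gcd (n * a ^ 2 + u) q : ℕ) : ℂ) ^ s *
      (archHeight ((a : ℝ) / q) ((u : ℝ) / (n * q ^ 2)) : ℂ) ^ (-s)
  else 0

/-- The Chinese remainder theorem: the three conditions single out one residue class modulo `d g h`.
-/
theorem exists_residue {d g h : ℤ} (h1 : IsCoprime d g) (h2 : IsCoprime d h) (h3 : IsCoprime g h) (b : ℤ) :
    ∃ c : ℤ, ∀ u : ℤ, (d ∣ u ∧ g ∣ u ∧ h ∣ b + u) ↔ d * g * h ∣ u - c := by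
  have h12 : IsCoprime (d * g) h := IsCoprime.mul_left h2 h3
  obtain ⟨x, y, hxy⟩ := h12
  -- With `x d g + y h = 1`, this number is `0` modulo `d g` and `-b` modulo `h`.
  refine ⟨-b * (x * (d * g)), fun u => ?_⟩
  have e1 : u - -b * (x * (d * g)) = (b + u) - b * (y * h) := by linear_combination b * hxy
  constructor
  · rintro ⟨hd, hg, hh⟩
    refine IsCoprime.mul_dvd ⟨x, y, hxy⟩ ?_ ?_
    · exact dvd_sub (h1.mul_dvd hd hg) (Dvd.intro_left (-b * x) (by ring))
    · rw [e1]
      exact dvd_sub hh (Dvd.intro_left (b * y) (by ring))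
  · intro hD
    have hdg : d * g ∣ u := by
      have := (Dvd.intro _ rfl : d * g ∣ d * g * h).trans hD
      have h5 := dvd_add this (Dvd.intro_left (-b * x) (by ring) : d * g ∣ -b * (x * (d * g)))
      rwa [sub_add_cancel] at h5
    refine ⟨(Dvd.intro _ rfl).trans hdg, (Dvd.intro_left _ rfl).trans hdg, ?_⟩
    have := (Dvd.intro_left _ rfl : h ∣ d * g * h).trans hD
    rw [e1] at this
    have h5 := dvd_add this (Dvd.intro_left (b * y) (by ring) : h ∣ b * (y * h))
    rwa [sub_add_cancel] at h5

/-- Both gcd's are expanded over their divisors. The coprimality conditions in `coprimePairs` are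
automatic: a common divisor of `u` and `n a² + u` dividing `q` divides `n a²`, yet it is prime to
`a` and to `n`. Restricting to such pairs makes the moduli pairwise coprime. -/
theorem gcd_cpow_mul_eq {q n : ℕ} (hq : 0 < q) {a u : ℤ} (ha : IsCoprime a q) (hu : IsCoprime u n)
    (s : ℂ) :
    ((Int.gcd u q * Int.gcd (n * a ^ 2 + u) q : ℕ) : ℂ) ^ s =
      ∑ g ∈ coprimePairs q n, if (g.1 : ℤ) ∣ u ∧ (g.2 : ℤ) ∣ n * a ^ 2 + u then
        jordanCoeff s g.1 * jordanCoeff s g.2 else 0 := by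
  have hq' : (q : ℤ) ≠ 0 := by exact_mod_cast hq.ne'
  have h1 : 0 < Int.gcd u q := Int.gcd_pos_of_ne_zero_right _ hq'
  have h2 : 0 < Int.gcd (n * a ^ 2 + u) q := Int.gcd_pos_of_ne_zero_right _ hq'
  rw [Nat.cast_mul, Complex.natCast_mul_natCast_cpow, ← sum_divisors_jordanCoeff s h1,
    ← sum_divisors_jordanCoeff s h2, Finset.sum_mul_sum, ← Finset.sum_product', ← Finset.sum_filter]
  refine Finset.sum_congr (Finset.ext fun g => ?_) fun _ _ => rfl
  rw [Finset.mem_product, Finset.mem_filter, Nat.mem_divisors, Nat.mem_divisors, mem_coprimePairs]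
  have d1 : g.1 ∣ Int.gcd u q ↔ (g.1 : ℤ) ∣ u ∧ g.1 ∣ q := by
    rw [← Int.natCast_dvd_natCast, Int.dvd_coe_gcd_iff, Int.natCast_dvd_natCast]
  have d2 : g.2 ∣ Int.gcd (n * a ^ 2 + u) q ↔ (g.2 : ℤ) ∣ n * a ^ 2 + u ∧ g.2 ∣ q := by
    rw [← Int.natCast_dvd_natCast, Int.dvd_coe_gcd_iff, Int.natCast_dvd_natCast]
  rw [d1, d2]
  constructor
  · rintro ⟨⟨⟨a1, a2⟩, -⟩, ⟨a3, a4⟩, -⟩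
    have c1 : IsCoprime (g.1 : ℤ) n := hu.of_isCoprime_of_dvd_left a1
    have c2 : IsCoprime (g.2 : ℤ) n := by
      have : IsCoprime (n * a ^ 2 + u) (n : ℤ) := by
        have := hu.add_mul_left_left (a ^ 2)
        rwa [add_comm] at this
      exact this.of_isCoprime_of_dvd_left a3
    have c3 : IsCoprime (g.1 : ℤ) g.2 := by
      have b1 : IsCoprime (g.1 : ℤ) (n * a ^ 2) :=
        c1.mul_right (IsCoprime.pow_right (ha.of_isCoprime_of_dvd_right
          (Int.natCast_dvd_natCast.2 a2)).symm)
      obtain ⟨k, hk⟩ := a1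
      have b2 : IsCoprime (g.1 : ℤ) (n * a ^ 2 + u) := by
        rw [hk]
        exact b1.add_mul_left_right k
      exact b2.of_isCoprime_of_dvd_right a3
    exact ⟨⟨⟨a2, a4, hq.ne'⟩, Nat.isCoprime_iff_coprime.1 c3, Nat.isCoprime_iff_coprime.1 c1,
      Nat.isCoprime_iff_coprime.1 c2⟩, a1, a3⟩
  · rintro ⟨⟨⟨a2, a4, -⟩, -⟩, a1, a3⟩
    exact ⟨⟨⟨a1, a2⟩, h1.ne'⟩, ⟨a3, a4⟩, h2.ne'⟩

theorem sum_moebius_eq_ite {n : ℕ} (hn : 0 < n) (u : ℤ) :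
    ∑ d ∈ n.divisors, (if (d : ℤ) ∣ u then (ArithmeticFunction.moebius d : ℂ) else 0) =
      if IsCoprime u n then 1 else 0 := by
  have hg : 0 < Int.gcd u n := Int.gcd_pos_of_ne_zero_right _ (by exact_mod_cast hn.ne')
  have h1 : ∑ d ∈ n.divisors, (if (d : ℤ) ∣ u then (ArithmeticFunction.moebius d : ℂ) else 0) =
      ∑ d ∈ (Int.gcd u n).divisors, (ArithmeticFunction.moebius d : ℂ) := by
    rw [← Finset.sum_filter]
    refine Finset.sum_congr (Finset.ext fun d => ?_) fun _ _ => rfl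
    rw [Finset.mem_filter, Nat.mem_divisors, Nat.mem_divisors,
      ← Int.natCast_dvd_natCast (n := Int.gcd u n), Int.dvd_coe_gcd_iff,
      Int.natCast_dvd_natCast]
    have := hn.ne'
    have := hg.ne'
    tauto
  rw [h1]
  have h2 := congrArg (fun f => f (Int.gcd u n))
    (ArithmeticFunction.coe_moebius_mul_coe_zeta (R := ℂ))
  simp only [ArithmeticFunction.coe_mul_zeta_apply, ArithmeticFunction.intCoe_apply,
    ArithmeticFunction.one_apply] at h2
  rw [h2]
  simp only [Int.isCoprime_iff_gcd_eq_one]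

theorem fibreTerm_eq {q n : ℕ} (hq : 0 < q) (hn : 0 < n) {a : ℤ} (ha : IsCoprime a q) (s : ℂ) (u : ℤ) :
    fibreTerm s q a n u = ∑ d ∈ n.divisors, ∑ g ∈ coprimePairs q n,
      (ArithmeticFunction.moebius d : ℂ) * (jordanCoeff s g.1 * jordanCoeff s g.2) *
      (if (d : ℤ) ∣ u ∧ (g.1 : ℤ) ∣ u ∧ (g.2 : ℤ) ∣ n * a ^ 2 + u then
        (archHeight ((a : ℝ) / q) ((u : ℝ) / (n * q ^ 2)) : ℂ) ^ (-s) else 0) := by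
  set φ := (archHeight ((a : ℝ) / q) ((u : ℝ) / (n * q ^ 2)) : ℂ) ^ (-s)
  have e1 : ∑ d ∈ n.divisors, ∑ g ∈ coprimePairs q n,
      (ArithmeticFunction.moebius d : ℂ) * (jordanCoeff s g.1 * jordanCoeff s g.2) *
      (if (d : ℤ) ∣ u ∧ (g.1 : ℤ) ∣ u ∧ (g.2 : ℤ) ∣ n * a ^ 2 + u then φ else 0) =
      (∑ d ∈ n.divisors, (if (d : ℤ) ∣ u then (ArithmeticFunction.moebius d : ℂ) else 0)) *
      (∑ g ∈ coprimePairs q n, if (g.1 : ℤ) ∣ u ∧ (g.2 : ℤ) ∣ n * a ^ 2 + u then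
        jordanCoeff s g.1 * jordanCoeff s g.2 else 0) * φ := by
    rw [Finset.sum_mul_sum, Finset.sum_mul]
    refine Finset.sum_congr rfl fun d _ => ?_
    rw [Finset.sum_mul]
    refine Finset.sum_congr rfl fun g _ => ?_
    by_cases h1 : (d : ℤ) ∣ u <;> by_cases h2 : (g.1 : ℤ) ∣ u ∧ (g.2 : ℤ) ∣ n * a ^ 2 + u <;>
      simp [h1, h2]
  rw [e1, sum_moebius_eq_ite hn, fibreTerm]
  by_cases hu : IsCoprime u n
  · rw [if_pos hu, if_pos hu, gcd_cpow_mul_eq hq ha hu, one_mul]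
  · rw [if_neg hu, if_neg hu]
    simp

theorem hasSum_progression {f : ℤ → ℂ} {P : ℤ → Prop} [DecidablePred P] {D : ℕ} (hD : 0 < D) {c : ℤ}
    (hP : ∀ u, P u ↔ (D : ℤ) ∣ u - c) (hs : Summable fun k : ℤ => f (c + D * k)) :
    HasSum (fun u => if P u then f u else 0) (∑' k : ℤ, f (c + D * k)) := by
  have hD' : (D : ℤ) ≠ 0 := by exact_mod_cast hD.ne'
  have hinj : Function.Injective fun k : ℤ => c + D * k := fun k l h => by
    have : (D : ℤ) * k = D * l := by simpa using h
    exact mul_left_cancel₀ hD' this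
  refine (hinj.hasSum_iff (fun u hu => ?_)).1 ?_
  · rw [if_neg]
    rintro h
    obtain ⟨k, hk⟩ := (hP u).1 h
    exact hu ⟨k, by dsimp only; rw [← hk]; ring⟩
  · convert! hs.hasSum using 1
    ext k
    exact if_pos ((hP _).2 ⟨k, by ring⟩)

theorem summable_archHeight_progression {s : ℂ} (hs : 3 / 4 < s.re) (y c : ℝ) {l : ℝ} (hl : 0 < l) :
    Summable (fun k : ℤ => (archHeight y (c + l * k) : ℂ) ^ (-s)) ∧
      ‖∑' k : ℤ, (archHeight y (c + l * k) : ℂ) ^ (-s) - (1 / l : ℝ) * fibreIntegral s y‖ ≤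
        ‖s‖ / s.re * (16 / (1 + y ^ 2)) :=
  (variationLE_archHeight_cpow hs.le y).summable_and_norm_tsum_sub_integral_le
    (integrable_archHeight_cpow hs y) c hl

theorem sum_moebius_mul_div {n : ℕ} (hn : 0 < n) :
    ∑ d ∈ n.divisors, (ArithmeticFunction.moebius d : ℂ) * (n / d) = n.totient := by
  have h := (ArithmeticFunction.sum_eq_iff_sum_mul_moebius_eq (f := fun n => (n.totient : ℂ))
    (g := fun n => (n : ℂ))).1 (fun n _ => by exact_mod_cast Nat.sum_totient n) n hn
  rw [← h, Nat.sum_divisorsAntidiagonal (f := fun x y => (ArithmeticFunction.moebius x : ℂ) * (y : ℂ))]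
  refine Finset.sum_congr rfl fun d hd => ?_
  have hd := Nat.mem_divisors.1 hd
  rw [Nat.cast_div hd.1]
  exact_mod_cast (Nat.pos_of_dvd_of_pos hd.1 hn).ne'

/-- For each triple `(d, g₁, g₂)` the sum runs over one progression of modulus `d g₁ g₂` and equals
its integral up to the total variation. The main terms recombine through `∑ μ(d) n/d = φ(n)`. For
the error there are at most `d(n) d(q)²` triples, each of weight at most `d(q)² q^σ` because `g₁ g₂`
divides `q`. -/
theorem tsum_fibreTerm {q n : ℕ} (hq : 0 < q) (hn : 0 < n) {a : ℤ} (ha : IsCoprime a q) {s : ℂ}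
    (hs : 3 / 4 < s.re) :
    Summable (fibreTerm s q a n) ∧
      ‖∑' u, fibreTerm s q a n u -
        q ^ 2 * n.totient * fibreCoeff s q n * fibreIntegral s ((a : ℝ) / q)‖ ≤
        n.divisors.card * (q.divisors.card : ℝ) ^ 4 * (q : ℝ) ^ s.re *
          (‖s‖ / s.re * (16 / (1 + ((a : ℝ) / q) ^ 2))) := by
  have hq0 : (0 : ℝ) < q := by exact_mod_cast hq
  have hn0 : (0 : ℝ) < n := by exact_mod_cast hn
  set y := (a : ℝ) / q with hy
  set V := ‖s‖ / s.re * (16 / (1 + y ^ 2)) with hV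
  have hV0 : 0 ≤ V := by
    have : 0 < s.re := by linarith
    positivity
  have key : ∀ d ∈ n.divisors, ∀ g ∈ coprimePairs q n, ∃ S : ℂ,
      HasSum (fun u : ℤ => if (d : ℤ) ∣ u ∧ (g.1 : ℤ) ∣ u ∧ (g.2 : ℤ) ∣ n * a ^ 2 + u then
        (archHeight y ((u : ℝ) / (n * q ^ 2)) : ℂ) ^ (-s) else 0) S ∧
      ‖S - n * q ^ 2 / (d * g.1 * g.2) * fibreIntegral s y‖ ≤ V := by
    intro d hd g hg
    have hd := Nat.mem_divisors.1 hd
    obtain ⟨⟨g1, g2, -⟩, g3, g4, g5⟩ := mem_coprimePairs.1 hg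
    have hd0 : 0 < d := Nat.pos_of_dvd_of_pos hd.1 hn
    have hg10 : 0 < g.1 := Nat.pos_of_dvd_of_pos g1 hq
    have hg20 : 0 < g.2 := Nat.pos_of_dvd_of_pos g2 hq
    obtain ⟨c, hc⟩ := exists_residue (d := d) (g := g.1) (h := g.2)
      (Nat.isCoprime_iff_coprime.2 (g4.coprime_dvd_right hd.1).symm)
      (Nat.isCoprime_iff_coprime.2 (g5.coprime_dvd_right hd.1).symm)
      (Nat.isCoprime_iff_coprime.2 g3) (n * a ^ 2)
    have hD : 0 < d * g.1 * g.2 := by positivity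
    have hDr : (0 : ℝ) < d * g.1 * g.2 := by exact_mod_cast hD
    obtain ⟨h1, h2⟩ := summable_archHeight_progression hs y ((c : ℝ) / (n * q ^ 2))
      (l := (d * g.1 * g.2) / (n * q ^ 2)) (by positivity)
    have e1 : ∀ k : ℤ, (((c + ((d * g.1 * g.2 : ℕ) : ℤ) * k : ℤ) : ℝ) / (n * q ^ 2)) =
        (c : ℝ) / (n * q ^ 2) + (d * g.1 * g.2) / (n * q ^ 2) * k := fun k => by
      push_cast
      ring
    refine ⟨_, hasSum_progression (f := fun u => (archHeight y ((u : ℝ) / (n * q ^ 2)) : ℂ) ^ (-s))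
      hD (c := c) (fun u => by rw [hc]; push_cast; rfl) (by simpa only [e1] using h1), ?_⟩
    simp only [e1]
    convert! h2 using 5
    push_cast
    rw [one_div_div]
  choose! S hS1 hS2 using key
  have hsum : HasSum (fibreTerm s q a n) (∑ d ∈ n.divisors, ∑ g ∈ coprimePairs q n,
      (ArithmeticFunction.moebius d : ℂ) * (jordanCoeff s g.1 * jordanCoeff s g.2) * S d g) := by
    rw [funext fun u => fibreTerm_eq hq hn ha s u]
    exact hasSum_sum fun d hd => hasSum_sum fun g hg => (hS1 d hd g hg).mul_left _
  refine ⟨hsum.summable, ?_⟩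
  have e2 : (q : ℂ) ^ 2 * n.totient * fibreCoeff s q n * fibreIntegral s y =
      ∑ d ∈ n.divisors, ∑ g ∈ coprimePairs q n,
      (ArithmeticFunction.moebius d : ℂ) * (jordanCoeff s g.1 * jordanCoeff s g.2) *
        (n * q ^ 2 / (d * g.1 * g.2) * fibreIntegral s y) := by
    have e3 : ∀ d ∈ n.divisors, ∑ g ∈ coprimePairs q n,
        (ArithmeticFunction.moebius d : ℂ) * (jordanCoeff s g.1 * jordanCoeff s g.2) *
        (n * q ^ 2 / (d * g.1 * g.2) * fibreIntegral s y) =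
        (ArithmeticFunction.moebius d : ℂ) * (n / d) * (q ^ 2 * fibreIntegral s y *
          fibreCoeff s q n) := fun d _ => by
      rw [fibreCoeff, Finset.mul_sum, Finset.mul_sum]
      refine Finset.sum_congr rfl fun g _ => ?_
      rw [mul_assoc (d : ℂ), ← div_div, div_eq_mul_inv _ ((g.1 : ℂ) * g.2),
        div_eq_mul_inv _ ((g.1 : ℂ) * g.2)]
      ring
    rw [Finset.sum_congr rfl e3, ← Finset.sum_mul, sum_moebius_mul_div hn]
    ring
  rw [hsum.tsum_eq, e2, ← Finset.sum_sub_distrib]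
  calc _ ≤ ∑ d ∈ n.divisors, ∑ g ∈ coprimePairs q n,
        (q.divisors.card : ℝ) ^ 2 * (q : ℝ) ^ s.re * V := by
        refine norm_sum_le_of_le _ fun d hd => ?_
        rw [← Finset.sum_sub_distrib]
        refine norm_sum_le_of_le _ fun g hg => ?_
        rw [← mul_sub, norm_mul, norm_mul]
        obtain ⟨⟨g1, g2, -⟩, g3, -⟩ := mem_coprimePairs.1 hg
        have hle : (g.1 * g.2 : ℝ) ≤ q := by
          exact_mod_cast Nat.le_of_dvd hq (g3.mul_dvd_of_dvd_of_dvd g1 g2)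
        have h3 := norm_jordanCoeff_mul_le (s := s) (by linarith) hg
        have h4 : ‖jordanCoeff s g.1 * jordanCoeff s g.2‖ ≤
            (q.divisors.card : ℝ) ^ 2 * (q : ℝ) ^ s.re := by
          refine h3.trans ?_
          have : 0 ≤ s.re := by linarith
          gcongr
        calc _ ≤ 1 * ((q.divisors.card : ℝ) ^ 2 * (q : ℝ) ^ s.re) * V := by
              gcongr
              · exact norm_moebius_le_one d
              · exact hS2 d hd g hg
          _ = _ := by ring
    _ = n.divisors.card * ((coprimePairs q n).card * ((q.divisors.card : ℝ) ^ 2 * (q : ℝ) ^ s.re * V)) := by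
        rw [Finset.sum_const, Finset.sum_const, nsmul_eq_mul, nsmul_eq_mul]
    _ ≤ n.divisors.card * ((q.divisors.card : ℝ) ^ 2 * ((q.divisors.card : ℝ) ^ 2 * (q : ℝ) ^ s.re * V)) := by
        gcongr
        exact_mod_cast card_coprimePairs_le q n
    _ = _ := by ring

end FibreSum

/-! ### Summability over rational numbers -/

section Summability

theorem summable_card_divisors_pow_mul_rpow (k : ℕ) {p : ℝ} (hp : 1 < p) :
    Summable fun n : ℕ => (n.divisors.card : ℝ) ^ k * (n : ℝ) ^ (-p) := by
  -- So small that `k ε ≤ (p - 1)/2`: the divisor functions use up at most half of the excess of `p`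
  -- over `1`.
  set ε := (p - 1) / (2 * (k + 1)) with hε
  have hε0 : 0 < ε := by
    have : 0 < p - 1 := by linarith
    positivity
  obtain ⟨C, hC, h⟩ := exists_card_divisors_le_rpow hε0
  have hk : k * ε ≤ (p - 1) / 2 := by
    rw [hε, mul_div_assoc', div_le_div_iff₀ (by positivity) (by norm_num)]
    nlinarith
  have hs : Summable fun n : ℕ => C ^ k * (n : ℝ) ^ (-(p - k * ε)) :=
    (Real.summable_nat_rpow.2 (by linarith)).mul_left _
  refine hs.of_nonneg_of_le (fun n => by positivity) fun n => ?_
  rcases Nat.eq_zero_or_pos n with rfl | hn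
  · rw [Nat.cast_zero, Real.zero_rpow (by linarith), Real.zero_rpow (by linarith)]
    simp
  have hn0 : (0 : ℝ) < n := by exact_mod_cast hn
  calc (n.divisors.card : ℝ) ^ k * (n : ℝ) ^ (-p) ≤ (C * (n : ℝ) ^ ε) ^ k * (n : ℝ) ^ (-p) := by
        gcongr
        exact h n
    _ = C ^ k * (n : ℝ) ^ (-(p - k * ε)) := by
        rw [mul_pow, ← Real.rpow_natCast ((n : ℝ) ^ ε), ← Real.rpow_mul hn0.le, mul_assoc,
          ← Real.rpow_add hn0]
        ring_nf

theorem injective_rat_den_num : Function.Injective fun y : ℚ => (y.den, y.num) := fun x y h => by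
  simp only [Prod.mk.injEq] at h
  exact Rat.ext h.2 h.1

theorem mem_range_rat_den_num {p : ℕ × ℤ} :
    p ∈ range (fun y : ℚ => (y.den, y.num)) ↔ 0 < p.1 ∧ IsCoprime p.2 p.1 := by
  constructor
  · rintro ⟨y, rfl⟩
    exact ⟨y.den_pos, y.isCoprime_num_den⟩
  · rintro ⟨h1, h2⟩
    refine ⟨⟨p.2, p.1, h1.ne', ?_⟩, rfl⟩
    have := Int.isCoprime_iff_gcd_eq_one.1 h2
    simpa [Int.gcd] using this

theorem cast_rat_eq_num_div_den (y : ℚ) : (y : ℝ) = (y.num : ℝ) / y.den := by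
  conv_lhs => rw [← Rat.num_div_den y]
  push_cast
  rfl

/-- The reduced fractions of denominator `q` are among all `k/q`, over which the weight sums to
`O(q)`. -/
theorem summable_rat_of_den {f : ℕ → ℝ} (hf : ∀ q, 0 ≤ f q) {p : ℝ} (hp : 1 / 2 < p)
    (hs : Summable fun q : ℕ => f q * q) :
    Summable fun y : ℚ => f y.den * (1 + (y : ℝ) ^ 2) ^ (-p) := by
  obtain ⟨C, hC, h⟩ := exists_lattice_bound hp
  set F : ℕ × ℤ → ℝ := fun x => if 0 < x.1 then f x.1 * (1 + ((x.2 : ℝ) / x.1) ^ 2) ^ (-p) else 0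
    with hF
  have hF0 : 0 ≤ F := fun x => by
    simp only [hF]
    split_ifs
    · exact mul_nonneg (hf _) (by positivity)
    · exact le_rfl
  have hsF : Summable F := by
    rw [summable_prod_of_nonneg hF0]
    constructor
    · intro q
      rcases Nat.eq_zero_or_pos q with rfl | hq
      · simp [hF]
      · simpa [hF, hq] using (h q hq).1.mul_left (f q)
    · refine (hs.mul_left C).of_nonneg_of_le (fun q => tsum_nonneg fun a => hF0 _) fun q => ?_
      rcases Nat.eq_zero_or_pos q with rfl | hq
      · simp [hF]
      · simp only [hF, hq, if_true]
        rw [tsum_mul_left]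
        calc _ ≤ f q * (C * q) := by
              gcongr
              · exact hf q
              · exact (h q hq).2
          _ = _ := by ring
  refine (hsF.comp_injective injective_rat_den_num).congr fun y => ?_
  simp only [hF, Function.comp_apply, y.den_pos, if_true]
  rw [cast_rat_eq_num_div_den y]

end Summability

/-! ### The accumulated error of the fibrewise approximation -/

section FibreError

theorem norm_fibreTerm_le {q n : ℕ} (hq : 0 < q) {a u : ℤ} {s : ℂ} (hs : 0 ≤ s.re) :
    ‖fibreTerm s q a n u‖ ≤
      (q ^ 2 : ℝ) ^ s.re * archHeight ((a : ℝ) / q) ((u : ℝ) / (n * q ^ 2)) ^ (-s.re) := by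
  have hq' : (q : ℤ) ≠ 0 := by exact_mod_cast hq.ne'
  have hpos : 0 ≤ archHeight ((a : ℝ) / q) ((u : ℝ) / (n * q ^ 2)) ^ (-s.re) :=
    Real.rpow_nonneg (archHeight_pos _ _).le _
  unfold fibreTerm
  split_ifs
  · have h1 : 0 < Int.gcd u q := Int.gcd_pos_of_ne_zero_right _ hq'
    have h2 : 0 < Int.gcd (n * a ^ 2 + u) q := Int.gcd_pos_of_ne_zero_right _ hq'
    rw [norm_mul, Complex.norm_natCast_cpow_of_pos (by positivity), norm_archHeight_cpow]
    gcongr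
    have hle : ∀ v : ℤ, Int.gcd v q ≤ q := fun v =>
      Nat.le_of_dvd hq (Int.natCast_dvd_natCast.1 (Int.gcd_dvd_right v q))
    rw [sq (q : ℝ)]
    exact_mod_cast Nat.mul_le_mul (hle _) (hle _)
  · rw [norm_zero]
    positivity

theorem differentiable_fibreTerm {q : ℕ} (hq : 0 < q) (a : ℤ) (n : ℕ) (u : ℤ) :
    Differentiable ℂ fun s => fibreTerm s q a n u := by
  have hq' : (q : ℤ) ≠ 0 := by exact_mod_cast hq.ne'
  unfold fibreTerm
  split_ifs
  · have h1 : 0 < Int.gcd u q := Int.gcd_pos_of_ne_zero_right _ hq'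
    have h2 : 0 < Int.gcd (n * a ^ 2 + u) q := Int.gcd_pos_of_ne_zero_right _ hq'
    have h3 : ((Int.gcd u q * Int.gcd (n * a ^ 2 + u) q : ℕ) : ℂ) ≠ 0 := by
      exact_mod_cast (Nat.mul_pos h1 h2).ne'
    have h4 : (archHeight ((a : ℝ) / q) ((u : ℝ) / (n * q ^ 2)) : ℂ) ≠ 0 := by
      exact_mod_cast (archHeight_pos _ _).ne'
    exact (differentiable_id.const_cpow (Or.inl h3)).mul
      (differentiable_id.neg.const_cpow (Or.inl h4))
  · exact differentiable_const _

theorem differentiableOn_tsum_fibreTerm {q n : ℕ} (hq : 0 < q) (hn : 0 < n) (a : ℤ) :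
    DifferentiableOn ℂ (fun s => ∑' u, fibreTerm s q a n u) {s | 3 / 4 < s.re} := by
  intro s hs
  have hs' : 3 / 4 < s.re := hs
  set σ₀ := (s.re + 3 / 4) / 2 with hσ₀
  have hq0 : (0 : ℝ) < q := by exact_mod_cast hq
  have hn0 : (0 : ℝ) < n := by exact_mod_cast hn
  have hopen : IsOpen {z : ℂ | σ₀ < z.re ∧ z.re < s.re + 1} :=
    (isOpen_lt continuous_const Complex.continuous_re).inter
      (isOpen_lt Complex.continuous_re continuous_const)
  have hsum : Summable fun u : ℤ =>
      (q ^ 2 : ℝ) ^ (s.re + 1) * archHeight ((a : ℝ) / q) ((u : ℝ) / (n * q ^ 2)) ^ (-σ₀) := by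
    have h := (summable_archHeight_progression (s := σ₀) (by simp; linarith) ((a : ℝ) / q) 0
      (l := 1 / (n * q ^ 2)) (by positivity)).1.norm
    simp only [norm_archHeight_cpow, Complex.ofReal_re] at h
    refine (h.mul_left ((q ^ 2 : ℝ) ^ (s.re + 1))).congr fun u => ?_
    congr 3
    ring
  have := Complex.differentiableOn_tsum_of_summable_norm (F := fun u s => fibreTerm s q a n u)
    hsum (U := {z : ℂ | σ₀ < z.re ∧ z.re < s.re + 1})
    (fun u => (differentiable_fibreTerm hq a n u).differentiableOn) hopen
    (fun u z hz => by
      refine (norm_fibreTerm_le hq (by linarith [hz.1])).trans ?_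
      have h1 : (1 : ℝ) ≤ q ^ 2 := one_le_pow₀ (by exact_mod_cast hq)
      have h2 := archHeight_pos ((a : ℝ) / q) ((u : ℝ) / (n * q ^ 2))
      gcongr
      · exact hz.2.le
      · exact one_le_archHeight _ _
      · exact hz.1.le)
  exact (this.differentiableAt (hopen.mem_nhds ⟨by linarith, by linarith⟩)).differentiableWithinAt

theorem differentiable_fibreCoeff (q n : ℕ) : Differentiable ℂ fun s => fibreCoeff s q n := by
  unfold fibreCoeff
  exact Differentiable.fun_sum fun g _ =>
    (differentiable_jordanCoeff.mul differentiable_jordanCoeff).div_const _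

/-- The main term of the sum over the fibre above `a / q` with denominator `n`. -/
noncomputable def fibreMain (s : ℂ) (q : ℕ) (a : ℤ) (n : ℕ) : ℂ :=
  ((q ^ 4 * n ^ 2 : ℕ) : ℂ) ^ (-s) *
    (q ^ 2 * n.totient * fibreCoeff s q n * fibreIntegral s ((a : ℝ) / q))

/-- The part of the height zeta function coming from the points above `a / q` with denominator
`n`. -/
noncomputable def fibreSum (s : ℂ) (q : ℕ) (a : ℤ) (n : ℕ) : ℂ :=
  ((q ^ 4 * n ^ 2 : ℕ) : ℂ) ^ (-s) * ∑' u, fibreTerm s q a n u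

theorem cpow_neg_zero_of_re_pos {s : ℂ} (hs : 0 < s.re) : (0 : ℂ) ^ (-s) = 0 :=
  Complex.zero_cpow (by intro h; rw [neg_eq_zero.1 h] at hs; simp at hs)

/-- Of the factor `q^(-4σ)` the gcd's consume `q^σ`, leaving `q^(-3σ)`. The variation provides the
decay `1/(1 + y²)`. The case `n = 0` is harmless because `0⁻ˢ = 0`. -/
theorem norm_fibreSum_sub_fibreMain_le {q : ℕ} (hq : 0 < q) (n : ℕ) {a : ℤ} (ha : IsCoprime a q)
    {s : ℂ} (hs : 3 / 4 < s.re) :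
    ‖fibreSum s q a n - fibreMain s q a n‖ ≤
      ‖s‖ / s.re * 16 * (((q.divisors.card : ℝ) ^ 4 * (q : ℝ) ^ (-(3 * s.re)) *
        (1 + ((a : ℝ) / q) ^ 2) ^ (-1 : ℝ)) *
        ((n.divisors.card : ℝ) ^ 1 * (n : ℝ) ^ (-(2 * s.re)))) := by
  have hs0 : 0 < s.re := by linarith
  rcases Nat.eq_zero_or_pos n with rfl | hn
  · simp [fibreSum, fibreMain, cpow_neg_zero_of_re_pos hs0]
  have hq0 : (0 : ℝ) < q := by exact_mod_cast hq
  have hn0 : (0 : ℝ) < n := by exact_mod_cast hn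
  have h := (tsum_fibreTerm hq hn ha hs).2
  rw [fibreSum, fibreMain, ← mul_sub, norm_mul, Complex.norm_natCast_cpow_of_pos (by positivity),
    Complex.neg_re]
  refine (mul_le_mul_of_nonneg_left h (by positivity)).trans (le_of_eq ?_)
  have e1 : ((q ^ 4 * n ^ 2 : ℕ) : ℝ) ^ (-s.re) =
      (q : ℝ) ^ (-(3 * s.re)) * (q : ℝ) ^ (-s.re) * (n : ℝ) ^ (-(2 * s.re)) := by
    push_cast
    rw [Real.mul_rpow (by positivity) (by positivity), ← Real.rpow_natCast, ← Real.rpow_natCast,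
      ← Real.rpow_mul hq0.le, ← Real.rpow_mul hn0.le, ← Real.rpow_add hq0]
    congr 2 <;> push_cast <;> ring
  have e2 : (q : ℝ) ^ (-s.re) * (q : ℝ) ^ s.re = 1 := by
    rw [← Real.rpow_add hq0]
    simp
  rw [e1, Real.rpow_neg_one]
  linear_combination ((q : ℝ) ^ (-(3 * s.re)) * (n : ℝ) ^ (-(2 * s.re)) * n.divisors.card *
    (q.divisors.card : ℝ) ^ 4 * (‖s‖ / s.re * (16 / (1 + ((a : ℝ) / q) ^ 2)))) * e2

theorem differentiableOn_fibreSum_sub_fibreMain {q : ℕ} (hq : 0 < q) (a : ℤ) (n : ℕ) :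
    DifferentiableOn ℂ (fun s => fibreSum s q a n - fibreMain s q a n) {s | 3 / 4 < s.re} := by
  rcases Nat.eq_zero_or_pos n with rfl | hn
  · refine (differentiableOn_const 0).congr fun s hs => ?_
    have hs' : 3 / 4 < s.re := hs
    simp [fibreSum, fibreMain, cpow_neg_zero_of_re_pos (by linarith : 0 < s.re)]
  have h0 : ((q ^ 4 * n ^ 2 : ℕ) : ℂ) ≠ 0 := by
    exact_mod_cast (by positivity : 0 < q ^ 4 * n ^ 2).ne'
  have h1 : Differentiable ℂ fun s : ℂ => ((q ^ 4 * n ^ 2 : ℕ) : ℂ) ^ (-s) :=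
    differentiable_id.neg.const_cpow (Or.inl h0)
  refine (h1.differentiableOn.mul (differentiableOn_tsum_fibreTerm hq hn a)).sub
    (h1.differentiableOn.mul (DifferentiableOn.mul ?_ (differentiableOn_fibreIntegral _)))
  exact ((differentiable_fibreCoeff q n).const_mul _).differentiableOn

/-- The total error of the fibrewise approximation of the height zeta function. -/
noncomputable def fibreError (s : ℂ) : ℂ :=
  ∑' p : ℚ × ℕ, (fibreSum s p.1.den p.1.num p.2 - fibreMain s p.1.den p.1.num p.2)

/-- Convergence needs `3σ₀ - 1 > 1` and `2σ₀ > 1`, both implied by `σ₀ > 3/4`. The imaginary part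
enters only through `‖s‖/σ`, hence linearly. -/
theorem exists_fibreError_majorant {σ₀ : ℝ} (h0 : 3 / 4 < σ₀) :
    ∃ M : ℚ × ℕ → ℝ, Summable M ∧ (∀ p, 0 ≤ M p) ∧ ∀ p : ℚ × ℕ, ∀ s : ℂ, σ₀ ≤ s.re →
      ‖fibreSum s p.1.den p.1.num p.2 - fibreMain s p.1.den p.1.num p.2‖ ≤ (1 + |s.im|) * M p := by
  set f : ℕ → ℝ := fun q => (q.divisors.card : ℝ) ^ 4 * (q : ℝ) ^ (-(3 * σ₀)) with hf
  have hf0 : ∀ q, 0 ≤ f q := fun q => by positivity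
  have h1 : Summable fun y : ℚ => f y.den * (1 + (y : ℝ) ^ 2) ^ (-1 : ℝ) := by
    refine summable_rat_of_den hf0 (by norm_num) ?_
    refine (summable_card_divisors_pow_mul_rpow 4 (p := 3 * σ₀ - 1) (by linarith)).congr fun q => ?_
    rcases Nat.eq_zero_or_pos q with rfl | hq
    · simp
    · have hq0 : (0 : ℝ) < q := by exact_mod_cast hq
      rw [hf]
      dsimp only
      rw [mul_assoc, show -(3 * σ₀ - 1) = -(3 * σ₀) + 1 by ring, Real.rpow_add hq0, Real.rpow_one]
  have h2 := summable_card_divisors_pow_mul_rpow 1 (p := 2 * σ₀) (by linarith)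
  refine ⟨fun p => 2 * 16 * ((f p.1.den * (1 + (p.1 : ℝ) ^ 2) ^ (-1 : ℝ)) *
    ((p.2.divisors.card : ℝ) ^ 1 * (p.2 : ℝ) ^ (-(2 * σ₀)))),
    (h1.mul_of_nonneg h2 (fun y => mul_nonneg (hf0 _) (by positivity)) fun n => by positivity).mul_left _, fun p => ?_, fun p s hs => ?_⟩
  · have := hf0 p.1.den
    positivity
  · have hs0 : 3 / 4 < s.re := by linarith
    refine (norm_fibreSum_sub_fibreMain_le p.1.den_pos p.2 p.1.isCoprime_num_den hs0).trans ?_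
    rw [← cast_rat_eq_num_div_den]
    have h3 : ‖s‖ / s.re ≤ (1 + |s.im|) * 2 := by
      rw [div_le_iff₀ (by linarith)]
      have h4 := Complex.norm_le_abs_re_add_abs_im s
      rw [abs_of_pos (by linarith : 0 < s.re)] at h4
      nlinarith [abs_nonneg s.im]
    have hden : (1 : ℝ) ≤ p.1.den := by exact_mod_cast p.1.den_pos
    have h5 : (p.2 : ℝ) ^ (-(2 * s.re)) ≤ (p.2 : ℝ) ^ (-(2 * σ₀)) := by
      rcases Nat.eq_zero_or_pos p.2 with h | h
      · rw [h, Nat.cast_zero, Real.zero_rpow (by linarith), Real.zero_rpow (by linarith)]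
      · exact Real.rpow_le_rpow_of_exponent_le (by exact_mod_cast h) (by linarith)
    calc _ ≤ ((1 + |s.im|) * 2) * 16 * ((f p.1.den * (1 + (p.1 : ℝ) ^ 2) ^ (-1 : ℝ)) *
          ((p.2.divisors.card : ℝ) ^ 1 * (p.2 : ℝ) ^ (-(2 * σ₀)))) := by
          simp only [hf]
          gcongr
      _ = _ := by ring

theorem differentiableOn_fibreError : DifferentiableOn ℂ fibreError {s | 3 / 4 < s.re} := by
  intro s hs
  have hs' : 3 / 4 < s.re := hs
  obtain ⟨M, hM, hM0, h⟩ := exists_fibreError_majorant (σ₀ := (s.re + 3 / 4) / 2) (by linarith)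
  set U := {z : ℂ | (s.re + 3 / 4) / 2 < z.re ∧ |z.im| < |s.im| + 1}
  have hopen : IsOpen U :=
    (isOpen_lt continuous_const Complex.continuous_re).inter
      (isOpen_lt (continuous_abs.comp Complex.continuous_im) continuous_const)
  have := Complex.differentiableOn_tsum_of_summable_norm (U := U)
    (F := fun (p : ℚ × ℕ) s => fibreSum s p.1.den p.1.num p.2 - fibreMain s p.1.den p.1.num p.2)
    (hM.mul_left (1 + (|s.im| + 1)))
    (fun p => (differentiableOn_fibreSum_sub_fibreMain p.1.den_pos _ _).mono fun z hz =>
      (by linarith : 3 / 4 < (s.re + 3 / 4) / 2).trans hz.1) hopen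
    (fun p z hz => (h p z hz.1.le).trans (by
      have := hM0 p
      have := hz.2
      gcongr))
  exact (this.differentiableAt (hopen.mem_nhds ⟨by linarith, by linarith⟩)).differentiableWithinAt

theorem exists_norm_fibreError_le {σ₀ : ℝ} (h0 : 3 / 4 < σ₀) :
    ∃ C : ℝ, ∀ s : ℂ, σ₀ ≤ s.re → ‖fibreError s‖ ≤ C * (1 + |s.im|) := by
  obtain ⟨M, hM, -, h⟩ := exists_fibreError_majorant h0
  refine ⟨∑' p, M p, fun s hs => ?_⟩
  have := tsum_of_norm_bounded (hM.mul_left (1 + |s.im|)).hasSum fun p => h p s hs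
  rwa [tsum_mul_left, mul_comm] at this

end FibreError

/-! ### Summation over the denominator `n` -/

section LocalCoeff

theorem two_pow_card_primeFactors_le {n : ℕ} (hn : n ≠ 0) :
    2 ^ n.primeFactors.card ≤ n.divisors.card := by
  rw [Nat.card_divisors hn, ← Finset.prod_const]
  refine Finset.prod_le_prod' fun p hp => ?_
  have := (Nat.prime_of_mem_primeFactors hp).factorization_pos_of_dvd hn
    (Nat.dvd_of_mem_primeFactors hp)
  omega

/-- The Euler factors at the primes dividing `g` of the totient Dirichlet series. -/
noncomputable def eulerCorrection (s : ℂ) (g : ℕ) : ℂ :=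
  ∏ p ∈ g.primeFactors, (1 - (p : ℂ) ^ (1 - 2 * s)) / (1 - (p : ℂ) ^ (-(2 * s)))

theorem norm_prime_cpow_le {p : ℕ} (hp : p.Prime) {w : ℂ} {c : ℝ} (h : w.re ≤ -c) (hc : 0 ≤ c) :
    ‖(p : ℂ) ^ w‖ ≤ 2 ^ (-c) := by
  rw [Complex.norm_natCast_cpow_of_pos hp.pos]
  have h2 : (2 : ℝ) ≤ p := by exact_mod_cast hp.two_le
  calc (p : ℝ) ^ w.re ≤ (p : ℝ) ^ (-c) := Real.rpow_le_rpow_of_exponent_le (by linarith) h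
    _ ≤ 2 ^ (-c) := Real.rpow_le_rpow_of_nonpos (by norm_num) h2 (by linarith)

theorem half_le_norm_one_sub_prime_cpow {p : ℕ} (hp : p.Prime) {w : ℂ} (h : w.re ≤ -1) :
    1 / 2 ≤ ‖1 - (p : ℂ) ^ w‖ := by
  have h1 := norm_prime_cpow_le hp h zero_le_one
  have h2 := norm_sub_norm_le (1 : ℂ) ((p : ℂ) ^ w)
  rw [norm_one] at h2
  rw [Real.rpow_neg_one] at h1
  linarith

theorem one_sub_prime_cpow_ne_zero {p : ℕ} (hp : p.Prime) {w : ℂ} (h : w.re ≤ -1) :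
    1 - (p : ℂ) ^ w ≠ 0 := by
  have := half_le_norm_one_sub_prime_cpow hp h
  exact norm_pos_iff.1 (by linarith)

/-- Each Euler factor is at most `4 = 2²`, and `2` to the number of prime factors is at most the
number of divisors. -/
theorem norm_eulerCorrection_le {s : ℂ} (hs : 3 / 4 ≤ s.re) {g : ℕ} (hg : g ≠ 0) :
    ‖eulerCorrection s g‖ ≤ (g.divisors.card : ℝ) ^ 2 := by
  have h1 : ‖eulerCorrection s g‖ ≤ ∏ p ∈ g.primeFactors, (4 : ℝ) := by
    rw [eulerCorrection, norm_prod]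
    refine Finset.prod_le_prod (fun _ _ => norm_nonneg _) fun p hp => ?_
    have hp := Nat.prime_of_mem_primeFactors hp
    have h2 := half_le_norm_one_sub_prime_cpow hp (w := -(2 * s)) (by simp; linarith)
    have h3 : ‖(p : ℂ) ^ (1 - 2 * s)‖ ≤ 2 ^ (-(0 : ℝ)) :=
      norm_prime_cpow_le hp (by simp; linarith) le_rfl
    have h4 := norm_sub_le (1 : ℂ) ((p : ℂ) ^ (1 - 2 * s))
    rw [norm_one] at h4
    rw [neg_zero, Real.rpow_zero] at h3
    rw [norm_div, div_le_iff₀ (by linarith)]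
    linarith
  refine h1.trans ?_
  rw [Finset.prod_const, show (4 : ℝ) = 2 ^ 2 by norm_num, ← pow_mul, mul_comm, pow_mul]
  gcongr
  exact_mod_cast two_pow_card_primeFactors_le hg

theorem differentiableOn_eulerCorrection (g : ℕ) :
    DifferentiableOn ℂ (fun s => eulerCorrection s g) {s | 3 / 4 < s.re} := by
  unfold eulerCorrection
  refine DifferentiableOn.fun_finsetProd fun p hp => ?_
  have hp := Nat.prime_of_mem_primeFactors hp
  have hp0 : (p : ℂ) ≠ 0 := by exact_mod_cast hp.ne_zero
  refine DifferentiableOn.div ?_ ?_ fun s hs => ?_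
  · exact (((differentiable_id.const_mul 2).const_sub 1).const_cpow
      (Or.inl hp0)).const_sub 1 |>.differentiableOn
  · exact ((differentiable_id.const_mul 2).neg.const_cpow
      (Or.inl hp0)).const_sub 1 |>.differentiableOn
  · have hs' : 3 / 4 < s.re := hs
    exact one_sub_prime_cpow_ne_zero hp (by simp; linarith)

/-- Since `φ = μ * id`, twisting by the trivial character modulo `g` gives a quotient of `L`-series
of that character, which are zeta functions with the Euler factors at `p ∣ g` removed. -/
theorem hasSum_totient_coprime {s : ℂ} (hs : 1 < s.re) {g : ℕ} (hg : g ≠ 0) :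
    HasSum (fun n : ℕ => if g.Coprime n then (n.totient : ℂ) * (n : ℂ) ^ (-(2 * s)) else 0)
      (riemannZeta (2 * s - 1) / riemannZeta (2 * s) * eulerCorrection s g) := by
  have : NeZero g := ⟨hg⟩
  set χ : DirichletCharacter ℂ g := 1 with hχ
  have h2s : 1 < (2 * s).re := by simp; linarith
  have h2s1 : 1 < (2 * s - 1).re := by simp; linarith
  set I : ℕ → ℂ := fun n => n with hI
  set M : ℕ → ℂ := fun n => (ArithmeticFunction.moebius n : ℂ) with hM
  set X : ℕ → ℂ := fun n => χ n with hX
  have hterm : LSeries.term (X * I) (2 * s) = LSeries.term X (2 * s - 1) := by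
    ext n
    rcases eq_or_ne n 0 with rfl | hn
    · simp
    · have hn0 : (n : ℂ) ≠ 0 := by exact_mod_cast hn
      rw [LSeries.term_of_ne_zero hn, LSeries.term_of_ne_zero hn, Complex.cpow_sub _ _ hn0,
        Complex.cpow_one, Pi.mul_apply, hI]
      field_simp
  have hs1 : LSeriesSummable (X * I) (2 * s) := by
    have := DirichletCharacter.LSeriesSummable_of_one_lt_re χ h2s1
    rw [LSeriesSummable, hterm]
    exact this
  have hs2 : LSeriesSummable (X * M) (2 * s) :=
    DirichletCharacter.LSeriesSummable_mul χ (ArithmeticFunction.LSeriesSummable_moebius_iff.2 h2s)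
  have hconv : LSeries.convolution (X * M) (X * I) = X * fun n => (n.totient : ℂ) := by
    rw [DirichletCharacter.mul_convolution_distrib χ M I]
    congr 1
    ext n
    rw [LSeries.convolution_def]
    rcases Nat.eq_zero_or_pos n with rfl | hn
    · simp
    · exact (ArithmeticFunction.sum_eq_iff_sum_mul_moebius_eq (f := fun n => (n.totient : ℂ))
        (g := fun n => (n : ℂ))).1 (fun n _ => by exact_mod_cast Nat.sum_totient n) n hn
  have hL := LSeriesHasSum.convolution hs2.LSeriesHasSum hs1.LSeriesHasSum
  rw [hconv] at hL
  have hL1 : LSeries (X * I) (2 * s) =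
      (∏ p ∈ g.primeFactors, (1 - (p : ℂ) ^ (1 - 2 * s))) * riemannZeta (2 * s - 1) := by
    have e : LSeries (X * I) (2 * s) = LSeries X (2 * s - 1) := by
      rw [LSeries, hterm, LSeries]
    rw [e, ← DirichletCharacter.LFunction_eq_LSeries χ h2s1]
    have := DirichletCharacter.LFunctionTrivChar_eq_mul_riemannZeta (N := g) (s := 2 * s - 1)
      (by intro h; rw [h] at h2s1; simp at h2s1)
    rw [DirichletCharacter.LFunctionTrivChar] at this
    rw [hχ, this]
    simp only [neg_sub]
  have hL2 : LSeries X (2 * s) =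
      (∏ p ∈ g.primeFactors, (1 - (p : ℂ) ^ (-(2 * s)))) * riemannZeta (2 * s) := by
    rw [← DirichletCharacter.LFunction_eq_LSeries χ h2s]
    exact DirichletCharacter.LFunctionTrivChar_eq_mul_riemannZeta (N := g) (s := 2 * s)
      (by intro h; rw [h] at h2s; simp at h2s)
  have hL3 := DirichletCharacter.LSeries.mul_mu_eq_one χ h2s
  have hne : LSeries X (2 * s) ≠ 0 := DirichletCharacter.LSeries_ne_zero_of_one_lt_re χ h2s
  have hval : LSeries (X * M) (2 * s) * LSeries (X * I) (2 * s) =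
      riemannZeta (2 * s - 1) / riemannZeta (2 * s) * eulerCorrection s g := by
    have h4 : LSeries (X * M) (2 * s) = (LSeries X (2 * s))⁻¹ := by
      exact eq_inv_of_mul_eq_one_right hL3
    rw [hL2] at hne
    rw [h4, hL2, hL1, eulerCorrection, Finset.prod_div_distrib]
    have h5 := left_ne_zero_of_mul hne
    have h6 := right_ne_zero_of_mul hne
    field_simp
  rw [hval, LSeriesHasSum] at hL
  convert! hL using 1
  ext n
  rcases eq_or_ne n 0 with rfl | hn
  · simp
  rw [LSeries.term_of_ne_zero hn, Pi.mul_apply, hX, hχ]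
  beta_reduce
  have hiff : IsUnit (n : ZMod g) ↔ g.Coprime n := by
    rw [ZMod.isUnit_iff_coprime, Nat.coprime_comm]
  by_cases h : g.Coprime n
  · rw [if_pos h, MulChar.one_apply (hiff.2 h), one_mul, Complex.cpow_neg, div_eq_mul_inv]
  · rw [if_neg h, MulChar.map_nonunit _ (fun h' => h (hiff.1 h')), zero_mul, zero_div]

/-- The coefficient of the main term of the sum over all points above fractions with
denominator `q`. -/
noncomputable def localCoeff (s : ℂ) (q : ℕ) : ℂ :=
  ∑ g ∈ coprimePairs q 1, jordanCoeff s g.1 * jordanCoeff s g.2 / (g.1 * g.2) *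
    eulerCorrection s (g.1 * g.2)

theorem norm_jordanCoeff_div_le {s : ℂ} (hs : 0 ≤ s.re) {q n : ℕ} {g : ℕ × ℕ}
    (hg : g ∈ coprimePairs q n) :
    ‖jordanCoeff s g.1 * jordanCoeff s g.2 / (g.1 * g.2)‖ ≤
      (q.divisors.card : ℝ) ^ 2 * max 1 ((q : ℝ) ^ (s.re - 1)) := by
  obtain ⟨⟨h1, h2, h0⟩, h3, -⟩ := mem_coprimePairs.1 hg
  have hq : 0 < q := Nat.pos_of_ne_zero h0
  have hpos : 0 < g.1 * g.2 := Nat.mul_pos (Nat.pos_of_dvd_of_pos h1 hq) (Nat.pos_of_dvd_of_pos h2 hq)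
  have hpos' : (0 : ℝ) < g.1 * g.2 := by exact_mod_cast hpos
  have hle : (g.1 * g.2 : ℝ) ≤ q := by
    exact_mod_cast Nat.le_of_dvd hq (h3.mul_dvd_of_dvd_of_dvd h1 h2)
  have hone : (1 : ℝ) ≤ g.1 * g.2 := by exact_mod_cast hpos
  have hn : ‖(g.1 * g.2 : ℂ)‖ = g.1 * g.2 := by
    rw [norm_mul, Complex.norm_natCast, Complex.norm_natCast]
  rw [norm_div, hn, div_le_iff₀ hpos']
  refine (norm_jordanCoeff_mul_le hs hg).trans ?_
  have e : (g.1 * g.2 : ℝ) ^ s.re = (g.1 * g.2 : ℝ) ^ (s.re - 1) * (g.1 * g.2) := by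
    rw [← Real.rpow_add_one hpos'.ne']
    ring_nf
  rw [e, ← mul_assoc]
  gcongr
  rcases le_total 1 s.re with h | h
  · refine le_max_of_le_right ?_
    have : 0 ≤ s.re - 1 := by linarith
    gcongr
  · exact le_max_of_le_left (Real.rpow_le_one_of_one_le_of_nonpos hone (by linarith))

theorem norm_fibreCoeff_le {s : ℂ} (hs : 0 ≤ s.re) (q n : ℕ) :
    ‖fibreCoeff s q n‖ ≤ (q.divisors.card : ℝ) ^ 4 * max 1 ((q : ℝ) ^ (s.re - 1)) := by
  unfold fibreCoeff
  refine (norm_sum_le_of_le _ fun g hg => norm_jordanCoeff_div_le hs hg).trans ?_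
  rw [Finset.sum_const, nsmul_eq_mul]
  calc _ ≤ (q.divisors.card : ℝ) ^ 2 * ((q.divisors.card : ℝ) ^ 2 * max 1 ((q : ℝ) ^ (s.re - 1))) := by
        gcongr
        exact_mod_cast card_coprimePairs_le q n
    _ = _ := by ring

theorem norm_localCoeff_le {s : ℂ} (hs : 3 / 4 ≤ s.re) (q : ℕ) :
    ‖localCoeff s q‖ ≤ (q.divisors.card : ℝ) ^ 6 * max 1 ((q : ℝ) ^ (s.re - 1)) := by
  unfold localCoeff
  refine (norm_sum_le_of_le (n := fun _ => (q.divisors.card : ℝ) ^ 2 *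
    max 1 ((q : ℝ) ^ (s.re - 1)) * (q.divisors.card : ℝ) ^ 2) _ fun g hg => ?_).trans ?_
  · obtain ⟨⟨h1, h2, h0⟩, h3, -⟩ := mem_coprimePairs.1 hg
    have hdvd : g.1 * g.2 ∣ q := h3.mul_dvd_of_dvd_of_dvd h1 h2
    rw [norm_mul]
    gcongr
    · exact norm_jordanCoeff_div_le (by linarith) hg
    · refine (norm_eulerCorrection_le hs (ne_zero_of_dvd_ne_zero h0 hdvd)).trans ?_
      gcongr
  · rw [Finset.sum_const, nsmul_eq_mul]
    calc _ ≤ (q.divisors.card : ℝ) ^ 2 * ((q.divisors.card : ℝ) ^ 2 *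
          max 1 ((q : ℝ) ^ (s.re - 1)) * (q.divisors.card : ℝ) ^ 2) := by
          gcongr
          exact_mod_cast card_coprimePairs_le q 1
      _ = _ := by ring

theorem differentiableOn_localCoeff (q : ℕ) :
    DifferentiableOn ℂ (fun s => localCoeff s q) {s | 3 / 4 < s.re} := by
  unfold localCoeff
  exact DifferentiableOn.fun_sum fun g _ =>
    ((differentiable_jordanCoeff.mul differentiable_jordanCoeff).div_const _).differentiableOn.mul
      (differentiableOn_eulerCorrection _)

/-- The dependence on `n` sits in the condition that `g₁ g₂` be prime to `n`. Exchanging the finite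
sum over pairs with the sum over `n` reduces this to the totient series. -/
theorem hasSum_fibreCoeff {s : ℂ} (hs : 1 < s.re) (q : ℕ) :
    HasSum (fun n : ℕ => (n : ℂ) ^ (-(2 * s)) * (n.totient * fibreCoeff s q n))
      (riemannZeta (2 * s - 1) / riemannZeta (2 * s) * localCoeff s q) := by
  have h : ∀ g ∈ coprimePairs q 1, HasSum (fun n : ℕ =>
      jordanCoeff s g.1 * jordanCoeff s g.2 / (g.1 * g.2) *
        if (g.1 * g.2).Coprime n then (n.totient : ℂ) * (n : ℂ) ^ (-(2 * s)) else 0)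
      (jordanCoeff s g.1 * jordanCoeff s g.2 / (g.1 * g.2) *
        (riemannZeta (2 * s - 1) / riemannZeta (2 * s) * eulerCorrection s (g.1 * g.2))) :=
    fun g hg => by
      obtain ⟨⟨h1, h2, h0⟩, -⟩ := mem_coprimePairs.1 hg
      exact (hasSum_totient_coprime hs (mul_ne_zero (ne_zero_of_dvd_ne_zero h0 h1)
        (ne_zero_of_dvd_ne_zero h0 h2))).mul_left _
  convert! hasSum_sum h using 1
  · ext n
    have : coprimePairs q n = (coprimePairs q 1).filter fun g => (g.1 * g.2).Coprime n := by
      ext g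
      simp only [Finset.mem_filter, mem_coprimePairs, Nat.coprime_mul_iff_left,
        Nat.coprime_one_right_iff]
      tauto
    rw [fibreCoeff, this, Finset.sum_filter, Finset.mul_sum, Finset.mul_sum]
    refine Finset.sum_congr rfl fun g _ => ?_
    split_ifs <;> ring
  · rw [localCoeff, Finset.mul_sum]
    refine Finset.sum_congr rfl fun g _ => ?_
    ring

end LocalCoeff

/-! ### Summation over the numerators, and the discrepancy series -/

section CoprimeSum

/-- The discrepancy between the sum of the fibre integrals over reduced fractions with
denominator `q` and its mean value. -/
noncomputable def coprimeError (q : ℕ) (s : ℂ) : ℂ :=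
  ∑ d ∈ q.divisors, (ArithmeticFunction.moebius d : ℂ) * latticeError (q / d) s

/-- Möbius inversion over `d ∣ q` turns reduced fractions into full lattices of spacing `d/q`; the
mean values recombine to `φ(q)`. -/
theorem hasSum_fibreIntegral_coprime {q : ℕ} (hq : 0 < q) {s : ℂ} (hs : 3 / 4 < s.re) :
    HasSum (fun a : ℤ => if IsCoprime a q then fibreIntegral s ((a : ℝ) / q) else 0)
      (q.totient * archDensity s + coprimeError q s) := by
  have hq0 : (q : ℝ) ≠ 0 := by exact_mod_cast hq.ne'
  have key : ∀ d ∈ q.divisors, HasSum (fun a : ℤ => (ArithmeticFunction.moebius d : ℂ) *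
      if (d : ℤ) ∣ a then fibreIntegral s ((a : ℝ) / q) else 0)
      ((ArithmeticFunction.moebius d : ℂ) *
        (((q / d : ℕ) : ℂ) * archDensity s + latticeError (q / d) s)) := by
    intro d hd
    have hd := (Nat.mem_divisors.1 hd).1
    have hd0 : 0 < d := Nat.pos_of_dvd_of_pos hd hq
    have hdr : (d : ℝ) ≠ 0 := by exact_mod_cast hd0.ne'
    have e : ∀ k : ℤ, (((0 + (d : ℤ) * k : ℤ) : ℝ) / q) = (k : ℝ) / ((q / d : ℕ) : ℝ) := fun k => by
      rw [Nat.cast_div hd hdr]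
      push_cast
      field_simp
      ring
    have hsum := summable_fibreIntegral (e := q / d) (Nat.div_pos (Nat.le_of_dvd hq hd) hd0) hs
    have h := hasSum_progression (f := fun a : ℤ => fibreIntegral s ((a : ℝ) / q)) hd0 (c := 0)
      (P := fun a => (d : ℤ) ∣ a) (fun u => by rw [sub_zero]) (by simpa only [e] using hsum)
    simp only [e] at h
    rw [latticeError, add_sub_cancel]
    exact h.mul_left _
  convert! hasSum_sum key using 1
  · ext a
    have h := sum_moebius_eq_ite hq a
    have h2 : (∑ d ∈ q.divisors, (ArithmeticFunction.moebius d : ℂ) *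
        if (d : ℤ) ∣ a then fibreIntegral s ((a : ℝ) / q) else 0) =
        (∑ d ∈ q.divisors, if (d : ℤ) ∣ a then (ArithmeticFunction.moebius d : ℂ) else 0) *
          fibreIntegral s ((a : ℝ) / q) := by
      rw [Finset.sum_mul]
      refine Finset.sum_congr rfl fun d _ => ?_
      split_ifs <;> ring
    rw [h2, h]
    split_ifs <;> ring
  · simp only [mul_add, Finset.sum_add_distrib]
    congr 1
    rw [← sum_moebius_mul_div hq, Finset.sum_mul]
    refine Finset.sum_congr rfl fun d hd => ?_
    have hd := (Nat.mem_divisors.1 hd).1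
    have hd0 : 0 < d := Nat.pos_of_dvd_of_pos hd hq
    rw [Nat.cast_div hd (by exact_mod_cast hd0.ne'), mul_assoc]

theorem differentiableOn_coprimeError (q : ℕ) :
    DifferentiableOn ℂ (coprimeError q) {s | 3 / 4 < s.re} := by
  unfold coprimeError
  refine DifferentiableOn.fun_sum fun d hd => (differentiableOn_latticeError ?_).const_mul _
  have hd := Nat.mem_divisors.1 hd
  exact Nat.div_pos (Nat.le_of_dvd (Nat.pos_of_ne_zero hd.2) hd.1) (Nat.pos_of_dvd_of_pos hd.1 (Nat.pos_of_ne_zero hd.2))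

theorem norm_coprimeError_le {q : ℕ} {s : ℂ} {B : ℝ}
    (hB : ∀ e : ℕ, 0 < e → e ≤ q → ‖latticeError e s‖ ≤ B) :
    ‖coprimeError q s‖ ≤ q.divisors.card * B := by
  unfold coprimeError
  refine (norm_sum_le_of_le (n := fun _ => B) _ fun d hd => ?_).trans ?_
  · have hd := Nat.mem_divisors.1 hd
    rw [norm_mul]
    have h1 := hB (q / d) (Nat.div_pos (Nat.le_of_dvd (Nat.pos_of_ne_zero hd.2) hd.1)
      (Nat.pos_of_dvd_of_pos hd.1 (Nat.pos_of_ne_zero hd.2))) (Nat.div_le_self _ _)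
    calc _ ≤ 1 * B := by
          gcongr
          exact norm_moebius_le_one d
      _ = B := one_mul B
  · rw [Finset.sum_const, nsmul_eq_mul]

theorem max_mul_rpow_le {q : ℕ} (hq : 0 < q) {σ p : ℝ} (h1 : p ≤ 4 * σ - 2) (h2 : p ≤ 3 * σ - 1) :
    (q : ℝ) ^ (2 - 4 * σ) * max 1 ((q : ℝ) ^ (σ - 1)) ≤ (q : ℝ) ^ (-p) := by
  have hq1 : (1 : ℝ) ≤ q := by exact_mod_cast hq
  rw [mul_max_of_nonneg _ _ (by positivity), mul_one, ← Real.rpow_add (by linarith)]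
  exact max_le (Real.rpow_le_rpow_of_exponent_le hq1 (by linarith))
    (Real.rpow_le_rpow_of_exponent_le hq1 (by linarith))

theorem norm_cpow_two_sub {q : ℕ} (hq : 0 < q) (s : ℂ) :
    ‖(q : ℂ) ^ (2 - 4 * s)‖ = (q : ℝ) ^ (2 - 4 * s.re) := by
  rw [Complex.norm_natCast_cpow_of_pos hq]
  simp

/-- For `Re s ≤ 5/4` the square-root bound is used, and convergence over `q` needs `4σ₀ - 2 > 1`,
which is `σ₀ > 3/4`. For larger `Re s` the trivial bound loses a factor `q`, which the stronger
decay pays for. -/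
theorem exists_norm_coprimeTerm_le {σ₀ : ℝ} (h0 : 3 / 4 < σ₀) :
    ∃ C p : ℝ, 0 < C ∧ 1 < p ∧ ∀ q : ℕ, ∀ s : ℂ, σ₀ ≤ s.re →
      ‖(q : ℂ) ^ (2 - 4 * s) * localCoeff s q * coprimeError q s‖ ≤
        √(1 + |s.im|) * (C * ((q.divisors.card : ℝ) ^ 7 * (q : ℝ) ^ (-p))) := by
  obtain ⟨K, hK, h1⟩ := exists_norm_latticeError_le_sqrt
  obtain ⟨C, hC, h2⟩ := exists_norm_latticeError_le (σ₀ := 5 / 4) (by norm_num)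
  -- The bound `5/4` is the value of `3σ - 1` at `σ = 3/4`, so the second condition of
  -- `max_mul_rpow_le` holds throughout.
  refine ⟨2 * K + C, min (4 * σ₀ - 2) (5 / 4), by positivity, lt_min (by linarith) (by norm_num), fun q s hs => ?_⟩
  set p := min (4 * σ₀ - 2) (5 / 4) with hp
  have hp1 : p ≤ 4 * σ₀ - 2 := min_le_left _ _
  have hp2 : p ≤ 5 / 4 := min_le_right _ _
  rcases Nat.eq_zero_or_pos q with rfl | hq
  · simp [coprimeError]
  have hR1 : 1 ≤ √(1 + |s.im|) := Real.one_le_sqrt.2 (by linarith [abs_nonneg s.im])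
  have hl := norm_localCoeff_le (s := s) (by linarith) q
  rw [norm_mul, norm_mul, norm_cpow_two_sub hq]
  have hd : (0 : ℝ) ≤ q.divisors.card := by positivity
  rcases le_total s.re (5 / 4) with h | h
  · have hE : ‖coprimeError q s‖ ≤ q.divisors.card * (K * (2 * √(1 + |s.im|))) :=
      norm_coprimeError_le fun e he _ => (h1 e he s (by linarith) h).trans (by
        gcongr
        rw [show (2 : ℝ) = √4 by rw [show (4 : ℝ) = 2 ^ 2 by norm_num]; simp, ← Real.sqrt_mul (by norm_num)]
        refine Real.sqrt_le_sqrt ?_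
        have := Complex.norm_le_abs_re_add_abs_im s
        rw [abs_of_nonneg (by linarith : 0 ≤ s.re)] at this
        linarith [abs_nonneg s.im])
    have hm := max_mul_rpow_le hq (σ := s.re) (p := p) (by linarith) (by linarith)
    calc _ ≤ (q : ℝ) ^ (2 - 4 * s.re) * ((q.divisors.card : ℝ) ^ 6 * max 1 ((q : ℝ) ^ (s.re - 1))) *
          (q.divisors.card * (K * (2 * √(1 + |s.im|)))) := by gcongr
      _ = √(1 + |s.im|) * (2 * K) * (q.divisors.card : ℝ) ^ 7 *
          ((q : ℝ) ^ (2 - 4 * s.re) * max 1 ((q : ℝ) ^ (s.re - 1))) := by ring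
      _ ≤ √(1 + |s.im|) * (2 * K + C) * (q.divisors.card : ℝ) ^ 7 * (q : ℝ) ^ (-p) := by
          gcongr
          linarith
      _ = _ := by ring
  · have hE : ‖coprimeError q s‖ ≤ q.divisors.card * (C * q) :=
      norm_coprimeError_le fun e he heq => (h2 e he s h).trans (by gcongr)
    have hm := max_mul_rpow_le hq (σ := s.re) (p := p + 1) (by linarith) (by linarith)
    have hq0 : (0 : ℝ) < q := by exact_mod_cast hq
    calc _ ≤ (q : ℝ) ^ (2 - 4 * s.re) * ((q.divisors.card : ℝ) ^ 6 * max 1 ((q : ℝ) ^ (s.re - 1))) *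
          (q.divisors.card * (C * q)) := by gcongr
      _ = 1 * C * (q.divisors.card : ℝ) ^ 7 *
          ((q : ℝ) ^ (2 - 4 * s.re) * max 1 ((q : ℝ) ^ (s.re - 1)) * q) := by ring
      _ ≤ √(1 + |s.im|) * (2 * K + C) * (q.divisors.card : ℝ) ^ 7 * ((q : ℝ) ^ (-(p + 1)) * q) := by
          gcongr
          linarith
      _ = √(1 + |s.im|) * (2 * K + C) * (q.divisors.card : ℝ) ^ 7 * (q : ℝ) ^ (-p) := by
          rw [← Real.rpow_add_one hq0.ne']
          ring_nf
      _ = _ := by ring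

/-- The Dirichlet series of the discrepancies `coprimeError`. -/
noncomputable def discrepancySeries (s : ℂ) : ℂ :=
  ∑' q : ℕ, (q : ℂ) ^ (2 - 4 * s) * localCoeff s q * coprimeError q s

theorem summable_coprimeTerm {s : ℂ} (hs : 3 / 4 < s.re) :
    Summable fun q : ℕ => (q : ℂ) ^ (2 - 4 * s) * localCoeff s q * coprimeError q s := by
  obtain ⟨C, p, -, hp, h⟩ := exists_norm_coprimeTerm_le hs
  exact .of_norm_bounded
    (((summable_card_divisors_pow_mul_rpow 7 hp).mul_left C).mul_left (√(1 + |s.im|)))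
    fun q => h q s le_rfl

theorem exists_norm_discrepancySeries_le {σ₀ : ℝ} (h0 : 3 / 4 < σ₀) :
    ∃ C : ℝ, 0 < C ∧ ∀ s : ℂ, σ₀ ≤ s.re → ‖discrepancySeries s‖ ≤ C * √(1 + |s.im|) := by
  obtain ⟨C, p, hC, hp, h⟩ := exists_norm_coprimeTerm_le h0
  have hs := (summable_card_divisors_pow_mul_rpow 7 hp).mul_left C
  refine ⟨∑' q : ℕ, C * ((q.divisors.card : ℝ) ^ 7 * (q : ℝ) ^ (-p)) + 1, ?_, fun s hs' => ?_⟩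
  · have : 0 ≤ ∑' q : ℕ, C * ((q.divisors.card : ℝ) ^ 7 * (q : ℝ) ^ (-p)) :=
      tsum_nonneg fun q => by positivity
    linarith
  have h2 := tsum_of_norm_bounded (hs.mul_left (√(1 + |s.im|))).hasSum fun q => h q s hs'
  rw [tsum_mul_left] at h2
  refine h2.trans ?_
  have := Real.sqrt_nonneg (1 + |s.im|)
  nlinarith

theorem differentiableOn_discrepancySeries :
    DifferentiableOn ℂ discrepancySeries {s | 3 / 4 < s.re} := by
  intro s hs
  have hs' : 3 / 4 < s.re := hs
  obtain ⟨C, p, hC, hp, h⟩ := exists_norm_coprimeTerm_le (σ₀ := (s.re + 3 / 4) / 2) (by linarith)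
  set U := {z : ℂ | (s.re + 3 / 4) / 2 < z.re ∧ |z.im| < |s.im| + 1}
  have hopen : IsOpen U :=
    (isOpen_lt continuous_const Complex.continuous_re).inter
      (isOpen_lt (continuous_abs.comp Complex.continuous_im) continuous_const)
  have := Complex.differentiableOn_tsum_of_summable_norm (U := U)
    (F := fun (q : ℕ) s => (q : ℂ) ^ (2 - 4 * s) * localCoeff s q * coprimeError q s)
    (((summable_card_divisors_pow_mul_rpow 7 hp).mul_left C).mul_left (√(1 + (|s.im| + 1))))
    (fun q => by
      have hsub : U ⊆ {z | 3 / 4 < z.re} := fun z hz =>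
        (by linarith : 3 / 4 < (s.re + 3 / 4) / 2).trans hz.1
      rcases Nat.eq_zero_or_pos q with rfl | hq
      · simp [coprimeError]
      · have hq0 : (q : ℂ) ≠ 0 := by exact_mod_cast hq.ne'
        refine (DifferentiableOn.mul ?_ ((differentiableOn_localCoeff q).mono hsub)).mul
          ((differentiableOn_coprimeError q).mono hsub)
        exact (((differentiable_id.const_mul 4).const_sub 2).const_cpow
          (Or.inl hq0)).differentiableOn) hopen
    (fun q z hz => (h q z hz.1.le).trans (by
      have := hz.2
      gcongr))
  exact (this.differentiableAt (hopen.mem_nhds ⟨by linarith, by linarith⟩)).differentiableWithinAt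

end CoprimeSum

/-! ### Assembling the main term -/

section MainTerm

theorem fibreMain_eq (s : ℂ) {q : ℕ} (hq : 0 < q) (a : ℤ) (n : ℕ) :
    fibreMain s q a n = (q : ℂ) ^ (2 - 4 * s) * fibreIntegral s ((a : ℝ) / q) *
      ((n : ℂ) ^ (-(2 * s)) * (n.totient * fibreCoeff s q n)) := by
  have hq0 : (q : ℂ) ≠ 0 := by exact_mod_cast hq.ne'
  have h1 : ((q ^ 4 * n ^ 2 : ℕ) : ℂ) ^ (-s) = (q : ℂ) ^ (-(4 * s)) * (n : ℂ) ^ (-(2 * s)) := by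
    push_cast
    have e : ((q : ℂ) ^ 4 * (n : ℂ) ^ 2) = ((q ^ 4 : ℕ) : ℂ) * ((n ^ 2 : ℕ) : ℂ) := by push_cast; rfl
    rw [e, Complex.natCast_mul_natCast_cpow, Nat.cast_pow, Nat.cast_pow]
    rw [← Complex.natCast_cpow_natCast_mul, ← Complex.natCast_cpow_natCast_mul]
    push_cast
    ring_nf
  have h2 : (q : ℂ) ^ (2 - 4 * s) = (q : ℂ) ^ (-(4 * s)) * (q : ℂ) ^ 2 := by
    rw [show 2 - 4 * s = -(4 * s) + (2 : ℕ) by push_cast; ring, Complex.cpow_add _ _ hq0,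
      Complex.cpow_natCast]
  rw [fibreMain, h1, h2]
  ring

theorem summable_card_divisors_pow_mul_denominator (k : ℕ) {σ : ℝ} (hσ : 1 < σ) :
    Summable fun q : ℕ => (q : ℝ) ^ (2 - 4 * σ) *
      ((q.divisors.card : ℝ) ^ k * max 1 ((q : ℝ) ^ (σ - 1))) * q := by
  refine (summable_card_divisors_pow_mul_rpow k (p := 3 * σ - 2) (by linarith)).of_nonneg_of_le
    (fun q => by positivity) fun q => ?_
  rcases Nat.eq_zero_or_pos q with rfl | hq
  · simp only [Nat.cast_zero, mul_zero]
    positivity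
  have hq0 : (0 : ℝ) < q := by exact_mod_cast hq
  have := max_mul_rpow_le hq (σ := σ) (p := 3 * σ - 1) (by linarith) le_rfl
  calc _ = (q.divisors.card : ℝ) ^ k * ((q : ℝ) ^ (2 - 4 * σ) * max 1 ((q : ℝ) ^ (σ - 1)) * q) := by
        ring
    _ ≤ (q.divisors.card : ℝ) ^ k * ((q : ℝ) ^ (-(3 * σ - 1)) * q) := by gcongr
    _ = _ := by
        rw [← Real.rpow_add_one hq0.ne']
        ring_nf

/-- This is where `Re s > 1` is needed: the fractions of denominator `q` contribute about
`q^(2-3σ)`, and the sum over `n` about `n^(1-2σ)`. -/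
theorem summable_fibreMain {s : ℂ} (hs : 1 < s.re) :
    Summable fun p : ℚ × ℕ => fibreMain s p.1.den p.1.num p.2 := by
  obtain ⟨C, hC, h⟩ := exists_norm_fibreIntegral_le (σ₀ := 1) (by norm_num) le_rfl
  have h1 := summable_rat_of_den
    (f := fun q : ℕ => (q : ℝ) ^ (2 - 4 * s.re) *
      ((q.divisors.card : ℝ) ^ 4 * max 1 ((q : ℝ) ^ (s.re - 1)))) (fun q => by positivity)
    (by norm_num : (1 / 2 : ℝ) < 3 / 4) (summable_card_divisors_pow_mul_denominator 4 hs)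
  have h2 : Summable fun n : ℕ => (n : ℝ) ^ (-(2 * s.re - 1)) :=
    Real.summable_nat_rpow.2 (by linarith)
  refine .of_norm_bounded ((h1.mul_of_nonneg h2
    (fun y => mul_nonneg (by positivity) (by positivity)) fun n => by positivity).mul_left C) fun p => ?_
  rw [fibreMain_eq s p.1.den_pos, ← cast_rat_eq_num_div_den, norm_mul, norm_mul, norm_mul,
    norm_mul, norm_cpow_two_sub p.1.den_pos]
  rcases Nat.eq_zero_or_pos p.2 with hn | hn
  · rw [hn]
    simp only [Nat.totient_zero, Nat.cast_zero, norm_zero, zero_mul, mul_zero]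
    positivity
  have hn0 : (0 : ℝ) < p.2 := by exact_mod_cast hn
  rw [Complex.norm_natCast_cpow_of_pos hn, Complex.norm_natCast]
  have e : (-(2 * s)).re = -(2 * s.re) := by simp
  have h3 := h s hs.le p.1
  have h4 := norm_fibreCoeff_le (s := s) (by linarith) p.1.den p.2
  have h5 : (p.2.totient : ℝ) ≤ p.2 := by exact_mod_cast Nat.totient_le _
  rw [e]
  calc _ ≤ (p.1.den : ℝ) ^ (2 - 4 * s.re) * (C * (1 + (p.1 : ℝ) ^ 2) ^ (-(1 - 1 / 4 : ℝ))) *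
        ((p.2 : ℝ) ^ (-(2 * s.re)) * (p.2 * ((p.1.den.divisors.card : ℝ) ^ 4 *
          max 1 ((p.1.den : ℝ) ^ (s.re - 1))))) := by
        gcongr
    _ = C * ((p.1.den : ℝ) ^ (2 - 4 * s.re) * ((p.1.den.divisors.card : ℝ) ^ 4 *
          max 1 ((p.1.den : ℝ) ^ (s.re - 1))) * (1 + (p.1 : ℝ) ^ 2) ^ (-(1 - 1 / 4 : ℝ)) *
          ((p.2 : ℝ) ^ (-(2 * s.re)) * p.2)) := by ring
    _ = _ := by
        rw [← Real.rpow_add_one hn0.ne', show -(1 - 1 / 4 : ℝ) = -(3 / 4) by norm_num]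
        ring_nf

/-- The Dirichlet series of the main term of the height zeta function. -/
noncomputable def totientSeries (s : ℂ) : ℂ :=
  ∑' q : ℕ, (q : ℂ) ^ (2 - 4 * s) * localCoeff s q * q.totient

theorem summable_totientTerm {s : ℂ} (hs : 1 < s.re) :
    Summable fun q : ℕ => (q : ℂ) ^ (2 - 4 * s) * localCoeff s q * q.totient := by
  refine .of_norm_bounded (summable_card_divisors_pow_mul_denominator 6 hs) fun q => ?_
  rcases Nat.eq_zero_or_pos q with rfl | hq
  · simp
  rw [norm_mul, norm_mul, norm_cpow_two_sub hq, Complex.norm_natCast]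
  have := norm_localCoeff_le (s := s) (by linarith) q
  gcongr
  exact Nat.totient_le q

/-- Absolute convergence permits summing over `n`, then over `a` prime to `q`, then over `q`.
Reduced fractions become pairs `(q, a)`, with the summand extended by zero. -/
theorem tsum_fibreMain {s : ℂ} (hs : 1 < s.re) :
    ∑' p : ℚ × ℕ, fibreMain s p.1.den p.1.num p.2 =
      riemannZeta (2 * s - 1) / riemannZeta (2 * s) *
        (archDensity s * totientSeries s + discrepancySeries s) := by
  have hs1 : 3 / 4 < s.re := by linarith
  have hsum := summable_fibreMain hs
  set Z := riemannZeta (2 * s - 1) / riemannZeta (2 * s) with hZ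
  set g : ℕ × ℤ → ℂ := fun p =>
    (p.1 : ℂ) ^ (2 - 4 * s) * localCoeff s p.1 * Z *
      if 0 < p.1 ∧ IsCoprime p.2 p.1 then fibreIntegral s ((p.2 : ℝ) / p.1) else 0 with hg
  have hinner : ∀ y : ℚ, HasSum (fun n => fibreMain s y.den y.num n) (g (y.den, y.num)) := by
    intro y
    simp only [fibreMain_eq s y.den_pos]
    convert! (hasSum_fibreCoeff hs y.den).mul_left
      ((y.den : ℂ) ^ (2 - 4 * s) * fibreIntegral s ((y.num : ℝ) / y.den)) using 1
    simp only [hg, y.den_pos, y.isCoprime_num_den, and_self, if_true]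
    ring
  have hrange : ∀ p ∉ range (fun y : ℚ => (y.den, y.num)), g p = 0 := by
    intro p hp
    rw [mem_range_rat_den_num] at hp
    simp only [hg, if_neg hp, mul_zero]
  have hgs : Summable g := by
    refine (injective_rat_den_num.summable_iff hrange).1 ?_
    exact (hsum.hasSum.prod_fiberwise hinner).summable
  have houter : ∀ q : ℕ, HasSum (fun a : ℤ => g (q, a))
      (Z * ((q : ℂ) ^ (2 - 4 * s) * localCoeff s q * q.totient * archDensity s +
        (q : ℂ) ^ (2 - 4 * s) * localCoeff s q * coprimeError q s)) := by
    intro q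
    rcases Nat.eq_zero_or_pos q with rfl | hq
    · simp [hg, coprimeError]
    · simp only [hg, hq, true_and]
      convert! (hasSum_fibreIntegral_coprime hq hs1).mul_left
        ((q : ℂ) ^ (2 - 4 * s) * localCoeff s q * Z) using 1
      ring
  have h1 := (hsum.hasSum.prod_fiberwise hinner).tsum_eq
  have h2 : ∑' y : ℚ, g (y.den, y.num) = ∑' p, g p :=
    injective_rat_den_num.tsum_eq (f := g) fun p hp => by
      by_contra h
      exact hp (hrange p h)
  rw [← h1, h2, ← (hgs.hasSum.prod_fiberwise houter).tsum_eq, tsum_mul_left,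
    ((summable_totientTerm hs).mul_right _).tsum_add (summable_coprimeTerm hs1), tsum_mul_right,
    totientSeries, discrepancySeries]
  ring

theorem summable_fibreSum {s : ℂ} (hs : 1 < s.re) :
    Summable fun p : ℚ × ℕ => fibreSum s p.1.den p.1.num p.2 := by
  obtain ⟨M, hM, -, h⟩ := exists_fibreError_majorant (σ₀ := s.re) (by linarith)
  have := (Summable.of_norm_bounded (hM.mul_left _) fun p => h p s le_rfl).add (summable_fibreMain hs)
  simpa using this

theorem tsum_fibreSum {s : ℂ} (hs : 1 < s.re) :
    ∑' p : ℚ × ℕ, fibreSum s p.1.den p.1.num p.2 =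
      riemannZeta (2 * s - 1) / riemannZeta (2 * s) *
        (archDensity s * totientSeries s + discrepancySeries s) + fibreError s := by
  rw [← tsum_fibreMain hs, fibreError, ← (summable_fibreMain hs).tsum_add]
  · simp
  · exact (summable_fibreSum hs).sub (summable_fibreMain hs)

end MainTerm

/-! ### The affine chart of the open subset -/

section Chart

/-- The point of the surface with affine coordinates `y = x₆ / x₅`, `z = x₃ / x₅`. -/
def affineVector {R : Type*} [CommRing R] (y z : R) : Fin 7 → R :=
  ![z * (-y ^ 2 - z), z * y, (-y ^ 2 - z) * y, z, -y ^ 2 - z, 1, y]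

theorem affineVector_ne_zero (y z : ℚ) : affineVector y z ≠ 0 := fun h => by
  have := congrFun h 5
  simp [affineVector] at this

theorem SurfaceEquations.smul {x : Fin 7 → ℚ} (h : SurfaceEquations x) (c : ℚ) :
    SurfaceEquations (c • x) := by
  obtain ⟨h1, h2, h3, h4, h5, h6, h7, h8, h9⟩ := h
  simp only [SurfaceEquations, Pi.smul_apply, smul_eq_mul]
  refine ⟨?_, ?_, ?_, ?_, ?_, ?_, ?_, ?_, ?_⟩
  · linear_combination c ^ 2 * h1
  · linear_combination c ^ 2 * h2
  · linear_combination c ^ 2 * h3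
  · linear_combination c ^ 2 * h4
  · linear_combination c ^ 2 * h5
  · linear_combination c ^ 2 * h6
  · linear_combination c ^ 2 * h7
  · linear_combination c ^ 2 * h8
  · linear_combination c ^ 2 * h9

theorem surfaceEquations_affineVector (y z : ℚ) : SurfaceEquations (affineVector y z) := by
  refine ⟨?_, ?_, ?_, ?_, ?_, ?_, ?_, ?_, ?_⟩ <;> simp [affineVector] <;> ring

theorem eq_smul_affineVector {x : Fin 7 → ℚ} (h : SurfaceEquations x) (h5 : x 5 ≠ 0) :
    x 5 • affineVector (x 6 / x 5) (x 3 / x 5) = x := by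
  obtain ⟨e1, e2, e3, e4, e5, e6, e7, e8, e9⟩ := h
  have hw : -(x 6 / x 5) ^ 2 - x 3 / x 5 = x 4 / x 5 := by
    field_simp
    linear_combination -e4
  ext i
  rw [affineVector, hw]
  fin_cases i <;> simp <;> field_simp <;> linarith

/-- If `x₅ = 0`, the equations force in turn `x₆² = 0`, `x₃² = x₄² = 0` and `x₁ x₂ = 0`, which
places the point on one of the two lines. -/
theorem apply_five_ne_zero {x : Fin 7 → ℚ} (h : SurfaceEquations x) (h1 : ¬ LineOneEquations x)
    (h2 : ¬ LineTwoEquations x) : x 5 ≠ 0 := by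
  intro h5
  obtain ⟨e1, e2, e3, e4, e5, e6, e7, e8, e9⟩ := h
  have h6 : x 6 = 0 := by
    rw [h5] at e4
    simpa using e4
  have h3 : x 3 = 0 := by
    rw [h5, h6] at e1
    simpa using e1
  have h4 : x 4 = 0 := by
    rw [h5, h6] at e7
    simpa using e7
  rw [h3, h4] at e3
  rcases mul_eq_zero.1 (by simpa using e3 : x 1 * x 2 = 0) with h | h
  · exact h1 ⟨h, h3, h4, h5, h6⟩
  · exact h2 ⟨h, h3, h4, h5, h6⟩

/-- The point of the surface with affine coordinates `y` and `z`, as a projective point. -/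
def affinePoint (y z : ℚ) : Projectivization ℚ (Fin 7 → ℚ) :=
  .mk ℚ (affineVector y z) (affineVector_ne_zero y z)

theorem affinePoint_mem_openPoints (y z : ℚ) : affinePoint y z ∈ openPoints := by
  obtain ⟨c, hc⟩ := Projectivization.exists_smul_eq_mk_rep ℚ _ (affineVector_ne_zero y z)
  have h5 : (affinePoint y z).rep 5 ≠ 0 := by
    rw [affinePoint, ← hc]
    simp [affineVector, Units.smul_def]
  refine ⟨?_, ?_⟩
  · change SurfaceEquations (Projectivization.mk _ _ _).rep
    rw [← hc]
    exact (surfaceEquations_affineVector y z).smul c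
  · rintro (⟨-, -, -, h, -⟩ | ⟨-, -, -, h, -⟩) <;> exact h5 h

/-- The parametrization of the open subset by the affine plane, with the second coordinate
rescaled by the squared denominator of the first. -/
def fibrePoint (p : ℚ × ℚ) : openPoints :=
  ⟨affinePoint p.1 (p.2 / p.1.den ^ 2), affinePoint_mem_openPoints _ _⟩

theorem affinePoint_injective {y z y' z' : ℚ} (h : affinePoint y z = affinePoint y' z') :
    y = y' ∧ z = z' := by
  rw [affinePoint, affinePoint, Projectivization.mk_eq_mk_iff'] at h
  obtain ⟨a, ha⟩ := h
  have h5 := congrFun ha 5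
  have h6 := congrFun ha 6
  have h3 := congrFun ha 3
  simp [affineVector] at h5 h6 h3
  subst h5
  simp at h6 h3
  exact ⟨h6.symm, h3.symm⟩

theorem bijective_fibrePoint : Function.Bijective fibrePoint := by
  constructor
  · rintro ⟨y, z⟩ ⟨y', z'⟩ h
    obtain ⟨h1, h2⟩ := affinePoint_injective (Subtype.ext_iff.1 h)
    dsimp only at h1 h2
    subst h1
    have hd : (y.den : ℚ) ≠ 0 := by exact_mod_cast y.den_pos.ne'
    rw [Prod.mk.injEq]
    refine ⟨rfl, ?_⟩
    field_simp at h2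
    exact h2
  · rintro ⟨x, hx⟩
    obtain ⟨h1, h2⟩ := hx
    have h5 := apply_five_ne_zero h1 (fun h => h2 (Or.inl h)) (fun h => h2 (Or.inr h))
    set y := x.rep 6 / x.rep 5
    have hd : (y.den : ℚ) ≠ 0 := by exact_mod_cast y.den_pos.ne'
    refine ⟨(y, x.rep 3 / x.rep 5 * y.den ^ 2), Subtype.ext ?_⟩
    simp only [fibrePoint]
    rw [mul_div_cancel_right₀ _ (pow_ne_zero 2 hd), affinePoint]
    conv_rhs => rw [← x.mk_rep]
    rw [Projectivization.mk_eq_mk_iff']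
    exact ⟨(x.rep 5)⁻¹, by rw [inv_smul_eq_iff₀ h5]; exact (eq_smul_affineVector h1 h5).symm⟩

end Chart

/-! ### Primitive representatives and the height formula -/

section PrimitiveVector

/-- The primitive integer vector of a point of the open subset. -/
def primitiveVector (q n a u v u' v' q' : ℤ) : Fin 7 → ℤ :=
  ![u' * v', u * a * n * q', v * a * n * q', u * n * q * q', v * n * q * q', n ^ 2 * q ^ 3 * q',
    a * n ^ 2 * q ^ 2 * q']

/-- Suppose a prime `p` divides all coordinates; then it divides `u'` or `v'`. If `p ∣ n`, this
contradicts `(u, n) = 1`. Otherwise the coordinate `n² q³ q'` gives `p ∣ q`, so `p` does not divide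
`a` and cannot divide both `u` and `v`. If, say, `p ∣ u'`, the coordinate `v a n q'` then yields `p
∣ q'`, against the coprimality of `u'` and `f q'`. -/
theorem gcd_primitiveVector {q n a u v u' v' q' e f : ℤ} (hu : u = e * u') (hv : v = f * v')
    (hq : q = e * f * q') (h1 : IsCoprime u' (f * q')) (h2 : IsCoprime v' (e * q'))
    (ha : IsCoprime a q) (hn : IsCoprime u n) (huv : u + v = -(n * a ^ 2)) :
    Finset.univ.gcd (primitiveVector q n a u v u' v' q') = 1 := by
  by_contra hne
  have hne' : (Finset.univ.gcd (primitiveVector q n a u v u' v' q')).natAbs ≠ 1 := fun h => by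
    refine hne ?_
    rw [← Finset.normalize_gcd, ← Int.abs_eq_normalize, Int.abs_eq_natAbs, h]
    rfl
  obtain ⟨p, hp, hdvd⟩ := Int.exists_prime_and_dvd hne'
  have hd : ∀ i, p ∣ primitiveVector q n a u v u' v' q' i := fun i =>
    hdvd.trans (Finset.gcd_dvd (Finset.mem_univ i))
  have d0 : p ∣ u' * v' := hd 0
  have d1 : p ∣ u * a * n * q' := hd 1
  have d2 : p ∣ v * a * n * q' := hd 2
  have d5 : p ∣ n ^ 2 * q ^ 3 * q' := hd 5
  have hcop : ∀ {x y : ℤ}, IsCoprime x y → p ∣ x → p ∣ y → False := fun h hx hy =>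
    hp.not_isUnit (h.isUnit_of_dvd' hx hy)
  have huu : p ∣ u' → p ∣ u := fun h => hu ▸ h.mul_left e
  have hvv : p ∣ v' → p ∣ v := fun h => hv ▸ h.mul_left f
  by_cases hpn : p ∣ n
  · rcases hp.dvd_or_dvd d0 with h | h
    · exact hcop hn (huu h) hpn
    · refine hcop hn ?_ hpn
      rw [show u = -(n * a ^ 2) - v by linarith]
      exact dvd_sub ((hpn.mul_right _).neg_right) (hvv h)
  · have hpq : p ∣ q := by
      rcases hp.dvd_or_dvd d5 with h | h
      · rcases hp.dvd_or_dvd h with h | h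
        · exact absurd (hp.dvd_of_dvd_pow h) hpn
        · exact hp.dvd_of_dvd_pow h
      · exact hq ▸ h.mul_left _
    have hpa : ¬ p ∣ a := fun h => hcop ha h hpq
    have hcontra : ¬ (p ∣ u ∧ p ∣ v) := fun ⟨h, h'⟩ => by
      have := dvd_add h h'
      rw [huv, dvd_neg] at this
      rcases hp.dvd_or_dvd this with h | h
      · exact hpn h
      · exact hpa (hp.dvd_of_dvd_pow h)
    have hsplit : ∀ {x : ℤ}, p ∣ x * a * n * q' → p ∣ x ∨ p ∣ q' := fun h => by
      rcases hp.dvd_or_dvd h with h | h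
      · rcases hp.dvd_or_dvd h with h | h
        · rcases hp.dvd_or_dvd h with h | h
          · exact Or.inl h
          · exact absurd h hpa
        · exact absurd h hpn
      · exact Or.inr h
    rcases hp.dvd_or_dvd d0 with h | h
    · rcases hsplit d2 with h' | h'
      · exact hcontra ⟨huu h, h'⟩
      · exact hcop h1 h (h'.mul_left f)
    · rcases hsplit d1 with h' | h'
      · exact hcontra ⟨h', hvv h⟩
      · exact hcop h2 h (h'.mul_left e)

/-- Clearing denominators takes `q⁴ n²`, because `x₀ = z w`; the factor `e f` is the cancellation in
`u v` allowed by the other coordinates. -/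
theorem primitiveVector_eq_smul {q n a u v u' v' q' e f : ℤ} (hu : u = e * u') (hv : v = f * v')
    (hq : q = e * f * q') (hq0 : q ≠ 0) (hn : n ≠ 0) (huv : u + v = -(n * a ^ 2)) :
    (fun i => (primitiveVector q n a u v u' v' q' i : ℚ)) =
      ((q : ℚ) ^ 4 * n ^ 2 / (e * f)) • affineVector ((a : ℚ) / q) ((u : ℚ) / n / q ^ 2) := by
  have hq0' : (q : ℚ) ≠ 0 := by exact_mod_cast hq0
  have hn' : (n : ℚ) ≠ 0 := by exact_mod_cast hn
  have hef : e * f * q' ≠ 0 := hq ▸ hq0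
  have he : (e : ℚ) ≠ 0 := by exact_mod_cast left_ne_zero_of_mul (left_ne_zero_of_mul hef)
  have hf : (f : ℚ) ≠ 0 := by exact_mod_cast right_ne_zero_of_mul (left_ne_zero_of_mul hef)
  have hw : -((a : ℚ) / q) ^ 2 - (u : ℚ) / n / q ^ 2 = (v : ℚ) / n / q ^ 2 := by
    have : (u : ℚ) + v = -(n * a ^ 2) := by exact_mod_cast huv
    field_simp
    linarith
  have hq' : (q' : ℚ) = q / (e * f) := by
    rw [hq]
    push_cast
    field_simp
  have hu' : (u' : ℚ) = u / e := by
    rw [hu]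
    push_cast
    field_simp
  have hv' : (v' : ℚ) = v / f := by
    rw [hv]
    push_cast
    field_simp
  ext i
  rw [affineVector, hw]
  fin_cases i <;> simp [primitiveVector, hq', hu', hv'] <;> field_simp

theorem abs_affineVector_le_archHeight (y z : ℝ) (i : Fin 7) :
    |affineVector y z i| ≤ archHeight y z := by
  have hw : |(-y ^ 2 - z)| = |y ^ 2 + z| := by rw [← abs_neg]; ring_nf
  unfold archHeight
  set A := |z| with hA
  set B := |y ^ 2 + z| with hB
  have hA0 : 0 ≤ A := abs_nonneg _
  have hB0 : 0 ≤ B := abs_nonneg _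
  have a1 : A ≤ max (max A B) 1 := (le_max_left _ _).trans (le_max_left _ _)
  have a2 : B ≤ max (max A B) 1 := (le_max_right _ _).trans (le_max_left _ _)
  have a3 : 1 ≤ max (max A B) 1 := le_max_right _ _
  have b1 : |y| ≤ max (min A B) (max |y| 1) := (le_max_left _ _).trans (le_max_right _ _)
  have b2 : 1 ≤ max (min A B) (max |y| 1) := (le_max_right _ _).trans (le_max_right _ _)
  have key : ∀ {x x' : ℝ}, 0 ≤ x' → x ≤ max (max A B) 1 → x' ≤ max (min A B) (max |y| 1) →
      x * x' ≤ max (max A B) 1 * max (min A B) (max |y| 1) := fun h0 h h' =>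
    mul_le_mul h h' h0 (by linarith)
  fin_cases i
  · change |z * (-y ^ 2 - z)| ≤ _
    rw [abs_mul, hw, ← max_mul_min]
    exact key (le_min hA0 hB0) (le_max_left _ _) (le_max_left _ _)
  · change |z * y| ≤ _
    rw [abs_mul]
    exact key (abs_nonneg _) a1 b1
  · change |(-y ^ 2 - z) * y| ≤ _
    rw [abs_mul, hw]
    exact key (abs_nonneg _) a2 b1
  · change |z| ≤ _
    simpa using key zero_le_one a1 b2
  · change |(-y ^ 2 - z)| ≤ _
    rw [hw]
    simpa using key zero_le_one a2 b2
  · change |(1 : ℝ)| ≤ _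
    simpa using key zero_le_one a3 b2
  · change |y| ≤ _
    simpa using key (abs_nonneg y) a3 b1

/-- The product of maxima is attained by a coordinate: if `|z|` and `|w|` are at most `1` it is
`|y|` or `1`; otherwise it is `max · min = |z w|`, or the larger of `|z|`, `|w|` times `|y|` or `1`.
-/
theorem exists_archHeight_le_abs_affineVector (y z : ℝ) :
    ∃ i, archHeight y z ≤ |affineVector y z i| := by
  have hw : |(-y ^ 2 - z)| = |y ^ 2 + z| := by rw [← abs_neg]; ring_nf
  unfold archHeight
  rcases le_total (max |z| |y ^ 2 + z|) 1 with h1 | h1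
  · have h2 : min |z| |y ^ 2 + z| ≤ max |y| 1 :=
      (min_le_max.trans h1).trans (le_max_right _ _)
    rw [max_eq_right h1, max_eq_right h2, one_mul]
    rcases max_choice |y| 1 with h | h <;> rw [h]
    · exact ⟨6, le_rfl⟩
    · exact ⟨5, by simp [affineVector]⟩
  · rw [max_eq_left h1]
    rcases max_choice (min |z| |y ^ 2 + z|) (max |y| 1) with h | h <;> rw [h]
    · refine ⟨0, ?_⟩
      rw [max_mul_min, ← hw, ← abs_mul]
      exact le_rfl
    · rcases max_choice |z| |y ^ 2 + z| with h3 | h3 <;> rw [h3] <;>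
        rcases max_choice |y| 1 with h4 | h4 <;> rw [h4]
      · exact ⟨1, by rw [← abs_mul]; exact le_rfl⟩
      · exact ⟨3, by rw [mul_one]; exact le_rfl⟩
      · exact ⟨2, by rw [← hw, ← abs_mul]; exact le_rfl⟩
      · exact ⟨4, by rw [mul_one, ← hw]; exact le_rfl⟩

end PrimitiveVector

/-! ### The height zeta function as a sum over fibres -/

section Reindexing

theorem cast_affineVector (y z : ℚ) (i : Fin 7) :
    ((affineVector y z i : ℚ) : ℝ) = affineVector (y : ℝ) (z : ℝ) i := by
  fin_cases i <;> simp [affineVector]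

theorem isCoprime_gcd_gcd {q n a u : ℤ} (ha : IsCoprime a q) (hu : IsCoprime u n) :
    IsCoprime (Int.gcd u q : ℤ) (Int.gcd (n * a ^ 2 + u) q) := by
  set e : ℤ := (Int.gcd u q : ℤ) with he
  set f : ℤ := (Int.gcd (n * a ^ 2 + u) q : ℤ) with hf
  have e1 : e ∣ u := Int.gcd_dvd_left _ _
  have e2 : e ∣ q := Int.gcd_dvd_right _ _
  have f1 : f ∣ n * a ^ 2 + u := Int.gcd_dvd_left _ _
  have b1 : IsCoprime e (n * a ^ 2) := (hu.of_isCoprime_of_dvd_left e1).mul_right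
    (IsCoprime.pow_right (ha.of_isCoprime_of_dvd_right e2).symm)
  obtain ⟨k, hk⟩ := e1
  have b2 : IsCoprime e (n * a ^ 2 + u) := by
    rw [hk]
    exact b1.add_mul_left_right k
  exact b2.of_isCoprime_of_dvd_right f1

theorem pointHeight_eq_of_smul {x : Projectivization ℚ (Fin 7 → ℚ)} {v : Fin 7 → ℤ}
    {y z c : ℚ} (hv : IsPrimitiveRep x v) (hc : 0 ≤ c)
    (h : (fun i => (v i : ℚ)) = c • affineVector y z) :
    (pointHeight x : ℝ) = c * archHeight y z := by
  have hi : ∀ i, ((v i).natAbs : ℝ) = c * |affineVector (y : ℝ) (z : ℝ) i| := fun i => by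
    have h1 := congrFun h i
    have h2 : ((v i : ℤ) : ℝ) = c * affineVector (y : ℝ) (z : ℝ) i := by
      rw [← cast_affineVector]
      exact_mod_cast h1
    have hc' : (0 : ℝ) ≤ c := by exact_mod_cast hc
    rw [Nat.cast_natAbs, Int.cast_abs, h2, abs_mul, abs_of_nonneg hc']
  have hc' : (0 : ℝ) ≤ c := by exact_mod_cast hc
  rw [pointHeight_eq hv]
  refine le_antisymm ?_ ?_
  · obtain ⟨i, -, h1⟩ := Finset.exists_mem_eq_sup (Finset.univ : Finset (Fin 7))
      Finset.univ_nonempty fun i => (v i).natAbs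
    rw [h1, hi]
    gcongr
    exact abs_affineVector_le_archHeight _ _ _
  · obtain ⟨i, h1⟩ := exists_archHeight_le_abs_affineVector (y : ℝ) (z : ℝ)
    calc c * archHeight y z ≤ c * |affineVector (y : ℝ) (z : ℝ) i| := by gcongr
      _ = ((v i).natAbs : ℝ) := (hi i).symm
      _ ≤ _ := by
          exact_mod_cast Finset.le_sup (f := fun i => (v i).natAbs) (Finset.mem_univ i)

/-- Measuring `z` in units of `1/q²` makes `u = q² n z` and `v = -(n a² + u)` integral, so that all
cancellation is recorded by the two gcd's with `q`. -/
theorem pointHeight_fibrePoint (y t : ℚ) :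
    (pointHeight (fibrePoint (y, t)).1 : ℝ) =
      (y.den : ℝ) ^ 4 * t.den ^ 2 /
        (Int.gcd t.num y.den * Int.gcd (t.den * y.num ^ 2 + t.num) y.den) *
        archHeight ((y.num : ℝ) / y.den) ((t.num : ℝ) / (t.den * y.den ^ 2)) := by
  set q : ℤ := (y.den : ℤ) with hq
  set n : ℤ := (t.den : ℤ) with hn
  set a := y.num with ha
  set u := t.num with hu
  have hq0 : q ≠ 0 := by rw [hq]; exact_mod_cast y.den_pos.ne'
  have hn0 : n ≠ 0 := by rw [hn]; exact_mod_cast t.den_pos.ne'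
  have haq : IsCoprime a q := y.isCoprime_num_den
  have hun : IsCoprime u n := t.isCoprime_num_den
  set e := Int.gcd u q with he
  set f := Int.gcd (n * a ^ 2 + u) q with hf
  have he0 : 0 < e := Int.gcd_pos_of_ne_zero_right _ hq0
  have hf0 : 0 < f := Int.gcd_pos_of_ne_zero_right _ hq0
  have hef : IsCoprime (e : ℤ) f := isCoprime_gcd_gcd haq hun
  obtain ⟨u', q₁, c1, hu', hq₁⟩ := Int.exists_gcd_one he0
  obtain ⟨v₀, q₂, c2, hv', hq₂⟩ := Int.exists_gcd_one hf0
  rw [← he] at hu' hq₁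
  rw [← hf] at hv' hq₂
  obtain ⟨q', hq'⟩ : (e * f : ℤ) ∣ q := hef.mul_dvd (Int.gcd_dvd_right _ _) (Int.gcd_dvd_right _ _)
  have he0' : (e : ℤ) ≠ 0 := by exact_mod_cast he0.ne'
  have hf0' : (f : ℤ) ≠ 0 := by exact_mod_cast hf0.ne'
  have e1 : q₁ = f * q' := mul_left_cancel₀ he0' (by linarith)
  have e2 : q₂ = e * q' := mul_left_cancel₀ hf0' (by linarith)
  have i1 : IsCoprime u' (f * q') := e1 ▸ Int.isCoprime_iff_gcd_eq_one.2 c1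
  have i2 : IsCoprime (-v₀) (e * q') := (e2 ▸ Int.isCoprime_iff_gcd_eq_one.2 c2 : IsCoprime v₀ _).neg_left
  have hU : u = e * u' := by linarith
  have hV : -(n * a ^ 2 + u) = f * -v₀ := by linarith
  have huv : u + -(n * a ^ 2 + u) = -(n * a ^ 2) := by ring
  have hgcd := gcd_primitiveVector hU hV hq' i1 i2 haq hun huv
  have hvec := primitiveVector_eq_smul hU hV hq' hq0 hn0 huv
  have hc : (0 : ℚ) < (q : ℚ) ^ 4 * n ^ 2 / (e * f) := by
    have : (0 : ℚ) < e := by exact_mod_cast he0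
    have : (0 : ℚ) < f := by exact_mod_cast hf0
    have : (q : ℚ) ≠ 0 := by exact_mod_cast hq0
    have : (n : ℚ) ≠ 0 := by exact_mod_cast hn0
    positivity
  have hy : (a : ℚ) / q = y := by
    rw [ha, hq]
    exact_mod_cast Rat.num_div_den y
  have ht : (u : ℚ) / n = t := by
    rw [hu, hn]
    exact_mod_cast Rat.num_div_den t
  have hqn : (q : ℚ) = y.den := by rw [hq]; rfl
  have hrep : IsPrimitiveRep (fibrePoint (y, t)).1
      (primitiveVector q n a u (-(n * a ^ 2 + u)) u' (-v₀) q') := by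
    have hvec' : (fun i => (primitiveVector q n a u (-(n * a ^ 2 + u)) u' (-v₀) q' i : ℚ)) =
        ((q : ℚ) ^ 4 * n ^ 2 / (e * f)) • affineVector y (t / y.den ^ 2) := by
      rw [← hqn, ← ht, ← hy]
      simpa [hy] using hvec
    refine ⟨hgcd, ?_, ?_⟩
    · rw [hvec']
      exact smul_ne_zero hc.ne' (affineVector_ne_zero _ _)
    · simp only [fibrePoint, affinePoint]
      rw [Projectivization.mk_eq_mk_iff']
      exact ⟨_, hvec'.symm⟩
  have := pointHeight_eq_of_smul hrep hc.le (by simpa using hvec)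
  rw [this]
  push_cast
  congr 2
  rw [hq, hn]
  push_cast
  exact div_div _ _ _

/-- The contribution to the height zeta function of the point above `a / q` with numerator `u` and
denominator `n`. -/
noncomputable def pointTerm (s : ℂ) (p : (ℚ × ℕ) × ℤ) : ℂ :=
  ((p.1.1.den ^ 4 * p.1.2 ^ 2 : ℕ) : ℂ) ^ (-s) * fibreTerm s p.1.1.den p.1.1.num p.1.2 p.2

theorem one_div_pointHeight_cpow (y t : ℚ) (s : ℂ) :
    1 / (pointHeight (fibrePoint (y, t)).1 : ℂ) ^ s = pointTerm s ((y, t.den), t.num) := by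
  have h := pointHeight_fibrePoint y t
  have hq' : (y.den : ℤ) ≠ 0 := by exact_mod_cast y.den_pos.ne'
  have h1 : 0 < Int.gcd t.num y.den := Int.gcd_pos_of_ne_zero_right _ hq'
  have h2 : 0 < Int.gcd (t.den * y.num ^ 2 + t.num) y.den := Int.gcd_pos_of_ne_zero_right _ hq'
  have hA := archHeight_pos ((y.num : ℝ) / y.den) ((t.num : ℝ) / (t.den * y.den ^ 2))
  rw [pointTerm, fibreTerm, if_pos t.isCoprime_num_den]
  set e := Int.gcd t.num y.den
  set f := Int.gcd (t.den * y.num ^ 2 + t.num) y.den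
  set A := archHeight ((y.num : ℝ) / y.den) ((t.num : ℝ) / (t.den * y.den ^ 2))
  have h3 : ((pointHeight (fibrePoint (y, t)).1 : ℕ) : ℂ) * ((e * f : ℕ) : ℂ) =
      ((y.den ^ 4 * t.den ^ 2 : ℕ) : ℂ) * (A : ℂ) := by
    have h0 : (0 : ℝ) < e * f := by exact_mod_cast Nat.mul_pos h1 h2
    have : (pointHeight (fibrePoint (y, t)).1 : ℝ) * ((e * f : ℕ) : ℝ) =
        ((y.den ^ 4 * t.den ^ 2 : ℕ) : ℝ) * A := by
      rw [h]
      push_cast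
      field_simp
    exact_mod_cast this
  have h4 : ((pointHeight (fibrePoint (y, t)).1 : ℕ) : ℂ) ^ s * ((e * f : ℕ) : ℂ) ^ s =
      ((y.den ^ 4 * t.den ^ 2 : ℕ) : ℂ) ^ s * (A : ℂ) ^ s := by
    rw [← Complex.natCast_mul_natCast_cpow, h3, ← Complex.ofReal_natCast, ← Complex.ofReal_mul,
      Complex.ofReal_mul, Complex.mul_cpow_ofReal_nonneg (by positivity) hA.le]
  have hN : ((y.den ^ 4 * t.den ^ 2 : ℕ) : ℂ) ^ s ≠ 0 := by
    have : 0 < y.den ^ 4 * t.den ^ 2 := by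
      have := y.den_pos
      have := t.den_pos
      positivity
    rw [Complex.cpow_ne_zero_iff]
    exact Or.inl (by exact_mod_cast this.ne')
  have hA' : (A : ℂ) ^ s ≠ 0 := by
    rw [Complex.cpow_ne_zero_iff]
    exact Or.inl (by exact_mod_cast hA.ne')
  have hE : ((e * f : ℕ) : ℂ) ^ s ≠ 0 := by
    rw [Complex.cpow_ne_zero_iff]
    exact Or.inl (by exact_mod_cast (Nat.mul_pos h1 h2).ne')
  have hP : ((pointHeight (fibrePoint (y, t)).1 : ℕ) : ℂ) ^ s ≠ 0 :=
    left_ne_zero_of_mul (h4 ▸ mul_ne_zero hN hA')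
  rw [Complex.cpow_neg, Complex.cpow_neg]
  field_simp
  linear_combination -h4

theorem ofReal_norm_pointTerm (s : ℂ) (p : (ℚ × ℕ) × ℤ) (hn : 0 < p.1.2) :
    ((‖pointTerm s p‖ : ℝ) : ℂ) = pointTerm s.re p := by
  obtain ⟨⟨y, n⟩, u⟩ := p
  dsimp only at hn
  have hq' : (y.den : ℤ) ≠ 0 := by exact_mod_cast y.den_pos.ne'
  have h1 : 0 < Int.gcd u y.den := Int.gcd_pos_of_ne_zero_right _ hq'
  have h2 : 0 < Int.gcd (n * y.num ^ 2 + u) y.den := Int.gcd_pos_of_ne_zero_right _ hq'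
  have h3 : 0 < y.den ^ 4 * n ^ 2 := by
    have := y.den_pos
    positivity
  have hA := archHeight_pos ((y.num : ℝ) / y.den) ((u : ℝ) / (n * y.den ^ 2))
  simp only [pointTerm, fibreTerm]
  split_ifs
  · rw [norm_mul, norm_mul, Complex.norm_natCast_cpow_of_pos h3,
      Complex.norm_natCast_cpow_of_pos (Nat.mul_pos h1 h2), norm_archHeight_cpow, Complex.neg_re]
    rw [Complex.ofReal_mul, Complex.ofReal_mul, Complex.ofReal_cpow (by positivity),
      Complex.ofReal_cpow (by positivity), Complex.ofReal_cpow hA.le]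
    push_cast
    rfl
  · simp

theorem pointTerm_zero {s : ℂ} (hs : 0 < s.re) (y : ℚ) (u : ℤ) : pointTerm s ((y, 0), u) = 0 := by
  simp [pointTerm, cpow_neg_zero_of_re_pos hs]

/-- The norms of the terms at `s` are the terms at the real point `Re s`, so absolute convergence
follows from the summability of the fibre sums there. -/
theorem summable_pointTerm {s : ℂ} (hs : 1 < s.re) : Summable (pointTerm s) := by
  have hs0 : 0 < s.re := by linarith
  have h : ∀ p : ℚ × ℕ, Summable fun u => ‖pointTerm s (p, u)‖ := by
    rintro ⟨y, n⟩
    rcases Nat.eq_zero_or_pos n with rfl | hn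
    · simp only [pointTerm_zero hs0, norm_zero]
      exact summable_zero
    · have h1 := ((tsum_fibreTerm (s := s) y.den_pos hn y.isCoprime_num_den
        (by linarith)).1.mul_left (((y.den ^ 4 * n ^ 2 : ℕ) : ℂ) ^ (-s))).norm
      simpa only [pointTerm] using h1
  have h0 : 0 ≤ fun p => ‖pointTerm s p‖ := fun p => norm_nonneg (pointTerm s p)
  refine Summable.of_norm ((summable_prod_of_nonneg h0).2 ⟨h, ?_⟩)
  refine (summable_fibreSum (s := (s.re : ℂ)) (by simpa using hs)).norm.congr ?_
  rintro ⟨y, n⟩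
  rw [fibreSum, ← tsum_mul_left]
  rcases Nat.eq_zero_or_pos n with rfl | hn
  · simp only [pointTerm_zero hs0]
    simp [cpow_neg_zero_of_re_pos (s := (s.re : ℂ)) (by simpa using hs0)]
  · have e : ∀ u : ℤ, ((y.den ^ 4 * n ^ 2 : ℕ) : ℂ) ^ (-(s.re : ℂ)) *
        fibreTerm s.re y.den y.num n u = ((‖pointTerm s ((y, n), u)‖ : ℝ) : ℂ) := fun u =>
      (ofReal_norm_pointTerm s ((y, n), u) hn).symm
    simp only [e]
    rw [← Complex.ofReal_tsum, Complex.norm_real, Real.norm_of_nonneg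
      (tsum_nonneg fun _ => norm_nonneg _)]

/-- Rational pairs as triples of a rational number, a denominator and a numerator. -/
def ratPairEmbedding (p : ℚ × ℚ) : (ℚ × ℕ) × ℤ := ((p.1, p.2.den), p.2.num)

theorem injective_ratPairEmbedding : Function.Injective ratPairEmbedding := by
  rintro ⟨y, t⟩ ⟨y', t'⟩ h
  simp only [ratPairEmbedding, Prod.mk.injEq] at h
  rw [h.1.1, Rat.ext h.2 h.1.2]

theorem pointTerm_eq_zero {s : ℂ} (hs : 0 < s.re) {p : (ℚ × ℕ) × ℤ} (hp : p ∉ range ratPairEmbedding) :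
    pointTerm s p = 0 := by
  obtain ⟨⟨y, n⟩, u⟩ := p
  rcases Nat.eq_zero_or_pos n with rfl | hn
  · exact pointTerm_zero hs y u
  · have : ¬ IsCoprime u n := fun h => hp (by
      obtain ⟨t, ht⟩ := mem_range_rat_den_num (p := (n, u)).2 ⟨hn, h⟩
      simp only [Prod.mk.injEq] at ht
      exact ⟨(y, t), by simp [ratPairEmbedding, ht.1, ht.2]⟩)
    simp [pointTerm, fibreTerm, this]

theorem summable_height {s : ℂ} (hs : 1 < s.re) :
    Summable fun x : openPoints => 1 / (pointHeight x.1 : ℂ) ^ s := by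
  rw [← (Equiv.ofBijective _ bijective_fibrePoint).summable_iff]
  refine ((summable_pointTerm hs).comp_injective injective_ratPairEmbedding).congr fun p => ?_
  exact (one_div_pointHeight_cpow p.1 p.2 s).symm

theorem heightZeta_eq_tsum_fibreSum {s : ℂ} (hs : 1 < s.re) :
    heightZeta s = ∑' p : ℚ × ℕ, fibreSum s p.1.den p.1.num p.2 := by
  rw [heightZeta, ← (Equiv.ofBijective _ bijective_fibrePoint).tsum_eq]
  have h1 : ∀ p : ℚ × ℚ, 1 / (pointHeight (fibrePoint p).1 : ℂ) ^ s = pointTerm s (ratPairEmbedding p) :=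
    fun p => one_div_pointHeight_cpow p.1 p.2 s
  simp only [Equiv.ofBijective_apply, h1]
  rw [injective_ratPairEmbedding.tsum_eq (f := pointTerm s) fun p hp => by
    by_contra h
    exact hp (pointTerm_eq_zero (by linarith) h)]
  rw [(summable_pointTerm hs).tsum_prod]
  refine tsum_congr fun p => ?_
  rw [fibreSum, ← tsum_mul_left]
  rfl

theorem heightZeta_eq {s : ℂ} (hs : 1 < s.re) :
    heightZeta s = riemannZeta (2 * s - 1) / riemannZeta (2 * s) *
      (archDensity s * totientSeries s + discrepancySeries s) + fibreError s := by
  rw [heightZeta_eq_tsum_fibreSum hs, tsum_fibreSum hs]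

end Reindexing

/-! ### Multiplicativity of the local coefficients -/

section Multiplicativity

theorem jordanCoeff_mul (s : ℂ) {m n : ℕ} (h : m.Coprime n) :
    jordanCoeff s (m * n) = jordanCoeff s m * jordanCoeff s n := by
  set P : ArithmeticFunction ℂ := ⟨fun n => if n = 0 then 0 else (n : ℂ) ^ s, by simp⟩ with hP
  have hPm : P.IsMultiplicative := by
    refine ArithmeticFunction.IsMultiplicative.iff_ne_zero.2 ⟨by simp [hP], fun {m n} hm hn _ => ?_⟩
    simp only [hP, ArithmeticFunction.coe_mk, hm, hn, mul_eq_zero, or_self, if_false]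
    rw [Nat.cast_mul, Complex.natCast_mul_natCast_cpow]
  have hJ : ∀ g, jordanCoeff s g = ((ArithmeticFunction.moebius : ArithmeticFunction ℂ) * P) g := by
    intro g
    rw [ArithmeticFunction.mul_apply, jordanCoeff]
    refine Finset.sum_congr rfl fun x hx => ?_
    have h2 : x.2 ≠ 0 := fun h0 => by
      have := Nat.mem_divisorsAntidiagonal.1 hx
      exact this.2 (by rw [← this.1, h0, mul_zero])
    simp [hP, h2]
  rw [hJ, hJ, hJ]
  exact (ArithmeticFunction.isMultiplicative_moebius.intCast.mul hPm).map_mul_of_coprime h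

theorem jordanCoeff_one (s : ℂ) : jordanCoeff s 1 = 1 := by simp [jordanCoeff]

theorem jordanCoeff_prime_pow (s : ℂ) {p : ℕ} (hp : p.Prime) (k : ℕ) :
    jordanCoeff s (p ^ (k + 1)) = ((p ^ (k + 1) : ℕ) : ℂ) ^ s - ((p ^ k : ℕ) : ℂ) ^ s := by
  rw [← sum_divisors_jordanCoeff s (pow_pos hp.pos (k + 1)), ← sum_divisors_jordanCoeff s (pow_pos hp.pos k),
    Nat.sum_divisors_prime_pow hp, Nat.sum_divisors_prime_pow hp, Finset.sum_range_succ _ (k + 1)]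
  ring

theorem eulerCorrection_mul (s : ℂ) {m n : ℕ} (h : m.Coprime n) :
    eulerCorrection s (m * n) = eulerCorrection s m * eulerCorrection s n := by
  rw [eulerCorrection, h.primeFactors_mul, Finset.prod_union h.disjoint_primeFactors]
  rfl

theorem eulerCorrection_one (s : ℂ) : eulerCorrection s 1 = 1 := by simp [eulerCorrection]

theorem eulerCorrection_prime_pow (s : ℂ) {p : ℕ} (hp : p.Prime) (k : ℕ) :
    eulerCorrection s (p ^ (k + 1)) = (1 - (p : ℂ) ^ (1 - 2 * s)) / (1 - (p : ℂ) ^ (-(2 * s))) := by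
  rw [eulerCorrection, Nat.primeFactors_prime_pow k.succ_ne_zero hp, Finset.prod_singleton]

/-- A divisor of `m n` factors uniquely into its gcd's with the coprime numbers `m` and `n`, and
coprimality of pairs respects this factorisation. -/
theorem sum_coprimePairs_mul {F : ℕ × ℕ → ℂ} {m n : ℕ} (h : m.Coprime n)
    (hF : ∀ g ∈ coprimePairs m 1, ∀ g' ∈ coprimePairs n 1,
      F (g.1 * g'.1, g.2 * g'.2) = F g * F g') :
    ∑ g ∈ coprimePairs (m * n) 1, F g =
      (∑ g ∈ coprimePairs m 1, F g) * ∑ g ∈ coprimePairs n 1, F g := by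
  rw [Finset.sum_mul_sum, ← Finset.sum_product']
  symm
  refine Finset.sum_bij' (fun x _ => (x.1.1 * x.2.1, x.1.2 * x.2.2))
    (fun g _ => ((Nat.gcd g.1 m, Nat.gcd g.2 m), (Nat.gcd g.1 n, Nat.gcd g.2 n))) ?_ ?_ ?_ ?_ ?_
  · rintro ⟨g, g'⟩ hx
    simp only [Finset.mem_product, mem_coprimePairs, Nat.coprime_one_right_iff, and_true] at hx ⊢
    obtain ⟨⟨⟨a1, a2, a3⟩, a4⟩, ⟨b1, b2, b3⟩, b4⟩ := hx
    have c1 : g.1.Coprime g'.2 := (h.coprime_dvd_left a1).coprime_dvd_right b2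
    have c2 : g'.1.Coprime g.2 := ((h.coprime_dvd_left a2).coprime_dvd_right b1).symm
    exact ⟨⟨Nat.mul_dvd_mul a1 b1, Nat.mul_dvd_mul a2 b2, Nat.mul_ne_zero a3 b3⟩,
      (a4.mul_right c1).mul_left (c2.mul_right b4)⟩
  · rintro g hg
    simp only [Finset.mem_product, mem_coprimePairs, Nat.coprime_one_right_iff, and_true] at hg ⊢
    obtain ⟨⟨-, -, a3⟩, a4⟩ := hg
    have a3' := mul_ne_zero_iff.1 a3
    exact ⟨⟨⟨Nat.gcd_dvd_right _ _, Nat.gcd_dvd_right _ _, a3'.1⟩,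
      (a4.coprime_dvd_left (Nat.gcd_dvd_left _ _)).coprime_dvd_right (Nat.gcd_dvd_left _ _)⟩,
      ⟨Nat.gcd_dvd_right _ _, Nat.gcd_dvd_right _ _, a3'.2⟩,
      (a4.coprime_dvd_left (Nat.gcd_dvd_left _ _)).coprime_dvd_right (Nat.gcd_dvd_left _ _)⟩
  · rintro ⟨g, g'⟩ hx
    simp only [Finset.mem_product, mem_coprimePairs] at hx
    obtain ⟨⟨⟨a1, a2, -⟩, -⟩, ⟨b1, b2, -⟩, -⟩ := hx
    have k1 : ∀ {a b : ℕ}, a ∣ m → b ∣ n → Nat.gcd (a * b) m = a := fun ha hb => by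
      rw [Nat.Coprime.gcd_mul_right_cancel _ (h.symm.coprime_dvd_left hb), Nat.gcd_eq_left ha]
    have k2 : ∀ {a b : ℕ}, a ∣ m → b ∣ n → Nat.gcd (a * b) n = b := fun ha hb => by
      rw [Nat.Coprime.gcd_mul_left_cancel _ (h.coprime_dvd_left ha), Nat.gcd_eq_left hb]
    simp only [k1 a1 b1, k1 a2 b2, k2 a1 b1, k2 a2 b2]
  · rintro g hg
    obtain ⟨⟨a1, a2, -⟩, -⟩ := mem_coprimePairs.1 hg
    simp only [← h.gcd_mul, Nat.gcd_eq_left a1, Nat.gcd_eq_left a2]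
  · rintro ⟨g, g'⟩ hx
    rw [Finset.mem_product] at hx
    exact (hF g hx.1 g' hx.2).symm

theorem localCoeff_mul (s : ℂ) {m n : ℕ} (h : m.Coprime n) :
    localCoeff s (m * n) = localCoeff s m * localCoeff s n := by
  refine sum_coprimePairs_mul h fun g hg g' hg' => ?_
  obtain ⟨⟨a1, a2, -⟩, a4, -⟩ := mem_coprimePairs.1 hg
  obtain ⟨⟨b1, b2, -⟩, b4, -⟩ := mem_coprimePairs.1 hg'
  have c1 : g.1.Coprime g'.1 := (h.coprime_dvd_left a1).coprime_dvd_right b1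
  have c2 : g.2.Coprime g'.2 := (h.coprime_dvd_left a2).coprime_dvd_right b2
  have c3 : (g.1 * g.2).Coprime (g'.1 * g'.2) :=
    (h.coprime_dvd_left (a4.mul_dvd_of_dvd_of_dvd a1 a2)).coprime_dvd_right
      (b4.mul_dvd_of_dvd_of_dvd b1 b2)
  dsimp only
  rw [jordanCoeff_mul s c1, jordanCoeff_mul s c2,
    show g.1 * g'.1 * (g.2 * g'.2) = g.1 * g.2 * (g'.1 * g'.2) by ring, eulerCorrection_mul s c3]
  push_cast
  ring

theorem sum_coprimePairs_prime_pow (F : ℕ × ℕ → ℂ) {p : ℕ} (hp : p.Prime) (k : ℕ) :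
    ∑ g ∈ coprimePairs (p ^ k) 1, F g = F (1, 1) +
      ∑ j ∈ Finset.range k, (F (1, p ^ (j + 1)) + F (p ^ (j + 1), 1)) := by
  have hc : ∀ i j : ℕ, (p ^ i).Coprime (p ^ j) ↔ i = 0 ∨ j = 0 := by
    intro i j
    constructor
    · intro h
      by_contra! hne
      have := Nat.Coprime.coprime_dvd_left (dvd_pow_self p hne.1)
        (Nat.Coprime.coprime_dvd_right (dvd_pow_self p hne.2) h)
      exact hp.one_lt.ne' ((Nat.coprime_self p).1 this)
    · rintro (rfl | rfl) <;> simp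
  rw [coprimePairs, Finset.sum_filter, Finset.sum_product, Nat.sum_divisors_prime_pow hp,
    Finset.sum_range_succ']
  simp only [Nat.sum_divisors_prime_pow hp, hc, Nat.coprime_one_right_iff, and_true]
  have e : ∑ j ∈ Finset.range (k + 1), (if True ∨ j = 0 then F (p ^ 0, p ^ j) else 0) =
      ∑ j ∈ Finset.range k, F (1, p ^ (j + 1)) + F (1, 1) := by
    simp [Finset.sum_range_succ']
  rw [Finset.sum_add_distrib, e]
  simp
  ring

/-- In a coprime pair of powers of `p` one entry is `1`, whence the factor `2`; the Euler correction
does not depend on the positive exponent, so a geometric sum remains. -/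
theorem localCoeff_prime_pow (s : ℂ) {p : ℕ} (hp : p.Prime) (k : ℕ) :
    localCoeff s (p ^ k) = 1 + 2 * ((1 - (p : ℂ) ^ (1 - 2 * s)) / (1 - (p : ℂ) ^ (-(2 * s))) *
      (1 - (p : ℂ) ^ (-s))) * ∑ j ∈ Finset.range k, ((p : ℂ) ^ (s - 1)) ^ (j + 1) := by
  rw [localCoeff, sum_coprimePairs_prime_pow _ hp, Finset.mul_sum]
  simp only [mul_one, one_mul, jordanCoeff_one, eulerCorrection_one, Nat.cast_one, div_one,
    eulerCorrection_prime_pow s hp, jordanCoeff_prime_pow s hp]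
  congr 1
  refine Finset.sum_congr rfl fun j _ => ?_
  have hp0 : (p : ℂ) ≠ 0 := by exact_mod_cast hp.ne_zero
  have e : (((p ^ (j + 1) : ℕ) : ℂ) ^ s - ((p ^ j : ℕ) : ℂ) ^ s) / ((p ^ (j + 1) : ℕ) : ℂ) =
      (1 - (p : ℂ) ^ (-s)) * ((p : ℂ) ^ (s - 1)) ^ (j + 1) := by
    rw [div_eq_iff (by exact_mod_cast (pow_pos hp.pos _).ne')]
    push_cast
    rw [mul_assoc, ← mul_pow, Complex.cpow_sub _ _ hp0, Complex.cpow_one, div_mul_cancel₀ _ hp0,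
      ← Complex.natCast_cpow_natCast_mul, ← Complex.natCast_cpow_natCast_mul, mul_comm _ s,
      mul_comm _ s, Complex.cpow_mul_nat, Complex.cpow_mul_nat, Complex.cpow_neg, pow_succ]
    have : (p : ℂ) ^ s ≠ 0 := by
      rw [Complex.cpow_ne_zero_iff]
      exact Or.inl hp0
    field_simp
  rw [e]
  ring

end Multiplicativity

/-! ### The Euler product of the main term -/

section EulerFactor

theorem hasSum_pow_mul_geom_sum {x t : ℂ} (hx : ‖x‖ < 1) (hxt : ‖x * t‖ < 1) (ht : t ≠ 1) (k : ℂ) :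
    HasSum (fun e : ℕ => x ^ (e + 1) * (1 + 2 * k * ∑ j ∈ Finset.range (e + 1), t ^ (j + 1)))
      (x / (1 - x) + 2 * k * (x * t) / ((1 - x) * (1 - x * t))) := by
  have h1 : 1 - x ≠ 0 := fun h => by rw [← sub_eq_zero.1 h] at hx; simp at hx
  have h2 : 1 - x * t ≠ 0 := fun h => by rw [← sub_eq_zero.1 h] at hxt; simp at hxt
  have h3 : t - 1 ≠ 0 := sub_ne_zero.2 ht
  have hs1 := (hasSum_geometric_of_norm_lt_one hx).mul_left (x * (1 - 2 * k * (t / (t - 1))))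
  have hs2 := (hasSum_geometric_of_norm_lt_one hxt).mul_left (x * t * (2 * k * (t / (t - 1))))
  convert! hs1.add hs2 using 1
  · ext e
    have : ∑ j ∈ Finset.range (e + 1), t ^ (j + 1) = t * ((t ^ (e + 1) - 1) / (t - 1)) := by
      rw [← geom_sum_eq ht, Finset.mul_sum]
      exact Finset.sum_congr rfl fun j _ => pow_succ' t j
    rw [this, mul_pow, pow_succ, pow_succ]
    ring
  · field_simp
    ring

theorem norm_prime_cpow_lt_one {p : ℕ} (hp : p.Prime) {w : ℂ} (h : w.re < 0) : ‖(p : ℂ) ^ w‖ < 1 := by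
  rw [Complex.norm_natCast_cpow_of_pos hp.pos]
  exact Real.rpow_lt_one_of_one_lt_of_neg (by exact_mod_cast hp.one_lt) h

theorem one_sub_prime_cpow_ne_zero_of_neg {p : ℕ} (hp : p.Prime) {w : ℂ} (h : w.re < 0) :
    1 - (p : ℂ) ^ w ≠ 0 := fun h0 => by
  have := norm_prime_cpow_lt_one hp h
  rw [← sub_eq_zero.1 h0] at this
  simp at this

/-- The local densities of the Dirichlet series `totientSeries`. -/
noncomputable def localFactor (s : ℂ) (p : ℕ) : ℂ :=
  1 + (1 - 1 / p) * ((p : ℂ) ^ (3 - 4 * s) / (1 - (p : ℂ) ^ (3 - 4 * s)) +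
    2 * ((1 - (p : ℂ) ^ (1 - 2 * s)) / (1 - (p : ℂ) ^ (-(2 * s))) * (1 - (p : ℂ) ^ (-s))) *
      (p : ℂ) ^ (2 - 3 * s) / ((1 - (p : ℂ) ^ (3 - 4 * s)) * (1 - (p : ℂ) ^ (2 - 3 * s))))

theorem localCoeff_one (s : ℂ) : localCoeff s 1 = 1 := by
  simpa using localCoeff_prime_pow s Nat.prime_two 0

theorem hasSum_localFactor {s : ℂ} (hs : 1 < s.re) {p : ℕ} (hp : p.Prime) :
    HasSum (fun e : ℕ => ((p ^ e : ℕ) : ℂ) ^ (2 - 4 * s) * localCoeff s (p ^ e) * (p ^ e).totient)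
      (localFactor s p) := by
  have hp0 : (p : ℂ) ≠ 0 := by exact_mod_cast hp.ne_zero
  have e13 : (p : ℂ) ^ (3 - 4 * s) * (p : ℂ) ^ (s - 1) = (p : ℂ) ^ (2 - 3 * s) := by
    rw [← Complex.cpow_add _ _ hp0]
    ring_nf
  have ht : (p : ℂ) ^ (s - 1) ≠ 1 := fun h => by
    have := norm_prime_cpow_lt_one hp (w := 1 - s) (by simp; linarith)
    rw [show 1 - s = -(s - 1) by ring, Complex.cpow_neg, h] at this
    simp at this
  have h := (hasSum_pow_mul_geom_sum (x := (p : ℂ) ^ (3 - 4 * s))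
    (norm_prime_cpow_lt_one hp (by simp; linarith))
    (e13 ▸ norm_prime_cpow_lt_one hp (by simp; linarith)) ht
    ((1 - (p : ℂ) ^ (1 - 2 * s)) / (1 - (p : ℂ) ^ (-(2 * s))) * (1 - (p : ℂ) ^ (-s)))).mul_left
      (1 - 1 / (p : ℂ))
  rw [e13] at h
  set f : ℕ → ℂ := fun e =>
    ((p ^ e : ℕ) : ℂ) ^ (2 - 4 * s) * localCoeff s (p ^ e) * (p ^ e).totient with hf
  have h0 : (fun e => (1 - 1 / (p : ℂ)) * (((p : ℂ) ^ (3 - 4 * s)) ^ (e + 1) *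
      (1 + 2 * ((1 - (p : ℂ) ^ (1 - 2 * s)) / (1 - (p : ℂ) ^ (-(2 * s))) * (1 - (p : ℂ) ^ (-s))) *
        ∑ j ∈ Finset.range (e + 1), ((p : ℂ) ^ (s - 1)) ^ (j + 1)))) = fun e => f (e + 1) := by
    ext e
    have e1 : ((p ^ (e + 1) : ℕ) : ℂ) ^ (2 - 4 * s) * (p ^ (e + 1)).totient =
        (1 - 1 / (p : ℂ)) * ((p : ℂ) ^ (3 - 4 * s)) ^ (e + 1) := by
      rw [Nat.totient_prime_pow_succ hp]
      push_cast [hp.one_le]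
      rw [← Complex.natCast_cpow_natCast_mul, mul_comm _ (2 - 4 * s), Complex.cpow_mul_nat,
        show 3 - 4 * s = (2 - 4 * s) + 1 by ring, Complex.cpow_add _ _ hp0, Complex.cpow_one, mul_pow,
        pow_succ (p : ℂ) e]
      field_simp
    rw [hf]
    dsimp only
    rw [localCoeff_prime_pow s hp, mul_right_comm (((p ^ (e + 1) : ℕ) : ℂ) ^ (2 - 4 * s)), e1]
    ring
  rw [h0] at h
  have := HasSum.zero_add (f := f) h
  simpa [localFactor, hf, localCoeff_one] using this

theorem hasProd_totientSeries {s : ℂ} (hs : 1 < s.re) :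
    HasProd (fun p : Nat.Primes => localFactor s p) (totientSeries s) := by
  have h := EulerProduct.eulerProduct_hasProd
    (f := fun q : ℕ => (q : ℂ) ^ (2 - 4 * s) * localCoeff s q * q.totient)
    (by simp [localCoeff_one])
    (fun {m n} hmn => by
      rw [localCoeff_mul s hmn, Nat.totient_mul hmn, Nat.cast_mul, Complex.natCast_mul_natCast_cpow]
      push_cast
      ring)
    (summable_totientTerm hs).norm (by simp)
  convert! h using 1
  ext p
  exact (hasSum_localFactor hs p.2).tsum_eq.symm

/-- The deviation from `1` of the local factors of the height zeta function after all the zeta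
factors have been split off. -/
noncomputable def localDefect (s : ℂ) (p : ℕ) : ℂ :=
  ((1 - (p : ℂ) ^ (2 - 3 * s)) * ((p : ℂ) ^ (-(2 * s)) * (p : ℂ) ^ (2 - 4 * s) -
      (p : ℂ) ^ (-(2 * s)) - (p : ℂ) ^ (2 - 4 * s)) +
    2 * (p : ℂ) ^ (2 - 3 * s) * ((1 - (p : ℂ) ^ (-1 : ℂ)) * (1 - (p : ℂ) ^ (-s)) *
      (1 - (p : ℂ) ^ (1 - 2 * s)) - 1)) / (1 + (p : ℂ) ^ (2 - 3 * s))

/-- With `X = p^(2-3s)`, the leading part `1 + 2X/(1 - X) = (1 - X²)/(1 - X)²` accounts for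
`ζ(3s-2)²/ζ(6s-4)`, and `p^(3-4s)` for `ζ(4s-3)`. The denominator `1 - p^(-2s)` produces the `ζ(2s)`
that cancels the one under `ζ(2s-1)`. The factor of `ζ(2s-1)` is carried along on both sides. -/
theorem localFactor_eq {s : ℂ} (hs : 1 < s.re) {p : ℕ} (hp : p.Prime) :
    localFactor s p * (1 - (p : ℂ) ^ (-(2 * s - 1)))⁻¹ * (1 - (p : ℂ) ^ (-(6 * s - 4)))⁻¹ =
      (1 + localDefect s p) * (1 - (p : ℂ) ^ (-(4 * s - 3)))⁻¹ * (1 - (p : ℂ) ^ (-(3 * s - 2)))⁻¹ *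
        (1 - (p : ℂ) ^ (-(3 * s - 2)))⁻¹ * (1 - (p : ℂ) ^ (-(2 * s - 1)))⁻¹ *
          (1 - (p : ℂ) ^ (-(2 * s)))⁻¹ := by
  have hp0 : (p : ℂ) ≠ 0 := by exact_mod_cast hp.ne_zero
  have n1 := one_sub_prime_cpow_ne_zero_of_neg hp (w := 3 - 4 * s) (by simp; linarith)
  have n2 := one_sub_prime_cpow_ne_zero_of_neg hp (w := 1 - 2 * s) (by simp; linarith)
  have n3 := one_sub_prime_cpow_ne_zero_of_neg hp (w := 2 - 3 * s) (by simp; linarith)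
  have n4 := one_sub_prime_cpow_ne_zero_of_neg hp (w := -(2 * s)) (by simp; linarith)
  have n5 := one_sub_prime_cpow_ne_zero_of_neg hp (w := 4 - 6 * s) (by simp; linarith)
  have e5 : (p : ℂ) ^ (4 - 6 * s) = ((p : ℂ) ^ (2 - 3 * s)) ^ 2 := by
    rw [sq, ← Complex.cpow_add _ _ hp0]
    ring_nf
  have eb : (p : ℂ) ^ (2 - 4 * s) = (p : ℂ) ^ (3 - 4 * s) / p := by
    rw [show 2 - 4 * s = 3 - 4 * s - 1 by ring, Complex.cpow_sub _ _ hp0, Complex.cpow_one]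
  rw [localFactor, localDefect, eb, Complex.cpow_neg_one, show -(2 * s - 1) = 1 - 2 * s by ring,
    show -(6 * s - 4) = 4 - 6 * s by ring, show -(4 * s - 3) = 3 - 4 * s by ring,
    show -(3 * s - 2) = 2 - 3 * s by ring]
  rw [e5] at n5 ⊢
  generalize (p : ℂ) ^ (3 - 4 * s) = x1 at *
  generalize (p : ℂ) ^ (2 - 3 * s) = x3 at *
  generalize (p : ℂ) ^ (1 - 2 * s) = x2 at *
  generalize (p : ℂ) ^ (-(2 * s)) = a at *
  generalize (p : ℂ) ^ (-s) = d at *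
  have n6 : 1 + x3 ≠ 0 := fun h => n5 (by linear_combination (1 - x3) * h)
  field_simp
  ring

theorem norm_natCast_cpow_le {p : ℕ} (hp : 0 < p) {w : ℂ} {c : ℝ} (h : w.re ≤ c) :
    ‖(p : ℂ) ^ w‖ ≤ (p : ℝ) ^ c := by
  rw [Complex.norm_natCast_cpow_of_pos hp]
  exact Real.rpow_le_rpow_of_exponent_le (by exact_mod_cast hp) h

theorem quarter_le_norm_one_add_prime_cpow {s : ℂ} (hs : 5 / 6 < s.re) {p : ℕ} (hp : p.Prime) :
    1 / 4 ≤ ‖1 + (p : ℂ) ^ (2 - 3 * s)‖ := by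
  have h1 := norm_prime_cpow_le hp (w := 2 - 3 * s) (c := 1 / 2) (by simp; linarith) (by norm_num)
  have h2 := norm_sub_norm_le (1 : ℂ) (-(p : ℂ) ^ (2 - 3 * s))
  rw [norm_one, norm_neg, sub_neg_eq_add] at h2
  have h3 : (2 : ℝ) ^ (-(1 / 2) : ℝ) ≤ 3 / 4 := by
    rw [Real.rpow_neg (by norm_num), ← Real.sqrt_eq_rpow, inv_le_comm₀ (by positivity) (by norm_num)]
    exact Real.le_sqrt_of_sq_le (by norm_num)
  linarith

/-- The critical term is `p^(2-3s) · p^(1-2s)`, of size at most `p^(-1/2) p^(-2/3) = p^(-7/6)` for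
`Re s > 5/6`. -/
theorem norm_localDefect_le {s : ℂ} (hs : 5 / 6 < s.re) {p : ℕ} (hp : p.Prime) :
    ‖localDefect s p‖ ≤ 80 * (p : ℝ) ^ (-(7 / 6) : ℝ) := by
  have hp1 : (1 : ℝ) ≤ p := by exact_mod_cast hp.one_le
  set D := (p : ℝ) ^ (-(2 / 3) : ℝ) with hD
  set E := (p : ℝ) ^ (-(7 / 6) : ℝ) with hE
  set F := (p : ℝ) ^ (-(1 / 2) : ℝ) with hF
  have hFD : F * D = E := by
    rw [hF, hD, hE, ← Real.rpow_add (by linarith)]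
    norm_num
  have ha := norm_natCast_cpow_le hp.pos (w := -(2 * s)) (c := -(7 / 6)) (by simp; linarith)
  have hb := norm_natCast_cpow_le hp.pos (w := 2 - 4 * s) (c := -(7 / 6)) (by simp; linarith)
  have hc := norm_natCast_cpow_le hp.pos (w := -1) (c := -(2 / 3)) (by simp; linarith)
  have hd := norm_natCast_cpow_le hp.pos (w := -s) (c := -(2 / 3)) (by simp; linarith)
  have h2 := norm_natCast_cpow_le hp.pos (w := 1 - 2 * s) (c := -(2 / 3)) (by simp; linarith)
  have h3 := norm_natCast_cpow_le hp.pos (w := 2 - 3 * s) (c := -(1 / 2)) (by simp; linarith)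
  have hq := quarter_le_norm_one_add_prime_cpow hs hp
  have hE1 : E ≤ 1 := Real.rpow_le_one_of_one_le_of_nonpos hp1 (by norm_num)
  have hD1 : D ≤ 1 := Real.rpow_le_one_of_one_le_of_nonpos hp1 (by norm_num)
  have hF1 : F ≤ 1 := Real.rpow_le_one_of_one_le_of_nonpos hp1 (by norm_num)
  have hE0 : 0 ≤ E := by positivity
  have hD0 : 0 ≤ D := by positivity
  have hF0 : 0 ≤ F := by positivity
  rw [localDefect, norm_div, div_le_iff₀ (by linarith)]
  generalize (p : ℂ) ^ (2 - 3 * s) = x3 at *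
  generalize (p : ℂ) ^ (1 - 2 * s) = x2 at *
  generalize (p : ℂ) ^ (2 - 4 * s) = b at *
  generalize (p : ℂ) ^ (-(2 * s)) = a at *
  generalize (p : ℂ) ^ (-s) = d at *
  generalize (p : ℂ) ^ (-1 : ℂ) = c at *
  have k : ∀ {x : ℂ} {r : ℝ}, ‖x‖ ≤ r → r ≤ 1 → ‖1 - x‖ ≤ 2 := fun h h' => by
    refine (norm_sub_le _ _).trans ?_
    rw [norm_one]
    linarith
  have g1 : ‖(1 - x3) * (a * b - a - b)‖ ≤ 2 * (3 * E) := by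
    rw [norm_mul]
    gcongr
    · exact k h3 hF1
    · refine (norm_sub_le _ _).trans ?_
      have := norm_sub_le (a * b) a
      have hab : ‖a * b‖ ≤ 1 * E := by
        rw [norm_mul]
        gcongr
        exact ha.trans hE1
      linarith
  have g2 : ‖(1 - c) * (1 - d) * (1 - x2) - 1‖ ≤ 7 * D := by
    have e : (1 - c) * (1 - d) * (1 - x2) - 1 = -c - d * (1 - c) - x2 * ((1 - c) * (1 - d)) := by ring
    rw [e]
    have b1 : ‖d * (1 - c)‖ ≤ D * 2 := by
      rw [norm_mul]
      gcongr
      exact k hc hD1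
    have b2 : ‖x2 * ((1 - c) * (1 - d))‖ ≤ D * (2 * 2) := by
      rw [norm_mul, norm_mul]
      gcongr
      · exact k hc hD1
      · exact k hd hD1
    have b3 := norm_sub_le (-c - d * (1 - c)) (x2 * ((1 - c) * (1 - d)))
    have b4 := norm_sub_le (-c) (d * (1 - c))
    rw [norm_neg] at b4
    linarith
  have g3 : ‖2 * x3 * ((1 - c) * (1 - d) * (1 - x2) - 1)‖ ≤ 2 * F * (7 * D) := by
    rw [norm_mul, norm_mul, Complex.norm_ofNat]
    gcongr
  have g4 := norm_add_le ((1 - x3) * (a * b - a - b)) (2 * x3 * ((1 - c) * (1 - d) * (1 - x2) - 1))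
  have g5 : 80 * E * (1 / 4) ≤ 80 * E * ‖1 + x3‖ := by gcongr
  have g6 : 2 * F * (7 * D) = 14 * E := by rw [← hFD]; ring
  linarith

/-- The Euler product of the local factors of the height zeta function after all the zeta factors
have been split off. -/
noncomputable def eulerRest (s : ℂ) : ℂ :=
  ∏' p : Nat.Primes, (1 + localDefect s p)

theorem summable_localDefect_bound :
    Summable fun p : Nat.Primes => 80 * ((p : ℕ) : ℝ) ^ (-(7 / 6) : ℝ) :=
  (Nat.Primes.summable_rpow.2 (by norm_num)).mul_left _

theorem hasProd_eulerRest {s : ℂ} (hs : 5 / 6 < s.re) :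
    HasProd (fun p : Nat.Primes => 1 + localDefect s p) (eulerRest s) :=
  (multipliable_one_add_of_summable (summable_localDefect_bound.of_nonneg_of_le
    (fun _ => norm_nonneg _) fun p => norm_localDefect_le hs p.2)).hasProd

theorem norm_eulerRest_le {s : ℂ} (hs : 5 / 6 < s.re) :
    ‖eulerRest s‖ ≤ Real.exp (∑' p : Nat.Primes, 80 * ((p : ℕ) : ℝ) ^ (-(7 / 6) : ℝ)) := by
  refine le_of_tendsto (hasProd_eulerRest hs).norm (Eventually.of_forall fun t => ?_)
  calc ∏ p ∈ t, ‖1 + localDefect s p‖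
      ≤ ∏ p ∈ t, Real.exp (80 * ((p : ℕ) : ℝ) ^ (-(7 / 6) : ℝ)) := by
        refine Finset.prod_le_prod (fun _ _ => norm_nonneg _) fun p _ => ?_
        have h1 := norm_add_le (1 : ℂ) (localDefect s p)
        have h2 := norm_localDefect_le hs p.2
        have h3 := Real.add_one_le_exp (80 * ((p : ℕ) : ℝ) ^ (-(7 / 6) : ℝ))
        rw [norm_one] at h1
        linarith
    _ = Real.exp (∑ p ∈ t, 80 * ((p : ℕ) : ℝ) ^ (-(7 / 6) : ℝ)) := (Real.exp_sum _ _).symm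
    _ ≤ _ := Real.exp_le_exp.2
        (summable_localDefect_bound.sum_le_tsum _ fun p _ => by positivity)

theorem isOpen_halfPlane (c : ℝ) : IsOpen {s : ℂ | c < s.re} :=
  isOpen_lt continuous_const Complex.continuous_re

theorem differentiableOn_localDefect {p : ℕ} (hp : p.Prime) :
    DifferentiableOn ℂ (fun s => localDefect s p) {s | 5 / 6 < s.re} := by
  have hp0 : (p : ℂ) ≠ 0 := by exact_mod_cast hp.ne_zero
  have h : ∀ a b : ℂ, Differentiable ℂ fun s : ℂ => (p : ℂ) ^ (a - b * s) := fun a b =>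
    ((differentiable_id.const_mul b).const_sub a).const_cpow (Or.inl hp0)
  have h2 : Differentiable ℂ fun s : ℂ => (p : ℂ) ^ (-(2 * s)) :=
    (differentiable_id.const_mul 2).neg.const_cpow (Or.inl hp0)
  have h1 : Differentiable ℂ fun s : ℂ => (p : ℂ) ^ (-s) :=
    differentiable_id.neg.const_cpow (Or.inl hp0)
  refine DifferentiableOn.div (Differentiable.differentiableOn ?_)
    ((h 2 3).const_add 1).differentiableOn fun s hs => ?_
  · exact (((h 2 3).const_sub 1).mul (((h2.mul (h 2 4)).sub h2).sub (h 2 4))).add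
      (((h 2 3).const_mul 2).mul ((((h1.const_sub 1).const_mul _).mul ((h 1 2).const_sub 1)).sub_const 1))
  · have := quarter_le_norm_one_add_prime_cpow hs hp
    exact norm_pos_iff.1 (by linarith)

theorem differentiableOn_eulerRest : DifferentiableOn ℂ eulerRest {s | 5 / 6 < s.re} := by
  have h := summable_localDefect_bound.hasProdLocallyUniformlyOn_one_add
    (f := fun (p : Nat.Primes) s => localDefect s p) (isOpen_halfPlane (5 / 6))
    (Eventually.of_forall fun p s hs => norm_localDefect_le hs p.2)
    (fun p => (differentiableOn_localDefect p.2).continuousOn)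
  exact h.differentiableOn (Eventually.of_forall fun t => by
    simpa [Finset.prod_fn] using DifferentiableOn.fun_finsetProd fun (p : Nat.Primes) _ =>
      (differentiableOn_localDefect p.2).const_add 1) (isOpen_halfPlane _)

/-- Both sides are values of convergent Euler products with the same factors. Stated without
division, so that no nonvanishing is needed. -/
theorem totientSeries_eq {s : ℂ} (hs : 1 < s.re) :
    totientSeries s * riemannZeta (2 * s - 1) * riemannZeta (6 * s - 4) =
      eulerRest s * riemannZeta (4 * s - 3) * riemannZeta (3 * s - 2) * riemannZeta (3 * s - 2) *
        riemannZeta (2 * s - 1) * riemannZeta (2 * s) := by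
  have hz : ∀ {w : ℂ}, 1 < w.re → _ := fun {w} h => riemannZeta_eulerProduct_hasProd (s := w) h
  have h1 := ((hasProd_totientSeries hs).mul (hz (w := 2 * s - 1) (by simp; linarith))).mul
    (hz (w := 6 * s - 4) (by simp; linarith))
  have h2 := (((((hasProd_eulerRest (s := s) (by linarith)).mul
    (hz (w := 4 * s - 3) (by simp; linarith))).mul (hz (w := 3 * s - 2) (by simp; linarith))).mul
    (hz (w := 3 * s - 2) (by simp; linarith))).mul (hz (w := 2 * s - 1) (by simp; linarith))).mul
    (hz (w := 2 * s) (by simp; linarith))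
  refine h1.unique ?_
  convert! h2 using 1
  ext p
  exact localFactor_eq hs p.2

end EulerFactor

/-! ### Bounds for the zeta function -/

section ZetaBounds

/-- The difference between a term of the zeta series and the corresponding integral. -/
noncomputable def zetaTerm (n : ℕ) (w : ℂ) : ℂ :=
  ((n + 1 : ℝ) : ℂ) ^ (-w) - ∫ x in Ioc (n + 1 : ℝ) (n + 2), ((max x 1 : ℝ) : ℂ) ^ (-w)

/-- The regular part of the Riemann zeta function at `1`. -/
noncomputable def zetaRegular (w : ℂ) : ℂ := ∑' n, zetaTerm n w

/-- The truncation `max x 1` is invisible on the cells, which lie in `[1, ∞)`. It makes the base at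
least `1` everywhere, as `differentiableOn_integral_cpow` requires. -/
theorem continuous_max_one_cpow (w : ℂ) : Continuous fun x : ℝ => ((max x 1 : ℝ) : ℂ) ^ (-w) :=
  (Complex.continuous_ofReal.comp (continuous_id.max continuous_const)).cpow continuous_const
    fun x => Or.inl (by
      simp only [Function.comp_apply, id, Complex.ofReal_re]
      exact lt_max_of_lt_right one_pos)

theorem differentiableOn_zetaTerm (n : ℕ) : DifferentiableOn ℂ (zetaTerm n) {w | 0 < w.re} := by
  have hn : ((n + 1 : ℝ) : ℂ) ≠ 0 := by exact_mod_cast n.succ_ne_zero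
  refine DifferentiableOn.sub (differentiable_id.neg.const_cpow (Or.inl hn)).differentiableOn ?_
  refine differentiableOn_integral_cpow _ (measurable_id.max measurable_const)
    (fun x => le_max_right x 1) fun σ _ => ?_
  have hc : Continuous fun x : ℝ => max x 1 ^ (-σ) :=
    (continuous_id.max continuous_const).rpow_const fun x =>
      Or.inl (lt_max_of_lt_right one_pos).ne'
  exact (hc.integrableOn_Icc (a := (n + 1 : ℝ)) (b := n + 2)).mono_set Ioc_subset_Icc_self

theorem norm_zetaTerm_le_of_forall {n : ℕ} {w : ℂ} {B : ℝ}
    (h : ∀ x : ℝ, n + 1 < x → x ≤ n + 2 → ‖((n + 1 : ℝ) : ℂ) ^ (-w) - (x : ℂ) ^ (-w)‖ ≤ B) :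
    ‖zetaTerm n w‖ ≤ B := by
  have hvol : (volume : Measure ℝ).real (Ioc (n + 1 : ℝ) (n + 2)) = 1 := by
    rw [Real.volume_real_Ioc_of_le (by linarith)]
    ring
  have hint : IntegrableOn (fun x : ℝ => ((max x 1 : ℝ) : ℂ) ^ (-w)) (Ioc (n + 1 : ℝ) (n + 2)) :=
    ((continuous_max_one_cpow w).integrableOn_Icc).mono_set Ioc_subset_Icc_self
  have hc : ((n + 1 : ℝ) : ℂ) ^ (-w) =
      ∫ _ in Ioc (n + 1 : ℝ) (n + 2), ((n + 1 : ℝ) : ℂ) ^ (-w) := by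
    rw [setIntegral_const, hvol, one_smul]
  rw [zetaTerm, hc, ← integral_sub (integrable_const _) hint]
  refine (norm_setIntegral_le_of_norm_le_const (by simp) (C := B) fun x hx => ?_).trans ?_
  · have : (1 : ℝ) ≤ x := by
      have : (0 : ℝ) ≤ n := n.cast_nonneg
      linarith [hx.1]
    rw [max_eq_left this]
    exact h x hx.1 hx.2
  · rw [hvol, mul_one]

theorem norm_zetaTerm_le_two_mul {n : ℕ} {w : ℂ} (hw : 0 ≤ w.re) :
    ‖zetaTerm n w‖ ≤ 2 * (n + 1 : ℝ) ^ (-w.re) := by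
  have hn : (0 : ℝ) < n + 1 := by positivity
  refine norm_zetaTerm_le_of_forall fun x hx _ => ?_
  refine (norm_sub_le _ _).trans ?_
  rw [Complex.norm_cpow_eq_rpow_re_of_pos hn, Complex.norm_cpow_eq_rpow_re_of_pos (hn.trans hx),
    Complex.neg_re, two_mul]
  exact add_le_add le_rfl (Real.rpow_le_rpow_of_nonpos hn hx.le (by linarith))

theorem norm_zetaTerm_le_norm_mul {n : ℕ} {w : ℂ} (hw : 0 ≤ w.re) :
    ‖zetaTerm n w‖ ≤ ‖w‖ * (n + 1 : ℝ) ^ (-w.re - 1) := by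
  have hn : (0 : ℝ) < n + 1 := by positivity
  refine norm_zetaTerm_le_of_forall fun x hx hx2 => ?_
  rw [norm_sub_rev]
  have := norm_sub_le_of_hasDerivAt_le (f := fun t : ℝ => (t : ℂ) ^ (-w))
    (f' := fun t => -w * (t : ℂ) ^ (-w - 1)) (B := fun t => ‖w‖ * (n + 1 : ℝ) ^ (-w.re - 1) * t)
    (B' := fun _ => ‖w‖ * (n + 1 : ℝ) ^ (-w.re - 1)) hx.le
    (fun t ht => hasDerivAt_ofReal_cpow (hn.trans_le ht.1) _)
    (fun t _ => by simpa using (hasDerivAt_id t).const_mul (‖w‖ * (n + 1 : ℝ) ^ (-w.re - 1)))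
    (fun t ht => by
      rw [norm_mul, norm_neg, Complex.norm_cpow_eq_rpow_re_of_pos (hn.trans_le ht.1)]
      simp only [Complex.sub_re, Complex.neg_re, Complex.one_re]
      exact mul_le_mul_of_nonneg_left (Real.rpow_le_rpow_of_nonpos hn ht.1 (by linarith))
        (norm_nonneg w))
  refine this.trans ?_
  rw [← mul_sub]
  exact mul_le_of_le_one_right (by positivity) (by linarith)

/-- The geometric mean of the trivial bound `n^(-σ)` and the derivative bound `‖w‖ n^(-σ-1)`: it
grows like `√|Im w|` and is summable for `σ > 1/2`. For `Re w > 2` the trivial bound alone suffices.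
-/
theorem norm_zetaTerm_le {σ₀ : ℝ} (h0 : 0 ≤ σ₀) (h1 : σ₀ ≤ 1) {w : ℂ} (hw : σ₀ ≤ w.re) (n : ℕ) :
    ‖zetaTerm n w‖ ≤ 2 * √(1 + |w.im|) * (n + 1 : ℝ) ^ (-(σ₀ + 1 / 2)) := by
  have hn : (1 : ℝ) ≤ n + 1 := by linarith [(n.cast_nonneg : (0 : ℝ) ≤ n)]
  have hn0 : (0 : ℝ) < n + 1 := by positivity
  have hR : 1 ≤ √(1 + |w.im|) := Real.one_le_sqrt.2 (by linarith [abs_nonneg w.im])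
  have hw0 : 0 ≤ w.re := h0.trans hw
  have g1 := norm_zetaTerm_le_two_mul (n := n) hw0
  rcases le_total w.re 2 with h | h
  · have g2 := norm_zetaTerm_le_norm_mul (n := n) hw0
    have g3 : ‖w‖ ≤ 2 * (1 + |w.im|) := by
      have := Complex.norm_le_abs_re_add_abs_im w
      rw [abs_of_nonneg hw0] at this
      linarith [abs_nonneg w.im]
    have g4 : ‖zetaTerm n w‖ ≤ 2 * √(1 + |w.im|) * (n + 1 : ℝ) ^ (-(w.re + 1 / 2)) := by
      refine abs_le_of_sq_le_sq' ?_ (by positivity) |>.2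
      rw [mul_pow, mul_pow, Real.sq_sqrt (by positivity), ← Real.rpow_natCast, ← Real.rpow_natCast (_ ^ _),
        ← Real.rpow_mul hn0.le]
      have g5 : (n + 1 : ℝ) ^ (-(w.re + 1 / 2) * (2 : ℕ)) =
          (n + 1 : ℝ) ^ (-w.re) * (n + 1 : ℝ) ^ (-w.re - 1) := by
        rw [← Real.rpow_add hn0]
        congr 1
        push_cast
        ring
      rw [g5, Real.rpow_natCast, sq]
      calc _ ≤ (2 * (n + 1 : ℝ) ^ (-w.re)) * (‖w‖ * (n + 1 : ℝ) ^ (-w.re - 1)) := by gcongr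
        _ ≤ (2 * (n + 1 : ℝ) ^ (-w.re)) * (2 * (1 + |w.im|) * (n + 1 : ℝ) ^ (-w.re - 1)) := by gcongr
        _ = _ := by ring
    refine g4.trans ?_
    gcongr
  · calc ‖zetaTerm n w‖ ≤ 2 * 1 * (n + 1 : ℝ) ^ (-w.re) := by simpa using g1
      _ ≤ _ := by
        gcongr
        linarith

theorem summable_succ_rpow {p : ℝ} (hp : 1 < p) : Summable fun n : ℕ => (n + 1 : ℝ) ^ (-p) := by
  have := (summable_nat_add_iff 1).2 (Real.summable_nat_rpow.2 (by linarith : -p < -1))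
  exact_mod_cast this

theorem summable_zetaTerm {w : ℂ} (hw : 1 / 2 < w.re) : Summable fun n => zetaTerm n w := by
  set σ₀ := min w.re 1 with hσ
  have h1 : 1 / 2 < σ₀ := lt_min hw (by norm_num)
  exact .of_norm_bounded ((summable_succ_rpow (by linarith)).mul_left _)
    fun n => norm_zetaTerm_le (by linarith) (min_le_right _ _) (min_le_left _ _) n

theorem exists_norm_zetaRegular_le {σ₀ : ℝ} (h0 : 1 / 2 < σ₀) :
    ∃ C : ℝ, 0 ≤ C ∧ ∀ w : ℂ, σ₀ ≤ w.re → ‖zetaRegular w‖ ≤ C * √(1 + |w.im|) := by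
  set σ₁ := min σ₀ 1 with hσ
  have h1 : 1 / 2 < σ₁ := lt_min h0 (by norm_num)
  have hs := summable_succ_rpow (p := σ₁ + 1 / 2) (by linarith)
  refine ⟨2 * ∑' n : ℕ, (n + 1 : ℝ) ^ (-(σ₁ + 1 / 2)), ?_, fun w hw => ?_⟩
  · have : 0 ≤ ∑' n : ℕ, (n + 1 : ℝ) ^ (-(σ₁ + 1 / 2)) := tsum_nonneg fun n => by positivity
    positivity
  · have := tsum_of_norm_bounded (hs.mul_left (2 * √(1 + |w.im|))).hasSum
      fun n => norm_zetaTerm_le (by linarith) (min_le_right _ _) ((min_le_left _ _).trans hw) n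
    rw [tsum_mul_left] at this
    calc _ ≤ _ := this
      _ = _ := by ring

theorem differentiableOn_zetaRegular : DifferentiableOn ℂ zetaRegular {w | 1 / 2 < w.re} := by
  intro w hw
  have hw' : 1 / 2 < w.re := hw
  set σ₀ := min ((w.re + 1 / 2) / 2) 1 with hσ
  have h1 : 1 / 2 < σ₀ := lt_min (by linarith) (by norm_num)
  have h2 : σ₀ < w.re := (min_le_left _ _).trans_lt (by linarith)
  set U := {z : ℂ | σ₀ < z.re ∧ |z.im| < |w.im| + 1}
  have hopen : IsOpen U :=
    (isOpen_lt continuous_const Complex.continuous_re).inter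
      (isOpen_lt (continuous_abs.comp Complex.continuous_im) continuous_const)
  have := Complex.differentiableOn_tsum_of_summable_norm (U := U) (F := fun n w => zetaTerm n w)
    ((summable_succ_rpow (p := σ₀ + 1 / 2) (by linarith)).mul_left (2 * √(1 + (|w.im| + 1))))
    (fun n => (differentiableOn_zetaTerm n).mono fun z hz => (by linarith : 0 < σ₀).trans hz.1) hopen
    (fun n z hz => (norm_zetaTerm_le (by linarith) (min_le_right _ _) hz.1.le n).trans (by
      have := hz.2
      gcongr))
  exact (this.differentiableAt (hopen.mem_nhds ⟨h2, by linarith⟩)).differentiableWithinAt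

/-- The integrals over the cells telescope to `∫ x^(-w) dx = 1/(w - 1)` over `[1, ∞)`. -/
theorem riemannZeta_eq_zetaRegular {w : ℂ} (hw : 1 < w.re) :
    riemannZeta w = zetaRegular w + 1 / (w - 1) := by
  have hw1 : w - 1 ≠ 0 := fun h => by
    rw [sub_eq_zero.1 h] at hw
    simp at hw
  have hw2 : 1 - w ≠ 0 := fun h => hw1 (by linear_combination -h)
  have hz : Summable fun n : ℕ => ((n + 1 : ℝ) : ℂ) ^ (-w) := by
    have := (summable_nat_add_iff 1).2 (Complex.summable_one_div_nat_cpow.2 hw)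
    refine this.congr fun n => ?_
    rw [Complex.cpow_neg, one_div]
    push_cast
    rfl
  have hζ : riemannZeta w = ∑' n : ℕ, ((n + 1 : ℝ) : ℂ) ^ (-w) := by
    rw [zeta_eq_tsum_one_div_nat_add_one_cpow hw]
    refine tsum_congr fun n => ?_
    rw [Complex.cpow_neg, one_div]
    push_cast
    rfl
  set g : ℕ → ℂ := fun n => ((n + 1 : ℝ) : ℂ) ^ (1 - w) with hg
  have hint : ∀ n : ℕ, ((n + 1 : ℝ) : ℂ) ^ (-w) - zetaTerm n w = (g n - g (n + 1)) / (w - 1) := by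
    intro n
    have hn : (0 : ℝ) < n + 1 := by positivity
    rw [zetaTerm, sub_sub_cancel]
    have e : ∫ x in Ioc (n + 1 : ℝ) (n + 2), ((max x 1 : ℝ) : ℂ) ^ (-w) =
        ∫ x in (n + 1 : ℝ)..(n + 2), (x : ℂ) ^ (-w) := by
      rw [intervalIntegral.integral_of_le (by linarith)]
      refine setIntegral_congr_fun measurableSet_Ioc fun x hx => ?_
      have : (1 : ℝ) ≤ x := by
        have : (0 : ℝ) ≤ n := n.cast_nonneg
        linarith [hx.1]
      simp only [max_eq_left this]
    rw [e, integral_cpow (Or.inr ⟨fun h => hw1 (by linear_combination -h), fun h => by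
      rw [uIcc_of_le (by linarith)] at h
      linarith [h.1]⟩), show -w + 1 = 1 - w by ring]
    simp only [hg]
    push_cast
    rw [show (n : ℂ) + 1 + 1 = n + 2 by ring, div_eq_div_iff hw2 hw1]
    ring
  have hlim : Tendsto (fun N => ∑ n ∈ Finset.range N, (((n + 1 : ℝ) : ℂ) ^ (-w) - zetaTerm n w)) atTop
      (𝓝 ((g 0 - 0) / (w - 1))) := by
    have h1 : (fun N => ∑ n ∈ Finset.range N, (((n + 1 : ℝ) : ℂ) ^ (-w) - zetaTerm n w)) =
        fun N => (g 0 - g N) / (w - 1) := by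
      ext N
      rw [Finset.sum_congr rfl fun n _ => hint n, ← Finset.sum_div, Finset.sum_range_sub']
    rw [h1]
    refine (tendsto_const_nhds.sub ?_).div_const _
    rw [tendsto_zero_iff_norm_tendsto_zero]
    have h2 : ∀ N, ‖g N‖ = (N + 1 : ℝ) ^ (-(w.re - 1)) := fun N => by
      rw [hg]
      dsimp only
      rw [Complex.norm_cpow_eq_rpow_re_of_pos (by positivity)]
      simp
    simp only [h2]
    exact (tendsto_rpow_neg_atTop (by linarith)).comp
      (tendsto_atTop_add_const_right _ _ tendsto_natCast_atTop_atTop)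
  have hsum := hz.sub (summable_zetaTerm (w := w) (by linarith))
  have h := tendsto_nhds_unique hsum.hasSum.tendsto_sum_nat hlim
  rw [hz.tsum_sub (summable_zetaTerm (by linarith)), ← hζ] at h
  have hg0 : g 0 = 1 := by simp [hg]
  rw [hg0, sub_zero] at h
  rw [zetaRegular]
  linear_combination h

/-- Both `ζ` and `1/ζ` are Dirichlet series with coefficients of modulus at most one. -/
theorem exists_norm_riemannZeta_le {c : ℝ} (hc : 1 < c) :
    ∃ C : ℝ, 0 ≤ C ∧ ∀ w : ℂ, c ≤ w.re → ‖riemannZeta w‖ ≤ C ∧ ‖(riemannZeta w)⁻¹‖ ≤ C := by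
  have hs : Summable fun n : ℕ => (n : ℝ) ^ (-c) := Real.summable_nat_rpow.2 (by linarith)
  have key : ∀ {f : ℕ → ℂ}, (∀ n, ‖f n‖ ≤ 1) → ∀ w : ℂ, c ≤ w.re →
      ‖LSeries f w‖ ≤ ∑' n : ℕ, (n : ℝ) ^ (-c) := fun {f} hf w hw => by
    refine tsum_of_norm_bounded hs.hasSum fun n => ?_
    rcases Nat.eq_zero_or_pos n with rfl | hn
    · rw [LSeries.term_zero, norm_zero]
      positivity
    · rw [LSeries.norm_term_eq, if_neg hn.ne', div_eq_mul_inv, ← Real.rpow_neg n.cast_nonneg]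
      have : (1 : ℝ) ≤ n := by exact_mod_cast hn
      calc _ ≤ 1 * (n : ℝ) ^ (-c) := by
            gcongr
            exact hf n
        _ = _ := one_mul _
  refine ⟨∑' n : ℕ, (n : ℝ) ^ (-c), tsum_nonneg fun n => by positivity, fun w hw => ⟨?_, ?_⟩⟩
  · rw [← LSeries_one_eq_riemannZeta (by linarith)]
    exact key (fun n => by simp) w hw
  · have h := ArithmeticFunction.LSeries_zeta_mul_Lseries_moebius (s := w) (by linarith)
    rw [ArithmeticFunction.LSeries_zeta_eq_riemannZeta (by linarith)] at h
    rw [inv_eq_of_mul_eq_one_right h]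
    exact key norm_moebius_le_one w hw

end ZetaBounds

/-! ### Conjugation symmetry, for the reality of the residue -/

section Conjugation

open ComplexConjugate

theorem conj_natCast_cpow (n : ℕ) (s : ℂ) : conj ((n : ℂ) ^ s) = (n : ℂ) ^ conj s := by
  rw [← Complex.ofReal_natCast, conj_ofReal_cpow n.cast_nonneg]

theorem conj_fibreIntegral (s : ℂ) (y : ℝ) : conj (fibreIntegral s y) = fibreIntegral (conj s) y := by
  rw [fibreIntegral, ← integral_conj, fibreIntegral]
  refine integral_congr_ae (Eventually.of_forall fun z => ?_)
  dsimp only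
  rw [conj_ofReal_cpow (archHeight_pos y z).le, map_neg]

theorem conj_archDensity (s : ℂ) : conj (archDensity s) = archDensity (conj s) := by
  rw [archDensity, ← integral_conj, archDensity]
  exact integral_congr_ae (Eventually.of_forall fun y => conj_fibreIntegral s y)

theorem conj_latticeError (e : ℕ) (s : ℂ) : conj (latticeError e s) = latticeError e (conj s) := by
  rw [latticeError, map_sub, map_mul, Complex.conj_tsum, conj_archDensity, Complex.conj_natCast,
    latticeError]
  simp only [conj_fibreIntegral]

theorem conj_coprimeError (q : ℕ) (s : ℂ) : conj (coprimeError q s) = coprimeError q (conj s) := by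
  simp only [coprimeError, map_sum, map_mul, conj_latticeError, map_intCast]

theorem conj_jordanCoeff (s : ℂ) (g : ℕ) : conj (jordanCoeff s g) = jordanCoeff (conj s) g := by
  simp only [jordanCoeff, map_sum, map_mul, conj_natCast_cpow, map_intCast]

theorem conj_eulerCorrection (s : ℂ) (g : ℕ) :
    conj (eulerCorrection s g) = eulerCorrection (conj s) g := by
  simp only [eulerCorrection, map_prod, map_div₀, map_sub, map_one, conj_natCast_cpow, map_mul,
    map_neg, Complex.conj_ofNat]

theorem conj_localCoeff (s : ℂ) (q : ℕ) : conj (localCoeff s q) = localCoeff (conj s) q := by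
  simp only [localCoeff, map_sum, map_mul, map_div₀, conj_jordanCoeff, conj_eulerCorrection,
    Complex.conj_natCast]

theorem conj_discrepancySeries (s : ℂ) :
    conj (discrepancySeries s) = discrepancySeries (conj s) := by
  simp only [discrepancySeries, Complex.conj_tsum, map_mul, conj_natCast_cpow, conj_localCoeff,
    conj_coprimeError, map_sub, Complex.conj_ofNat]

end Conjugation

/-! ### The secondary pole and the remainder -/

section SecondaryTerm

/-- The secondary factor `Q(s)` of the height zeta function. -/
noncomputable def discrepancyQuotient (s : ℂ) : ℂ := discrepancySeries s / riemannZeta (2 * s)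

theorem differentiableAt_riemannZeta_comp {a b : ℂ} {s : ℂ} (h : 1 < (a * s + b).re) :
    DifferentiableAt ℂ (fun s : ℂ => riemannZeta (a * s + b)) s := by
  have h1 : a * s + b ≠ 1 := fun h' => by
    rw [h'] at h
    simp at h
  exact (differentiableAt_riemannZeta h1).comp s (by fun_prop)

theorem differentiableOn_discrepancyQuotient :
    DifferentiableOn ℂ discrepancyQuotient {s | 3 / 4 < s.re} := by
  refine differentiableOn_discrepancySeries.div (fun s hs => ?_) fun s hs => ?_
  · have hs' : 3 / 4 < s.re := hs
    have := differentiableAt_riemannZeta_comp (a := 2) (b := 0) (s := s) (by simp; linarith)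
    simpa using this.differentiableWithinAt
  · have hs' : 3 / 4 < s.re := hs
    exact riemannZeta_ne_zero_of_one_lt_re (by simp; linarith)

theorem exists_norm_discrepancyQuotient_le {σ₀ : ℝ} (h0 : 3 / 4 < σ₀) :
    ∃ C : ℝ, 0 ≤ C ∧ ∀ s : ℂ, σ₀ ≤ s.re → ‖discrepancyQuotient s‖ ≤ C * √(1 + |s.im|) := by
  obtain ⟨C, hC, h⟩ := exists_norm_discrepancySeries_le h0
  obtain ⟨D, hD, h'⟩ := exists_norm_riemannZeta_le (c := 3 / 2) (by norm_num)
  refine ⟨C * D, by positivity, fun s hs => ?_⟩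
  rw [discrepancyQuotient, div_eq_mul_inv, norm_mul]
  have h1 := h s hs
  have h2 := (h' (2 * s) (by simp; linarith)).2
  calc _ ≤ C * √(1 + |s.im|) * D := by gcongr
    _ = _ := by ring

theorem discrepancyQuotient_one : ((discrepancyQuotient 1).re : ℂ) = discrepancyQuotient 1 := by
  rw [← Complex.conj_eq_iff_re, discrepancyQuotient, map_div₀, conj_discrepancySeries,
    ← riemannZeta_conj, map_mul, map_one, Complex.conj_ofNat]

/-- The holomorphic remainder of the height zeta function. -/
noncomputable def heightRemainder (s : ℂ) : ℂ :=
  zetaRegular (2 * s - 1) * discrepancyQuotient s + dslope discrepancyQuotient 1 s / 2 + fibreError s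

theorem differentiableOn_heightRemainder : DifferentiableOn ℂ heightRemainder {s | 3 / 4 < s.re} := by
  have h1 : {s : ℂ | 3 / 4 < s.re} ∈ 𝓝 (1 : ℂ) :=
    (isOpen_halfPlane _).mem_nhds (by simp; norm_num)
  refine ((DifferentiableOn.mul ?_ differentiableOn_discrepancyQuotient).add
    (((Complex.differentiableOn_dslope h1).2 differentiableOn_discrepancyQuotient).div_const 2)).add
    differentiableOn_fibreError
  exact differentiableOn_zetaRegular.comp (by fun_prop) fun s hs => by
    have hs' : 3 / 4 < s.re := hs
    simp
    linarith

/-- The regular part of `ζ(2s-1)` and the discrepancy quotient are each `O(√(1 + |Im s|))`, so their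
product has linear growth. The difference quotient at `1` is bounded by compactness near `1` and by
its definition elsewhere. -/
theorem exists_norm_heightRemainder_le {σ₀ : ℝ} (h0 : 3 / 4 < σ₀) :
    ∃ C : ℝ, ∀ s : ℂ, σ₀ ≤ s.re → ‖heightRemainder s‖ ≤ C * (1 + |s.im|) := by
  obtain ⟨A, hA, h1⟩ := exists_norm_zetaRegular_le (σ₀ := 2 * σ₀ - 1) (by linarith)
  obtain ⟨B, hB, h2⟩ := exists_norm_discrepancyQuotient_le h0
  obtain ⟨D, h3⟩ := exists_norm_fibreError_le h0
  have hU : {s : ℂ | 3 / 4 < s.re} ∈ 𝓝 (1 : ℂ) :=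
    (isOpen_halfPlane _).mem_nhds (by simp; norm_num)
  -- The radius `1/8` keeps the ball inside `Re s > 3/4`.
  obtain ⟨E, h4⟩ := (isCompact_closedBall (1 : ℂ) (1 / 8)).exists_bound_of_continuousOn
    (f := dslope discrepancyQuotient 1)
    (((Complex.differentiableOn_dslope hU).2 differentiableOn_discrepancyQuotient).continuousOn.mono
      fun s hs => by
        have h := (Complex.abs_re_le_norm (s - 1)).trans (mem_closedBall_iff_norm.1 hs)
        rw [Complex.sub_re, Complex.one_re, abs_le] at h
        show 3 / 4 < s.re
        linarith [h.1])
  refine ⟨2 * A * B + (|E| + 8 * (B + ‖discrepancyQuotient 1‖)) + D, fun s hs => ?_⟩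
  set R := 1 + |s.im| with hR
  have hR1 : 1 ≤ R := by linarith [abs_nonneg s.im]
  have hsq : √R * √R = R := Real.mul_self_sqrt (by linarith)
  have hsR : √R ≤ R := by
    rw [Real.sqrt_le_left (by linarith)]
    nlinarith
  have g1 : ‖zetaRegular (2 * s - 1) * discrepancyQuotient s‖ ≤ 2 * A * B * R := by
    rw [norm_mul]
    have k1 := h1 (2 * s - 1) (by simp; linarith)
    have k2 : √(1 + |(2 * s - 1).im|) ≤ 2 * √R := by
      rw [show (2 : ℝ) = √4 by rw [show (4 : ℝ) = 2 ^ 2 by norm_num]; simp,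
        ← Real.sqrt_mul (by norm_num)]
      refine Real.sqrt_le_sqrt ?_
      have : |(2 * s - 1).im| = 2 * |s.im| := by simp [abs_mul]
      rw [this, hR]
      linarith [abs_nonneg s.im]
    calc _ ≤ (A * (2 * √R)) * (B * √R) := by
          gcongr
          · exact k1.trans (by gcongr)
          · exact h2 s hs
      _ = 2 * A * B * (√R * √R) := by ring
      _ = _ := by rw [hsq]
  have g2 : ‖dslope discrepancyQuotient 1 s / 2‖ ≤ (|E| + 8 * (B + ‖discrepancyQuotient 1‖)) * R := by
    rw [norm_div, Complex.norm_ofNat]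
    have hn := norm_nonneg (discrepancyQuotient 1)
    rcases le_or_gt ‖s - 1‖ (1 / 8) with h | h
    · have k := (h4 s (mem_closedBall_iff_norm.2 h)).trans (le_abs_self E)
      have : |E| * 1 ≤ |E| * R := by gcongr
      have : 0 ≤ 8 * (B + ‖discrepancyQuotient 1‖) * R := by positivity
      have := norm_nonneg (dslope discrepancyQuotient 1 s)
      nlinarith
    · have hs1 : s ≠ 1 := by
        rintro rfl
        norm_num at h
      rw [dslope_of_ne _ hs1, slope_def_field, norm_div]
      have k1 := (norm_sub_le (discrepancyQuotient s) (discrepancyQuotient 1)).trans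
        (add_le_add (h2 s hs) le_rfl)
      have k2 : ‖discrepancyQuotient s - discrepancyQuotient 1‖ ≤ (B + ‖discrepancyQuotient 1‖) * R := by
        have : B * √R ≤ B * R := by gcongr
        have : ‖discrepancyQuotient 1‖ * 1 ≤ ‖discrepancyQuotient 1‖ * R := by gcongr
        linarith
      have k3 : ‖discrepancyQuotient s - discrepancyQuotient 1‖ / ‖s - 1‖ ≤
          (B + ‖discrepancyQuotient 1‖) * R / (1 / 8) := by gcongr
      have : 0 ≤ |E| * R := by positivity
      have : 0 ≤ (B + ‖discrepancyQuotient 1‖) * R := by positivity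
      linarith
  have g3 := h3 s hs
  refine (norm_add_le _ _).trans ?_
  have g4 := norm_add_le (zetaRegular (2 * s - 1) * discrepancyQuotient s)
    (dslope discrepancyQuotient 1 s / 2)
  linarith

end SecondaryTerm

/-! ### The principal term and the continuation -/

section PrincipalTerm

/-- The factor `G₁` of the height zeta function. -/
noncomputable def principalFactor (s : ℂ) : ℂ :=
  archDensity s * eulerRest s * riemannZeta (4 * (s - 1) + 2) ^ 3 *
    riemannZeta (5 * (s - 1) + 2) ^ 2 * riemannZeta (10 * (s - 1) + 4) *
    (riemannZeta (7 * (s - 1) + 3))⁻¹ ^ 4 * (riemannZeta (8 * (s - 1) + 3))⁻¹ ^ 2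

theorem differentiableOn_riemannZeta_affine {a b : ℂ}
    (h : ∀ s : ℂ, 5 / 6 < s.re → 1 < (a * (s - 1) + b).re) :
    DifferentiableOn ℂ (fun s : ℂ => riemannZeta (a * (s - 1) + b)) {s | 5 / 6 < s.re} := fun s hs => by
  have h0 := h s hs
  have h1 : a * (s - 1) + b ≠ 1 := fun h' => by
    rw [h'] at h0
    simp at h0
  exact ((differentiableAt_riemannZeta h1).comp s
    (f := fun s => a * (s - 1) + b) (by fun_prop)).differentiableWithinAt

theorem differentiableOn_principalFactor :
    DifferentiableOn ℂ principalFactor {s | 5 / 6 < s.re} := by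
  have hz : ∀ {a b : ℂ}, (∀ s : ℂ, 5 / 6 < s.re → 1 < (a * (s - 1) + b).re) →
      DifferentiableOn ℂ (fun s : ℂ => (riemannZeta (a * (s - 1) + b))⁻¹) {s | 5 / 6 < s.re} :=
    fun h => (differentiableOn_riemannZeta_affine h).inv fun s hs =>
      riemannZeta_ne_zero_of_one_lt_re (h s hs)
  unfold principalFactor
  refine ((((((differentiableOn_archDensity.mono fun s hs => ?_).mul differentiableOn_eulerRest).mul
    ((differentiableOn_riemannZeta_affine ?_).pow 3)).mul
    ((differentiableOn_riemannZeta_affine ?_).pow 2)).mul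
    (differentiableOn_riemannZeta_affine ?_)).mul ((hz ?_).pow 4)).mul ((hz ?_).pow 2)
  · have hs' : 5 / 6 < s.re := hs
    show 3 / 4 < s.re
    linarith
  all_goals
    intro s hs
    simp
    linarith

/-- For `Re s > 5/6` every zeta argument here has real part above `7/6`, the extreme case being
`5(s-1) + 2`. Only `ζ(6(s-1)+2)` reaches the edge of absolute convergence, and it stays in `E₂`. -/
theorem exists_norm_principalFactor_le :
    ∃ C : ℝ, ∀ s : ℂ, 5 / 6 < s.re → ‖principalFactor s‖ ≤ C := by
  obtain ⟨A, hA, h1⟩ := exists_norm_archDensity_le (σ₀ := 5 / 6) (by norm_num)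
  obtain ⟨B, hB, h2⟩ := exists_norm_riemannZeta_le (c := 7 / 6) (by norm_num)
  set D := Real.exp (∑' p : Nat.Primes, 80 * ((p : ℕ) : ℝ) ^ (-(7 / 6) : ℝ))
  refine ⟨A * D * B ^ 3 * B ^ 2 * B * B ^ 4 * B ^ 2, fun s hs => ?_⟩
  have k1 := (h2 (4 * (s - 1) + 2) (by simp; linarith)).1
  have k2 := (h2 (5 * (s - 1) + 2) (by simp; linarith)).1
  have k3 := (h2 (10 * (s - 1) + 4) (by simp; linarith)).1
  have k4 := (h2 (7 * (s - 1) + 3) (by simp; linarith)).2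
  have k5 := (h2 (8 * (s - 1) + 3) (by simp; linarith)).2
  have k6 := h1 s hs.le
  have k7 : ‖eulerRest s‖ ≤ D := norm_eulerRest_le hs
  have hD : 0 ≤ D := (Real.exp_pos _).le
  simp only [principalFactor, norm_mul, norm_pow]
  gcongr

/-- The zeta factors of `E₂` other than `ζ(6(s-1)+2)` cancel against `principalFactor`. In the
secondary term, `ζ(2s-1)` splits into its regular part and `1/(2(s-1))`; the latter times the
quotient gives the simple pole and a difference quotient. -/
theorem heightZeta_eq_principal_add {s : ℂ} (hs : 1 < s.re) :
    heightZeta s = zetaE₁ s * zetaE₂ s * principalFactor s +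
      discrepancyQuotient 1 / 2 / (s - 1) + heightRemainder s := by
  have hs1 : s - 1 ≠ 0 := fun h => by
    rw [sub_eq_zero.1 h] at hs
    simp at hs
  have hT := totientSeries_eq hs
  have hZ : ∀ {w : ℂ}, 1 < w.re → riemannZeta w ≠ 0 := riemannZeta_ne_zero_of_one_lt_re
  have z2 := hZ (w := 2 * s) (by simp; linarith)
  have z6 := hZ (w := 6 * (s - 1) + 2) (by simp; linarith)
  have z4 := hZ (w := 4 * (s - 1) + 2) (by simp; linarith)
  have z5 := hZ (w := 5 * (s - 1) + 2) (by simp; linarith)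
  have z10 := hZ (w := 10 * (s - 1) + 4) (by simp; linarith)
  have z7 := hZ (w := 7 * (s - 1) + 3) (by simp; linarith)
  have z8 := hZ (w := 8 * (s - 1) + 3) (by simp; linarith)
  have hmain : riemannZeta (2 * s - 1) / riemannZeta (2 * s) * (archDensity s * totientSeries s) =
      zetaE₁ s * zetaE₂ s * principalFactor s := by
    rw [show 6 * s - 4 = 6 * (s - 1) + 2 by ring, show 4 * s - 3 = 4 * (s - 1) + 1 by ring,
      show 3 * s - 2 = 3 * (s - 1) + 1 by ring, show 2 * s - 1 = 2 * (s - 1) + 1 by ring] at hT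
    rw [zetaE₁, zetaE₂, principalFactor, show 2 * s - 1 = 2 * (s - 1) + 1 by ring]
    generalize riemannZeta (2 * s) = Z2 at *
    generalize riemannZeta (6 * (s - 1) + 2) = Z6 at *
    generalize riemannZeta (4 * (s - 1) + 2) = Z4 at *
    generalize riemannZeta (5 * (s - 1) + 2) = Z5 at *
    generalize riemannZeta (10 * (s - 1) + 4) = Z10 at *
    generalize riemannZeta (7 * (s - 1) + 3) = Z7 at *
    generalize riemannZeta (8 * (s - 1) + 3) = Z8 at *
    generalize riemannZeta (2 * (s - 1) + 1) = W2 at *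
    generalize riemannZeta (3 * (s - 1) + 1) = W3 at *
    generalize riemannZeta (4 * (s - 1) + 1) = W4 at *
    field_simp
    linear_combination archDensity s * hT
  have hsec : riemannZeta (2 * s - 1) / riemannZeta (2 * s) * discrepancySeries s =
      riemannZeta (2 * s - 1) * discrepancyQuotient s := by
    rw [discrepancyQuotient]
    ring
  have hds : dslope discrepancyQuotient 1 s * (s - 1) = discrepancyQuotient s - discrepancyQuotient 1 := by
    rw [dslope_of_ne _ (sub_ne_zero.1 hs1), slope_def_field, div_mul_cancel₀ _ hs1]
  rw [heightZeta_eq hs, mul_add, hmain, hsec, riemannZeta_eq_zetaRegular (by simp; linarith),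
    heightRemainder, show 2 * s - 1 - 1 = 2 * (s - 1) by ring]
  field_simp
  linear_combination -hds

/-- The entire function `(w - 1) ζ(w)`. -/
noncomputable def zetaMulSub (w : ℂ) : ℂ := Function.update (fun w => (w - 1) * riemannZeta w) 1 1 w

theorem differentiable_zetaMulSub : Differentiable ℂ zetaMulSub := by
  unfold zetaMulSub
  rw [← differentiableOn_univ,
    ← Complex.differentiableOn_compl_singleton_and_continuousAt_iff (c := 1) Filter.univ_mem]
  refine ⟨fun w hw => ?_, ?_⟩
  · have hw' : w ≠ 1 := hw.2
    refine DifferentiableAt.differentiableWithinAt ?_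
    have h : DifferentiableAt ℂ (fun w => (w - 1) * riemannZeta w) w :=
      (differentiableAt_fun_id.sub_const 1).mul (differentiableAt_riemannZeta hw')
    refine h.congr_of_eventuallyEq ?_
    filter_upwards [isOpen_compl_singleton.mem_nhds hw'] with z hz
    exact Function.update_of_ne hz _ _
  · exact continuousAt_update_same.2 riemannZeta_residue_one

theorem zetaMulSub_of_ne {w : ℂ} (hw : w ≠ 1) : zetaMulSub w = (w - 1) * riemannZeta w :=
  Function.update_of_ne hw _ _

theorem differentiableOn_zetaE₂ : DifferentiableOn ℂ zetaE₂ {s | 5 / 6 < s.re} := by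
  unfold zetaE₂
  have hz : ∀ {w : ℂ}, 1 < w.re → riemannZeta w ≠ 0 := riemannZeta_ne_zero_of_one_lt_re
  refine DifferentiableOn.div
    (((differentiableOn_riemannZeta_affine ?_).pow 4).mul ((differentiableOn_riemannZeta_affine ?_).pow 2))
    (((((differentiableOn_riemannZeta_affine ?_).pow 3).mul
      ((differentiableOn_riemannZeta_affine ?_).pow 2)).mul
      (differentiableOn_riemannZeta_affine ?_)).mul (differentiableOn_riemannZeta_affine ?_))
    fun s hs => ?_
  rotate_right
  · have hs' : 5 / 6 < s.re := hs
    exact mul_ne_zero (mul_ne_zero (mul_ne_zero (pow_ne_zero _ (hz (by simp; linarith)))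
      (pow_ne_zero _ (hz (by simp; linarith)))) (hz (by simp; linarith))) (hz (by simp; linarith))
  all_goals
    intro s hs
    simp
    linarith

/-- Each of the four zeta factors of `E₁` has a simple pole at `s = 1`, cleared by one factor `s -
1`; the divisors `4`, `3`, `2` undo the scaling of the arguments. -/
theorem exists_heightZeta_continuation (c : ℂ) :
    ∃ F : ℂ → ℂ, AnalyticOnNhd ℂ F {s : ℂ | 5 / 6 < s.re} ∧
      ∀ s : ℂ, 5 / 6 < s.re → s ≠ 1 → F s = (s - 1) ^ 4 *
        (zetaE₁ s * zetaE₂ s * principalFactor s + c / (s - 1) + heightRemainder s) := by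
  refine ⟨fun s => zetaMulSub (4 * (s - 1) + 1) / 4 * (zetaMulSub (3 * (s - 1) + 1) / 3) ^ 2 *
    (zetaMulSub (2 * (s - 1) + 1) / 2) * zetaE₂ s * principalFactor s + (s - 1) ^ 3 * c +
      (s - 1) ^ 4 * heightRemainder s, ?_, fun s hs hs1 => ?_⟩
  · refine DifferentiableOn.analyticOnNhd ?_ (isOpen_halfPlane _)
    have hZ : ∀ a : ℂ, DifferentiableOn ℂ (fun s => zetaMulSub (a * (s - 1) + 1)) {s | 5 / 6 < s.re} :=
      fun a => (differentiable_zetaMulSub.comp (f := fun s : ℂ => a * (s - 1) + 1)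
        (by fun_prop)).differentiableOn
    refine ((((((((hZ 4).div_const 4).mul (((hZ 3).div_const 3).pow 2)).mul ((hZ 2).div_const 2)).mul
      differentiableOn_zetaE₂).mul differentiableOn_principalFactor).add ?_)).add
      (DifferentiableOn.mul ?_ (differentiableOn_heightRemainder.mono fun s hs => ?_))
    · exact Differentiable.differentiableOn (by fun_prop)
    · exact Differentiable.differentiableOn (by fun_prop)
    · have hs' : 5 / 6 < s.re := hs
      show 3 / 4 < s.re
      linarith
  · have h1 : s - 1 ≠ 0 := sub_ne_zero.2 hs1
    have h2 : ∀ {a : ℂ}, a ≠ 0 → a * (s - 1) + 1 ≠ 1 := fun ha h =>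
      mul_ne_zero ha h1 (by linear_combination h)
    dsimp only
    rw [zetaMulSub_of_ne (h2 (a := 4) (by norm_num)), zetaMulSub_of_ne (h2 (a := 3) (by norm_num)),
      zetaMulSub_of_ne (h2 (a := 2) (by norm_num)), zetaE₁]
    field_simp
    ring

end PrincipalTerm

theorem theorem2 :
    (∀ s : ℂ, 1 < s.re → Summable fun x : openPoints => 1 / (pointHeight x.1 : ℂ) ^ s) ∧
    ∃ (lam : ℝ) (G₁ G₂ : ℂ → ℂ),
      AnalyticOnNhd ℂ G₁ {s : ℂ | 5 / 6 < s.re} ∧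
      (∃ C : ℝ, ∀ s : ℂ, 5 / 6 < s.re → ‖G₁ s‖ ≤ C) ∧
      (∀ ε : ℝ, 0 < ε →
        AnalyticOnNhd ℂ G₂ {s : ℂ | 3 / 4 + ε ≤ s.re} ∧
        ∃ C : ℝ, ∀ s : ℂ, 3 / 4 + ε ≤ s.re → ‖G₂ s‖ ≤ C * (1 + |s.im|)) ∧
      (∀ s : ℂ, 1 < s.re →
        heightZeta s =
          zetaE₁ s * zetaE₂ s * G₁ s + ((12 / Real.pi ^ 2 + 2 * lam : ℝ) : ℂ) / (s - 1) + G₂ s) ∧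
      ∃ F : ℂ → ℂ,
        AnalyticOnNhd ℂ F {s : ℂ | 5 / 6 < s.re} ∧
        (∀ s : ℂ, 1 < s.re → F s = (s - 1) ^ 4 * heightZeta s) ∧
        (∀ s : ℂ, 5 / 6 < s.re → s ≠ 1 →
          F s = (s - 1) ^ 4 *
            (zetaE₁ s * zetaE₂ s * G₁ s + ((12 / Real.pi ^ 2 + 2 * lam : ℝ) : ℂ) / (s - 1) +
              G₂ s)) := by
  refine ⟨fun s hs => summable_height hs,
    -- Solves `12/π² + 2λ = Q(1)/2` for `λ`, where `Q` is the discrepancy quotient.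
    ((discrepancyQuotient 1).re / 2 - 12 / Real.pi ^ 2) / 2, principalFactor, heightRemainder,
    differentiableOn_principalFactor.analyticOnNhd (isOpen_halfPlane _),
    exists_norm_principalFactor_le, fun ε hε => ⟨?_, ?_⟩, ?_⟩
  · exact (differentiableOn_heightRemainder.analyticOnNhd (isOpen_halfPlane _)).mono fun s hs =>
      (by linarith : 3 / 4 < 3 / 4 + ε).trans_le hs
  · exact exists_norm_heightRemainder_le (by linarith)
  have hres : ((12 / Real.pi ^ 2 + 2 * (((discrepancyQuotient 1).re / 2 - 12 / Real.pi ^ 2) / 2) : ℝ) : ℂ) =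
      discrepancyQuotient 1 / 2 := by
    rw [← discrepancyQuotient_one, Complex.ofReal_re, mul_div_cancel₀ _ two_ne_zero, add_sub_cancel]
    push_cast
    rfl
  rw [hres]
  obtain ⟨F, hF, h⟩ := exists_heightZeta_continuation (discrepancyQuotient 1 / 2)
  refine ⟨fun s hs => heightZeta_eq_principal_add hs, F, hF, fun s hs => ?_, h⟩
  have hs1 : s ≠ 1 := by
    rintro rfl
    simp at hs
  rw [h s (by linarith) hs1, heightZeta_eq_principal_add hs]
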